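/- **Setting.** Fix real numbers $A,F,C,D,I,P,Q$, $M\ge 0$, $K>0$, a discount rate $\rho>0$ and volatility bounds $0<\underline\sigma\le\overline\sigma<\infty$. Let $\hat{\mathbb E}$ be the sublinear expectation on the canonical path space with raw canonical filtration under which the canonical process $B$ is a scalar $G$-Brownian motion with $B(1)\sim\mathcal N(0,[\underline\sigma^2,\overline\sigma^2])$; that is, $\hat{\mathbb E}[\xi]=\sup_{\mathbb P\in\mathcal P}E_{\mathbb P}[\xi]$, where $\mathcal P$ is the set of laws under which $B$ is a martingale with $\underline\sigma^2dt\le d\langle B\rangle_t\le\overline\sigma^2dt$. Put $\mathcal E[\xi]=-\hat{\mathbb E}[-\xi]$; "quasi-surely" (q.s.) means $\mathbb P$-almost surely for every $\mathbb P\in\mathcal P$. Let $$b(x,u)=Ax+Fu,\quad \sigma(x,u)=Cx+Du,\quad r(x,u)=-\Big(\tfrac M2x^2+Ixu+\tfrac K2u^2+Px+Qu\Big),\qquad x,u\in\mathbb R.$$ *Exploratory problem with weight $\lambda>0$.* For a density-valued process $\theta=(\theta_t)_{t\ge0}$ let $X^\theta$ solve $$dX_t=\int_{\mathbb R} b(X_t,u)\theta_t(u)\,du\,dt+\Big(\int_{\mathbb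 R}\sigma^2(X_t,u)\theta_t(u)\,du\Big)^{1/2}dB_t,\qquad X_0=x,$$ and let $g_\lambda(y,f)=\int r(y,u)f(u)\,du-\lambda\int f(u)\ln f(u)\,du$. Then $$V_\lambda(x)=\sup_{\theta\in\mathcal A(x)}\mathcal E\Big[\int_0^\infty e^{-\rho t}g_\lambda(X^\theta_t,\theta_t)\,dt\Big],$$ where $\theta\in\mathcal A(x)$ if: each $\theta_t$ is q.s. a probability density; $\int_S\theta_t(u)du$ is progressively measurable for every Borel set $S$; $\hat{\mathbb E}[\int_0^t\int u^2\theta_s(u)\,du\,ds]<\infty$ for all $t$; $\liminf_{T\to\infty}e^{-\rho T}\hat{\mathbb E}[(X^\theta_T)^2]=0$; and $\theta_t\ln\theta_t$ is integrable for a.e. $t$ q.s. with $\hat{\mathbb E}[\int_0^\infty e^{-\rho t}|g_\lambda(X^\theta_t,\theta_t)|dt]<\infty$. *Non-exploratory problem.* For a real-valued control process $u$ let $dx^u_t=(Ax^u_t+Fu_t)dt+(Cx^u_t+Du_t)dB_t$, $x^u_0=x$, and $$V^{ne}(x)=\sup_{u\in\mathcal A^{ne}(x)}\mathcal E\Big[\int_0^\infty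 e^{-\rho t}r(x^u_t,u_t)\,dt\Big],$$ where $u\in\mathcal A^{ne}(x)$ if $u$ is progressively measurable, $\hat{\mathbb E}[\int_0^tu_s^2ds]<\infty$ for all $t$, $\liminf_{T\to\infty}e^{-\rho T}\hat{\mathbb E}[(x^u_T)^2]=0$ and $\hat{\mathbb E}[\int_0^\infty e^{-\rho t}|r(x^u_t,u_t)|dt]<\infty$. A (randomized) feedback control is *optimal* if, for every initial state $x$, its closed-loop state equation has a q.s. unique solution and the open-loop control so generated is admissible and attains the value function at $x$. For $\alpha_0,\alpha_1\in\mathbb R$, $\alpha_2<0$, $\lambda>0$ let $$u^*(x)=\frac{(\alpha_2(F+CD\overline\sigma^2)-I)x+\alpha_1F-Q}{K-\alpha_2D^2\overline\sigma^2},\qquad \theta^*_\lambda(\cdot;x)=\mathcal N\Big(u^*(x),\ \frac{\lambda}{K-\alpha_2D^2\overline\sigma^2}\Big),$$ and consider the two statements * (a)$_\lambda$: $V_\lambda(x)=\frac12\alpha_2x^2+\alpha_1x+\alpha_0+\frac{\lambda}{2\rho}\Big(\ln\frac{2\pi e\lambda}{K-\alpha_2D^2\overline\sigma^2}-1\Big)$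 for all $x\in\mathbb R$, and $\theta^*_\lambda$ is an optimal randomized feedback control of the exploratory problem with weight $\lambda$; * (b): $V^{ne}(x)=\frac12\alpha_2x^2+\alpha_1x+\alpha_0$ for all $x\in\mathbb R$, and $u^*$ is an optimal feedback control of the non-exploratory problem. **Proposition 4.** Let $\alpha_0,\alpha_1\in\mathbb R$, $\alpha_2<0$, and assume that (a)$_\lambda$ holds for some $\lambda>0$, or that (b) holds. Then $\theta^*_\lambda$ is an optimal randomized feedback control of the exploratory problem for every $\lambda>0$, $u^*$ is an optimal feedback control of the non-exploratory problem, all values $V_\lambda(x)$ and $V^{ne}(x)$ are finite, and for each $x\in\mathbb R$, as $\lambda\downarrow0$, $$\theta^*_\lambda(\cdot;x)\to\delta_{u^*(x)}\ \text{ weakly},\qquad |V_\lambda(x)-V^{ne}(x)|\to0.$$ -/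

import Mathlib

open MeasureTheory ProbabilityTheory Filter Topology
open scoped NNReal ENNReal

namespace GLQ

/-! ### The canonical space and the sublinear expectation of a scalar G-Brownian motion -/

/-- The canonical space: continuous paths `[0, ∞) → ℝ` starting from `0`, with the σ-algebra
generated by the coordinates (which is the Borel σ-algebra of locally uniform convergence). -/
def Path : Type := {ω : ℝ≥0 → ℝ // Continuous ω ∧ ω 0 = 0}

instance : MeasurableSpace Path :=
  inferInstanceAs (MeasurableSpace {ω : ℝ≥0 → ℝ // Continuous ω ∧ ω 0 = 0})

/-- The canonical process `B_t(ω) = ω(t)`. -/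
def B (t : ℝ≥0) (ω : Path) : ℝ := ω.1 t

theorem measurable_B (t : ℝ≥0) : Measurable (B t) :=
  (measurable_pi_apply t).comp measurable_subtype_coe

/-- The (raw) filtration `F_t` generated by the path stopped at time `t`. -/
noncomputable def Filt : Filtration ℝ≥0 (inferInstance : MeasurableSpace Path) :=
  Filtration.natural B fun t => (measurable_B t).stronglyMeasurable

/-- The set of priors of the G-Brownian motion with `B(1) ~ N(0, [σlo², σhi²])`: all laws on path
space under which the canonical process is a martingale with `σlo² dt ≤ d⟨B⟩_t ≤ σhi² dt`, i.e.
`B_t² - σhi² t` is a supermartingale and `B_t² - σlo² t` is a submartingale. -/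
def priors (σlo σhi : ℝ) : Set (Measure Path) :=
  {P | IsProbabilityMeasure P ∧ Martingale B Filt P ∧
    Supermartingale (fun (t : ℝ≥0) ω => B t ω ^ 2 - σhi ^ 2 * (t : ℝ)) Filt P ∧
    Submartingale (fun (t : ℝ≥0) ω => B t ω ^ 2 - σlo ^ 2 * (t : ℝ)) Filt P}

/-- Lebesgue measure `dt` on the time axis `[0, ∞)`. -/
noncomputable def dt : Measure ℝ≥0 := Measure.comap ((↑) : ℝ≥0 → ℝ) volume

/-- Quasi-surely: outside of a set that is null for every prior. -/
def QS (Ps : Set (Measure Path)) (p : Path → Prop) : Prop := ∀ P ∈ Ps, ∀ᵐ ω ∂P, p ω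

/-- The sublinear expectation `Ê[ξ] = sup_P E_P[ξ]` of a nonnegative random variable, which may
be `∞`. -/
noncomputable def upperE (Ps : Set (Measure Path)) (ξ : Path → ℝ≥0∞) : ℝ≥0∞ :=
  ⨆ P ∈ Ps, ∫⁻ ω, ξ ω ∂P

/-- The sublinear expectation `Ê[ξ] = sup_P E_P[ξ]` of a real random variable; it is only used for
`ξ` with `Ê[|ξ|] < ∞`. -/
noncomputable def sublinE (Ps : Set (Measure Path)) (ξ : Path → ℝ) : EReal :=
  ⨆ P ∈ Ps, ((∫ ω, ξ ω ∂P : ℝ) : EReal)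

/-- The lower expectation `-Ê[-ξ]`. -/
noncomputable def lowerE (Ps : Set (Measure Path)) (ξ : Path → ℝ) : EReal :=
  -sublinE Ps fun ω => -ξ ω

/-! ### The Itô integral with respect to the canonical process -/

/-- A simple process `∑_{i<n} ξ_i 1_{(t_i, t_{i+1}]}` with `ξ_i` bounded and `F_{t_i}`-measurable. -/
structure SimpleProc where
  n : ℕ
  t : ℕ → ℝ≥0
  mono : Monotone t
  ξ : ℕ → Path → ℝ
  meas : ∀ i, Measurable[Filt (t i)] (ξ i)
  bdd : ∀ i, ∃ c : ℝ, ∀ ω, |ξ i ω| ≤ c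

/-- The value of a simple process at a time. -/
noncomputable def SimpleProc.value (h : SimpleProc) (s : ℝ≥0) (ω : Path) : ℝ :=
  ∑ i ∈ Finset.range h.n, (Set.Ioc (h.t i) (h.t (i + 1))).indicator (fun _ => h.ξ i ω) s

/-- The stochastic integral `∫_0^T h dB` of a simple process. -/
noncomputable def SimpleProc.integral (h : SimpleProc) (T : ℝ≥0) (ω : Path) : ℝ :=
  ∑ i ∈ Finset.range h.n, h.ξ i ω * (B (min (h.t (i + 1)) T) ω - B (min (h.t i) T) ω)

/-- `ξ = ∫_0^T H dB` under `P` (Itô integral): `ξ` is the `L²(P)`-limit of the integrals of simple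
processes that converge to `H` in `L²(dt ⊗ P)` on `[0, T]`. -/
def HasItoIntegral (P : Measure Path) (H : ℝ≥0 → Path → ℝ) (T : ℝ≥0) (ξ : Path → ℝ) : Prop :=
  ∃ h : ℕ → SimpleProc,
    Tendsto (fun n => ∫⁻ ω, ∫⁻ s in Set.Iic T,
      ENNReal.ofReal (((h n).value s ω - H s ω) ^ 2) ∂dt ∂P) atTop (𝓝 0) ∧
    Tendsto (fun n => ∫⁻ ω, ENNReal.ofReal (((h n).integral T ω - ξ ω) ^ 2) ∂P) atTop (𝓝 0)

/-! ### The linear-quadratic model -/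

/-- The data of the linear-quadratic problem. The control set is `ℝ`. -/
structure Model where
  /-- drift `b(x,u) = A x + F u` -/
  A : ℝ
  F : ℝ
  /-- volatility `σ(x,u) = C x + D u` -/
  C : ℝ
  D : ℝ
  /-- reward `r(x,u) = -(M/2 x² + I x u + K/2 u² + P x + Q u)` -/
  M : ℝ
  I : ℝ
  K : ℝ
  P : ℝ
  Q : ℝ
  /-- discount rate -/
  ρ : ℝ
  /-- lower and upper volatility of the G-Brownian motion -/
  σlo : ℝ
  σhi : ℝ
  M_nonneg : 0 ≤ M
  K_pos : 0 < K
  ρ_pos : 0 < ρ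
  σlo_pos : 0 < σlo
  σlo_le : σlo ≤ σhi

namespace Model

variable (m : Model)

/-- The drift coefficient `b`. -/
def b (x u : ℝ) : ℝ := m.A * x + m.F * u

/-- The volatility coefficient `σ`. -/
def vol (x u : ℝ) : ℝ := m.C * x + m.D * u

/-- The reward function `r`. -/
noncomputable def r (x u : ℝ) : ℝ :=
  -(m.M / 2 * x ^ 2 + m.I * x * u + m.K / 2 * u ^ 2 + m.P * x + m.Q * u)

/-- The priors of the driving G-Brownian motion. -/
def scen : Set (Measure Path) := priors m.σlo m.σhi

end Model

/-! ### The exploratory (entropy-regularized, relaxed) problem -/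

/-- Densities of probability measures on `ℝ`. -/
def IsDensity (f : ℝ → ℝ) : Prop := Integrable f ∧ (∀ᵐ u, 0 ≤ f u) ∧ ∫ u, f u = 1

/-- A density-valued process: `θ t ω` is the density `θ_t`. -/
abbrev RandControl : Type := ℝ≥0 → Path → ℝ → ℝ

namespace Model

variable (m : Model)

/-- The exploratory drift `∫ b(y,u) f(u) du`. -/
noncomputable def bTilde (y : ℝ) (f : ℝ → ℝ) : ℝ := ∫ u, m.b y u * f u

/-- The exploratory volatility `(∫ σ(y,u)² f(u) du)^{1/2}`. -/
noncomputable def volTilde (y : ℝ) (f : ℝ → ℝ) : ℝ := √(∫ u, m.vol y u ^ 2 * f u)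

/-- The exploratory running reward `∫ r(y,u) f(u) du - λ ∫ f(u) ln f(u) du`. -/
noncomputable def g (lam y : ℝ) (f : ℝ → ℝ) : ℝ :=
  (∫ u, m.r y u * f u) - lam * ∫ u, f u * Real.log (f u)

/-- `X` is a strong solution, under every prior, of
`dX_t = b̃(X_t, θ_t) dt + σ̃(X_t, θ_t) dB_t`, `X_0 = x`, in the space of progressively measurable
processes with `Ê[∫_0^T X_t² dt] < ∞` for all `T`. -/
def IsExplState (x : ℝ) (θ : RandControl) (X : ℝ≥0 → Path → ℝ) : Prop :=
  IsProgressive Filt X ∧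
  (∀ T : ℝ≥0, upperE m.scen (fun ω => ∫⁻ s in Set.Iic T, ENNReal.ofReal (X s ω ^ 2) ∂dt) < ∞) ∧
  ∀ P ∈ m.scen, ∀ T : ℝ≥0, HasItoIntegral P (fun s ω => m.volTilde (X s ω) (θ s ω)) T
    (fun ω => X T ω - x - ∫ s in Set.Iic T, m.bTilde (X s ω) (θ s ω) ∂dt)

/-- `θ` is an admissible randomized control for the initial state `x`, with state process `X`. -/
structure Admissible (lam x : ℝ) (θ : RandControl) (X : ℝ≥0 → Path → ℝ) : Prop where
  /-- `θ_t` is quasi-surely a density. -/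
  density : ∀ t, QS m.scen fun ω => IsDensity (θ t ω)
  /-- `∫_A θ_t(u) du` is progressively measurable. -/
  progressive : ∀ S : Set ℝ, MeasurableSet S → IsProgressive Filt fun t ω => ∫ u in S, θ t ω u
  /-- `Ê[∫_0^t (μ_s² + σ_s²) ds] < ∞`: here `μ_s² + σ_s²` is the second moment of `θ_s`. -/
  moment : ∀ t : ℝ≥0, upperE m.scen
    (fun ω => ∫⁻ s in Set.Iic t, ∫⁻ u, ENNReal.ofReal (u ^ 2 * θ s ω u) ∂volume ∂dt) < ∞
  /-- `X` is the state process of `θ`. -/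
  state : m.IsExplState x θ X
  /-- `liminf_{T → ∞} e^{-ρT} Ê[X_T²] = 0`. -/
  transversality : liminf (fun T : ℝ≥0 => ENNReal.ofReal (Real.exp (-m.ρ * T)) *
    upperE m.scen (fun ω => ENNReal.ofReal (X T ω ^ 2))) atTop = 0
  /-- The entropy of `θ_t` is finite, for a.e. `t`, quasi-surely (part of finiteness of `g`). -/
  entropy : QS m.scen fun ω => ∀ᵐ t ∂dt, Integrable fun u => θ t ω u * Real.log (θ t ω u)
  /-- `Ê[∫_0^∞ e^{-ρt} |g(X_t, θ_t)| dt] < ∞`. -/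
  reward : upperE m.scen (fun ω => ∫⁻ t,
    ENNReal.ofReal (Real.exp (-m.ρ * t) * |m.g lam (X t ω) (θ t ω)|) ∂dt) < ∞

/-- The exploratory objective: the lower expectation of `∫_0^∞ e^{-ρt} g(X_t, θ_t) dt`. -/
noncomputable def explReward (lam : ℝ) (θ : RandControl) (X : ℝ≥0 → Path → ℝ) : EReal :=
  lowerE m.scen fun ω => ∫ t, Real.exp (-m.ρ * t) * m.g lam (X t ω) (θ t ω) ∂dt

/-- The exploratory value function `V`. -/
noncomputable def V (lam x : ℝ) : EReal :=
  ⨆ (θ : RandControl) (X : ℝ≥0 → Path → ℝ) (_ : m.Admissible lam x θ X), m.explReward lam θ X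

/-- The randomized feedback control `ϑ` (`ϑ y` is the density used in state `y`) is optimal: for
every initial state the closed-loop equation has a quasi-surely unique solution, which generates an
admissible open-loop control attaining the value `V`. -/
def IsOptimalRandFeedback (lam : ℝ) (ϑ : ℝ → ℝ → ℝ) : Prop :=
  (∀ y, IsDensity (ϑ y)) ∧
  ∀ x : ℝ, ∃ X : ℝ≥0 → Path → ℝ,
    m.Admissible lam x (fun t ω => ϑ (X t ω)) X ∧
    (∀ Y : ℝ≥0 → Path → ℝ, m.IsExplState x (fun t ω => ϑ (Y t ω)) Y →
      ∀ t, QS m.scen fun ω => Y t ω = X t ω) ∧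
    m.explReward lam (fun t ω => ϑ (X t ω)) X = m.V lam x

end Model

/-! ### The non-exploratory problem -/

namespace Model

variable (m : Model)

/-- `X` is a strong solution, under every prior, of
`dX_t = (A X_t + F u_t) dt + (C X_t + D u_t) dB_t`, `X_0 = x`. -/
def IsState (x : ℝ) (u X : ℝ≥0 → Path → ℝ) : Prop :=
  IsProgressive Filt X ∧
  (∀ T : ℝ≥0, upperE m.scen (fun ω => ∫⁻ s in Set.Iic T, ENNReal.ofReal (X s ω ^ 2) ∂dt) < ∞) ∧
  ∀ P ∈ m.scen, ∀ T : ℝ≥0, HasItoIntegral P (fun s ω => m.vol (X s ω) (u s ω)) T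
    (fun ω => X T ω - x - ∫ s in Set.Iic T, m.b (X s ω) (u s ω) ∂dt)

/-- `u` is an admissible control for the initial state `x`, with state process `X`. -/
structure AdmissibleNe (x : ℝ) (u X : ℝ≥0 → Path → ℝ) : Prop where
  progressive : IsProgressive Filt u
  moment : ∀ t : ℝ≥0,
    upperE m.scen (fun ω => ∫⁻ s in Set.Iic t, ENNReal.ofReal (u s ω ^ 2) ∂dt) < ∞
  state : m.IsState x u X
  transversality : liminf (fun T : ℝ≥0 => ENNReal.ofReal (Real.exp (-m.ρ * T)) *
    upperE m.scen (fun ω => ENNReal.ofReal (X T ω ^ 2))) atTop = 0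
  reward : upperE m.scen (fun ω => ∫⁻ t,
    ENNReal.ofReal (Real.exp (-m.ρ * t) * |m.r (X t ω) (u t ω)|) ∂dt) < ∞

/-- The non-exploratory objective. -/
noncomputable def reward (u X : ℝ≥0 → Path → ℝ) : EReal :=
  lowerE m.scen fun ω => ∫ t, Real.exp (-m.ρ * t) * m.r (X t ω) (u t ω) ∂dt

/-- The non-exploratory value function `V^ne`. -/
noncomputable def Vne (x : ℝ) : EReal :=
  ⨆ (u : ℝ≥0 → Path → ℝ) (X : ℝ≥0 → Path → ℝ) (_ : m.AdmissibleNe x u X), m.reward u X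

/-- The feedback control `φ` is optimal for the non-exploratory problem. -/
def IsOptimalFeedback (φ : ℝ → ℝ) : Prop :=
  ∀ x : ℝ, ∃ X : ℝ≥0 → Path → ℝ,
    m.AdmissibleNe x (fun t ω => φ (X t ω)) X ∧
    (∀ Y : ℝ≥0 → Path → ℝ, m.IsState x (fun t ω => φ (Y t ω)) Y →
      ∀ t, QS m.scen fun ω => Y t ω = X t ω) ∧
    m.reward (fun t ω => φ (X t ω)) X = m.Vne x

/-! ### The solutions of the two problems -/

/-- `K - α₂ D² σhi²`. -/
def denom (α₂ : ℝ) : ℝ := m.K - α₂ * m.D ^ 2 * m.σhi ^ 2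

/-- The linear feedback `u*(x)`. -/
noncomputable def uStar (α₂ α₁ x : ℝ) : ℝ :=
  ((α₂ * (m.F + m.C * m.D * m.σhi ^ 2) - m.I) * x + α₁ * m.F - m.Q) / m.denom α₂

/-- The variance `λ / (K - α₂ D² σhi²)` of the Gaussian policy. -/
noncomputable def varStar (lam α₂ : ℝ) : ℝ≥0 := (lam / m.denom α₂).toNNReal

/-- The Gaussian randomized feedback `θ*(·; x)`, as a density. -/
noncomputable def thetaStar (lam α₂ α₁ x : ℝ) : ℝ → ℝ :=
  gaussianPDFReal (m.uStar α₂ α₁ x) (m.varStar lam α₂)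

/-- The Gaussian randomized feedback `θ*(·; x)`, as a probability measure. -/
noncomputable def thetaStarMeasure (lam α₂ α₁ x : ℝ) : ProbabilityMeasure ℝ :=
  ⟨gaussianReal (m.uStar α₂ α₁ x) (m.varStar lam α₂), inferInstance⟩

/-- The exploratory problem with weight `λ` has the value function
`½ α₂ x² + α₁ x + α₀ + λ/(2ρ) (ln(2πeλ / (K - α₂ D² σhi²)) - 1)` and the optimal randomized feedback
control `θ*`. -/
def SolvedExpl (lam α₂ α₁ α₀ : ℝ) : Prop :=
  (∀ x : ℝ, m.V lam x = ((1 / 2 * α₂ * x ^ 2 + α₁ * x + α₀ + lam / (2 * m.ρ) *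
    (Real.log (2 * Real.pi * Real.exp 1 * lam / m.denom α₂) - 1) : ℝ) : EReal)) ∧
  m.IsOptimalRandFeedback lam (m.thetaStar lam α₂ α₁)

/-- The non-exploratory problem has the value function `½ α₂ x² + α₁ x + α₀` and the optimal
feedback control `u*`. -/
def SolvedNe (α₂ α₁ α₀ : ℝ) : Prop :=
  (∀ x : ℝ, m.Vne x = ((1 / 2 * α₂ * x ^ 2 + α₁ * x + α₀ : ℝ) : EReal)) ∧
  m.IsOptimalFeedback (m.uStar α₂ α₁)

end Model

end GLQ

namespace GLQ

/-! ### Increments of the canonical process under a prior -/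

/-! The two problems share one Hamilton–Jacobi–Bellman equation up to additive constants. Neither
that equation (`SolvesHJB`) nor the stability of the closed loop (`Stable`: the second moment grows
at a rate below `ρ`) involves `λ`. The proof extracts these two facts from either hypothesis and
rebuilds the solutions of all the problems from them.

Extraction (`hjb_of_loopReward`). Under the feedback the state solves a scalar equation with affine
drift and quadratic squared volatility, and the reward rate is a quadratic polynomial in the state.
Only one thing is used: the reward earned by the feedback is a given strictly concave quadratic
function of the initial state. A convex reward rate would make this function bounded below, an
affine rate would make it affine, and both are impossible. In the concave case, integrability of the
reward forces integrability of the discounted square of the state, so the first two discounted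
moments can be computed. The worst prior is the one of constant volatility `σhi`. Nonnegativity of
the second moment yields stability, and comparing coefficients in the initial state yields the
equation.

Reconstruction. Since `u*` is the critical point in the control variable, the reward rate at `u`
falls short of `ρφ - bφ' - ½σhi²σ²φ''` by exactly `denom / 2 * (u - u*)²` (`SolvesHJB.r_eq`). For a
density, Gibbs' inequality with the Gaussian of variance `λ / denom` bounds the entropy by a
constant plus this very penalty (`SolvesHJB.g_le`), and the Gaussian feedback attains equality
(`solvesHJB_iff`). Discounted Dynkin formulas do the rest: Wiener measure with volatility `σhi`
bounds every admissible control from above (`verification_le`), and concavity bounds the feedback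
from below under every prior (`verification_ge`, `loopReward_eq`). Hence `V` and `Vne` differ by
`entropyValue`, a multiple of `λ ln (c λ)`, which vanishes with `λ`.

The stochastic calculus needed is an `L²` theory: isometry bounds `lo ‖H‖ ≤ ‖∫ H dB‖ ≤ hi ‖H‖`, a
second-moment formula that replaces Itô's formula (`ItoProc.integral_X_sq`), Euler schemes whose
pathwise limit solves the equation under all priors at once (`exists_isSol`), and uniqueness by
Gronwall (`IsSol.unique`). Two further ingredients are the existence of Wiener measure on path space
(`exists_mem_priors`) and jointly measurable versions of density-valued processes (`densVersion`).
-/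

theorem measurable_B_filt {s t : ℝ≥0} (h : s ≤ t) : Measurable[Filt t] (B s) :=
  ((Filtration.stronglyAdapted_natural
    (fun t => (measurable_B t).stronglyMeasurable) s).mono (Filt.mono h)).measurable

section Priors

variable {lo hi : ℝ} {P : Measure Path}

/-- Square integrability is hidden in the integrability of the supermartingale `B² - hi² t`. -/
theorem memLp_B (hP : P ∈ priors lo hi) (t : ℝ≥0) : MemLp (B t) 2 P := by
  have := hP.1
  rw [memLp_two_iff_integrable_sq (measurable_B t).aestronglyMeasurable]
  have := (hP.2.2.1.integrable t).add (integrable_const (hi ^ 2 * (t : ℝ)))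
  exact this.congr (ae_of_all _ fun ω => by simp)

/-- The increments of `B` are orthogonal to the past. -/
theorem integral_mul_incr (hP : P ∈ priors lo hi) {s t : ℝ≥0} (hst : s ≤ t) {Z : Path → ℝ}
    (hZ : Measurable[Filt s] Z) (hi : Integrable (fun ω => Z ω * (B t ω - B s ω)) P) :
    ∫ ω, Z ω * (B t ω - B s ω) ∂P = 0 := by
  have := hP.1
  have hB : Integrable (fun ω => B t ω - B s ω) P :=
    ((memLp_B hP t).sub (memLp_B hP s)).integrable one_le_two
  have h1 : P[fun ω => B t ω - B s ω | Filt s] =ᵐ[P] 0 := by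
    have e := condExp_sub (m := Filt s) ((memLp_B hP t).integrable one_le_two)
      ((memLp_B hP s).integrable one_le_two)
    have e2 := hP.2.1.2 s t hst
    have e3 := hP.2.1.2 s s le_rfl
    filter_upwards [e, e2, e3] with ω h h2 h3
    change (P[B t - B s | Filt s]) ω = 0
    rw [h, Pi.sub_apply, h2, h3, sub_self]
  have h2 := condExp_mul_of_stronglyMeasurable_left (m := Filt s) (hZ.stronglyMeasurable)
    (show Integrable (Z * fun ω => B t ω - B s ω) P from hi) hB
  rw [← integral_condExp (Filt.le s)]
  rw [show (∫ ω, (P[fun ω => Z ω * (B t ω - B s ω) | Filt s]) ω ∂P) = ∫ ω, (0 : ℝ) ∂P from ?_]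
  · simp
  refine integral_congr_ae ?_
  filter_upwards [h2, h1] with ω h h'
  change (P[Z * fun ω => B t ω - B s ω | Filt s]) ω = 0
  rw [h, Pi.mul_apply, h']; simp

/-- The cross term `B s * (B t - B s)` integrates to zero over `A`, because the indicator of `A`
times `B s` is known at time `s`. This converts the super- and submartingale conditions on `B²` into
bounds on squared increments. -/
theorem setIntegral_incr_sq (hP : P ∈ priors lo hi) {s t : ℝ≥0} (hst : s ≤ t) {A : Set Path}
    (hA : MeasurableSet[Filt s] A) :
    ∫ ω in A, (B t ω - B s ω) ^ 2 ∂P = ∫ ω in A, B t ω ^ 2 ∂P - ∫ ω in A, B s ω ^ 2 ∂P := by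
  have := hP.1
  have hA' : MeasurableSet A := Filt.le s _ hA
  have i1 := (memLp_B hP t).integrable_sq
  have i2 := (memLp_B hP s).integrable_sq
  have hd := (memLp_B hP t).sub (memLp_B hP s)
  have i12 : Integrable (fun ω => B t ω ^ 2 - B s ω ^ 2) P := i1.sub i2
  have i3 : Integrable (fun ω => B s ω * (B t ω - B s ω)) P := (memLp_B hP s).integrable_mul hd
  have h0 := integral_mul_incr hP hst (Z := A.indicator (B s))
    ((measurable_B_filt le_rfl).indicator hA) ((i3.indicator hA').congr
      (ae_of_all _ fun ω => Set.indicator_mul_left A (B s) fun ω => B t ω - B s ω))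
  have h1 : ∫ ω in A, B s ω * (B t ω - B s ω) ∂P = 0 := by
    rw [← integral_indicator hA', ← h0]
    congr 1; ext ω
    by_cases h : ω ∈ A <;> simp [h]
  have e : (fun ω => (B t ω - B s ω) ^ 2) =
      fun ω => (B t ω ^ 2 - B s ω ^ 2) - 2 * (B s ω * (B t ω - B s ω)) := by
    ext ω; ring
  rw [e, integral_sub i12.integrableOn (i3.const_mul 2).integrableOn,
    integral_sub i1.integrableOn i2.integrableOn, integral_const_mul, h1]
  ring

theorem setIntegral_incr_sq_le (hP : P ∈ priors lo hi) {s t : ℝ≥0} (hst : s ≤ t) {A : Set Path}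
    (hA : MeasurableSet[Filt s] A) :
    ∫ ω in A, (B t ω - B s ω) ^ 2 ∂P ≤ hi ^ 2 * ((t : ℝ) - s) * P.real A := by
  have := hP.1
  have h := hP.2.2.1.setIntegral_le hst hA
  rw [integral_sub (memLp_B hP t).integrable_sq.integrableOn (integrable_const _),
    integral_sub (memLp_B hP s).integrable_sq.integrableOn (integrable_const _)] at h
  rw [setIntegral_incr_sq hP hst hA]
  simp only [integral_const, MeasurableSet.univ, measureReal_restrict_apply, Set.univ_inter,
    smul_eq_mul] at h
  linarith

theorem le_setIntegral_incr_sq (hP : P ∈ priors lo hi) {s t : ℝ≥0} (hst : s ≤ t) {A : Set Path}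
    (hA : MeasurableSet[Filt s] A) :
    lo ^ 2 * ((t : ℝ) - s) * P.real A ≤ ∫ ω in A, (B t ω - B s ω) ^ 2 ∂P := by
  have := hP.1
  have h := hP.2.2.2.setIntegral_le hst hA
  rw [integral_sub (memLp_B hP t).integrable_sq.integrableOn (integrable_const _),
    integral_sub (memLp_B hP s).integrable_sq.integrableOn (integrable_const _)] at h
  rw [setIntegral_incr_sq hP hst hA]
  simp only [integral_const, MeasurableSet.univ, measureReal_restrict_apply, Set.univ_inter,
    smul_eq_mul] at h
  linarith

theorem measurable_incr_sq (s t : ℝ≥0) :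
    Measurable fun ω : Path => ENNReal.ofReal ((B t ω - B s ω) ^ 2) :=
  (((measurable_B t).sub (measurable_B s)).pow_const 2).ennreal_ofReal

theorem setLIntegral_incr_sq (hP : P ∈ priors lo hi) (s t : ℝ≥0) (A : Set Path) :
    ∫⁻ ω in A, ENNReal.ofReal ((B t ω - B s ω) ^ 2) ∂P
      = ENNReal.ofReal (∫ ω in A, (B t ω - B s ω) ^ 2 ∂P) := by
  rw [ofReal_integral_eq_lintegral_ofReal]
  · exact ((memLp_B hP t).sub (memLp_B hP s)).integrable_sq.integrableOn
  · exact ae_of_all _ fun _ => sq_nonneg _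

/-- Conditional second moments of the increments are at most `σhi² dt`. -/
theorem lintegral_mul_incr_sq_le (hP : P ∈ priors lo hi) {s t : ℝ≥0} (hst : s ≤ t)
    {f : Path → ℝ≥0∞} (hf : Measurable[Filt s] f) :
    ∫⁻ ω, f ω * ENNReal.ofReal ((B t ω - B s ω) ^ 2) ∂P
      ≤ ENNReal.ofReal (hi ^ 2 * ((t : ℝ) - s)) * ∫⁻ ω, f ω ∂P := by
  have := hP.1
  have hd : (0 : ℝ) ≤ (t : ℝ) - s := sub_nonneg.2 (by exact_mod_cast hst)
  -- The inequality is known on every event of the past. Comparing the two measures restricted to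
  -- the past extends it to all nonnegative functions of the past at once.
  set ν := P.withDensity fun ω => ENNReal.ofReal ((B t ω - B s ω) ^ 2) with hν
  have h1 : ∫⁻ ω, f ω * ENNReal.ofReal ((B t ω - B s ω) ^ 2) ∂P = ∫⁻ ω, f ω ∂ν := by
    rw [hν, lintegral_withDensity_eq_lintegral_mul _ (measurable_incr_sq s t)
      (hf.mono (Filt.le s) le_rfl)]
    simp [mul_comm]
  have h2 : ν.trim (Filt.le s) ≤ ENNReal.ofReal (hi ^ 2 * ((t : ℝ) - s)) • P.trim (Filt.le s) := by
    refine @Measure.le_iff _ (Filt s) _ _ |>.2 fun A hA => ?_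
    rw [Measure.smul_apply, trim_measurableSet_eq _ hA, trim_measurableSet_eq _ hA, hν,
      withDensity_apply _ (Filt.le s _ hA), setLIntegral_incr_sq hP, smul_eq_mul,
      ← ofReal_measureReal, ← ENNReal.ofReal_mul (by positivity)]
    exact ENNReal.ofReal_le_ofReal (setIntegral_incr_sq_le hP hst hA)
  rw [h1, ← lintegral_trim (Filt.le s) hf, ← lintegral_trim (Filt.le s) hf,
    ← smul_eq_mul, ← lintegral_smul_measure]
  exact lintegral_mono' h2 le_rfl

/-- Conditional second moments of the increments are at least `σlo² dt`. -/
theorem le_lintegral_mul_incr_sq (hP : P ∈ priors lo hi) {s t : ℝ≥0} (hst : s ≤ t)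
    {f : Path → ℝ≥0∞} (hf : Measurable[Filt s] f) :
    ENNReal.ofReal (lo ^ 2 * ((t : ℝ) - s)) * ∫⁻ ω, f ω ∂P
      ≤ ∫⁻ ω, f ω * ENNReal.ofReal ((B t ω - B s ω) ^ 2) ∂P := by
  have := hP.1
  have hd : (0 : ℝ) ≤ (t : ℝ) - s := sub_nonneg.2 (by exact_mod_cast hst)
  set ν := P.withDensity fun ω => ENNReal.ofReal ((B t ω - B s ω) ^ 2) with hν
  have h1 : ∫⁻ ω, f ω * ENNReal.ofReal ((B t ω - B s ω) ^ 2) ∂P = ∫⁻ ω, f ω ∂ν := by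
    rw [hν, lintegral_withDensity_eq_lintegral_mul _ (measurable_incr_sq s t)
      (hf.mono (Filt.le s) le_rfl)]
    simp [mul_comm]
  have h2 : ENNReal.ofReal (lo ^ 2 * ((t : ℝ) - s)) • P.trim (Filt.le s) ≤ ν.trim (Filt.le s) := by
    refine @Measure.le_iff _ (Filt s) _ _ |>.2 fun A hA => ?_
    rw [Measure.smul_apply, trim_measurableSet_eq _ hA, trim_measurableSet_eq _ hA, hν,
      withDensity_apply _ (Filt.le s _ hA), setLIntegral_incr_sq hP, smul_eq_mul,
      ← ofReal_measureReal, ← ENNReal.ofReal_mul (by positivity)]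
    exact ENNReal.ofReal_le_ofReal (le_setIntegral_incr_sq hP hst hA)
  rw [h1, ← lintegral_trim (Filt.le s) hf, ← lintegral_trim (Filt.le s) hf,
    ← smul_eq_mul, ← lintegral_smul_measure]
  exact lintegral_mono' h2 le_rfl

/-- Multiplying an increment by a square-integrable random variable of the past. -/
theorem memLp_mul_incr (hP : P ∈ priors lo hi) {s t : ℝ≥0} (hst : s ≤ t) {Z : Path → ℝ}
    (hZ : Measurable[Filt s] Z) (hZ2 : MemLp Z 2 P) :
    MemLp (fun ω => Z ω * (B t ω - B s ω)) 2 P := by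
  have hm : Measurable fun ω => Z ω * (B t ω - B s ω) :=
    (hZ.mono (Filt.le s) le_rfl).mul ((measurable_B t).sub (measurable_B s))
  refine ⟨hm.aestronglyMeasurable, ?_⟩
  rw [eLpNorm_lt_top_iff_lintegral_rpow_enorm_lt_top two_ne_zero ENNReal.ofNat_ne_top]
  have hZ3 := hZ2.2
  rw [eLpNorm_lt_top_iff_lintegral_rpow_enorm_lt_top two_ne_zero ENNReal.ofNat_ne_top] at hZ3
  refine lt_of_le_of_lt ?_ (lt_of_le_of_lt (lintegral_mul_incr_sq_le hP hst
    (f := fun ω => ‖Z ω‖ₑ ^ ((2 : ℝ≥0∞).toReal)) (Measurable.comp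
      (g := fun x : ℝ => ‖x‖ₑ ^ ((2 : ℝ≥0∞).toReal)) (by fun_prop) hZ))
    (ENNReal.mul_lt_top ENNReal.ofReal_lt_top hZ3))
  refine lintegral_mono fun ω => le_of_eq ?_
  rw [enorm_mul, ENNReal.mul_rpow_of_nonneg _ _ (by norm_num)]
  congr 1
  rw [Real.enorm_eq_ofReal_abs, ENNReal.ofReal_rpow_of_nonneg (abs_nonneg _) (by norm_num)]
  simp

end Priors

/-! ### The time axis -/

theorem measurableEmbedding_coe_nnreal : MeasurableEmbedding ((↑) : ℝ≥0 → ℝ) :=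
  MeasurableEmbedding.subtype_coe (s := Set.Ici (0 : ℝ)) measurableSet_Ici

theorem map_dt : dt.map ((↑) : ℝ≥0 → ℝ) = volume.restrict (Set.Ici 0) := by
  rw [dt, measurableEmbedding_coe_nnreal.map_comap]
  congr 1
  ext x
  exact ⟨fun ⟨y, h⟩ => h ▸ y.2, fun h => ⟨⟨x, h⟩, rfl⟩⟩

theorem dt_Ioc (a b : ℝ≥0) : dt (Set.Ioc a b) = ENNReal.ofReal (b - a) := by
  rw [dt, measurableEmbedding_coe_nnreal.comap_apply, ← Real.volume_Ioc]
  congr 1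
  ext x
  constructor
  · rintro ⟨y, h, rfl⟩; exact h
  · rintro ⟨h1, h2⟩
    exact ⟨⟨x, a.2.trans h1.le⟩, ⟨h1, h2⟩, rfl⟩

theorem dt_singleton (a : ℝ≥0) : dt {a} = 0 := by
  rw [dt, measurableEmbedding_coe_nnreal.comap_apply]; simp

instance : NullSingletonClass dt := ⟨dt_singleton⟩

theorem dt_Iic (b : ℝ≥0) : dt (Set.Iic b) = ENNReal.ofReal b := by
  have h : Set.Iic b = {0} ∪ Set.Ioc 0 b := by
    ext x; simp only [Set.mem_Iic, Set.singleton_union, Set.mem_insert_iff, Set.mem_Ioc]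
    constructor
    · intro h
      rcases eq_or_ne x 0 with h0 | h0
      · exact .inl h0
      · exact .inr ⟨pos_iff_ne_zero.2 h0, h⟩
    · rintro (rfl | h)
      · exact zero_le
      · exact h.2
  refine le_antisymm ?_ ?_
  · rw [h]
    refine (measure_union_le _ _).trans ?_
    rw [dt_singleton, dt_Ioc]; simp
  · have := measure_mono (μ := dt) (show Set.Ioc 0 b ⊆ Set.Iic b from fun x hx => hx.2)
    rw [dt_Ioc] at this; simpa using this

instance : SigmaFinite dt := by
  refine ⟨⟨⟨fun n => Set.Iic (n : ℝ≥0), fun _ => trivial, fun n => ?_, ?_⟩⟩⟩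
  · rw [dt_Iic]; exact ENNReal.ofReal_lt_top
  · refine Set.eq_univ_of_forall fun x => Set.mem_iUnion.2 ?_
    exact exists_nat_ge x

instance (T : ℝ≥0) : IsFiniteMeasure (dt.restrict (Set.Iic T)) :=
  ⟨by rw [Measure.restrict_apply_univ, dt_Iic]; exact ENNReal.ofReal_lt_top⟩

theorem dt_restrict_Ioc (T a b : ℝ≥0) (h : a ≤ b) : (dt.restrict (Set.Iic T)) (Set.Ioc a b) =
    ENNReal.ofReal ((min b T : ℝ≥0) - (min a T : ℝ≥0)) := by
  rw [Measure.restrict_apply measurableSet_Ioc, ← dt_Ioc]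
  have : Set.Ioc a b ∩ Set.Iic T = Set.Ioc a (min b T) := by ext; simp
  rw [this]
  rcases le_total a T with h1 | h1
  · rw [min_eq_left h1]
  · rw [min_eq_right h1, min_eq_right (h1.trans h)]; simp [h1]

/-- A process as a function on the product of path space and time. -/
def joint (H : ℝ≥0 → Path → ℝ) : Path × ℝ≥0 → ℝ := fun p => H p.2 p.1

/-- The measure `P ⊗ dt` on `[0, T]`. -/
noncomputable abbrev prodT (P : Measure Path) (T : ℝ≥0) : Measure (Path × ℝ≥0) :=
  P.prod (dt.restrict (Set.Iic T))

/-- Progressive measurability speaks of each interval `[0, n]` separately. Stopping the clock at `n`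
and letting `n` grow gives joint measurability on the whole time axis. -/
theorem measurable_joint {H : ℝ≥0 → Path → ℝ} (hH : IsProgressive Filt H) :
    Measurable (joint H) := by
  have h : ∀ n : ℕ, Measurable fun p : Path × ℝ≥0 => H (min p.2 n) p.1 := fun n => by
    have h1 : Measurable fun p : Set.Iic (n : ℝ≥0) × Path => H p.1 p.2 :=
      (hH n).mono (sup_le_sup le_rfl (MeasurableSpace.comap_mono (Filt.le _))) le_rfl
    exact h1.comp (g := fun p : Set.Iic (n : ℝ≥0) × Path => H p.1 p.2)
      (f := fun p : Path × ℝ≥0 => ((⟨min p.2 n, Set.mem_Iic.2 (min_le_right _ _)⟩ : Set.Iic (n : ℝ≥0)), p.1))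
      (((measurable_snd.min measurable_const).subtype_mk).prodMk measurable_fst)
  refine measurable_of_tendsto_metrizable h (tendsto_pi_nhds.2 fun p => ?_)
  refine tendsto_const_nhds.congr' ?_
  obtain ⟨n, hn⟩ := exists_nat_ge p.2
  filter_upwards [eventually_ge_atTop n] with k hk
  rw [min_eq_left (hn.trans (by exact_mod_cast hk))]; rfl

theorem eLpNorm_two_sq {α : Type*} {m : MeasurableSpace α} (f : α → ℝ) (μ : Measure α) :
    eLpNorm f 2 μ ^ 2 = ∫⁻ x, ENNReal.ofReal (f x ^ 2) ∂μ := by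
  rw [eLpNorm_eq_lintegral_rpow_enorm_toReal two_ne_zero ENNReal.ofNat_ne_top,
    ← ENNReal.rpow_natCast, ← ENNReal.rpow_mul]
  simp only [ENNReal.toReal_ofNat, Nat.cast_ofNat, one_div, isUnit_iff_ne_zero, ne_eq,
    OfNat.ofNat_ne_zero, not_false_eq_true, IsUnit.inv_mul_cancel, ENNReal.rpow_one]
  refine lintegral_congr fun x => ?_
  rw [Real.enorm_eq_ofReal_abs, ENNReal.ofReal_rpow_of_nonneg (abs_nonneg _) (by norm_num)]
  simp

theorem eLpNorm_two_sq_eq_ofReal {α : Type*} {m : MeasurableSpace α} {f : α → ℝ} {μ : Measure α}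
    (hf : MemLp f 2 μ) : eLpNorm f 2 μ ^ 2 = ENNReal.ofReal (∫ x, f x ^ 2 ∂μ) := by
  rw [eLpNorm_two_sq, ofReal_integral_eq_lintegral_ofReal hf.integrable_sq
    (ae_of_all _ fun _ => sq_nonneg _)]

theorem memLp_two_of_lintegral {α : Type*} {m : MeasurableSpace α} {f : α → ℝ} {μ : Measure α}
    (hf : AEStronglyMeasurable f μ) (h : ∫⁻ x, ENNReal.ofReal (f x ^ 2) ∂μ < ∞) :
    MemLp f 2 μ := by
  refine ⟨hf, ?_⟩
  rw [← eLpNorm_two_sq] at h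
  by_contra h'
  rw [not_lt, top_le_iff] at h'
  simp [h'] at h

/-! ### Step processes -/

/-- The step process `∑_{i<n} ξ_i 1_{(t_i, t_{i+1}]}`. -/
noncomputable def stepVal (n : ℕ) (t : ℕ → ℝ≥0) (ξ : ℕ → Path → ℝ) (s : ℝ≥0) (ω : Path) : ℝ :=
  ∑ i ∈ Finset.range n, (Set.Ioc (t i) (t (i + 1))).indicator (fun _ => ξ i ω) s

/-- The stochastic integral over `[0, T]` of a step process. -/
noncomputable def stepInt (n : ℕ) (t : ℕ → ℝ≥0) (ξ : ℕ → Path → ℝ) (T : ℝ≥0) (ω : Path) : ℝ :=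
  ∑ i ∈ Finset.range n, ξ i ω * (B (min (t (i + 1)) T) ω - B (min (t i) T) ω)

variable {n : ℕ} {t : ℕ → ℝ≥0} {ξ : ℕ → Path → ℝ} {lo hi : ℝ} {P : Measure Path}

theorem measurable_joint_stepVal (hm : ∀ i, Measurable (ξ i)) :
    Measurable (joint (stepVal n t ξ)) := by
  unfold joint stepVal
  refine Finset.measurable_sum _ fun i _ => ?_
  have : (fun p : Path × ℝ≥0 => (Set.Ioc (t i) (t (i + 1))).indicator (fun _ => ξ i p.1) p.2) =
      (Set.univ ×ˢ Set.Ioc (t i) (t (i + 1))).indicator fun p => ξ i p.1 := by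
    ext p; by_cases h : p.2 ∈ Set.Ioc (t i) (t (i + 1)) <;> simp [Set.indicator, h]
  rw [this]
  exact ((hm i).comp measurable_fst).indicator (MeasurableSet.univ.prod measurableSet_Ioc)

/-- At each time at most one of the disjoint half-open intervals is active, so a function vanishing
at `0` passes through the sum. -/
theorem map_stepVal (ht : Monotone t) {E : Type*} [AddCommMonoid E] (φ : ℝ → E) (h0 : φ 0 = 0)
    (s : ℝ≥0) (ω : Path) : φ (stepVal n t ξ s ω) =
      ∑ i ∈ Finset.range n, (Set.Ioc (t i) (t (i + 1))).indicator (fun _ => φ (ξ i ω)) s := by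
  unfold stepVal
  by_cases h : ∃ j ∈ Finset.range n, s ∈ Set.Ioc (t j) (t (j + 1))
  · obtain ⟨j, hj, hs⟩ := h
    have hd : ∀ i, i ≠ j → s ∉ Set.Ioc (t i) (t (i + 1)) := fun i hij hi =>
      Set.disjoint_left.1 (ht.pairwise_disjoint_on_Ioc_succ hij) hi hs
    rw [Finset.sum_eq_single_of_mem j hj fun i _ hij => Set.indicator_of_notMem (hd i hij) _,
      Finset.sum_eq_single_of_mem j hj fun i _ hij => Set.indicator_of_notMem (hd i hij) _,
      Set.indicator_of_mem hs, Set.indicator_of_mem hs]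
  · push Not at h
    rw [Finset.sum_eq_zero fun i hi => Set.indicator_of_notMem (h i hi) _,
      Finset.sum_eq_zero fun i hi => Set.indicator_of_notMem (h i hi) _, h0]

theorem lintegral_stepVal_sq [IsProbabilityMeasure P] (ht : Monotone t)
    (hm : ∀ i, Measurable (ξ i)) (T : ℝ≥0) :
    ∫⁻ p, ENNReal.ofReal (joint (stepVal n t ξ) p ^ 2) ∂prodT P T =
      ∑ i ∈ Finset.range n,
        ENNReal.ofReal ((min (t (i + 1)) T : ℝ≥0) - (min (t i) T : ℝ≥0)) *
          ∫⁻ ω, ENNReal.ofReal (ξ i ω ^ 2) ∂P := by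
  have e : ∀ p : Path × ℝ≥0, ENNReal.ofReal (joint (stepVal n t ξ) p ^ 2) =
      ∑ i ∈ Finset.range n, ENNReal.ofReal (ξ i p.1 ^ 2) *
        (Set.Ioc (t i) (t (i + 1))).indicator 1 p.2 := fun p => by
    unfold joint
    rw [map_stepVal ht (fun x => ENNReal.ofReal (x ^ 2)) (by simp)]
    refine Finset.sum_congr rfl fun i _ => ?_
    by_cases h : p.2 ∈ Set.Ioc (t i) (t (i + 1)) <;> simp [Set.indicator, h]
  simp_rw [e]
  have hm' : ∀ i, Measurable fun ω => ENNReal.ofReal (ξ i ω ^ 2) := fun i =>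
    ((hm i).pow_const 2).ennreal_ofReal
  rw [lintegral_finsetSum]
  · refine Finset.sum_congr rfl fun i _ => ?_
    rw [lintegral_prod_mul (hm' i).aemeasurable
      (measurable_one.indicator measurableSet_Ioc).aemeasurable,
      lintegral_indicator_one measurableSet_Ioc, dt_restrict_Ioc _ _ _ (ht (Nat.le_succ i)),
      mul_comm]
  · intro i _
    exact ((hm' i).comp measurable_fst).mul
      ((measurable_one.indicator measurableSet_Ioc).comp measurable_snd)

/-- Square integral of a sum of orthogonal increments. -/
theorem integral_sum_mul_incr_sq (hP : P ∈ priors lo hi) (ht : Monotone t)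
    (hm : ∀ i, Measurable[Filt (t i)] (ξ i)) (h2 : ∀ i, MemLp (ξ i) 2 P) (n : ℕ) :
    MemLp (fun ω => ∑ i ∈ Finset.range n, ξ i ω * (B (t (i + 1)) ω - B (t i) ω)) 2 P ∧
    (∀ m, n ≤ m → Measurable[Filt (t m)]
      (fun ω => ∑ i ∈ Finset.range n, ξ i ω * (B (t (i + 1)) ω - B (t i) ω))) ∧
    ∫ ω, (∑ i ∈ Finset.range n, ξ i ω * (B (t (i + 1)) ω - B (t i) ω)) ^ 2 ∂P =
      ∑ i ∈ Finset.range n, ∫ ω, (ξ i ω * (B (t (i + 1)) ω - B (t i) ω)) ^ 2 ∂P := by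
  have hL : ∀ i, MemLp (fun ω => ξ i ω * (B (t (i + 1)) ω - B (t i) ω)) 2 P := fun i =>
    memLp_mul_incr hP (ht (Nat.le_succ i)) (hm i) (h2 i)
  have hM : ∀ k m, k ≤ m → Measurable[Filt (t m)]
      (fun ω => ∑ i ∈ Finset.range k, ξ i ω * (B (t (i + 1)) ω - B (t i) ω)) := by
    intro k m hkm
    refine Finset.measurable_sum _ fun i hi => ?_
    have hik : i + 1 ≤ m := (Finset.mem_range.1 hi).trans_le hkm
    exact ((hm i).mono (Filt.mono (ht ((Nat.le_succ i).trans hik))) le_rfl).mul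
      ((measurable_B_filt (ht hik)).sub (measurable_B_filt (ht ((Nat.le_succ i).trans hik))))
  refine ⟨memLp_finsetSum _ fun i _ => hL i, hM n, ?_⟩
  induction n with
  | zero => simp
  | succ n ih =>
    have hS : MemLp (fun ω => ∑ i ∈ Finset.range n, ξ i ω * (B (t (i + 1)) ω - B (t i) ω)) 2 P :=
      memLp_finsetSum _ fun i _ => hL i
    have hc : Integrable (fun ω => (∑ i ∈ Finset.range n, ξ i ω * (B (t (i + 1)) ω - B (t i) ω)) *
        (ξ n ω * (B (t (n + 1)) ω - B (t n) ω))) P := hS.integrable_mul (hL n)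
    -- The partial sum times `ξ n` is known at time `t n`, hence orthogonal to the next increment.
    have hz : ∫ ω, (∑ i ∈ Finset.range n, ξ i ω * (B (t (i + 1)) ω - B (t i) ω)) *
        (ξ n ω * (B (t (n + 1)) ω - B (t n) ω)) ∂P = 0 := by
      rw [← integral_mul_incr hP (ht (Nat.le_succ n)) ((hM n n le_rfl).mul (hm n))
        (by simpa [mul_assoc] using hc)]
      simp [mul_assoc]
    rw [Finset.sum_range_succ, ← ih]
    simp_rw [Finset.sum_range_succ _ n, add_sq, mul_assoc]
    have hadd : Integrable (fun ω => (∑ i ∈ Finset.range n, ξ i ω * (B (t (i + 1)) ω - B (t i) ω)) ^ 2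
        + 2 * ((∑ i ∈ Finset.range n, ξ i ω * (B (t (i + 1)) ω - B (t i) ω)) *
        (ξ n ω * (B (t (n + 1)) ω - B (t n) ω)))) P := hS.integrable_sq.add (hc.const_mul 2)
    rw [integral_add hadd (hL n).integrable_sq,
      integral_add hS.integrable_sq (hc.const_mul 2), integral_const_mul, hz]
    simp

/-- Restriction of the coefficients of a step process to those active before `T`. -/
theorem stepInt_eq (ht : Monotone t) (T : ℝ≥0) (ω : Path) : stepInt n t ξ T ω =
    ∑ i ∈ Finset.range n, (if t i ≤ T then ξ i ω else 0) *
      (B (min (t (i + 1)) T) ω - B (min (t i) T) ω) := by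
  refine Finset.sum_congr rfl fun i _ => ?_
  split_ifs with h
  · rfl
  · rw [min_eq_right (not_le.1 h).le, min_eq_right ((not_le.1 h).le.trans (ht (Nat.le_succ i)))]
    simp

theorem measurable_trunc_coeff (hm : ∀ i, Measurable[Filt (t i)] (ξ i)) (T : ℝ≥0) (i : ℕ) :
    Measurable[Filt (min (t i) T)] fun ω => if t i ≤ T then ξ i ω else 0 := by
  by_cases h : t i ≤ T
  · rw [min_eq_left h]; simpa only [h, if_true] using hm i
  · simp only [h, if_false]; exact measurable_const

theorem memLp_trunc_coeff (h2 : ∀ i, MemLp (ξ i) 2 P) (T : ℝ≥0) (i : ℕ) :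
    MemLp (fun ω => if t i ≤ T then ξ i ω else 0) 2 P := by
  by_cases h : t i ≤ T
  · simpa [h] using h2 i
  · simp [h]

theorem memLp_stepInt (hP : P ∈ priors lo hi) (ht : Monotone t)
    (hm : ∀ i, Measurable[Filt (t i)] (ξ i)) (h2 : ∀ i, MemLp (ξ i) 2 P) (T : ℝ≥0) :
    MemLp (stepInt n t ξ T) 2 P := by
  have := (integral_sum_mul_incr_sq hP (fun _ _ h => min_le_min (ht h) le_rfl)
    (measurable_trunc_coeff hm T) (memLp_trunc_coeff h2 T) n).1
  exact (memLp_congr_ae (ae_of_all _ fun ω => stepInt_eq ht T ω)).2 this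

theorem lintegral_stepInt_sq (hP : P ∈ priors lo hi) (ht : Monotone t)
    (hm : ∀ i, Measurable[Filt (t i)] (ξ i)) (h2 : ∀ i, MemLp (ξ i) 2 P) (T : ℝ≥0) :
    ∫⁻ ω, ENNReal.ofReal (stepInt n t ξ T ω ^ 2) ∂P = ∑ i ∈ Finset.range n,
      ∫⁻ ω, ENNReal.ofReal ((if t i ≤ T then ξ i ω else 0) ^ 2) *
        ENNReal.ofReal ((B (min (t (i + 1)) T) ω - B (min (t i) T) ω) ^ 2) ∂P := by
  have hmono : Monotone fun i => min (t i) T := fun _ _ h => min_le_min (ht h) le_rfl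
  have h := integral_sum_mul_incr_sq hP hmono (measurable_trunc_coeff hm T)
    (memLp_trunc_coeff h2 T) n
  simp_rw [stepInt_eq ht T]
  rw [← ofReal_integral_eq_lintegral_ofReal h.1.integrable_sq
    (ae_of_all _ fun _ => sq_nonneg _), h.2.2,
    ENNReal.ofReal_sum_of_nonneg fun i _ => integral_nonneg fun _ => sq_nonneg _]
  refine Finset.sum_congr rfl fun i _ => ?_
  rw [ofReal_integral_eq_lintegral_ofReal (memLp_mul_incr hP (hmono (Nat.le_succ i))
    (measurable_trunc_coeff hm T i) (memLp_trunc_coeff h2 T i)).integrable_sq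
    (ae_of_all _ fun _ => sq_nonneg _)]
  refine lintegral_congr fun ω => ?_
  rw [mul_pow, ENNReal.ofReal_mul (sq_nonneg _)]

/-- Itô isometry inequality for step processes, upper bound. -/
theorem eLpNorm_stepInt_le (hP : P ∈ priors lo hi) (h0 : 0 ≤ hi) (ht : Monotone t)
    (hm : ∀ i, Measurable[Filt (t i)] (ξ i)) (h2 : ∀ i, MemLp (ξ i) 2 P) (T : ℝ≥0) :
    eLpNorm (stepInt n t ξ T) 2 P ≤
      ENNReal.ofReal hi * eLpNorm (joint (stepVal n t ξ)) 2 (prodT P T) := by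
  have := hP.1
  have hmono : Monotone fun i => min (t i) T := fun _ _ h => min_le_min (ht h) le_rfl
  rw [← ENNReal.pow_le_pow_left_iff two_ne_zero, mul_pow, eLpNorm_two_sq, eLpNorm_two_sq,
    lintegral_stepInt_sq hP ht hm h2,
    lintegral_stepVal_sq ht fun i => (hm i).mono (Filt.le _) le_rfl, Finset.mul_sum]
  refine Finset.sum_le_sum fun i _ => ?_
  refine (lintegral_mul_incr_sq_le hP (hmono (Nat.le_succ i))
    (f := fun ω => ENNReal.ofReal ((if t i ≤ T then ξ i ω else 0) ^ 2))
    (Measurable.comp (g := fun x : ℝ => ENNReal.ofReal (x ^ 2)) (by fun_prop)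
      (measurable_trunc_coeff hm T i))).trans ?_
  rw [ENNReal.ofReal_mul (sq_nonneg _), ENNReal.ofReal_pow h0, mul_assoc]
  refine mul_le_mul_right (mul_le_mul_right (lintegral_mono fun ω => ?_) _) _
  split_ifs
  · exact le_rfl
  · simp

/-- Itô isometry inequality for step processes, lower bound. -/
theorem le_eLpNorm_stepInt (hP : P ∈ priors lo hi) (h0 : 0 ≤ lo) (ht : Monotone t)
    (hm : ∀ i, Measurable[Filt (t i)] (ξ i)) (h2 : ∀ i, MemLp (ξ i) 2 P) (T : ℝ≥0) :
    ENNReal.ofReal lo * eLpNorm (joint (stepVal n t ξ)) 2 (prodT P T) ≤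
      eLpNorm (stepInt n t ξ T) 2 P := by
  have := hP.1
  have hmono : Monotone fun i => min (t i) T := fun _ _ h => min_le_min (ht h) le_rfl
  rw [← ENNReal.pow_le_pow_left_iff two_ne_zero, mul_pow, eLpNorm_two_sq, eLpNorm_two_sq,
    lintegral_stepInt_sq hP ht hm h2,
    lintegral_stepVal_sq ht fun i => (hm i).mono (Filt.le _) le_rfl, Finset.mul_sum]
  refine Finset.sum_le_sum fun i _ => ?_
  refine le_trans ?_ (le_lintegral_mul_incr_sq hP (hmono (Nat.le_succ i))
    (f := fun ω => ENNReal.ofReal ((if t i ≤ T then ξ i ω else 0) ^ 2))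
    (Measurable.comp (g := fun x : ℝ => ENNReal.ofReal (x ^ 2)) (by fun_prop)
      (measurable_trunc_coeff hm T i)))
  rw [ENNReal.ofReal_mul (sq_nonneg _), ENNReal.ofReal_pow h0, mul_assoc]
  split_ifs with h
  · exact le_rfl
  · rw [min_eq_right (not_le.1 h).le, min_eq_right ((not_le.1 h).le.trans (ht (Nat.le_succ i)))]
    simp

/-- The increments of the integral of a step process are orthogonal to the past. -/
theorem integral_mul_stepInt_sub (hP : P ∈ priors lo hi) (ht : Monotone t)
    (hm : ∀ i, Measurable[Filt (t i)] (ξ i)) (hb : ∀ i, ∃ c : ℝ, ∀ ω, |ξ i ω| ≤ c)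
    {s T : ℝ≥0} (hsT : s ≤ T) {Z : Path → ℝ} (hZ : Measurable[Filt s] Z) (hZ2 : MemLp Z 2 P) :
    ∫ ω, Z ω * (stepInt n t ξ T ω - stepInt n t ξ s ω) ∂P = 0 := by
  have := hP.1
  -- Replacing each grid time by its maximum with `s` expresses the increment of the integral over
  -- `[s, T]` through increments of `B` that start at or after `s`. The factor `Z` then belongs to
  -- the past of each of them.
  have key : ∀ i ω, ξ i ω * (B (min (t (i + 1)) T) ω - B (min (t i) T) ω) -
      ξ i ω * (B (min (t (i + 1)) s) ω - B (min (t i) s) ω) =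
      (if t i ≤ T then ξ i ω else 0) *
        (B (max (min (t (i + 1)) T) s) ω - B (max (min (t i) T) s) ω) := by
    have hB : ∀ (a : ℝ≥0) ω, B (max (min a T) s) ω = B (min a T) ω - B (min a s) ω + B s ω := by
      intro a ω
      rcases le_total a s with h | h
      · rw [min_eq_left h, min_eq_left (h.trans hsT), max_eq_right h]; ring
      · rw [min_eq_right h, max_eq_left (le_min h hsT)]; ring
    intro i ω
    rw [hB, hB]
    split_ifs with h
    · ring
    · have h' := (not_le.1 h).le
      have h'' := h'.trans (ht (Nat.le_succ i))
      rw [min_eq_right h', min_eq_right h'', min_eq_right (hsT.trans h'),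
        min_eq_right (hsT.trans h'')]; ring
  have e : ∀ ω, Z ω * (stepInt n t ξ T ω - stepInt n t ξ s ω) = ∑ i ∈ Finset.range n,
      (Z ω * (if t i ≤ T then ξ i ω else 0)) *
        (B (max (min (t (i + 1)) T) s) ω - B (max (min (t i) T) s) ω) := by
    intro ω
    rw [stepInt, stepInt, ← Finset.sum_sub_distrib, Finset.mul_sum]
    refine Finset.sum_congr rfl fun i _ => ?_
    rw [key, mul_assoc]
  have hmeas : ∀ i, Measurable[Filt (max (min (t i) T) s)]
      fun ω => Z ω * (if t i ≤ T then ξ i ω else 0) := fun i =>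
    (hZ.mono (Filt.mono (le_max_right _ _)) le_rfl).mul
      ((measurable_trunc_coeff hm T i).mono (Filt.mono (le_max_left _ _)) le_rfl)
  have hL : ∀ i, MemLp (fun ω => Z ω * (if t i ≤ T then ξ i ω else 0)) 2 P := by
    intro i
    obtain ⟨c, hc⟩ := hb i
    refine hZ2.of_le_mul (c := |c|)
      ((hmeas i).mono (Filt.le _) le_rfl).aestronglyMeasurable (ae_of_all _ fun ω => ?_)
    rw [norm_mul, mul_comm]
    refine mul_le_mul_of_nonneg_right ?_ (norm_nonneg _)
    split_ifs
    · exact (hc ω).trans (le_abs_self c)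
    · simp
  have hmono : ∀ i, max (min (t i) T) s ≤ max (min (t (i + 1)) T) s := fun i =>
    max_le_max (min_le_min (ht (Nat.le_succ i)) le_rfl) le_rfl
  have hint := fun i => (memLp_mul_incr hP (hmono i) (hmeas i) (hL i)).integrable one_le_two
  simp_rw [e]
  rw [integral_finsetSum _ fun i _ => hint i]
  exact Finset.sum_eq_zero fun i _ => integral_mul_incr hP (hmono i) (hmeas i) (hint i)

/-! ### Common refinements of simple processes -/

theorem sum_range_telescope (f : ℕ → ℝ) {p q M : ℕ} (hpq : p ≤ q) (hq : q ≤ M) :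
    ∑ i ∈ Finset.range M, (if p ≤ i ∧ i < q then f (i + 1) - f i else 0) = f q - f p := by
  rw [← Finset.sum_filter]
  have : Finset.filter (fun i => p ≤ i ∧ i < q) (Finset.range M) = Finset.Ico p q := by
    ext i; simp only [Finset.mem_filter, Finset.mem_range, Finset.mem_Ico]; omega
  rw [this, Finset.sum_Ico_eq_sub _ hpq, Finset.sum_range_sub, Finset.sum_range_sub]
  ring

/-- Every finite nonempty set of times is contained in a grid along which increments telescope. -/
theorem exists_grid (s : Finset ℝ≥0) (hs : s.Nonempty) :
    ∃ (N : ℕ) (u : ℕ → ℝ≥0), Monotone u ∧ ∀ a ∈ s, ∀ b ∈ s, a ≤ b → ∀ F : ℝ≥0 → ℝ,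
      ∑ i ∈ Finset.range N, (if a ≤ u i ∧ u i < b then F (u (i + 1)) - F (u i) else 0) =
        F b - F a := by
  have hc : 0 < s.card := hs.card_pos
  let e := s.orderEmbOfFin rfl
  -- The index is capped at the last point, so the sequence is total and constant beyond the grid.
  let u : ℕ → ℝ≥0 := fun i => e ⟨min i (s.card - 1), by omega⟩
  refine ⟨s.card - 1, u, fun i j hij => e.monotone ?_, ?_⟩
  · simp only [Fin.mk_le_mk]; omega
  · have hu : ∀ a ∈ s, ∃ p, p ≤ s.card - 1 ∧ u p = a := fun a ha => by
      have : a ∈ Set.range e := by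
        rw [Finset.range_orderEmbOfFin]; exact ha
      obtain ⟨p, rfl⟩ := this
      refine ⟨p, by have := p.2; omega, ?_⟩
      simp only [u]; congr; have := p.2; omega
    have hlt : ∀ i j, i ≤ s.card - 1 → j ≤ s.card - 1 → (u i < u j ↔ i < j) := by
      intro i j hi hj
      simp only [u, e.lt_iff_lt, Fin.mk_lt_mk]; omega
    intro a ha b hb hab F
    obtain ⟨p, hp, rfl⟩ := hu a ha
    obtain ⟨q, hq, rfl⟩ := hu b hb
    have hpq : p ≤ q := by
      by_contra h
      exact absurd ((hlt q p hq hp).2 (not_le.1 h)) (not_lt.2 hab)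
    rw [← sum_range_telescope (fun i => F (u i)) hpq hq]
    refine Finset.sum_congr rfl fun i hi => ?_
    have hi' := Finset.mem_range.1 hi
    have h1 : u p ≤ u i ↔ p ≤ i := by
      rw [← not_lt, hlt i p (by omega) hp, not_lt]
    simp only [h1, hlt i q (by omega) hq]

namespace SimpleProc

/-- The coefficient of a simple process on the cell of a finer grid starting at `r`. -/
noncomputable def coeff (h : SimpleProc) (r : ℝ≥0) (ω : Path) : ℝ :=
  ∑ j ∈ Finset.range h.n, if h.t j ≤ r ∧ r < h.t (j + 1) then h.ξ j ω else 0

theorem measurable_coeff (h : SimpleProc) (r : ℝ≥0) : Measurable[Filt r] (h.coeff r) := by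
  refine Finset.measurable_sum _ fun j _ => ?_
  by_cases hj : h.t j ≤ r ∧ r < h.t (j + 1)
  · simp only [hj, and_self, if_true]
    exact (h.meas j).mono (Filt.mono hj.1) le_rfl
  · simp only [hj, if_false]; exact measurable_const

theorem bdd_coeff (h : SimpleProc) (r : ℝ≥0) : ∃ c : ℝ, ∀ ω, |h.coeff r ω| ≤ c := by
  choose c hc using h.bdd
  refine ⟨∑ j ∈ Finset.range h.n, |c j|, fun ω => ?_⟩
  refine (Finset.abs_sum_le_sum_abs _ _).trans (Finset.sum_le_sum fun j _ => ?_)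
  split_ifs
  · exact (hc j ω).trans (le_abs_self _)
  · simp

theorem sum_coeff (h : SimpleProc) {N : ℕ} {u : ℕ → ℝ≥0} {F : ℝ≥0 → ℝ}
    (hu : ∀ j < h.n, ∑ i ∈ Finset.range N,
      (if h.t j ≤ u i ∧ u i < h.t (j + 1) then F (u (i + 1)) - F (u i) else 0) =
        F (h.t (j + 1)) - F (h.t j)) (ω : Path) :
    ∑ i ∈ Finset.range N, h.coeff (u i) ω * (F (u (i + 1)) - F (u i)) =
      ∑ j ∈ Finset.range h.n, h.ξ j ω * (F (h.t (j + 1)) - F (h.t j)) := by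
  simp_rw [coeff, Finset.sum_mul]
  rw [Finset.sum_comm]
  refine Finset.sum_congr rfl fun j hj => ?_
  rw [← hu j (Finset.mem_range.1 hj), Finset.mul_sum]
  refine Finset.sum_congr rfl fun i _ => ?_
  split_ifs <;> simp

/-- The common refinement is tested against an arbitrary function `F` of time. Indicators in time
give the values of the processes and the stopped path gives their integrals, so one identity serves
both. -/
theorem exists_sub_aux (h k : SimpleProc) : ∃ l : SimpleProc, ∀ (F : ℝ≥0 → ℝ) (ω : Path),
    ∑ i ∈ Finset.range l.n, l.ξ i ω * (F (l.t (i + 1)) - F (l.t i)) =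
      ∑ i ∈ Finset.range h.n, h.ξ i ω * (F (h.t (i + 1)) - F (h.t i)) -
      ∑ i ∈ Finset.range k.n, k.ξ i ω * (F (k.t (i + 1)) - F (k.t i)) := by
  classical
  let s : Finset ℝ≥0 := (Finset.range (h.n + 1)).image h.t ∪ (Finset.range (k.n + 1)).image k.t
  have hs : s.Nonempty := ⟨h.t 0, by
    simp only [s, Finset.mem_union, Finset.mem_image, Finset.mem_range]
    exact .inl ⟨0, by omega, rfl⟩⟩
  obtain ⟨N, u, hu, hF⟩ := exists_grid s hs
  have h1 : ∀ j ≤ h.n, h.t j ∈ s := fun j hj => by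
    simp only [s, Finset.mem_union, Finset.mem_image, Finset.mem_range]
    exact .inl ⟨j, by omega, rfl⟩
  have h2 : ∀ j ≤ k.n, k.t j ∈ s := fun j hj => by
    simp only [s, Finset.mem_union, Finset.mem_image, Finset.mem_range]
    exact .inr ⟨j, by omega, rfl⟩
  refine ⟨⟨N, u, hu, fun i ω => h.coeff (u i) ω - k.coeff (u i) ω,
    fun i => (h.measurable_coeff _).sub (k.measurable_coeff _), fun i => ?_⟩, fun F ω => ?_⟩
  · obtain ⟨c, hc⟩ := h.bdd_coeff (u i)
    obtain ⟨d, hd⟩ := k.bdd_coeff (u i)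
    exact ⟨c + d, fun ω => (abs_sub _ _).trans (add_le_add (hc ω) (hd ω))⟩
  · simp only [sub_mul, Finset.sum_sub_distrib]
    rw [h.sum_coeff fun j hj => hF _ (h1 j (by omega)) _ (h1 (j + 1) (by omega))
        (h.mono (Nat.le_succ j)) F,
      k.sum_coeff fun j hj => hF _ (h2 j (by omega)) _ (h2 (j + 1) (by omega))
        (k.mono (Nat.le_succ j)) F]

/-- The indicator of `(t i, t (i+1)]` at `s` is the increment of the jump function `r ↦ 1_{s ≤ r}`,
which is the form `exists_sub_aux` asks for. -/
theorem value_eq_sum (h : SimpleProc) (s : ℝ≥0) (ω : Path) : h.value s ω =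
    ∑ i ∈ Finset.range h.n, h.ξ i ω *
      ((fun r => if s ≤ r then (1 : ℝ) else 0) (h.t (i + 1)) -
        (fun r => if s ≤ r then (1 : ℝ) else 0) (h.t i)) := by
  refine Finset.sum_congr rfl fun i _ => ?_
  have := h.mono (Nat.le_succ i)
  by_cases h1 : s ≤ h.t i
  · have h3 : s ∉ Set.Ioc (h.t i) (h.t (i + 1)) := fun hh => not_lt.2 h1 hh.1
    rw [Set.indicator_of_notMem h3]
    simp [h1, h1.trans this]
  · by_cases h2 : s ≤ h.t (i + 1)
    · have h3 : s ∈ Set.Ioc (h.t i) (h.t (i + 1)) := ⟨not_le.1 h1, h2⟩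
      rw [Set.indicator_of_mem h3]; simp [h1, h2]
    · have h3 : s ∉ Set.Ioc (h.t i) (h.t (i + 1)) := fun hh => h2 hh.2
      rw [Set.indicator_of_notMem h3]; simp [h1, h2]

/-- Simple processes are stable under subtraction, compatibly with the integral. -/
theorem exists_sub (h k : SimpleProc) : ∃ l : SimpleProc,
    (∀ s ω, l.value s ω = h.value s ω - k.value s ω) ∧
    ∀ T ω, l.integral T ω = h.integral T ω - k.integral T ω := by
  obtain ⟨l, hl⟩ := exists_sub_aux h k
  refine ⟨l, fun s ω => ?_, fun T ω => ?_⟩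
  · rw [value_eq_sum, value_eq_sum, value_eq_sum]; exact hl (fun r => if s ≤ r then (1 : ℝ) else 0) ω
  · exact hl (fun r => B (min r T) ω) ω

variable {lo hi : ℝ} {P : Measure Path}

theorem memLp_coeff [IsProbabilityMeasure P] (h : SimpleProc) (i : ℕ) : MemLp (h.ξ i) 2 P := by
  obtain ⟨c, hc⟩ := h.bdd i
  exact MemLp.of_bound ((h.meas i).mono (Filt.le _) le_rfl).aestronglyMeasurable c
    (ae_of_all _ hc)

theorem measurable_joint_value (h : SimpleProc) : Measurable (joint h.value) :=
  measurable_joint_stepVal fun i => (h.meas i).mono (Filt.le _) le_rfl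

theorem memLp_integral (hP : P ∈ priors lo hi) (h : SimpleProc) (T : ℝ≥0) :
    MemLp (h.integral T) 2 P :=
  have := hP.1
  memLp_stepInt hP h.mono h.meas (fun i => h.memLp_coeff i) T

theorem eLpNorm_integral_le (hP : P ∈ priors lo hi) (h0 : 0 ≤ hi) (h : SimpleProc) (T : ℝ≥0) :
    eLpNorm (h.integral T) 2 P ≤ ENNReal.ofReal hi * eLpNorm (joint h.value) 2 (prodT P T) :=
  have := hP.1
  eLpNorm_stepInt_le hP h0 h.mono h.meas (fun i => h.memLp_coeff i) T

theorem le_eLpNorm_integral (hP : P ∈ priors lo hi) (h0 : 0 ≤ lo) (h : SimpleProc) (T : ℝ≥0) :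
    ENNReal.ofReal lo * eLpNorm (joint h.value) 2 (prodT P T) ≤ eLpNorm (h.integral T) 2 P :=
  have := hP.1
  le_eLpNorm_stepInt hP h0 h.mono h.meas (fun i => h.memLp_coeff i) T

theorem eLpNorm_integral_sub_le (hP : P ∈ priors lo hi) (h0 : 0 ≤ hi) (h k : SimpleProc)
    (T : ℝ≥0) : eLpNorm (h.integral T - k.integral T) 2 P ≤
      ENNReal.ofReal hi * eLpNorm (joint h.value - joint k.value) 2 (prodT P T) := by
  obtain ⟨l, h1, h2⟩ := exists_sub h k
  have := l.eLpNorm_integral_le hP h0 T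
  rwa [show l.integral T = h.integral T - k.integral T from funext (h2 T),
    show joint l.value = joint h.value - joint k.value from funext fun p => h1 p.2 p.1] at this

end SimpleProc

/-! ### The Itô integral in `L²` -/

section Ito

variable {lo hi : ℝ} {P : Measure Path} {H H' : ℝ≥0 → Path → ℝ} {T : ℝ≥0} {ξ ξ' : Path → ℝ}

theorem tendsto_zero_of_sq {u : ℕ → ℝ≥0∞} (h : Tendsto (fun n => u n ^ 2) atTop (𝓝 0)) :
    Tendsto u atTop (𝓝 0) := by
  have := (ENNReal.continuous_rpow_const (y := 1 / 2)).tendsto 0 |>.comp h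
  simp only [one_div] at this
  rw [ENNReal.zero_rpow_of_pos (by norm_num)] at this
  refine this.congr fun n => ?_
  rw [Function.comp_apply, ← ENNReal.rpow_natCast, ← ENNReal.rpow_mul]; simp

theorem tendsto_sq_zero {u : ℕ → ℝ≥0∞} (h : Tendsto u atTop (𝓝 0)) :
    Tendsto (fun n => u n ^ 2) atTop (𝓝 0) := by
  have := (ENNReal.continuous_pow 2).tendsto 0 |>.comp h
  simpa [Function.comp_def] using this

/-- Rewriting iterated integrals of squares as `L²` norms on the product space makes the triangle
inequality available. -/
theorem hasItoIntegral_iff (hH : AEMeasurable (joint H) (prodT P T)) :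
    HasItoIntegral P H T ξ ↔ ∃ h : ℕ → SimpleProc,
      Tendsto (fun n => eLpNorm (joint (h n).value - joint H) 2 (prodT P T)) atTop (𝓝 0) ∧
      Tendsto (fun n => eLpNorm ((h n).integral T - ξ) 2 P) atTop (𝓝 0) := by
  have e1 : ∀ h : SimpleProc, ∫⁻ ω, ∫⁻ s in Set.Iic T,
      ENNReal.ofReal ((h.value s ω - H s ω) ^ 2) ∂dt ∂P =
      eLpNorm (joint h.value - joint H) 2 (prodT P T) ^ 2 := fun h => by
    rw [eLpNorm_two_sq, lintegral_prod]
    · rfl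
    · exact ((h.measurable_joint_value.aemeasurable.sub hH).pow_const 2).ennreal_ofReal
  have e2 : ∀ h : SimpleProc, ∫⁻ ω, ENNReal.ofReal ((h.integral T ω - ξ ω) ^ 2) ∂P =
      eLpNorm (h.integral T - ξ) 2 P ^ 2 := fun h => by
    rw [eLpNorm_two_sq]; rfl
  unfold HasItoIntegral
  simp_rw [e1, e2]
  exact exists_congr fun h => and_congr ⟨tendsto_zero_of_sq, tendsto_sq_zero⟩
    ⟨tendsto_zero_of_sq, tendsto_sq_zero⟩

theorem HasItoIntegral.congr (h : HasItoIntegral P H T ξ)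
    (hH : joint H =ᵐ[prodT P T] joint H') (hξ : ξ =ᵐ[P] ξ') : HasItoIntegral P H' T ξ' := by
  obtain ⟨k, h1, h2⟩ := h
  refine ⟨k, h1.congr fun n => ?_, h2.congr fun n => ?_⟩
  · refine lintegral_congr_ae ?_
    filter_upwards [Measure.ae_ae_of_ae_prod hH] with ω hω
    refine lintegral_congr_ae ?_
    filter_upwards [hω] with s hs
    simp only [joint] at hs
    rw [hs]
  · refine lintegral_congr_ae ?_
    filter_upwards [hξ] with ω hω
    rw [hω]

theorem memLp_of_tendsto {α : Type*} {m : MeasurableSpace α} {μ : Measure α} {f : ℕ → α → ℝ}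
    {g : α → ℝ} (hf : ∀ n, MemLp (f n) 2 μ) (hg : AEStronglyMeasurable g μ)
    (h : Tendsto (fun n => eLpNorm (f n - g) 2 μ) atTop (𝓝 0)) : MemLp g 2 μ := by
  obtain ⟨n, hn⟩ := (h.eventually (gt_mem_nhds ENNReal.zero_lt_top)).exists
  have : MemLp (f n - (f n - g)) 2 μ := (hf n).sub ⟨(hf n).1.sub hg, hn⟩
  simpa using this

/-- This is the triangle inequality on both sides. It carries the isometry bounds from simple
processes to their limits. -/
theorem tendsto_eLpNorm_of_tendsto {α : Type*} {m : MeasurableSpace α} {μ : Measure α}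
    {f : ℕ → α → ℝ} {g : α → ℝ} (hf : ∀ n, MemLp (f n) 2 μ) (hg : AEStronglyMeasurable g μ)
    (h : Tendsto (fun n => eLpNorm (f n - g) 2 μ) atTop (𝓝 0)) :
    Tendsto (fun n => eLpNorm (f n) 2 μ) atTop (𝓝 (eLpNorm g 2 μ)) := by
  have hg2 := memLp_of_tendsto hf hg h
  refine tendsto_of_tendsto_of_tendsto_of_le_of_le
    (g := fun n => eLpNorm g 2 μ - eLpNorm (f n - g) 2 μ)
    (h := fun n => eLpNorm g 2 μ + eLpNorm (f n - g) 2 μ) ?_ ?_ (fun n => ?_) fun n => ?_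
  · have := ENNReal.Tendsto.sub (tendsto_const_nhds (x := eLpNorm g 2 μ) (f := atTop)) h
      (.inl hg2.2.ne)
    simpa using this
  · simpa using (tendsto_const_nhds (x := eLpNorm g 2 μ)).add h
  · change eLpNorm g 2 μ - eLpNorm (f n - g) 2 μ ≤ eLpNorm (f n) 2 μ
    refine (tsub_le_iff_right (α := ℝ≥0∞)).2 ?_
    calc eLpNorm g 2 μ = eLpNorm (f n - (f n - g)) 2 μ := by simp
      _ ≤ eLpNorm (f n) 2 μ + eLpNorm (f n - g) 2 μ := eLpNorm_sub_le (hf n).1 ((hf n).1.sub hg) one_le_two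
  · calc eLpNorm (f n) 2 μ = eLpNorm (g + (f n - g)) 2 μ := by simp
      _ ≤ eLpNorm g 2 μ + eLpNorm (f n - g) 2 μ := eLpNorm_add_le hg ((hf n).1.sub hg) one_le_two

theorem SimpleProc.memLp_value [IsProbabilityMeasure P] (h : SimpleProc) (T : ℝ≥0) :
    MemLp (joint h.value) 2 (prodT P T) := by
  choose c hc using h.bdd
  refine MemLp.of_bound h.measurable_joint_value.aestronglyMeasurable
    (∑ i ∈ Finset.range h.n, |c i|) (ae_of_all _ fun p => ?_)
  change |∑ i ∈ Finset.range h.n,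
    (Set.Ioc (h.t i) (h.t (i + 1))).indicator (fun _ => h.ξ i p.1) p.2| ≤ _
  refine (Finset.abs_sum_le_sum_abs _ _).trans (Finset.sum_le_sum fun i _ => ?_)
  by_cases hs : p.2 ∈ Set.Ioc (h.t i) (h.t (i + 1))
  · rw [Set.indicator_of_mem hs]; exact (hc i _).trans (le_abs_self _)
  · rw [Set.indicator_of_notMem hs]; simp

theorem HasItoIntegral.memLp_integrand (hP : P ∈ priors lo hi)
    (hH : AEMeasurable (joint H) (prodT P T)) (h : HasItoIntegral P H T ξ) :
    MemLp (joint H) 2 (prodT P T) := by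
  have := hP.1
  obtain ⟨k, h1, -⟩ := (hasItoIntegral_iff hH).1 h
  exact memLp_of_tendsto (fun n => (k n).memLp_value T) hH.aestronglyMeasurable h1

theorem HasItoIntegral.memLp (hP : P ∈ priors lo hi)
    (hH : AEMeasurable (joint H) (prodT P T)) (hξ : AEStronglyMeasurable ξ P)
    (h : HasItoIntegral P H T ξ) : MemLp ξ 2 P := by
  obtain ⟨k, -, h2⟩ := (hasItoIntegral_iff hH).1 h
  exact memLp_of_tendsto (fun n => (k n).memLp_integral hP T) hξ h2

theorem HasItoIntegral.eLpNorm_le (hP : P ∈ priors lo hi) (h0 : 0 ≤ hi)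
    (hH : AEMeasurable (joint H) (prodT P T)) (hξ : AEStronglyMeasurable ξ P)
    (h : HasItoIntegral P H T ξ) :
    eLpNorm ξ 2 P ≤ ENNReal.ofReal hi * eLpNorm (joint H) 2 (prodT P T) := by
  have := hP.1
  obtain ⟨k, h1, h2⟩ := (hasItoIntegral_iff hH).1 h
  refine le_of_tendsto_of_tendsto'
    (tendsto_eLpNorm_of_tendsto (fun n => (k n).memLp_integral hP T) hξ h2)
    (ENNReal.Tendsto.const_mul (tendsto_eLpNorm_of_tendsto (fun n => (k n).memLp_value T)
      hH.aestronglyMeasurable h1) (.inr ENNReal.ofReal_ne_top))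
    fun n => (k n).eLpNorm_integral_le hP h0 T

theorem HasItoIntegral.le_eLpNorm (hP : P ∈ priors lo hi) (h0 : 0 ≤ lo)
    (hH : AEMeasurable (joint H) (prodT P T)) (hξ : AEStronglyMeasurable ξ P)
    (h : HasItoIntegral P H T ξ) :
    ENNReal.ofReal lo * eLpNorm (joint H) 2 (prodT P T) ≤ eLpNorm ξ 2 P := by
  have := hP.1
  obtain ⟨k, h1, h2⟩ := (hasItoIntegral_iff hH).1 h
  refine le_of_tendsto_of_tendsto'
    (ENNReal.Tendsto.const_mul (tendsto_eLpNorm_of_tendsto (fun n => (k n).memLp_value T)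
      hH.aestronglyMeasurable h1) (.inr ENNReal.ofReal_ne_top))
    (tendsto_eLpNorm_of_tendsto (fun n => (k n).memLp_integral hP T) hξ h2)
    fun n => (k n).le_eLpNorm_integral hP h0 T

theorem HasItoIntegral.sub (hP : P ∈ priors lo hi)
    (hH : AEMeasurable (joint H) (prodT P T)) (hξ : AEStronglyMeasurable ξ P)
    (hH' : AEMeasurable (joint H') (prodT P T)) (hξ' : AEStronglyMeasurable ξ' P)
    (h : HasItoIntegral P H T ξ) (h' : HasItoIntegral P H' T ξ') :
    HasItoIntegral P (fun s ω => H s ω - H' s ω) T (fun ω => ξ ω - ξ' ω) := by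
  have := hP.1
  obtain ⟨k, h1, h2⟩ := (hasItoIntegral_iff hH).1 h
  obtain ⟨k', h1', h2'⟩ := (hasItoIntegral_iff hH').1 h'
  choose l hl hl' using fun n => (k n).exists_sub (k' n)
  rw [hasItoIntegral_iff (H := fun s ω => H s ω - H' s ω) (hH.sub hH')]
  refine ⟨l, ?_, ?_⟩
  · refine tendsto_of_tendsto_of_tendsto_of_le_of_le tendsto_const_nhds
      (by simpa using h1.add h1') (fun _ => zero_le) fun n => ?_
    have e : joint (l n).value - joint (fun s ω => H s ω - H' s ω) =
        (joint (k n).value - joint H) - (joint (k' n).value - joint H') := by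
      ext p; simp only [joint, Pi.sub_apply, hl]; ring
    rw [e]
    exact eLpNorm_sub_le
      ((k n).measurable_joint_value.aemeasurable.sub hH).aestronglyMeasurable
      ((k' n).measurable_joint_value.aemeasurable.sub hH').aestronglyMeasurable one_le_two
  · refine tendsto_of_tendsto_of_tendsto_of_le_of_le tendsto_const_nhds
      (by simpa using h2.add h2') (fun _ => zero_le) fun n => ?_
    have e : (l n).integral T - (fun ω => ξ ω - ξ' ω) =
        ((k n).integral T - ξ) - ((k' n).integral T - ξ') := by
      ext p; simp only [Pi.sub_apply, hl']; ring
    rw [e]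
    exact eLpNorm_sub_le (((k n).memLp_integral hP T).1.sub hξ)
      (((k' n).memLp_integral hP T).1.sub hξ') one_le_two

theorem prodT_mono {s T : ℝ≥0} (h : s ≤ T) : prodT P s ≤ prodT P T :=
  Measure.prod_mono le_rfl (Measure.restrict_mono (Set.Iic_subset_Iic.2 h) le_rfl)

/-- The Itô integral process is a martingale: increments are orthogonal to the past. -/
theorem HasItoIntegral.integral_mul_sub (hP : P ∈ priors lo hi) (h0 : 0 ≤ hi) {s : ℝ≥0}
    (hsT : s ≤ T) (hH : AEMeasurable (joint H) (prodT P T))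
    (hξ : AEStronglyMeasurable ξ P) (hξ' : AEStronglyMeasurable ξ' P)
    (h : HasItoIntegral P H T ξ) (h' : HasItoIntegral P H s ξ')
    {Z : Path → ℝ} (hZ : Measurable[Filt s] Z) (hZ2 : MemLp Z 2 P) :
    ∫ ω, Z ω * (ξ ω - ξ' ω) ∂P = 0 := by
  have := hP.1
  have hHs : AEMeasurable (joint H) (prodT P s) := hH.mono_measure (prodT_mono hsT)
  obtain ⟨k, h1, h2⟩ := (hasItoIntegral_iff hH).1 h
  obtain ⟨k', h1', h2'⟩ := (hasItoIntegral_iff hHs).1 h'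
  -- The two integrals come with unrelated approximating sequences. The isometry bound on `[0, s]`
  -- shows that the sequence chosen for `[0, T]` also has integrals up to `s` that converge to `ξ'`.
  have hks : ∀ n, eLpNorm ((k n).integral s - ξ') 2 P ≤ ENNReal.ofReal hi *
      (eLpNorm (joint (k n).value - joint H) 2 (prodT P T) +
        eLpNorm (joint (k' n).value - joint H) 2 (prodT P s)) +
      eLpNorm ((k' n).integral s - ξ') 2 P := fun n => by
    have e : (k n).integral s - ξ' =
      ((k n).integral s - (k' n).integral s) + ((k' n).integral s - ξ') := by simp
    rw [e]
    refine (eLpNorm_add_le (((k n).memLp_integral hP s).1.sub ((k' n).memLp_integral hP s).1)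
      (((k' n).memLp_integral hP s).1.sub hξ') one_le_two).trans ?_
    gcongr
    refine ((k n).eLpNorm_integral_sub_le hP h0 (k' n) s).trans ?_
    gcongr
    have e : joint (k n).value - joint (k' n).value =
      (joint (k n).value - joint H) - (joint (k' n).value - joint H) := by simp
    rw [e]
    refine (eLpNorm_sub_le
      ((k n).measurable_joint_value.aemeasurable.sub hHs).aestronglyMeasurable
      ((k' n).measurable_joint_value.aemeasurable.sub hHs).aestronglyMeasurable one_le_two).trans ?_
    gcongr
    exact prodT_mono hsT
  have hlim : Tendsto (fun n => eLpNorm Z 2 P * (eLpNorm ((k n).integral T - ξ) 2 P +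
      (ENNReal.ofReal hi * (eLpNorm (joint (k n).value - joint H) 2 (prodT P T) +
        eLpNorm (joint (k' n).value - joint H) 2 (prodT P s)) +
      eLpNorm ((k' n).integral s - ξ') 2 P))) atTop (𝓝 0) := by
    have := ENNReal.Tendsto.const_mul (a := ENNReal.ofReal hi) (h1.add h1')
      (.inr ENNReal.ofReal_ne_top)
    have := ENNReal.Tendsto.const_mul (a := eLpNorm Z 2 P) (h2.add (this.add h2'))
      (.inr hZ2.2.ne)
    simpa using this
  have hξL := h.memLp hP hH hξ
  have hξL' := h'.memLp hP hHs hξ'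
  -- Subtracting the increment of the simple integral changes nothing, since that increment is
  -- orthogonal to `Z`. The remainder is estimated by Cauchy–Schwarz.
  have hbound : ∀ n, ‖∫ ω, Z ω * (ξ ω - ξ' ω) ∂P‖ₑ ≤ eLpNorm Z 2 P *
      (eLpNorm ((k n).integral T - ξ) 2 P +
      (ENNReal.ofReal hi * (eLpNorm (joint (k n).value - joint H) 2 (prodT P T) +
        eLpNorm (joint (k' n).value - joint H) 2 (prodT P s)) +
      eLpNorm ((k' n).integral s - ξ') 2 P)) := fun n => by
    have hz := integral_mul_stepInt_sub (n := (k n).n) hP (k n).mono (k n).meas (k n).bdd hsT hZ hZ2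
    have hkT := (k n).memLp_integral hP T
    have hks' := (k n).memLp_integral hP s
    have hd := (hkT.sub hξL).sub (hks'.sub hξL')
    have e : ∫ ω, Z ω * (ξ ω - ξ' ω) ∂P = -∫ ω, (Z • (((k n).integral T - ξ) -
        ((k n).integral s - ξ'))) ω ∂P := by
      have i1 : Integrable (fun ω => Z ω * ((k n).integral T ω - (k n).integral s ω)) P :=
        hZ2.integrable_mul (hkT.sub hks')
      have i2 : Integrable (fun ω => Z ω * (ξ ω - ξ' ω)) P := hZ2.integrable_mul (hξL.sub hξL')
      have e2 : (fun ω => (Z • (((k n).integral T - ξ) - ((k n).integral s - ξ'))) ω) =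
          fun ω => Z ω * ((k n).integral T ω - (k n).integral s ω) - Z ω * (ξ ω - ξ' ω) := by
        ext ω; simp only [Pi.smul_apply', Pi.sub_apply, smul_eq_mul]; ring
      rw [e2, integral_sub i1 i2]
      have hz' : ∫ ω, Z ω * ((k n).integral T ω - (k n).integral s ω) ∂P = 0 := hz
      rw [hz']; ring
    rw [e, enorm_neg]
    refine (enorm_integral_le_lintegral_enorm _).trans ?_
    rw [← eLpNorm_one_eq_lintegral_enorm]
    refine (eLpNorm_smul_le_mul_eLpNorm (p := 2) (q := 2) hd.1 hZ2.1).trans ?_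
    gcongr
    refine (eLpNorm_sub_le (hkT.sub hξL).1 (hks'.sub hξL').1 one_le_two).trans ?_
    gcongr
    exact hks n
  have := ge_of_tendsto' hlim hbound
  simpa using this

theorem hasItoIntegral_zero_time (H : ℝ≥0 → Path → ℝ) :
    HasItoIntegral P H 0 (fun _ => 0) := by
  have hd : dt.restrict (Set.Iic (0 : ℝ≥0)) = 0 := by
    rw [Measure.restrict_eq_zero, dt_Iic]; simp
  refine ⟨fun _ => ⟨0, fun _ => 0, monotone_const, fun _ _ => 0, fun _ => measurable_const,
    fun _ => ⟨0, by simp⟩⟩, ?_, ?_⟩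
  · simp [hd]
  · simp [SimpleProc.integral]

theorem HasItoIntegral.integral_eq_zero (hP : P ∈ priors lo hi) (h0 : 0 ≤ hi)
    (hH : AEMeasurable (joint H) (prodT P T)) (hξ : AEStronglyMeasurable ξ P)
    (h : HasItoIntegral P H T ξ) : ∫ ω, ξ ω ∂P = 0 := by
  have := hP.1
  have := h.integral_mul_sub hP h0 zero_le hH hξ aestronglyMeasurable_const
    (hasItoIntegral_zero_time H) (Z := fun _ => 1) measurable_const (memLp_const 1)
  simpa using this

/-- The Itô integral is closed under `L²` limits. -/
theorem hasItoIntegral_of_tendsto (hP : P ∈ priors lo hi) {Hn : ℕ → ℝ≥0 → Path → ℝ}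
    {ξn : ℕ → Path → ℝ}
    (hHn : ∀ n, AEMeasurable (joint (Hn n)) (prodT P T)) (hξn : ∀ n, AEStronglyMeasurable (ξn n) P)
    (hH : AEMeasurable (joint H) (prodT P T)) (hξ : AEStronglyMeasurable ξ P)
    (h : ∀ᶠ n in atTop, HasItoIntegral P (Hn n) T (ξn n))
    (h1 : Tendsto (fun n => eLpNorm (joint (Hn n) - joint H) 2 (prodT P T)) atTop (𝓝 0))
    (h2 : Tendsto (fun n => eLpNorm (ξn n - ξ) 2 P) atTop (𝓝 0)) :
    HasItoIntegral P H T ξ := by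
  have := hP.1
  -- Diagonal choice: the `n`-th simple process approximates the `n`-th pair up to `1 / (n + 1)`.
  -- Indices at which no integral is assumed get the zero process.
  have hex : ∀ n, ∃ k : SimpleProc, HasItoIntegral P (Hn n) T (ξn n) →
      eLpNorm (joint k.value - joint (Hn n)) 2 (prodT P T) ≤ ((n : ℝ≥0∞) + 1)⁻¹ ∧
      eLpNorm (k.integral T - ξn n) 2 P ≤ ((n : ℝ≥0∞) + 1)⁻¹ := fun n => by
    by_cases hn : HasItoIntegral P (Hn n) T (ξn n)
    · obtain ⟨k, h1, h2⟩ := (hasItoIntegral_iff (hHn n)).1 hn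
      have hpos : (0 : ℝ≥0∞) < ((n : ℝ≥0∞) + 1)⁻¹ := by simp
      obtain ⟨m, hm, hm'⟩ := ((h1.eventually (ge_mem_nhds hpos)).and
        (h2.eventually (ge_mem_nhds hpos))).exists
      exact ⟨k m, fun _ => ⟨hm, hm'⟩⟩
    · exact ⟨⟨0, fun _ => 0, monotone_const, fun _ _ => 0, fun _ => measurable_const,
        fun _ => ⟨0, by simp⟩⟩, fun h => absurd h hn⟩
  choose k hk using hex
  have hinv : Tendsto (fun n : ℕ => ((n : ℝ≥0∞) + 1)⁻¹) atTop (𝓝 0) := by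
    have := (tendsto_add_atTop_iff_nat 1).2 ENNReal.tendsto_inv_nat_nhds_zero
    simpa using this
  rw [hasItoIntegral_iff hH]
  refine ⟨k, ?_, ?_⟩
  · refine tendsto_of_tendsto_of_tendsto_of_le_of_le' tendsto_const_nhds
      (by simpa using hinv.add h1) (.of_forall fun _ => zero_le) ?_
    filter_upwards [h] with n hn
    have e : joint (k n).value - joint H =
      (joint (k n).value - joint (Hn n)) + (joint (Hn n) - joint H) := by simp
    rw [e]
    refine (eLpNorm_add_le
      ((k n).measurable_joint_value.aemeasurable.sub (hHn n)).aestronglyMeasurable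
      ((hHn n).sub hH).aestronglyMeasurable one_le_two).trans ?_
    gcongr
    exact (hk n hn).1
  · refine tendsto_of_tendsto_of_tendsto_of_le_of_le' tendsto_const_nhds
      (by simpa using hinv.add h2) (.of_forall fun _ => zero_le) ?_
    filter_upwards [h] with n hn
    have e : (k n).integral T - ξ =
      ((k n).integral T - ξn n) + (ξn n - ξ) := by simp
    rw [e]
    refine (eLpNorm_add_le (((k n).memLp_integral hP T).1.sub (hξn n))
      ((hξn n).sub hξ) one_le_two).trans ?_
    gcongr
    exact (hk n hn).2

theorem stepVal_sub (n : ℕ) (t : ℕ → ℝ≥0) (ξ ζ : ℕ → Path → ℝ) :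
    joint (stepVal n t fun i ω => ξ i ω - ζ i ω) = joint (stepVal n t ξ) - joint (stepVal n t ζ) := by
  ext p
  simp only [joint, stepVal, Pi.sub_apply, ← Finset.sum_sub_distrib]
  refine Finset.sum_congr rfl fun i _ => ?_
  by_cases h : p.2 ∈ Set.Ioc (t i) (t (i + 1)) <;> simp [Set.indicator, h]

theorem stepInt_sub (n : ℕ) (t : ℕ → ℝ≥0) (ξ ζ : ℕ → Path → ℝ) (T : ℝ≥0) :
    (stepInt n t (fun i ω => ξ i ω - ζ i ω) T) = stepInt n t ξ T - stepInt n t ζ T := by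
  ext p
  simp only [stepInt, Pi.sub_apply, ← Finset.sum_sub_distrib, sub_mul]

/-- Truncation to `[-N, N]`. -/
def clip (N : ℕ) (x : ℝ) : ℝ := max (-N) (min N x)

theorem measurable_clip (N : ℕ) : Measurable (clip N) :=
  measurable_const.max (measurable_const.min measurable_id)

theorem abs_clip_le (N : ℕ) (x : ℝ) : |clip N x| ≤ N := by
  have : (0 : ℝ) ≤ N := N.cast_nonneg
  rw [abs_le]; exact ⟨le_max_left _ _, max_le (by linarith) (min_le_left _ _)⟩

theorem abs_clip_sub_le (N : ℕ) (x : ℝ) : |clip N x - x| ≤ |x| := by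
  have : (0 : ℝ) ≤ N := N.cast_nonneg
  unfold clip
  rcases le_total (N : ℝ) x with h | h
  · rw [min_eq_left h, max_eq_right (by linarith), abs_le, abs_of_nonneg (by linarith)]
    constructor <;> linarith
  · rw [min_eq_right h]
    rcases le_total (-(N : ℝ)) x with h' | h'
    · rw [max_eq_right h']; simp
    · rw [max_eq_left h', abs_of_nonpos (by linarith : x ≤ 0), abs_le]
      constructor <;> linarith

theorem clip_of_abs_le {N : ℕ} {x : ℝ} (h : |x| ≤ N) : clip N x = x := by
  obtain ⟨h1, h2⟩ := abs_le.1 h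
  rw [clip, min_eq_right h2, max_eq_right h1]

/-- Square-integrable step processes have the obvious Itô integral. -/
theorem hasItoIntegral_step (hP : P ∈ priors lo hi) (h0 : 0 ≤ hi) {n : ℕ} {t : ℕ → ℝ≥0}
    (ht : Monotone t) {ζ : ℕ → Path → ℝ} (hm : ∀ i, Measurable[Filt (t i)] (ζ i))
    (h2 : ∀ i, MemLp (ζ i) 2 P) (T : ℝ≥0) :
    HasItoIntegral P (stepVal n t ζ) T (stepInt n t ζ T) := by
  have := hP.1
  have hm' : ∀ i, Measurable (ζ i) := fun i => (hm i).mono (Filt.le _) le_rfl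
  rw [hasItoIntegral_iff (measurable_joint_stepVal hm').aemeasurable]
  -- Simple processes need bounded coefficients, so the coefficients are clipped to `[-N, N]`.
  -- Dominated convergence with dominating function `ζ i ^ 2` then removes the clipping.
  let c : ℕ → ℕ → Path → ℝ := fun N i ω => clip N (ζ i ω)
  have hcm : ∀ N i, Measurable[Filt (t i)] (c N i) := fun N i => (measurable_clip N).comp (hm i)
  have hcb : ∀ N i ω, |c N i ω| ≤ N := fun N i ω => abs_clip_le N _
  have hc2 : ∀ N i, MemLp (c N i) 2 P := fun N i =>
    MemLp.of_bound ((hcm N i).mono (Filt.le _) le_rfl).aestronglyMeasurable N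
      (ae_of_all _ (hcb N i))
  let k : ℕ → SimpleProc := fun N => ⟨n, t, ht, c N, hcm N, fun i => ⟨N, hcb N i⟩⟩
  have hv : Tendsto (fun N => eLpNorm (joint (stepVal n t (c N)) - joint (stepVal n t ζ)) 2
      (prodT P T)) atTop (𝓝 0) := by
    refine tendsto_zero_of_sq ?_
    have e : ∀ N, eLpNorm (joint (stepVal n t (c N)) - joint (stepVal n t ζ)) 2 (prodT P T) ^ 2 =
        ∑ i ∈ Finset.range n, ENNReal.ofReal ((min (t (i + 1)) T : ℝ≥0) - (min (t i) T : ℝ≥0)) *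
          ∫⁻ ω, ENNReal.ofReal ((c N i ω - ζ i ω) ^ 2) ∂P := fun N => by
      rw [← stepVal_sub, eLpNorm_two_sq, lintegral_stepVal_sq ht]
      exact fun i => ((hcm N i).mono (Filt.le _) le_rfl).sub (hm' i)
    simp_rw [e]
    rw [← Finset.sum_const_zero (s := Finset.range n)]
    refine tendsto_finsetSum _ fun i _ => ?_
    have hz : Tendsto (fun N => ∫⁻ ω, ENNReal.ofReal ((c N i ω - ζ i ω) ^ 2) ∂P) atTop (𝓝 0) := by
      have hd := tendsto_lintegral_of_dominated_convergence (μ := P)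
        (F := fun N ω => ENNReal.ofReal ((c N i ω - ζ i ω) ^ 2)) (f := fun _ => 0)
        (fun ω => ENNReal.ofReal (ζ i ω ^ 2))
        (fun N => ((((hcm N i).mono (Filt.le _) le_rfl).sub (hm' i)).pow_const 2).ennreal_ofReal)
        (fun N => ae_of_all _ fun ω => ENNReal.ofReal_le_ofReal
          (sq_le_sq.2 (abs_clip_sub_le N _)))
        (by rw [← eLpNorm_two_sq]; exact ENNReal.pow_ne_top (h2 i).2.ne)
        (ae_of_all _ fun ω => by
          refine tendsto_const_nhds.congr' ?_
          obtain ⟨M, hM⟩ := exists_nat_ge |ζ i ω|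
          filter_upwards [eventually_ge_atTop M] with N hN
          have : clip N (ζ i ω) = ζ i ω := clip_of_abs_le (hM.trans (by exact_mod_cast hN))
          simp [c, this])
      simpa using hd
    simpa using ENNReal.Tendsto.const_mul hz (.inr ENNReal.ofReal_ne_top)
  refine ⟨k, hv, ?_⟩
  have hlim := ENNReal.Tendsto.const_mul (a := ENNReal.ofReal hi) hv (.inr ENNReal.ofReal_ne_top)
  rw [mul_zero] at hlim
  refine tendsto_of_tendsto_of_tendsto_of_le_of_le tendsto_const_nhds hlim
    (fun _ => zero_le) fun N => ?_
  have := eLpNorm_stepInt_le (n := n) hP h0 ht (fun i => (hcm N i).sub (hm i))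
    (fun i => (hc2 N i).sub (h2 i)) T
  rwa [show (stepInt n t (fun i => c N i - ζ i) T) = stepInt n t (c N) T - stepInt n t ζ T from
    stepInt_sub n t (c N) ζ T, show joint (stepVal n t fun i => c N i - ζ i) = _ from
    stepVal_sub n t (c N) ζ] at this

end Ito

/-! ### Integration by parts on the time axis -/

theorem integral_Iic_eq_indicator {T s : ℝ≥0} (h : s ≤ T) (f : ℝ≥0 → ℝ) :
    ∫ r in Set.Iic s, f r ∂dt = ∫ r in Set.Iic T, (Set.Iic s).indicator f r ∂dt := by
  rw [integral_indicator measurableSet_Iic, Measure.restrict_restrict measurableSet_Iic,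
    Set.inter_eq_left.2 (Set.Iic_subset_Iic.2 h)]

/-- Integration by parts is Fubini on the square `[0, T]²` cut along its diagonal, which is a null
set. -/
theorem integral_mul_integral_Iic {T : ℝ≥0} {f g : ℝ≥0 → ℝ}
    (hf : IntegrableOn f (Set.Iic T) dt) (hg : IntegrableOn g (Set.Iic T) dt) :
    (∫ s in Set.Iic T, f s ∂dt) * ∫ s in Set.Iic T, g s ∂dt =
      ∫ s in Set.Iic T, f s * (∫ r in Set.Iic s, g r ∂dt) ∂dt +
      ∫ s in Set.Iic T, g s * (∫ r in Set.Iic s, f r ∂dt) ∂dt := by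
  set ν := dt.restrict (Set.Iic T) with hν
  have hfg : Integrable (fun p : ℝ≥0 × ℝ≥0 => f p.1 * g p.2) (ν.prod ν) := hf.mul_prod hg
  have hS : MeasurableSet {p : ℝ≥0 × ℝ≥0 | p.2 ≤ p.1} := measurableSet_le measurable_snd measurable_fst
  rw [← integral_prod_mul, ← integral_add_compl hS hfg, ← integral_indicator hS,
    ← integral_indicator hS.compl, integral_prod _ (hfg.indicator hS),
    integral_prod_symm _ (hfg.indicator hS.compl)]
  congr 1
  · refine setIntegral_congr_fun measurableSet_Iic fun s hs => ?_
    rw [integral_Iic_eq_indicator hs g, ← integral_const_mul]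
    refine integral_congr_ae (ae_of_all _ fun r => ?_)
    by_cases h : r ≤ s <;> simp [Set.indicator, h]
  · refine setIntegral_congr_fun measurableSet_Iic fun s hs => ?_
    rw [integral_Iic_eq_indicator hs f, ← integral_const_mul]
    have hne : ∀ᵐ r ∂ν, r ≠ s := by
      refine ae_restrict_of_ae ?_
      rw [ae_iff]; simp
    refine integral_congr_ae ?_
    filter_upwards [hne] with r hr
    by_cases h : r ≤ s
    · have h' : ¬ s ≤ r := fun h'' => hr (le_antisymm h h'')
      simp [Set.indicator, h, lt_of_le_of_ne h hr, mul_comm]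
    · simp [Set.indicator, h, (not_le.1 h).le]

instance : IsFiniteMeasureOnCompacts dt := by
  refine ⟨fun K hK => ?_⟩
  obtain ⟨b, hb⟩ := hK.bddAbove
  refine (measure_mono (show K ⊆ Set.Iic b from fun x hx => hb hx)).trans_lt ?_
  rw [dt_Iic]; exact ENNReal.ofReal_lt_top

theorem integrableOn_of_continuous {f : ℝ≥0 → ℝ} (hf : Continuous f) (T : ℝ≥0) :
    IntegrableOn f (Set.Iic T) dt := by
  have hc : IsCompact (Set.Iic T) := by
    rw [show Set.Iic T = Set.Icc 0 T by ext; simp]; exact isCompact_Icc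
  exact hf.continuousOn.integrableOn_compact' hc measurableSet_Iic (μ := dt) |>.congr_fun
    (fun _ _ => rfl) measurableSet_Iic

theorem setIntegral_dt (f : ℝ → ℝ) (T : ℝ≥0) :
    ∫ s in Set.Iic T, f s ∂dt = ∫ s in (0 : ℝ)..T, f s := by
  rw [intervalIntegral.integral_of_le T.coe_nonneg, ← integral_Icc_eq_integral_Ioc]
  have : Set.Icc (0 : ℝ) T = Set.Iic (T : ℝ) ∩ Set.Ici 0 := by ext; simp [and_comm]
  rw [this, ← Measure.restrict_restrict measurableSet_Iic, ← map_dt,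
    measurableEmbedding_coe_nnreal.setIntegral_map]
  rfl

theorem integral_exp_Iic (ρ : ℝ) (T : ℝ≥0) :
    ∫ s in Set.Iic T, ρ * Real.exp (-ρ * s) ∂dt = 1 - Real.exp (-ρ * T) := by
  rw [setIntegral_dt (fun s => ρ * Real.exp (-ρ * s))]
  have : ∀ x : ℝ, HasDerivAt (fun s => -Real.exp (-ρ * s)) (ρ * Real.exp (-ρ * x)) x := by
    intro x
    have h := (((hasDerivAt_id x).const_mul (-ρ)).exp).neg
    exact h.congr_deriv (by simp; ring)
  rw [intervalIntegral.integral_eq_sub_of_hasDerivAt (fun x _ => this x)]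
  · simp; ring
  · exact (by fun_prop : Continuous fun s : ℝ => ρ * Real.exp (-ρ * s)).intervalIntegrable _ _

/-- Discounting of an indefinite integral. -/
theorem discount_integral (ρ : ℝ) {T : ℝ≥0} {k : ℝ≥0 → ℝ} (hk : IntegrableOn k (Set.Iic T) dt) :
    Real.exp (-ρ * T) * ∫ s in Set.Iic T, k s ∂dt +
      ∫ s in Set.Iic T, (ρ * Real.exp (-ρ * s)) * (∫ r in Set.Iic s, k r ∂dt) ∂dt =
      ∫ s in Set.Iic T, Real.exp (-ρ * s) * k s ∂dt := by
  have hc : Continuous fun s : ℝ≥0 => ρ * Real.exp (-ρ * s) := by fun_prop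
  -- The partner of `k` is `ρ e^{-ρs}`, whose primitive is `1 - e^{-ρs}`.
  have h := integral_mul_integral_Iic (integrableOn_of_continuous hc T) hk
  simp_rw [integral_exp_Iic] at h
  have e : ∀ s : ℝ≥0, k s * (1 - Real.exp (-ρ * s)) = k s - Real.exp (-ρ * s) * k s := fun s => by
    ring
  have hk' : IntegrableOn (fun s : ℝ≥0 => Real.exp (-ρ * s) * k s) (Set.Iic T) dt := by
    have hc : IsCompact (Set.Iic T) := by
      rw [show Set.Iic T = Set.Icc 0 T by ext; simp]; exact isCompact_Icc
    exact hk.continuousOn_mul (by fun_prop) hc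
  simp_rw [e] at h
  rw [integral_sub hk hk'] at h
  linarith

/-! ### Itô processes and their second moments -/

/-- `X` is a square-integrable Itô process `dX = β dt + H dB`, `X_0 = x`, under the prior `P`. -/
structure ItoProc (P : Measure Path) (x : ℝ) (X β H : ℝ≥0 → Path → ℝ) : Prop where
  progX : IsProgressive Filt X
  progβ : IsProgressive Filt β
  progH : IsProgressive Filt H
  sqX : ∀ T, MemLp (joint X) 2 (prodT P T)
  sqβ : ∀ T, MemLp (joint β) 2 (prodT P T)
  ito : ∀ T, HasItoIntegral P H T fun ω => X T ω - x - ∫ s in Set.Iic T, β s ω ∂dt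

/-- The indefinite time integral of a process. -/
noncomputable def primitive (β : ℝ≥0 → Path → ℝ) (T : ℝ≥0) (ω : Path) : ℝ :=
  ∫ s in Set.Iic T, β s ω ∂dt

theorem measurable_joint_primitive {β : ℝ≥0 → Path → ℝ} (hβ : Measurable (joint β)) :
    Measurable (joint (primitive β)) := by
  have e : joint (primitive β) = fun p => ∫ r, (if r ≤ p.2 then β r p.1 else 0) ∂dt := by
    ext p
    simp only [joint, primitive]
    rw [← integral_indicator measurableSet_Iic]
    rfl
  rw [e]
  refine StronglyMeasurable.measurable ?_
  refine StronglyMeasurable.integral_prod_right (f := fun (p : Path × ℝ≥0) r =>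
    if r ≤ p.2 then β r p.1 else 0) (Measurable.stronglyMeasurable ?_)
  refine Measurable.ite (measurableSet_le measurable_snd (measurable_snd.comp measurable_fst))
    (hβ.comp ((measurable_fst.comp measurable_fst).prodMk measurable_snd)) measurable_const

theorem measurable_slice {X : ℝ≥0 → Path → ℝ} (h : Measurable (joint X)) (T : ℝ≥0) :
    Measurable (X T) := h.comp (measurable_id.prodMk measurable_const)

/-- Cauchy–Schwarz in time, for each path. -/
theorem sq_primitive_le {β : ℝ≥0 → Path → ℝ} (hβ : Measurable (joint β)) (T : ℝ≥0) (ω : Path) :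
    ENNReal.ofReal (primitive β T ω ^ 2) ≤
      ENNReal.ofReal T * ∫⁻ s in Set.Iic T, ENNReal.ofReal (β s ω ^ 2) ∂dt := by
  have hm : AEStronglyMeasurable (fun s => β s ω) (dt.restrict (Set.Iic T)) :=
    (hβ.comp (measurable_const.prodMk measurable_id)).aestronglyMeasurable
  have h1 : ‖primitive β T ω‖ₑ ≤ eLpNorm (fun s => β s ω) 1 (dt.restrict (Set.Iic T)) := by
    rw [eLpNorm_one_eq_lintegral_enorm]
    exact enorm_integral_le_lintegral_enorm _
  have h2 := eLpNorm_le_eLpNorm_mul_rpow_measure_univ (p := 1) (q := 2) one_le_two hm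
  have h3 := pow_le_pow_left₀ zero_le (h1.trans h2) 2
  rw [mul_pow, eLpNorm_two_sq, Measure.restrict_apply_univ, dt_Iic, mul_comm] at h3
  have a : ENNReal.ofReal (primitive β T ω ^ 2) = ‖primitive β T ω‖ₑ ^ 2 := by
    rw [Real.enorm_eq_ofReal_abs, ← ENNReal.ofReal_pow (abs_nonneg _), sq_abs]
  have b : (ENNReal.ofReal T ^ (1 / ENNReal.toReal 1 - 1 / ENNReal.toReal 2)) ^ 2 =
      ENNReal.ofReal T := by
    rw [← ENNReal.rpow_natCast, ← ENNReal.rpow_mul]; norm_num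
  rw [b] at h3
  rw [a]
  exact h3

section

variable {lo hi : ℝ} {P : Measure Path} {β : ℝ≥0 → Path → ℝ}

theorem lintegral_prodT {f : Path × ℝ≥0 → ℝ≥0∞} (hf : Measurable f) (T : ℝ≥0) :
    ∫⁻ p, f p ∂prodT P T = ∫⁻ ω, ∫⁻ s in Set.Iic T, f (ω, s) ∂dt ∂P :=
  lintegral_prod _ hf.aemeasurable

theorem measurable_sq_joint (hβ : Measurable (joint β)) :
    Measurable fun p => ENNReal.ofReal (joint β p ^ 2) :=
  (hβ.pow_const 2).ennreal_ofReal

theorem lintegral_sq_primitive_le (hβ : Measurable (joint β)) (T : ℝ≥0) :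
    ∫⁻ ω, ENNReal.ofReal (primitive β T ω ^ 2) ∂P ≤
      ENNReal.ofReal T * ∫⁻ p, ENNReal.ofReal (joint β p ^ 2) ∂prodT P T := by
  rw [lintegral_prodT (measurable_sq_joint hβ)]
  rw [← lintegral_const_mul' _ _ ENNReal.ofReal_ne_top]
  exact lintegral_mono fun ω => sq_primitive_le hβ T ω

theorem memLp_primitive (hβ : Measurable (joint β)) {T : ℝ≥0}
    (h : MemLp (joint β) 2 (prodT P T)) : MemLp (primitive β T) 2 P := by
  refine memLp_two_of_lintegral
    (measurable_slice (measurable_joint_primitive hβ) T).aestronglyMeasurable ?_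
  refine (lintegral_sq_primitive_le hβ T).trans_lt (ENNReal.mul_lt_top ENNReal.ofReal_lt_top ?_)
  rw [← eLpNorm_two_sq]; exact ENNReal.pow_lt_top h.2

theorem memLp_joint_primitive (hβ : Measurable (joint β)) {T : ℝ≥0}
    (h : MemLp (joint β) 2 (prodT P T)) : MemLp (joint (primitive β)) 2 (prodT P T) := by
  refine memLp_two_of_lintegral (measurable_joint_primitive hβ).aestronglyMeasurable ?_
  have hfin : ∫⁻ ω, ∫⁻ s in Set.Iic T, ENNReal.ofReal (joint β (ω, s) ^ 2) ∂dt ∂P < ∞ := by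
    rw [← lintegral_prodT (measurable_sq_joint hβ), ← eLpNorm_two_sq]
    exact ENNReal.pow_lt_top h.2
  rw [lintegral_prodT (measurable_sq_joint (measurable_joint_primitive hβ))]
  calc ∫⁻ ω, ∫⁻ s in Set.Iic T, ENNReal.ofReal (joint (primitive β) (ω, s) ^ 2) ∂dt ∂P
      ≤ ∫⁻ ω, ∫⁻ _ in Set.Iic T, ENNReal.ofReal T *
        ∫⁻ s in Set.Iic T, ENNReal.ofReal (joint β (ω, s) ^ 2) ∂dt ∂dt ∂P := by
        refine lintegral_mono fun ω => setLIntegral_mono measurable_const fun s hs => ?_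
        refine (sq_primitive_le hβ s ω).trans ?_
        have hs' : s ≤ T := hs
        refine mul_le_mul' (ENNReal.ofReal_le_ofReal (by exact_mod_cast hs')) ?_
        exact lintegral_mono_set (Set.Iic_subset_Iic.2 hs')
    _ = ∫⁻ ω, ENNReal.ofReal T * ENNReal.ofReal T *
        ∫⁻ s in Set.Iic T, ENNReal.ofReal (joint β (ω, s) ^ 2) ∂dt ∂P := by
        refine lintegral_congr fun ω => ?_
        rw [setLIntegral_const, dt_Iic]; ring
    _ < ∞ := by
        rw [lintegral_const_mul' _ _ (by finiteness)]
        exact ENNReal.mul_lt_top (by finiteness) hfin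

theorem ae_memLp_slice [SFinite P] {X : ℝ≥0 → Path → ℝ} (hX : Measurable (joint X)) {T : ℝ≥0}
    (h : MemLp (joint X) 2 (prodT P T)) : ∀ᵐ s ∂dt.restrict (Set.Iic T), MemLp (X s) 2 P := by
  have h1 := h.integrable_sq.prod_left_ae
  filter_upwards [h1] with s hs
  rw [memLp_two_iff_integrable_sq (measurable_slice hX s).aestronglyMeasurable]
  exact hs

theorem memLp_comp_fst [IsProbabilityMeasure P] {f : Path → ℝ} (hf : MemLp f 2 P) (T : ℝ≥0) :
    MemLp (fun p : Path × ℝ≥0 => f p.1) 2 (prodT P T) := hf.comp_fst _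

end

namespace ItoProc

variable {lo hi x : ℝ} {P : Measure Path} {X β H : ℝ≥0 → Path → ℝ}

/-- The martingale part of an Itô process. -/
noncomputable def mart (x : ℝ) (X β : ℝ≥0 → Path → ℝ) (T : ℝ≥0) (ω : Path) : ℝ :=
  X T ω - x - primitive β T ω

theorem measX (h : ItoProc P x X β H) : Measurable (joint X) := measurable_joint h.progX
theorem measβ (h : ItoProc P x X β H) : Measurable (joint β) := measurable_joint h.progβ
theorem measH (h : ItoProc P x X β H) : Measurable (joint H) := measurable_joint h.progH

theorem measurable_mart (h : ItoProc P x X β H) : Measurable (joint (mart x X β)) :=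
  (h.measX.sub_const x).sub (measurable_joint_primitive h.measβ)

theorem sqH (h : ItoProc P x X β H) (hP : P ∈ priors lo hi) (T : ℝ≥0) :
    MemLp (joint H) 2 (prodT P T) :=
  (h.ito T).memLp_integrand hP h.measH.aemeasurable

theorem aesm_mart (h : ItoProc P x X β H) (T : ℝ≥0) : AEStronglyMeasurable (mart x X β T) P :=
  (measurable_slice h.measurable_mart T).aestronglyMeasurable

theorem memLp_mart (h : ItoProc P x X β H) (hP : P ∈ priors lo hi) (T : ℝ≥0) :
    MemLp (mart x X β T) 2 P :=
  (h.ito T).memLp hP h.measH.aemeasurable (h.aesm_mart T)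

theorem eq_add (T : ℝ≥0) (ω : Path) : X T ω = x + primitive β T ω + mart x X β T ω := by
  simp [mart]

theorem memLp_X (h : ItoProc P x X β H) (hP : P ∈ priors lo hi) (T : ℝ≥0) :
    MemLp (X T) 2 P := by
  have := hP.1
  have := ((memLp_const x).add (memLp_primitive h.measβ (h.sqβ T))).add (h.memLp_mart hP T)
  exact (memLp_congr_ae (ae_of_all _ fun ω => eq_add T ω)).2 this

theorem integral_mart (h : ItoProc P x X β H) (hP : P ∈ priors lo hi) (h0 : 0 ≤ hi) (T : ℝ≥0) :
    ∫ ω, mart x X β T ω ∂P = 0 :=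
  (h.ito T).integral_eq_zero hP h0 h.measH.aemeasurable (h.aesm_mart T)

theorem integral_mart_sq_le (h : ItoProc P x X β H) (hP : P ∈ priors lo hi) (h0 : 0 ≤ hi)
    (T : ℝ≥0) : ∫ ω, mart x X β T ω ^ 2 ∂P ≤ hi ^ 2 * ∫ p, joint H p ^ 2 ∂prodT P T := by
  have h1 := (h.ito T).eLpNorm_le hP h0 h.measH.aemeasurable (h.aesm_mart T)
  have h2 := pow_le_pow_left₀ zero_le h1 2
  rw [mul_pow, eLpNorm_two_sq_eq_ofReal (h.sqH hP T), ← ENNReal.ofReal_pow h0,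
    ← ENNReal.ofReal_mul (sq_nonneg _)] at h2
  change eLpNorm (mart x X β T) 2 P ^ 2 ≤ _ at h2
  rw [eLpNorm_two_sq_eq_ofReal (h.memLp_mart hP T)] at h2
  exact (ENNReal.ofReal_le_ofReal_iff
    (mul_nonneg (sq_nonneg _) (integral_nonneg fun _ => sq_nonneg _))).1 h2

theorem le_integral_mart_sq (h : ItoProc P x X β H) (hP : P ∈ priors lo hi) (h0 : 0 ≤ lo)
    (T : ℝ≥0) : lo ^ 2 * ∫ p, joint H p ^ 2 ∂prodT P T ≤ ∫ ω, mart x X β T ω ^ 2 ∂P := by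
  have h1 := (h.ito T).le_eLpNorm hP h0 h.measH.aemeasurable (h.aesm_mart T)
  have h2 := pow_le_pow_left₀ zero_le h1 2
  rw [mul_pow, eLpNorm_two_sq_eq_ofReal (h.sqH hP T), ← ENNReal.ofReal_pow h0,
    ← ENNReal.ofReal_mul (sq_nonneg _)] at h2
  change _ ≤ eLpNorm (mart x X β T) 2 P ^ 2 at h2
  rw [eLpNorm_two_sq_eq_ofReal (h.memLp_mart hP T)] at h2
  exact (ENNReal.ofReal_le_ofReal_iff (integral_nonneg fun _ => sq_nonneg _)).1 h2

/-- First moment. -/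
theorem integral_X (h : ItoProc P x X β H) (hP : P ∈ priors lo hi) (h0 : 0 ≤ hi) (T : ℝ≥0) :
    ∫ ω, X T ω ∂P = x + ∫ p, joint β p ∂prodT P T := by
  have := hP.1
  have hi1 : Integrable (primitive β T) P :=
    (memLp_primitive h.measβ (h.sqβ T)).integrable one_le_two
  have hi2 : Integrable (fun ω => x + primitive β T ω) P := (integrable_const x).add hi1
  simp_rw [eq_add (x := x) (X := X) (β := β) T]
  rw [integral_add hi2 ((h.memLp_mart hP T).integrable one_le_two),
    integral_add (integrable_const x) hi1, h.integral_mart hP h0 T,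
    integral_prod _ ((h.sqβ T).integrable one_le_two)]
  simp [primitive, joint]

/-- This is the chain rule for the square of an absolutely continuous path, obtained by integrating
`β` by parts against itself. -/
theorem sq_add_primitive (hβ : Measurable (joint β)) {T : ℝ≥0} {ω : Path}
    (hi : IntegrableOn (fun s => β s ω) (Set.Iic T) dt) :
    (x + primitive β T ω) ^ 2 =
      x ^ 2 + 2 * ∫ s in Set.Iic T, β s ω * (x + primitive β s ω) ∂dt := by
  have h := integral_mul_integral_Iic hi hi
  have hb : IntegrableOn (fun s => β s ω * primitive β s ω) (Set.Iic T) dt := by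
    obtain ⟨C, hC⟩ : ∃ C, ∀ s ≤ T, ‖primitive β s ω‖ ≤ C :=
      ⟨∫ r in Set.Iic T, ‖β r ω‖ ∂dt, fun s hs => (norm_integral_le_integral_norm _).trans
        (setIntegral_mono_set hi.norm (ae_of_all _ fun _ => norm_nonneg _)
          (Set.Iic_subset_Iic.2 hs).eventuallyLE)⟩
    refine (Integrable.bdd_mul (c := C) hi
      ((measurable_joint_primitive hβ).comp (measurable_const.prodMk measurable_id)
        : Measurable fun s => primitive β s ω).aestronglyMeasurable ?_).congr
      (ae_of_all _ fun s => mul_comm _ _)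
    filter_upwards [ae_restrict_mem measurableSet_Iic] with s hs using hC s hs
  have e : ∀ s, β s ω * (x + primitive β s ω) = x * β s ω + β s ω * primitive β s ω := fun s => by
    ring
  simp_rw [e]
  rw [integral_add (hi.const_mul x) hb, integral_const_mul]
  have h' : primitive β T ω * primitive β T ω =
    2 * ∫ s in Set.Iic T, β s ω * primitive β s ω ∂dt := by
    rw [two_mul]; exact h
  change (x + primitive β T ω) ^ 2 = x ^ 2 + 2 * (x * primitive β T ω + _)
  linear_combination h'

/-- Second moment. -/
theorem integral_X_sq (h : ItoProc P x X β H) (hP : P ∈ priors lo hi) (h0 : 0 ≤ hi) (T : ℝ≥0) :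
    ∫ ω, X T ω ^ 2 ∂P = x ^ 2 + 2 * ∫ p, joint β p * joint X p ∂prodT P T +
      ∫ ω, mart x X β T ω ^ 2 ∂P := by
  have := hP.1
  have mD := measurable_joint_primitive h.measβ
  have hD := memLp_primitive h.measβ (h.sqβ T)
  have hxD : MemLp (fun ω => x + primitive β T ω) 2 P := (memLp_const x).add hD
  have hN := h.memLp_mart hP T
  have hDj := memLp_joint_primitive h.measβ (h.sqβ T)
  have hxDj : MemLp (fun p : Path × ℝ≥0 => x + joint (primitive β) p) 2 (prodT P T) :=
    (memLp_const x).add hDj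
  have hNj : MemLp (joint (mart x X β)) 2 (prodT P T) :=
    ((h.sqX T).sub (memLp_const x)).sub hDj
  have hNT : MemLp (fun p : Path × ℝ≥0 => mart x X β T p.1) 2 (prodT P T) := memLp_comp_fst hN T
  have i1 : Integrable (fun p => joint β p * (x + joint (primitive β) p)) (prodT P T) :=
    (h.sqβ T).integrable_mul hxDj
  have i2 : Integrable (fun p => joint β p * joint (mart x X β) p) (prodT P T) :=
    (h.sqβ T).integrable_mul hNj
  have i3 : Integrable (fun p => joint β p * mart x X β T p.1) (prodT P T) :=
    (h.sqβ T).integrable_mul hNT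
  -- the pathwise part
  have e1 : ∫ ω, (x + primitive β T ω) ^ 2 ∂P =
      x ^ 2 + 2 * ∫ p, joint β p * (x + joint (primitive β) p) ∂prodT P T := by
    have hae : ∀ᵐ ω ∂P, (x + primitive β T ω) ^ 2 =
        x ^ 2 + 2 * ∫ s in Set.Iic T, joint β (ω, s) * (x + joint (primitive β) (ω, s)) ∂dt := by
      filter_upwards [((h.sqβ T).integrable one_le_two).prod_right_ae] with ω hω
      exact sq_add_primitive h.measβ hω
    rw [integral_congr_ae hae, integral_add (integrable_const _)
      (i1.integral_prod_left.const_mul 2), integral_const_mul, integral_prod _ i1]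
    simp
  -- the cross term
  have e2 : ∫ ω, (x + primitive β T ω) * mart x X β T ω ∂P =
      ∫ p, joint β p * joint (mart x X β) p ∂prodT P T := by
    have hx1 : Integrable (fun ω => x * mart x X β T ω) P :=
      (hN.integrable one_le_two).const_mul x
    have hx2 : Integrable (fun ω => primitive β T ω * mart x X β T ω) P := hD.integrable_mul hN
    simp_rw [add_mul]
    rw [integral_add hx1 hx2, integral_const_mul, h.integral_mart hP h0 T, mul_zero, zero_add]
    have e3 : ∫ ω, primitive β T ω * mart x X β T ω ∂P =
        ∫ p, joint β p * mart x X β T p.1 ∂prodT P T := by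
      rw [integral_prod _ i3]
      refine integral_congr_ae (ae_of_all _ fun ω => ?_)
      simp only [joint]
      rw [integral_mul_const]; rfl
    rw [e3, integral_prod_symm _ i3, integral_prod_symm _ i2]
    refine integral_congr_ae ?_
    filter_upwards [ae_memLp_slice h.measβ (h.sqβ T), ae_restrict_mem measurableSet_Iic]
      with s hs hsT
    -- The factor `β s` is known at time `s`, so the martingale at time `T` may be replaced by its
    -- value at time `s`.
    have hz := (h.ito T).integral_mul_sub hP h0 hsT h.measH.aemeasurable (h.aesm_mart T)
      (h.aesm_mart s) (h.ito s) (h.progβ.adapted s) hs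
    change ∫ ω, β s ω * (mart x X β T ω - mart x X β s ω) ∂P = 0 at hz
    simp_rw [mul_sub] at hz
    rw [integral_sub] at hz
    · exact sub_eq_zero.1 hz
    · exact hs.integrable_mul hN
    · exact hs.integrable_mul (h.memLp_mart hP s)
  -- The state splits into an absolutely continuous part and a martingale. The square of the first
  -- obeys the classical chain rule, the cross term was reduced to running values, and the squared
  -- martingale is kept for the isometry bounds. No quadratic variation has to be defined.
  have e4 : ∀ ω, X T ω ^ 2 = (x + primitive β T ω) ^ 2 +
      2 * ((x + primitive β T ω) * mart x X β T ω) + mart x X β T ω ^ 2 := fun ω => by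
    rw [eq_add (x := x) (X := X) (β := β) T ω]; ring
  have j1 : Integrable (fun ω => (x + primitive β T ω) ^ 2) P := hxD.integrable_sq
  have j2 : Integrable (fun ω => 2 * ((x + primitive β T ω) * mart x X β T ω)) P :=
    (hxD.integrable_mul hN).const_mul 2
  have j12 : Integrable (fun ω => (x + primitive β T ω) ^ 2 +
    2 * ((x + primitive β T ω) * mart x X β T ω)) P := j1.add j2
  simp_rw [e4]
  rw [integral_add j12 hN.integrable_sq, integral_add j1 j2, integral_const_mul, e1, e2]
  have e5 : ∫ p, joint β p * joint X p ∂prodT P T =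
      ∫ p, joint β p * (x + joint (primitive β) p) ∂prodT P T +
      ∫ p, joint β p * joint (mart x X β) p ∂prodT P T := by
    rw [← integral_add i1 i2]
    refine integral_congr_ae (ae_of_all _ fun p => ?_)
    simp only [joint]
    rw [eq_add (x := x) (X := X) (β := β) p.2 p.1]; ring
  rw [e5]; ring

end ItoProc

/-! ### Discounted second moments and verification -/

theorem integrableOn_exp_mul (ρ : ℝ) {T : ℝ≥0} {k : ℝ≥0 → ℝ}
    (hk : IntegrableOn k (Set.Iic T) dt) :
    IntegrableOn (fun s : ℝ≥0 => Real.exp (-ρ * s) * k s) (Set.Iic T) dt := by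
  have hc : IsCompact (Set.Iic T) := by
    rw [show Set.Iic T = Set.Icc 0 T by ext; simp]; exact isCompact_Icc
  exact hk.continuousOn_mul (by fun_prop) hc

theorem integrableOn_primitive {T : ℝ≥0} {k : ℝ≥0 → ℝ} (hk : IntegrableOn k (Set.Iic T) dt) :
    IntegrableOn (fun s => ∫ r in Set.Iic s, k r ∂dt) (Set.Iic T) dt := by
  refine ⟨?_, ?_⟩
  · have : (fun s => ∫ r in Set.Iic s, k r ∂dt) =ᵐ[dt.restrict (Set.Iic T)] fun s =>
      ∫ r in Set.Iic T, (if r ≤ s then k r else 0) ∂dt := by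
      filter_upwards [ae_restrict_mem measurableSet_Iic] with s hs
      rw [integral_Iic_eq_indicator hs]; rfl
    refine AEStronglyMeasurable.congr ?_ this.symm
    refine AEStronglyMeasurable.integral_prod_right' (f := fun p : ℝ≥0 × ℝ≥0 =>
      if p.2 ≤ p.1 then k p.2 else 0) ?_
    have hm : AEStronglyMeasurable (fun p : ℝ≥0 × ℝ≥0 => k p.2)
      ((dt.restrict (Set.Iic T)).prod (dt.restrict (Set.Iic T))) := hk.1.comp_snd
    exact hm.indicator (s := {p : ℝ≥0 × ℝ≥0 | p.2 ≤ p.1})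
      (measurableSet_le measurable_snd measurable_fst)
  · refine HasFiniteIntegral.restrict_of_bounded (∫ r in Set.Iic T, ‖k r‖ ∂dt)
      (by rw [dt_Iic]; exact ENNReal.ofReal_lt_top) ?_
    filter_upwards [ae_restrict_mem measurableSet_Iic] with s hs
    exact (norm_integral_le_integral_norm _).trans
      (setIntegral_mono_set hk.norm (ae_of_all _ fun _ => norm_nonneg _)
        (Set.Iic_subset_Iic.2 hs).eventuallyLE)

/-- Integrating the hypothesis against `ρ e^{-ρs}` and adding its discounted terminal case produces
the double integral that `discount_integral` collapses. It plays the role of Itô's formula for the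
discounted process. -/
theorem discount_le {ρ c : ℝ} (hρ : 0 ≤ ρ) {T : ℝ≥0} {y k : ℝ≥0 → ℝ}
    (hy : IntegrableOn y (Set.Iic T) dt) (hk : IntegrableOn k (Set.Iic T) dt)
    (h : ∀ s ≤ T, y s ≤ c + ∫ r in Set.Iic s, k r ∂dt) :
    Real.exp (-ρ * T) * y T + ∫ s in Set.Iic T, ρ * (Real.exp (-ρ * s) * y s) ∂dt ≤
      c + ∫ s in Set.Iic T, Real.exp (-ρ * s) * k s ∂dt := by
  have hF := integrableOn_primitive hk
  have h1 := discount_integral ρ hk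
  have h2 := integral_exp_Iic ρ T
  have hexp : IntegrableOn (fun s : ℝ≥0 => ρ * Real.exp (-ρ * s)) (Set.Iic T) dt :=
    integrableOn_of_continuous (by fun_prop) T
  have h3 : ∫ s in Set.Iic T, ρ * (Real.exp (-ρ * s) * y s) ∂dt ≤
      ∫ s in Set.Iic T, (c * (ρ * Real.exp (-ρ * s)) +
        ρ * (Real.exp (-ρ * s) * ∫ r in Set.Iic s, k r ∂dt)) ∂dt := by
    refine setIntegral_mono_on ((integrableOn_exp_mul ρ hy).const_mul ρ)
      ((hexp.const_mul c).add ((integrableOn_exp_mul ρ hF).const_mul ρ)) measurableSet_Iic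
      fun s hs => ?_
    have := mul_le_mul_of_nonneg_left (h s hs) (mul_nonneg hρ (Real.exp_pos (-ρ * s)).le)
    linarith
  rw [integral_add (hexp.const_mul c) ((integrableOn_exp_mul ρ hF).const_mul ρ),
    integral_const_mul c (fun s : ℝ≥0 => ρ * Real.exp (-ρ * s)), h2] at h3
  have h4 := mul_le_mul_of_nonneg_left (h T le_rfl) (Real.exp_pos (-ρ * T)).le
  simp_rw [mul_assoc] at h1
  linarith

theorem integrable_exp_mul_prodT {P : Measure Path} [SFinite P] (ρ : ℝ) (hρ : 0 ≤ ρ) {T : ℝ≥0}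
    {g : Path × ℝ≥0 → ℝ} (hg : Integrable g (prodT P T)) :
    Integrable (fun p : Path × ℝ≥0 => Real.exp (-ρ * p.2) * g p) (prodT P T) := by
  refine Integrable.bdd_mul (c := 1) hg
    (by fun_prop : Measurable fun p : Path × ℝ≥0 => Real.exp (-ρ * p.2)).aestronglyMeasurable
    (ae_of_all _ fun p => ?_)
  rw [Real.norm_eq_abs, Real.abs_exp, Real.exp_le_one_iff]
  have : (0 : ℝ) ≤ p.2 := p.2.coe_nonneg
  nlinarith

/-- The quadratic polynomial `½ p₂ y² + p₁ y + p₀`. -/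
noncomputable def quad (p₂ p₁ p₀ y : ℝ) : ℝ := 1 / 2 * p₂ * y ^ 2 + p₁ * y + p₀

/-- `ρ φ(y) - β φ'(y) - ½ v H² φ''(y)` for `φ = quad p₂ p₁ p₀`. -/
noncomputable def residual (ρ v p₂ p₁ p₀ y β H : ℝ) : ℝ :=
  ρ * quad p₂ p₁ p₀ y - β * (p₂ * y + p₁) - 1 / 2 * p₂ * v * H ^ 2

namespace ItoProc

variable {lo hi x ρ p₂ p₁ p₀ : ℝ} {P : Measure Path} {X β H : ℝ≥0 → Path → ℝ}

theorem integrable_quad (h : ItoProc P x X β H) (hP : P ∈ priors lo hi) (T : ℝ≥0) :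
    Integrable (fun ω => quad p₂ p₁ p₀ (X T ω)) P := by
  have := hP.1
  have hX := h.memLp_X hP T
  exact ((hX.integrable_sq.const_mul _).add ((hX.integrable one_le_two).const_mul _)).add
    (integrable_const _)

theorem integrable_quad_joint (h : ItoProc P x X β H) (hP : P ∈ priors lo hi) (T : ℝ≥0) :
    Integrable (fun p => quad p₂ p₁ p₀ (joint X p)) (prodT P T) := by
  have := hP.1
  have hX := h.sqX T
  exact ((hX.integrable_sq.const_mul _).add ((hX.integrable one_le_two).const_mul _)).add
    (integrable_const _)

theorem integrable_gen (h : ItoProc P x X β H) (hP : P ∈ priors lo hi) (v : ℝ) (T : ℝ≥0) :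
    Integrable (fun p => joint β p * (p₂ * joint X p + p₁) + 1 / 2 * p₂ * v * joint H p ^ 2)
      (prodT P T) := by
  have := hP.1
  have hX := (h.sqX T).const_mul p₂ |>.add (memLp_const p₁)
  exact ((h.sqβ T).integrable_mul hX).add ((h.sqH hP T).integrable_sq.const_mul _)

/-- A Dynkin formula in which a reference rate `v` stands for the unknown density of `⟨B⟩`. The last
term is the error made, and its sign follows from the isometry bounds. -/
theorem integral_quad_sub (h : ItoProc P x X β H) (hP : P ∈ priors lo hi) (h0 : 0 ≤ hi) (v : ℝ)
    (T : ℝ≥0) : ∫ ω, quad p₂ p₁ p₀ (X T ω) ∂P = quad p₂ p₁ p₀ x +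
      ∫ p, (joint β p * (p₂ * joint X p + p₁) + 1 / 2 * p₂ * v * joint H p ^ 2) ∂prodT P T +
      1 / 2 * p₂ * (∫ ω, mart x X β T ω ^ 2 ∂P - v * ∫ p, joint H p ^ 2 ∂prodT P T) := by
  have := hP.1
  have hX := h.memLp_X hP T
  have i1 : Integrable (fun ω => 1 / 2 * p₂ * X T ω ^ 2) P := hX.integrable_sq.const_mul _
  have i2 : Integrable (fun ω => p₁ * X T ω) P := (hX.integrable one_le_two).const_mul _
  have i12 : Integrable (fun ω => 1 / 2 * p₂ * X T ω ^ 2 + p₁ * X T ω) P := i1.add i2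
  have e : ∀ p : Path × ℝ≥0, joint β p * (p₂ * joint X p + p₁) + 1 / 2 * p₂ * v * joint H p ^ 2 =
      p₂ * (joint β p * joint X p) + p₁ * joint β p + 1 / 2 * p₂ * v * joint H p ^ 2 := fun p => by
    ring
  have j1 : Integrable (fun p => p₂ * (joint β p * joint X p)) (prodT P T) :=
    ((h.sqβ T).integrable_mul (h.sqX T)).const_mul _
  have j2 : Integrable (fun p => p₁ * joint β p) (prodT P T) :=
    ((h.sqβ T).integrable one_le_two).const_mul _
  have j12 : Integrable (fun p => p₂ * (joint β p * joint X p) + p₁ * joint β p) (prodT P T) :=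
    j1.add j2
  simp_rw [e, quad]
  rw [integral_add i12 (integrable_const _), integral_add i1 i2, integral_const_mul,
    integral_const_mul, integral_add j12 ((h.sqH hP T).integrable_sq.const_mul _),
    integral_add j1 j2, integral_const_mul, integral_const_mul, integral_const_mul,
    h.integral_X_sq hP h0, h.integral_X hP h0]
  simp
  ring

/-- With `v = hi²` the error is `p₂ / 2` times a nonpositive number, so concavity gives the
direction of the inequality. -/
theorem le_integral_quad (h : ItoProc P x X β H) (hP : P ∈ priors lo hi) (h0 : 0 ≤ hi)
    (hp : p₂ ≤ 0) (T : ℝ≥0) : quad p₂ p₁ p₀ x +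
      ∫ p, (joint β p * (p₂ * joint X p + p₁) + 1 / 2 * p₂ * hi ^ 2 * joint H p ^ 2) ∂prodT P T
      ≤ ∫ ω, quad p₂ p₁ p₀ (X T ω) ∂P := by
  rw [h.integral_quad_sub hP h0 (hi ^ 2)]
  have := h.integral_mart_sq_le hP h0 T
  nlinarith

/-- When the two volatility bounds coincide, so do the two isometry bounds, and the error vanishes
whatever the sign of `p₂`. -/
theorem integral_quad_eq (h : ItoProc P x X β H) (hP : P ∈ priors hi hi) (h0 : 0 ≤ hi)
    (T : ℝ≥0) : ∫ ω, quad p₂ p₁ p₀ (X T ω) ∂P = quad p₂ p₁ p₀ x +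
      ∫ p, (joint β p * (p₂ * joint X p + p₁) + 1 / 2 * p₂ * hi ^ 2 * joint H p ^ 2) ∂prodT P T := by
  rw [h.integral_quad_sub hP h0 (hi ^ 2)]
  have h1 := h.integral_mart_sq_le hP h0 T
  have h2 := h.le_integral_mart_sq hP h0 T
  rw [le_antisymm h1 h2]; ring

/-- Discounting a one-sided Dynkin formula. -/
theorem discount_quad (h : ItoProc P x X β H) (hP : P ∈ priors lo hi) (hρ : 0 ≤ ρ)
    {v : ℝ} (hle : ∀ T, quad p₂ p₁ p₀ x +
      ∫ p, (joint β p * (p₂ * joint X p + p₁) + 1 / 2 * p₂ * v * joint H p ^ 2) ∂prodT P T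
      ≤ ∫ ω, quad p₂ p₁ p₀ (X T ω) ∂P) (T : ℝ≥0) :
    quad p₂ p₁ p₀ x - Real.exp (-ρ * T) * ∫ ω, quad p₂ p₁ p₀ (X T ω) ∂P ≤
      ∫ p, Real.exp (-ρ * p.2) * residual ρ v p₂ p₁ p₀ (joint X p) (joint β p) (joint H p)
        ∂prodT P T := by
  have := hP.1
  have hg := fun T => h.integrable_gen (p₂ := p₂) (p₁ := p₁) hP v T
  have hq := h.integrable_quad_joint (p₂ := p₂) (p₁ := p₁) (p₀ := p₀) hP T
  have hd := discount_le (c := -quad p₂ p₁ p₀ x) (T := T) hρ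
    (y := fun s => -∫ ω, quad p₂ p₁ p₀ (X s ω) ∂P)
    (k := fun s => -∫ ω, (β s ω * (p₂ * X s ω + p₁) + 1 / 2 * p₂ * v * H s ω ^ 2) ∂P)
    -- `discount_le` bounds from above, so it is applied to minus the expectation of the quadratic.
    hq.integral_prod_right.neg (hg T).integral_prod_right.neg fun s _ => by
      have := hle s
      rw [integral_prod_symm _ (hg s)] at this
      rw [integral_neg]
      simp only [joint] at this
      linarith
  have i1 := integrable_exp_mul_prodT ρ hρ hq
  have i2 := integrable_exp_mul_prodT ρ hρ (hg T)
  have e : ∀ p : Path × ℝ≥0,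
      Real.exp (-ρ * p.2) * residual ρ v p₂ p₁ p₀ (joint X p) (joint β p) (joint H p) =
      ρ * (Real.exp (-ρ * p.2) * quad p₂ p₁ p₀ (joint X p)) -
      Real.exp (-ρ * p.2) *
        (joint β p * (p₂ * joint X p + p₁) + 1 / 2 * p₂ * v * joint H p ^ 2) := fun p => by
    simp only [residual]; ring
  simp_rw [e]
  rw [integral_sub (i1.const_mul ρ) i2, integral_const_mul, integral_prod_symm _ i1,
    integral_prod_symm _ i2]
  simp only [joint, integral_const_mul]
  simp only [mul_neg, integral_neg, integral_const_mul] at hd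
  linarith

end ItoProc

/-- Transversality: the discounted second moment vanishes along a sequence of times. -/
def Transversal (P : Measure Path) (ρ : ℝ) (X : ℝ≥0 → Path → ℝ) : Prop :=
  ∀ ε > 0, ∃ᶠ T : ℝ≥0 in atTop, Real.exp (-ρ * T) * ∫ ω, X T ω ^ 2 ∂P < ε

theorem tendsto_exp_neg_mul {ρ : ℝ} (hρ : 0 < ρ) :
    Tendsto (fun T : ℝ≥0 => Real.exp (-ρ * T)) atTop (𝓝 0) := by
  refine Real.tendsto_exp_atBot.comp ?_
  exact (NNReal.tendsto_coe_atTop.2 tendsto_id).const_mul_atTop_of_neg (neg_lt_zero.2 hρ)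

theorem prodT_eq_restrict (P : Measure Path) [SFinite P] (T : ℝ≥0) :
    prodT P T = (P.prod dt).restrict (Prod.snd ⁻¹' Set.Iic T) := by
  rw [← Set.univ_prod, ← Measure.prod_restrict, Measure.restrict_univ]

theorem tendsto_integral_prodT {P : Measure Path} [SFinite P] {g : Path × ℝ≥0 → ℝ}
    (hg : Integrable g (P.prod dt)) :
    Tendsto (fun T : ℝ≥0 => ∫ p, g p ∂prodT P T) atTop (𝓝 (∫ p, g p ∂P.prod dt)) := by
  simp_rw [prodT_eq_restrict]
  have hc : AECover (P.prod dt) atTop fun T : ℝ≥0 =>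
      (Prod.snd ⁻¹' Set.Iic T : Set (Path × ℝ≥0)) :=
    ⟨ae_of_all _ fun p => by
      filter_upwards [eventually_ge_atTop p.2] with T hT using hT,
      fun T => measurable_snd measurableSet_Iic⟩
  exact hc.integral_tendsto_of_countably_generated hg

namespace ItoProc

variable {lo hi x ρ p₂ p₁ p₀ : ℝ} {P : Measure Path} {X β H : ℝ≥0 → Path → ℝ}

/-- A quadratic polynomial is at most `C (1 + y²)`. The discounted constant tends to zero, and the
discounted square is small along the times supplied by transversality. -/
theorem frequently_abs_quad_le (h : ItoProc P x X β H) (hP : P ∈ priors lo hi) (hρ : 0 < ρ)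
    (htv : Transversal P ρ X) {δ : ℝ} (hδ : 0 < δ) : ∃ᶠ T : ℝ≥0 in atTop,
      Real.exp (-ρ * T) * ∫ ω, quad p₂ p₁ p₀ (X T ω) ∂P < δ := by
  have := hP.1
  set C : ℝ := |p₂| + |p₁| + |p₀| + 1 with hC
  have hC0 : 0 < C := by positivity
  have h1 := htv (δ / (2 * C)) (by positivity)
  have h2 : ∀ᶠ T : ℝ≥0 in atTop, Real.exp (-ρ * T) < δ / (2 * C) :=
    (tendsto_exp_neg_mul hρ).eventually (gt_mem_nhds (by positivity))
  refine (h1.and_eventually h2).mono fun T hT => ?_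
  have hX := h.memLp_X hP T
  have hb : ∫ ω, quad p₂ p₁ p₀ (X T ω) ∂P ≤ C * ∫ ω, X T ω ^ 2 ∂P + C := by
    have hle : ∫ ω, quad p₂ p₁ p₀ (X T ω) ∂P ≤ ∫ ω, (C * X T ω ^ 2 + C) ∂P := by
      refine integral_mono (h.integrable_quad hP T)
        ((hX.integrable_sq.const_mul C).add (integrable_const C)) fun ω => ?_
      have a1 : X T ω ≤ 1 + X T ω ^ 2 := by nlinarith [sq_nonneg (X T ω - 1)]
      have a2 : -X T ω ≤ 1 + X T ω ^ 2 := by nlinarith [sq_nonneg (X T ω + 1)]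
      have b1 : p₁ * X T ω ≤ |p₁| * (1 + X T ω ^ 2) :=
        (le_abs_self _).trans (by
          rw [abs_mul]; exact mul_le_mul_of_nonneg_left (abs_le.2 ⟨by linarith, a1⟩) (abs_nonneg _))
      have b2 : p₂ * X T ω ^ 2 ≤ |p₂| * X T ω ^ 2 :=
        mul_le_mul_of_nonneg_right (le_abs_self _) (sq_nonneg _)
      have b3 : p₀ ≤ |p₀| := le_abs_self _
      have s0 := sq_nonneg (X T ω)
      simp only [quad, hC]
      nlinarith [abs_nonneg p₂, abs_nonneg p₁, abs_nonneg p₀,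
        mul_nonneg (abs_nonneg p₂) s0, mul_nonneg (abs_nonneg p₀) s0]
    rwa [integral_add (hX.integrable_sq.const_mul C) (integrable_const C), integral_const_mul,
      integral_const, probReal_univ, one_smul] at hle
  have he := (Real.exp_pos (-ρ * T)).le
  calc Real.exp (-ρ * T) * ∫ ω, quad p₂ p₁ p₀ (X T ω) ∂P
      ≤ Real.exp (-ρ * T) * (C * ∫ ω, X T ω ^ 2 ∂P + C) := mul_le_mul_of_nonneg_left hb he
    _ = C * (Real.exp (-ρ * T) * ∫ ω, X T ω ^ 2 ∂P) + C * Real.exp (-ρ * T) := by ring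
    _ < C * (δ / (2 * C)) + C * (δ / (2 * C)) :=
        add_lt_add (mul_lt_mul_of_pos_left hT.1 hC0) (mul_lt_mul_of_pos_left hT.2 hC0)
    _ = δ := by field_simp; ring

/-- The horizon goes to infinity along the transversality times. If the conclusion failed by `δ`,
some horizon would make the terminal term less than `δ / 2` while the running integral is already
more than `δ / 2` below the initial value. -/
theorem le_of_discount (h : ItoProc P x X β H) (hP : P ∈ priors lo hi) (hρ : 0 < ρ)
    (htv : Transversal P ρ X) {R : Path × ℝ≥0 → ℝ} {v : ℝ}
    (hR : Integrable (fun p : Path × ℝ≥0 => Real.exp (-ρ * p.2) * R p) (P.prod dt))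
    (hd : ∀ T : ℝ≥0, quad p₂ p₁ p₀ x - Real.exp (-ρ * T) * ∫ ω, quad p₂ p₁ p₀ (X T ω) ∂P ≤
      ∫ p, Real.exp (-ρ * p.2) * residual ρ v p₂ p₁ p₀ (joint X p) (joint β p) (joint H p)
        ∂prodT P T)
    (hle : ∀ᵐ p ∂P.prod dt, residual ρ v p₂ p₁ p₀ (joint X p) (joint β p) (joint H p) ≤ R p) :
    quad p₂ p₁ p₀ x ≤ ∫ p, Real.exp (-ρ * p.2) * R p ∂P.prod dt := by
  have := hP.1
  by_contra hcon
  rw [not_le] at hcon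
  set δ := quad p₂ p₁ p₀ x - ∫ p, Real.exp (-ρ * p.2) * R p ∂P.prod dt with hδ
  have hδ0 : 0 < δ / 2 := by linarith
  have ht := (tendsto_integral_prodT hR).eventually
    (gt_mem_nhds (show _ < quad p₂ p₁ p₀ x - δ / 2 by linarith))
  obtain ⟨T, hT1, hT2⟩ := ((h.frequently_abs_quad_le (p₂ := p₂) (p₁ := p₁) (p₀ := p₀)
    hP hρ htv hδ0).and_eventually ht).exists
  have hmono : ∫ p, Real.exp (-ρ * p.2) *
      residual ρ v p₂ p₁ p₀ (joint X p) (joint β p) (joint H p) ∂prodT P T ≤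
      ∫ p, Real.exp (-ρ * p.2) * R p ∂prodT P T := by
    refine integral_mono_ae ?_ ?_ ?_
    · refine integrable_exp_mul_prodT ρ hρ.le ?_
      have i1 := (h.integrable_quad_joint (p₂ := p₂) (p₁ := p₁) (p₀ := p₀) hP T).const_mul ρ
      refine (i1.sub (h.integrable_gen (p₂ := p₂) (p₁ := p₁) hP v T)).congr
        (ae_of_all _ fun p => ?_)
      simp only [residual, Pi.sub_apply]; ring
    · rw [prodT_eq_restrict]; exact hR.restrict
    · rw [prodT_eq_restrict]
      filter_upwards [ae_restrict_of_ae hle] with p hp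
      exact mul_le_mul_of_nonneg_left hp (Real.exp_pos _).le
  have := hd T
  linarith

/-- Verification, lower bound under every prior. -/
theorem verification_ge (h : ItoProc P x X β H) (hP : P ∈ priors lo hi) (h0 : 0 ≤ hi) (hρ : 0 < ρ)
    (hp : p₂ ≤ 0) (htv : Transversal P ρ X) {R : Path × ℝ≥0 → ℝ}
    (hR : Integrable (fun p : Path × ℝ≥0 => Real.exp (-ρ * p.2) * R p) (P.prod dt))
    (hle : ∀ᵐ p ∂P.prod dt,
      residual ρ (hi ^ 2) p₂ p₁ p₀ (joint X p) (joint β p) (joint H p) ≤ R p) :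
    quad p₂ p₁ p₀ x ≤ ∫ p, Real.exp (-ρ * p.2) * R p ∂P.prod dt :=
  h.le_of_discount hP hρ htv hR
    (fun T => h.discount_quad hP hρ.le (fun T => h.le_integral_quad hP h0 hp T) T) hle

/-- Verification, upper bound under a prior of constant volatility. -/
theorem verification_le (h : ItoProc P x X β H) (hP : P ∈ priors hi hi) (h0 : 0 ≤ hi) (hρ : 0 < ρ)
    (htv : Transversal P ρ X) {R : Path × ℝ≥0 → ℝ}
    (hR : Integrable (fun p : Path × ℝ≥0 => Real.exp (-ρ * p.2) * R p) (P.prod dt))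
    (hle : ∀ᵐ p ∂P.prod dt,
      R p ≤ residual ρ (hi ^ 2) p₂ p₁ p₀ (joint X p) (joint β p) (joint H p)) :
    ∫ p, Real.exp (-ρ * p.2) * R p ∂P.prod dt ≤ quad p₂ p₁ p₀ x := by
  -- Under constant volatility the Dynkin formula is an equality, so it may be applied to the
  -- negated polynomial without any convexity assumption.
  have hneg : ∀ y, quad (-p₂) (-p₁) (-p₀) y = -quad p₂ p₁ p₀ y := fun y => by
    simp only [quad]; ring
  have := h.le_of_discount (p₂ := -p₂) (p₁ := -p₁) (p₀ := -p₀) (R := fun p => -R p) hP hρ htv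
    (v := hi ^ 2) (by simpa using hR.neg)
    (fun T => h.discount_quad hP hρ.le (fun T => (h.integral_quad_eq hP h0 T).ge) T) (by
      filter_upwards [hle] with p hp
      simp only [residual, hneg] at hp ⊢
      linarith)
  rw [hneg] at this
  simp only [mul_neg, integral_neg] at this
  linarith

/-- The case of equality. -/
theorem verification_eq (h : ItoProc P x X β H) (hP : P ∈ priors hi hi) (h0 : 0 ≤ hi) (hρ : 0 < ρ)
    (htv : Transversal P ρ X) (hR : Integrable (fun p : Path × ℝ≥0 => Real.exp (-ρ * p.2) *
      residual ρ (hi ^ 2) p₂ p₁ p₀ (joint X p) (joint β p) (joint H p)) (P.prod dt)) :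
    ∫ p, Real.exp (-ρ * p.2) *
      residual ρ (hi ^ 2) p₂ p₁ p₀ (joint X p) (joint β p) (joint H p) ∂P.prod dt =
      quad p₂ p₁ p₀ x :=
  le_antisymm (h.verification_le hP h0 hρ htv hR (ae_of_all _ fun _ => le_rfl))
    (h.le_of_discount hP hρ htv hR
      (fun T => h.discount_quad hP hρ.le (fun T => (h.integral_quad_eq hP h0 T).ge) T)
      (ae_of_all _ fun _ => le_rfl))

/-- The first moment does not depend on the prior. -/
theorem verification_linear (h : ItoProc P x X β H) (hP : P ∈ priors lo hi) (h0 : 0 ≤ hi)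
    (hρ : 0 < ρ) (htv : Transversal P ρ X)
    (hR : Integrable (fun p : Path × ℝ≥0 => Real.exp (-ρ * p.2) *
      (ρ * joint X p - joint β p)) (P.prod dt)) :
    ∫ p, Real.exp (-ρ * p.2) * (ρ * joint X p - joint β p) ∂P.prod dt = x := by
  refine le_antisymm ?_ ?_
  -- A linear function is concave with either sign, so the one-sided verification gives both
  -- inequalities under every prior.
  · have := h.verification_ge (p₂ := 0) (p₁ := -1) (p₀ := 0) hP h0 hρ le_rfl htv
      (R := fun p => -(ρ * joint X p - joint β p))
      (hR.neg.congr (ae_of_all _ fun p => by simp only [Pi.neg_apply]; ring))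
      (ae_of_all _ fun p => le_of_eq (by simp only [residual, quad]; ring))
    simp only [mul_neg, integral_neg, quad] at this
    linarith
  · have := h.verification_ge (p₂ := 0) (p₁ := 1) (p₀ := 0) hP h0 hρ le_rfl htv hR
      (ae_of_all _ fun p => le_of_eq (by simp only [residual, quad]; ring))
    simp only [quad] at this
    linarith

end ItoProc

/-! ### A Gronwall inequality and uniqueness of solutions -/

/-- The weight `e^{-2Cs}` decays twice as fast as needed, so half of the double integral produced by
`discount_integral` absorbs the integral term. No continuity of `f` is required. The constant is not
sharp; only its being proportional to `K` matters. -/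
theorem gronwall {K C : ℝ} (hK : 0 ≤ K) (hC : 0 < C) {T : ℝ≥0} {f : ℝ≥0 → ℝ}
    (hf : IntegrableOn f (Set.Iic T) dt) (hf0 : ∀ s, 0 ≤ f s)
    (h : ∀ s ≤ T, f s ≤ K + C * ∫ r in Set.Iic s, f r ∂dt) :
    f T ≤ K * (1 + Real.exp (2 * C * T)) := by
  have hF := integrableOn_primitive hf
  have h1 := discount_integral (2 * C) hf
  have h2 := integral_exp_Iic (2 * C) T
  have hexp : IntegrableOn (fun s : ℝ≥0 => 2 * C * Real.exp (-(2 * C) * s)) (Set.Iic T) dt :=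
    integrableOn_of_continuous (by fun_prop) T
  have hG := (integrableOn_exp_mul (2 * C) hF)
  have hG' : IntegrableOn (fun s : ℝ≥0 => 2 * C * Real.exp (-(2 * C) * s) *
      ∫ r in Set.Iic s, f r ∂dt) (Set.Iic T) dt := by
    exact IntegrableOn.congr_fun (hG.const_mul (2 * C)) (fun s _ => by ring) measurableSet_Iic
  have h3 : ∫ s in Set.Iic T, Real.exp (-(2 * C) * s) * f s ∂dt ≤
      ∫ s in Set.Iic T, ((K / (2 * C)) * (2 * C * Real.exp (-(2 * C) * s)) +
        1 / 2 * (2 * C * Real.exp (-(2 * C) * s) * ∫ r in Set.Iic s, f r ∂dt)) ∂dt := by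
    refine setIntegral_mono_on (integrableOn_exp_mul (2 * C) hf)
      ((hexp.const_mul _).add (hG'.const_mul _)) measurableSet_Iic fun s hs => ?_
    have := mul_le_mul_of_nonneg_left (h s hs) (Real.exp_pos (-(2 * C) * s)).le
    refine this.trans (le_of_eq ?_)
    field_simp
  rw [integral_add (hexp.const_mul _) (hG'.const_mul _), integral_const_mul (K / (2 * C)),
    integral_const_mul (1 / 2 : ℝ), h2] at h3
  have h4 : 0 ≤ ∫ s in Set.Iic T, (2 * C * Real.exp (-(2 * C) * s) *
      ∫ r in Set.Iic s, f r ∂dt) ∂dt := integral_nonneg fun s =>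
    mul_nonneg (by positivity) (integral_nonneg fun r => hf0 r)
  have h5 : Real.exp (-(2 * C) * T) * ∫ s in Set.Iic T, f s ∂dt ≤ K / (2 * C) := by
    have : K / (2 * C) * (1 - Real.exp (-(2 * C) * T)) ≤ K / (2 * C) := by
      have := (Real.exp_pos (-(2 * C) * T)).le
      have hq : 0 ≤ K / (2 * C) := by positivity
      nlinarith
    linarith
  have h6 : ∫ s in Set.Iic T, f s ∂dt ≤ K / (2 * C) * Real.exp (2 * C * T) := by
    have := mul_le_mul_of_nonneg_left h5 (Real.exp_pos (2 * C * T)).le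
    rw [← mul_assoc, ← Real.exp_add] at this
    simp only [neg_mul, add_neg_cancel, Real.exp_zero, one_mul] at this
    linarith
  have h7 := h T le_rfl
  have h8 := mul_le_mul_of_nonneg_left h6 hC.le
  have h9 : C * (K / (2 * C) * Real.exp (2 * C * T)) = K * Real.exp (2 * C * T) / 2 := by
    field_simp
  have h10 : 0 ≤ K * Real.exp (2 * C * T) := by positivity
  linarith

theorem _root_.MeasureTheory.IsProgressive.comp_measurable {X : ℝ≥0 → Path → ℝ}
    (hX : IsProgressive Filt X) {g : ℝ → ℝ} (hg : Measurable g) :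
    IsProgressive Filt fun s ω => g (X s ω) := fun i => hg.comp (hX i)

theorem integral_prodT {P : Measure Path} [SFinite P] {T : ℝ≥0} {g : Path × ℝ≥0 → ℝ}
    (hg : Integrable g (prodT P T)) :
    ∫ p, g p ∂prodT P T = ∫ s in Set.Iic T, ∫ ω, g (ω, s) ∂P ∂dt := integral_prod_symm _ hg

namespace ItoProc

variable {lo hi x x' : ℝ} {P : Measure Path} {X X' β β' H H' : ℝ≥0 → Path → ℝ}

theorem sub (h : ItoProc P x X β H) (h' : ItoProc P x' X' β' H') (hP : P ∈ priors lo hi) :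
    ItoProc P (x - x') (fun s ω => X s ω - X' s ω) (fun s ω => β s ω - β' s ω)
      (fun s ω => H s ω - H' s ω) where
  progX := h.progX.sub h'.progX
  progβ := h.progβ.sub h'.progβ
  progH := h.progH.sub h'.progH
  sqX T := (h.sqX T).sub (h'.sqX T)
  sqβ T := (h.sqβ T).sub (h'.sqβ T)
  ito T := by
    have := hP.1
    refine ((h.ito T).sub hP h.measH.aemeasurable (h.aesm_mart T) h'.measH.aemeasurable
      (h'.aesm_mart T) (h'.ito T)).congr (ae_eq_refl _) ?_
    filter_upwards [((h.sqβ T).integrable one_le_two).prod_right_ae,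
      ((h'.sqβ T).integrable one_le_two).prod_right_ae] with ω h1 h2
    simp only [joint] at h1 h2
    rw [integral_sub h1 h2]
    simp only [mart, primitive]; ring

/-- A crude second moment estimate. -/
theorem integral_X_sq_le (h : ItoProc P x X β H) (hP : P ∈ priors lo hi) (h0 : 0 ≤ hi) (T : ℝ≥0) :
    ∫ ω, X T ω ^ 2 ∂P ≤ x ^ 2 + ∫ p, (joint X p ^ 2 + joint β p ^ 2 + hi ^ 2 * joint H p ^ 2)
      ∂prodT P T := by
  have := hP.1
  rw [h.integral_X_sq hP h0]
  have h1 := h.integral_mart_sq_le hP h0 T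
  have i1 := (h.sqX T).integrable_sq
  have i2 := (h.sqβ T).integrable_sq
  have i3 := (h.sqH hP T).integrable_sq
  have i12 : Integrable (fun p => joint X p ^ 2 + joint β p ^ 2) (prodT P T) := i1.add i2
  rw [integral_add i12 (i3.const_mul _), integral_const_mul]
  have h2 : 2 * ∫ p, joint β p * joint X p ∂prodT P T ≤
      ∫ p, (joint X p ^ 2 + joint β p ^ 2) ∂prodT P T := by
    rw [← integral_const_mul]
    refine integral_mono (((h.sqβ T).integrable_mul (h.sqX T)).const_mul 2) i12 fun p => ?_
    have := sq_nonneg (joint X p - joint β p)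
    dsimp only
    nlinarith
  linarith

end ItoProc

/-- `X` solves `dX = (a X + b) dt + S(X) dB`, `X_0 = x`, under every prior. -/
def IsSol (lo hi a b : ℝ) (S : ℝ → ℝ) (x : ℝ) (X : ℝ≥0 → Path → ℝ) : Prop :=
  IsProgressive Filt X ∧
  (∀ T : ℝ≥0, upperE (priors lo hi)
    (fun ω => ∫⁻ s in Set.Iic T, ENNReal.ofReal (X s ω ^ 2) ∂dt) < ∞) ∧
  ∀ P ∈ priors lo hi, ∀ T : ℝ≥0, HasItoIntegral P (fun s ω => S (X s ω)) T
    (fun ω => X T ω - x - ∫ s in Set.Iic T, (a * X s ω + b) ∂dt)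

theorem lintegral_lt_top_of_upperE {Ps : Set (Measure Path)} {ξ : Path → ℝ≥0∞}
    (h : upperE Ps ξ < ∞) {P : Measure Path} (hP : P ∈ Ps) : ∫⁻ ω, ξ ω ∂P < ∞ :=
  (le_iSup₂ (f := fun P (_ : P ∈ Ps) => ∫⁻ ω, ξ ω ∂P) P hP).trans_lt h

section Sol

variable {lo hi a b x L : ℝ} {S : ℝ → ℝ} {X Y : ℝ≥0 → Path → ℝ} {P : Measure Path}

theorem memLp_joint_of_lintegral (hX : Measurable (joint X)) {T : ℝ≥0}
    (h : ∫⁻ ω, ∫⁻ s in Set.Iic T, ENNReal.ofReal (X s ω ^ 2) ∂dt ∂P < ∞) :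
    MemLp (joint X) 2 (prodT P T) := by
  refine memLp_two_of_lintegral hX.aestronglyMeasurable ?_
  rw [lintegral_prodT (measurable_sq_joint hX)]; exact h

theorem IsSol.itoProc (hX : IsSol lo hi a b S x X) (hS : Continuous S) (hP : P ∈ priors lo hi) :
    ItoProc P x X (fun s ω => a * X s ω + b) (fun s ω => S (X s ω)) := by
  have := hP.1
  have hm := fun T => memLp_joint_of_lintegral (measurable_joint hX.1)
    (lintegral_lt_top_of_upperE (hX.2.1 T) hP)
  exact ⟨hX.1, hX.1.comp_measurable (g := fun y => a * y + b) (by fun_prop),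
    hX.1.comp_measurable hS.measurable, hm,
    fun T => ((hm T).const_mul a).add (memLp_const b), fun T => hX.2.2 P hP T⟩

/-- The difference of two solutions is an Itô process started at `0` whose coefficients are bounded
by multiples of the difference itself, so Gronwall applies with `K = 0`. -/
theorem IsSol.unique (hX : IsSol lo hi a b S x X) (hY : IsSol lo hi a b S x Y) (h0 : 0 ≤ hi)
    (hS : ∀ y z, |S y - S z| ≤ L * |y - z|) (hSc : Continuous S) (hP : P ∈ priors lo hi)
    (T : ℝ≥0) : ∀ᵐ ω ∂P, Y T ω = X T ω := by
  have := hP.1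
  have hD := (hX.itoProc hSc hP).sub (hY.itoProc hSc hP) hP
  set D : ℝ≥0 → Path → ℝ := fun s ω => X s ω - Y s ω with hDdef
  set C : ℝ := 1 + a ^ 2 + hi ^ 2 * L ^ 2 with hC
  have hC0 : 0 < C := by positivity
  have hi' : IntegrableOn (fun s => ∫ ω, D s ω ^ 2 ∂P) (Set.Iic T) dt :=
    (hD.sqX T).integrable_sq.integral_prod_right
  have hg := gronwall (K := 0) le_rfl hC0 hi' (fun s => integral_nonneg fun _ => sq_nonneg _)
    fun s _ => by
      refine (hD.integral_X_sq_le hP h0 s).trans ?_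
      rw [sub_self, zero_pow two_ne_zero, zero_add, zero_add, ← integral_const_mul]
      have i1 := (hD.sqX s).integrable_sq
      have e : ∫ r in Set.Iic s, C * ∫ ω, D r ω ^ 2 ∂P ∂dt =
          ∫ p, C * joint D p ^ 2 ∂prodT P s := by
        rw [integral_prodT (i1.const_mul C)]
        simp only [integral_const_mul]; rfl
      rw [e]
      refine integral_mono ((i1.add (hD.sqβ s).integrable_sq).add
        ((hD.sqH hP s).integrable_sq.const_mul _)) (i1.const_mul C) fun p => ?_
      have h1 := hS (X p.2 p.1) (Y p.2 p.1)
      have h2 : (S (X p.2 p.1) - S (Y p.2 p.1)) ^ 2 ≤ L ^ 2 * (X p.2 p.1 - Y p.2 p.1) ^ 2 := by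
        rw [← sq_abs, ← sq_abs (X p.2 p.1 - Y p.2 p.1), ← mul_pow]
        exact pow_le_pow_left₀ (abs_nonneg _) h1 2
      simp only [joint, hDdef, hC]
      have := mul_le_mul_of_nonneg_left h2 (sq_nonneg hi)
      linarith
  rw [zero_mul] at hg
  have hz : ∫ ω, D T ω ^ 2 ∂P = 0 := le_antisymm hg (integral_nonneg fun _ => sq_nonneg _)
  rw [integral_eq_zero_iff_of_nonneg (fun _ => sq_nonneg _)
    (hD.memLp_X hP T).integrable_sq] at hz
  filter_upwards [hz] with ω hω
  have : D T ω = 0 := by simpa using hω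
  exact (sub_eq_zero.1 this).symm

end Sol

/-! ### The Euler scheme -/

/-- Up to time `c` the process is zero, so nothing about `Z` has to be known before `c`. The strict
inequality fits the half-open intervals of step processes. -/
theorem isProgressive_after {c : ℝ≥0} {Z : Path → ℝ} (hZ : Measurable[Filt c] Z) :
    IsProgressive Filt fun s ω => if c < s then Z ω else 0 := fun i => by
  by_cases h : c ≤ i
  · have hZ' : @Measurable _ _ (@Prod.instMeasurableSpace (Set.Iic i) Path _ (Filt i)) _
        fun p : Set.Iic i × Path => Z p.2 :=
      (hZ.mono (Filt.mono h) le_rfl).comp (@measurable_snd _ _ _ (Filt i))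
    refine Measurable.ite ?_ hZ' measurable_const
    exact measurableSet_lt measurable_const
      (measurable_subtype_coe.comp (@measurable_fst _ _ _ (Filt i)))
  · have : (fun p : Set.Iic i × Path => if c < (p.1 : ℝ≥0) then Z p.2 else 0) = fun _ => 0 := by
      ext p
      rw [if_neg fun h' => h (h'.le.trans p.1.2)]
    rw [this]
    exact measurable_const

theorem isProgressive_of_continuous {X : ℝ≥0 → Path → ℝ} (hX : ∀ t, Measurable[Filt t] (X t))
    (hc : ∀ ω, Continuous fun t => X t ω) : IsProgressive Filt X :=
  (StronglyAdapted.isStronglyProgressive_of_continuous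
    (fun t => (hX t).stronglyMeasurable) hc).isProgressive

theorem continuous_B (ω : Path) : Continuous fun t => B t ω := ω.2.1

theorem isProgressive_B_min (c : ℝ≥0) : IsProgressive Filt fun s ω => B (min c s) ω :=
  isProgressive_of_continuous (fun _ => measurable_B_filt (min_le_right _ _)) fun ω =>
    (continuous_B ω).comp (by fun_prop)

theorem isProgressive_of_time {f : ℝ≥0 → ℝ} (hf : Measurable f) :
    IsProgressive Filt fun s _ => f s := fun i =>
  hf.comp (measurable_subtype_coe.comp (@measurable_fst _ _ _ (Filt i)))

theorem isProgressive_sum {ι : Type*} (s : Finset ι) {X : ι → ℝ≥0 → Path → ℝ}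
    (h : ∀ i ∈ s, IsProgressive Filt (X i)) :
    IsProgressive Filt fun t ω => ∑ i ∈ s, X i t ω := fun i =>
  Finset.measurable_sum _ fun j hj => h j hj i

section Step

variable {n : ℕ} {t : ℕ → ℝ≥0} {ξ : ℕ → Path → ℝ} {lo hi : ℝ} {P : Measure Path}

theorem isProgressive_stepVal (hm : ∀ i, Measurable[Filt (t i)] (ξ i)) :
    IsProgressive Filt (stepVal n t ξ) := by
  refine isProgressive_sum _ fun i _ => ?_
  have e : (fun s ω => (Set.Ioc (t i) (t (i + 1))).indicator (fun _ => ξ i ω) s) = fun s ω =>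
      (Set.Iic (t (i + 1))).indicator 1 s * (if t i < s then ξ i ω else 0) := by
    ext s ω
    by_cases h1 : t i < s <;> by_cases h2 : s ≤ t (i + 1) <;> simp [Set.indicator, h1, h2]
  rw [e]
  exact (isProgressive_of_time (measurable_one.indicator measurableSet_Iic)).mul
    (isProgressive_after (hm i))

theorem isProgressive_stepInt (ht : Monotone t) (hm : ∀ i, Measurable[Filt (t i)] (ξ i)) :
    IsProgressive Filt (stepInt n t ξ) := by
  refine isProgressive_sum _ fun i _ => ?_
  have e : (fun s ω => ξ i ω * (B (min (t (i + 1)) s) ω - B (min (t i) s) ω)) = fun s ω =>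
      (if t i < s then ξ i ω else 0) * (B (min (t (i + 1)) s) ω - B (min (t i) s) ω) := by
    ext s ω
    split_ifs with h
    · rfl
    · rw [min_eq_right (not_lt.1 h), min_eq_right ((not_lt.1 h).trans (ht (Nat.le_succ i)))]
      simp
  rw [e]
  exact (isProgressive_after (hm i)).mul ((isProgressive_B_min _).sub (isProgressive_B_min _))

theorem primitive_stepVal (ht : Monotone t) (T : ℝ≥0) (ω : Path) :
    primitive (stepVal n t ξ) T ω =
      ∑ i ∈ Finset.range n, ξ i ω * ((min (t (i + 1)) T : ℝ≥0) - (min (t i) T : ℝ≥0) : ℝ) := by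
  unfold primitive stepVal
  rw [integral_finsetSum]
  · refine Finset.sum_congr rfl fun i _ => ?_
    rw [integral_indicator measurableSet_Ioc, setIntegral_const, measureReal_def,
      dt_restrict_Ioc _ _ _ (ht (Nat.le_succ i)), smul_eq_mul, mul_comm, ENNReal.toReal_ofReal]
    exact sub_nonneg.2 (by exact_mod_cast min_le_min (ht (Nat.le_succ i)) le_rfl)
  · exact fun i _ => (integrable_const _).indicator measurableSet_Ioc

theorem memLp_joint_stepVal [IsProbabilityMeasure P] (ht : Monotone t)
    (hm : ∀ i, Measurable (ξ i)) (h2 : ∀ i, MemLp (ξ i) 2 P) (T : ℝ≥0) :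
    MemLp (joint (stepVal n t ξ)) 2 (prodT P T) := by
  refine memLp_two_of_lintegral (measurable_joint_stepVal hm).aestronglyMeasurable ?_
  rw [lintegral_stepVal_sq ht hm]
  refine ENNReal.sum_lt_top.2 fun i _ => ENNReal.mul_lt_top ENNReal.ofReal_lt_top ?_
  rw [← eLpNorm_two_sq]
  exact ENNReal.pow_lt_top (h2 i).2

theorem memLp_joint_stepInt (hP : P ∈ priors lo hi) (h0 : 0 ≤ hi) (ht : Monotone t)
    (hm : ∀ i, Measurable[Filt (t i)] (ξ i)) (h2 : ∀ i, MemLp (ξ i) 2 P) (T : ℝ≥0) :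
    MemLp (joint (stepInt n t ξ)) 2 (prodT P T) := by
  have := hP.1
  have hmj := measurable_joint (isProgressive_stepInt (n := n) ht hm)
  refine memLp_two_of_lintegral hmj.aestronglyMeasurable ?_
  have hL := memLp_joint_stepVal (n := n) ht (fun i => (hm i).mono (Filt.le _) le_rfl) h2 T
  set A := ENNReal.ofReal hi * eLpNorm (joint (stepVal n t ξ)) 2 (prodT P T) with hA
  have hA' : A < ∞ := ENNReal.mul_lt_top ENNReal.ofReal_lt_top hL.2
  rw [lintegral_prod_symm _ (measurable_sq_joint hmj).aemeasurable]
  calc _ ≤ ∫⁻ _ in Set.Iic T, A ^ 2 ∂dt := by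
        refine setLIntegral_mono measurable_const fun s hs => ?_
        change ∫⁻ ω, ENNReal.ofReal (stepInt n t ξ s ω ^ 2) ∂P ≤ _
        rw [← eLpNorm_two_sq]
        refine pow_le_pow_left₀ zero_le ((eLpNorm_stepInt_le hP h0 ht hm h2 s).trans ?_) 2
        exact mul_le_mul' le_rfl (eLpNorm_mono_measure _ (prodT_mono hs))
    _ < ∞ := by
        rw [setLIntegral_const, dt_Iic]
        exact ENNReal.mul_lt_top (ENNReal.pow_lt_top hA') ENNReal.ofReal_lt_top

/-- The Itô process with step coefficients. -/
theorem itoProc_step (hP : P ∈ priors lo hi) (h0 : 0 ≤ hi) (ht : Monotone t) {ζ : ℕ → Path → ℝ}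
    (hm : ∀ i, Measurable[Filt (t i)] (ξ i)) (h2 : ∀ i, MemLp (ξ i) 2 P)
    (hm' : ∀ i, Measurable[Filt (t i)] (ζ i)) (h2' : ∀ i, MemLp (ζ i) 2 P) (x : ℝ) :
    ItoProc P x (fun s ω => x + (∑ i ∈ Finset.range n,
        ζ i ω * ((min (t (i + 1)) s : ℝ≥0) - (min (t i) s : ℝ≥0) : ℝ)) + stepInt n t ξ s ω)
      (stepVal n t ζ) (stepVal n t ξ) := by
  have := hP.1
  have e : (fun s ω => x + (∑ i ∈ Finset.range n,
        ζ i ω * ((min (t (i + 1)) s : ℝ≥0) - (min (t i) s : ℝ≥0) : ℝ)) + stepInt n t ξ s ω) =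
      fun s ω => x + primitive (stepVal n t ζ) s ω + stepInt n t ξ s ω := by
    ext s ω; rw [primitive_stepVal ht]
  have hmz : ∀ i, Measurable (ζ i) := fun i => (hm' i).mono (Filt.le _) le_rfl
  have hL := memLp_joint_stepVal (n := n) (P := P) ht hmz h2'
  refine ⟨?_, isProgressive_stepVal hm', isProgressive_stepVal hm, fun T => ?_, hL, fun T => ?_⟩
  · refine IsProgressive.add (IsProgressive.add (fun _ => measurable_const) ?_)
      (isProgressive_stepInt ht hm)
    refine isProgressive_sum _ fun i _ => ?_
    have e : (fun s ω => ζ i ω * ((min (t (i + 1)) s : ℝ≥0) - (min (t i) s : ℝ≥0) : ℝ)) =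
        fun s ω => (if t i < s then ζ i ω else 0) *
          ((min (t (i + 1)) s : ℝ≥0) - (min (t i) s : ℝ≥0) : ℝ) := by
      ext s ω
      split_ifs with h
      · rfl
      · rw [min_eq_right (not_lt.1 h), min_eq_right ((not_lt.1 h).trans (ht (Nat.le_succ i)))]
        simp
    rw [e]
    exact (isProgressive_after (hm' i)).mul (isProgressive_of_time (by fun_prop))
  · rw [e]
    exact ((memLp_const x).add (memLp_joint_primitive (measurable_joint_stepVal hmz) (hL T))).add
      (memLp_joint_stepInt hP h0 ht hm h2 T)
  · refine (hasItoIntegral_step hP h0 ht hm h2 T).congr (ae_eq_refl _) (ae_of_all _ fun ω => ?_)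
    have := primitive_stepVal (n := n) (ξ := ζ) ht T ω
    unfold primitive at this
    simp only [this]; ring

theorem stepVal_of_mem (ht : Monotone t) {k : ℕ} (hk : k < n) {s : ℝ≥0}
    (hs : s ∈ Set.Ioc (t k) (t (k + 1))) (ω : Path) : stepVal n t ξ s ω = ξ k ω := by
  unfold stepVal
  have hd : ∀ i, i ≠ k → s ∉ Set.Ioc (t i) (t (i + 1)) := fun i hik hi =>
    Set.disjoint_left.1 (ht.pairwise_disjoint_on_Ioc_succ hik) hi hs
  rw [Finset.sum_eq_single_of_mem k (Finset.mem_range.2 hk) fun i _ hik =>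
    Set.indicator_of_notMem (hd i hik) _, Set.indicator_of_mem hs]

end Step

/-- The values of the Euler scheme of `dX = (a X + b) dt + S(X) dB` on the grid `δ ℕ`. -/
noncomputable def euler (a b : ℝ) (S : ℝ → ℝ) (x : ℝ) (δ : ℝ≥0) : ℕ → Path → ℝ
  | 0 => fun _ => x
  | k + 1 => fun ω => euler a b S x δ k ω + (a * euler a b S x δ k ω + b) * δ +
      S (euler a b S x δ k ω) * (B ((k + 1 : ℕ) * δ) ω - B (k * δ) ω)

/-- The Euler scheme with `n` steps. -/
noncomputable def eulerProc (a b : ℝ) (S : ℝ → ℝ) (x : ℝ) (δ : ℝ≥0) (n : ℕ) (s : ℝ≥0)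
    (ω : Path) : ℝ :=
  x + (∑ i ∈ Finset.range n, (a * euler a b S x δ i ω + b) *
      ((min ((i + 1 : ℕ) * δ) s : ℝ≥0) - (min (i * δ) s : ℝ≥0) : ℝ)) +
    stepInt n (fun i => i * δ) (fun i ω => S (euler a b S x δ i ω)) s ω

section Euler

variable {lo hi a b x L : ℝ} {S : ℝ → ℝ} {P : Measure Path} {δ : ℝ≥0}

theorem monotone_grid (δ : ℝ≥0) : Monotone fun i : ℕ => (i : ℝ≥0) * δ := fun i j h => by
  have : (i : ℝ≥0) ≤ j := by exact_mod_cast h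
  exact mul_le_mul_left this δ

theorem measurable_euler (hS : Measurable S) (k : ℕ) :
    Measurable[Filt (k * δ)] (euler a b S x δ k) := by
  induction k with
  | zero => exact measurable_const
  | succ k ih =>
    have h := ih.mono (Filt.mono (monotone_grid δ (Nat.le_succ k))) le_rfl
    exact (h.add (((h.const_mul a).add_const b).mul_const _)).add
      ((hS.comp h).mul ((measurable_B_filt le_rfl).sub
        (measurable_B_filt (monotone_grid δ (Nat.le_succ k)))))

/-- Inside cell `k` the contributions of earlier cells are complete and add up to the grid value
`euler k`, while later cells contribute nothing. -/
theorem eulerProc_of_mem {n k : ℕ} (hk : k < n) {s : ℝ≥0}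
    (hs : s ∈ Set.Icc (k * δ) ((k + 1 : ℕ) * δ)) (ω : Path) :
    eulerProc a b S x δ n s ω = euler a b S x δ k ω + (a * euler a b S x δ k ω + b) * (s - k * δ) +
      S (euler a b S x δ k ω) * (B s ω - B (k * δ) ω) := by
  have hlow : ∀ j ≤ k, min ((j : ℝ≥0) * δ) s = j * δ := fun j hj =>
    min_eq_left ((monotone_grid δ hj).trans hs.1)
  have hhigh : ∀ j, k + 1 ≤ j → min ((j : ℝ≥0) * δ) s = s := fun j hj =>
    min_eq_right (hs.2.trans (monotone_grid δ hj))
  have hsum : ∀ j ≤ k, x + (∑ i ∈ Finset.range j, (a * euler a b S x δ i ω + b) *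
      ((min ((i + 1 : ℕ) * δ) s : ℝ≥0) - (min (i * δ) s : ℝ≥0) : ℝ)) +
      ∑ i ∈ Finset.range j, S (euler a b S x δ i ω) *
        (B (min ((i + 1 : ℕ) * δ) s) ω - B (min (i * δ) s) ω) = euler a b S x δ j ω := by
    intro j hj
    induction j with
    | zero => simp [euler]
    | succ j ih =>
      have := ih (Nat.le_of_succ_le hj)
      rw [Finset.sum_range_succ, Finset.sum_range_succ, hlow _ hj, hlow j (Nat.le_of_succ_le hj)]
      have c1 : (((j + 1 : ℕ) * δ : ℝ≥0) : ℝ) = j * δ + δ := by push_cast; ring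
      have c2 : ((j * δ : ℝ≥0) : ℝ) = j * δ := by push_cast; ring
      rw [euler, c1, c2]
      linear_combination this
  have hrest : ∀ (f : ℕ → ℝ), (∀ i, k + 1 ≤ i → f i = 0) →
      ∑ i ∈ Finset.range n, f i = ∑ i ∈ Finset.range k, f i + f k := fun f hf => by
    rw [← Finset.sum_range_succ]
    exact (Finset.sum_subset (Finset.range_subset_range.2 hk) fun i _ hi =>
      hf i (not_lt.1 fun h => hi (Finset.mem_range.2 h))).symm
  unfold eulerProc stepInt
  have c2 : ((k * δ : ℝ≥0) : ℝ) = k * δ := by push_cast; ring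
  rw [hrest, hrest, hlow k le_rfl, hhigh (k + 1) le_rfl, c2]
  · linear_combination hsum k le_rfl
  · intro i hi
    rw [hhigh i hi, hhigh _ (Nat.le_succ_of_le hi)]; simp
  · intro i hi
    rw [hhigh i hi, hhigh _ (Nat.le_succ_of_le hi)]; simp

end Euler

/-! ### Moment and convergence estimates for the Euler scheme -/

theorem continuous_of_lip {S : ℝ → ℝ} {L : ℝ} (hS : ∀ y z, |S y - S z| ≤ L * |y - z|) :
    Continuous S := by
  have hL : 0 ≤ L := by simpa using (abs_nonneg _).trans (hS 1 0)
  exact (LipschitzWith.of_dist_le_mul (K := ⟨L, hL⟩) fun y z => hS y z).continuous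

theorem memLp_comp_lip {α : Type*} {mα : MeasurableSpace α} {μ : Measure α} [IsFiniteMeasure μ]
    {S : ℝ → ℝ} {L : ℝ} (hS : ∀ y z, |S y - S z| ≤ L * |y - z|) {f : α → ℝ} (hf : MemLp f 2 μ) :
    MemLp (fun ω => S (f ω)) 2 μ := by
  refine MemLp.mono' ((memLp_const |S 0|).add (hf.abs.const_mul L))
    ((continuous_of_lip hS).comp_aestronglyMeasurable hf.1) (ae_of_all _ fun ω => ?_)
  have h1 := hS (f ω) 0
  have h2 := abs_sub_abs_le_abs_sub (S (f ω)) (S 0)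
  rw [sub_zero] at h1
  simp only [Pi.add_apply, Pi.abs_apply, Real.norm_eq_abs]
  change |S (f ω)| ≤ |S 0| + L * |f ω|
  linarith

/-- A constant of linear growth for the coefficients of the state equation. -/
def growth (hi a b : ℝ) (S : ℝ → ℝ) (L : ℝ) : ℝ :=
  2 * a ^ 2 + 2 * b ^ 2 + hi ^ 2 * (2 * S 0 ^ 2 + 2 * L ^ 2)

section Growth

variable {hi a b L : ℝ} {S : ℝ → ℝ}

theorem growth_nonneg : 0 ≤ growth hi a b S L := by unfold growth; positivity

theorem drift_sq_le (y : ℝ) : (a * y + b) ^ 2 ≤ growth hi a b S L * (1 + y ^ 2) := by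
  have h : 0 ≤ hi ^ 2 * (2 * S 0 ^ 2 + 2 * L ^ 2) * (1 + y ^ 2) := by positivity
  have h2 : 0 ≤ a ^ 2 + b ^ 2 * y ^ 2 := by positivity
  unfold growth
  nlinarith [sq_nonneg (a * y - b), sq_nonneg a, sq_nonneg b, sq_nonneg (b * y),
    sq_nonneg (a * y)]

theorem vol_sq_le (hS : ∀ y z, |S y - S z| ≤ L * |y - z|) (y : ℝ) :
    hi ^ 2 * S y ^ 2 ≤ growth hi a b S L * (1 + y ^ 2) := by
  have h1 := hS y 0
  rw [sub_zero] at h1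
  have h2 : (S y - S 0) ^ 2 ≤ L ^ 2 * y ^ 2 := by
    rw [← sq_abs, ← sq_abs y, ← mul_pow]; exact pow_le_pow_left₀ (abs_nonneg _) h1 2
  have h3 : S y ^ 2 ≤ 2 * S 0 ^ 2 + 2 * L ^ 2 * y ^ 2 := by nlinarith [sq_nonneg (S y - 2 * S 0)]
  have h4 := mul_le_mul_of_nonneg_left h3 (sq_nonneg hi)
  unfold growth
  have h5 : 0 ≤ (2 * a ^ 2 + 2 * b ^ 2) * (1 + y ^ 2) := by positivity
  have h6 : 0 ≤ hi ^ 2 * (2 * S 0 ^ 2 * y ^ 2 + 2 * L ^ 2) := by positivity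
  nlinarith

end Growth

theorem integral_mul_incr_sq_le {lo hi : ℝ} {P : Measure Path} (hP : P ∈ priors lo hi) {s t : ℝ≥0}
    (hst : s ≤ t) {Z : Path → ℝ} (hZ : Measurable[Filt s] Z) (hZ2 : MemLp Z 2 P) :
    ∫ ω, (Z ω * (B t ω - B s ω)) ^ 2 ∂P ≤ hi ^ 2 * (t - s) * ∫ ω, Z ω ^ 2 ∂P := by
  have hd : (0 : ℝ) ≤ t - s := sub_nonneg.2 (by exact_mod_cast hst)
  have h := lintegral_mul_incr_sq_le hP hst (f := fun ω => ENNReal.ofReal (Z ω ^ 2))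
    (hZ.pow_const 2).ennreal_ofReal
  simp_rw [← ENNReal.ofReal_mul (sq_nonneg _), ← mul_pow] at h
  rw [← ofReal_integral_eq_lintegral_ofReal (memLp_mul_incr hP hst hZ hZ2).integrable_sq
      (ae_of_all _ fun _ => sq_nonneg _),
    ← ofReal_integral_eq_lintegral_ofReal hZ2.integrable_sq (ae_of_all _ fun _ => sq_nonneg _),
    ← ENNReal.ofReal_mul (mul_nonneg (sq_nonneg _) hd)] at h
  exact (ENNReal.ofReal_le_ofReal_iff (mul_nonneg (mul_nonneg (sq_nonneg _) hd)
    (integral_nonneg fun _ => sq_nonneg _))).1 h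

/-- Time `0` has to be excluded because the cells are open on the left; it is a null set for all
later integrals. -/
theorem exists_mem_grid {δ : ℝ≥0} {n : ℕ} {s : ℝ≥0} (h0 : 0 < s) (hs : s ≤ n * δ) :
    ∃ k < n, s ∈ Set.Ioc ((k : ℝ≥0) * δ) ((k + 1 : ℕ) * δ) := by
  induction n with
  | zero => exact absurd (hs.trans_lt' h0) (by simp)
  | succ n ih =>
    by_cases h : s ≤ n * δ
    · obtain ⟨k, hk, hk'⟩ := ih h
      exact ⟨k, hk.trans n.lt_succ_self, hk'⟩
    · exact ⟨n, n.lt_succ_self, not_le.1 h, hs⟩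

section Euler

variable {lo hi a b x L : ℝ} {S : ℝ → ℝ} {P : Measure Path} {δ : ℝ≥0} {n : ℕ}

theorem memLp_euler (hP : P ∈ priors lo hi) (hS : ∀ y z, |S y - S z| ≤ L * |y - z|) (k : ℕ) :
    MemLp (euler a b S x δ k) 2 P := by
  have := hP.1
  induction k with
  | zero => exact memLp_const x
  | succ k ih =>
    have h := measurable_euler (a := a) (b := b) (x := x) (δ := δ)
      (continuous_of_lip hS).measurable k
    exact (ih.add (((ih.const_mul a).add (memLp_const b)).mul_const (δ : ℝ))).add
      (memLp_mul_incr hP (monotone_grid δ (Nat.le_succ k))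
        ((continuous_of_lip hS).measurable.comp h) (memLp_comp_lip hS ih))

theorem integral_sq_le_growth [IsProbabilityMeasure P] {f g : Path → ℝ} {G c : ℝ}
    (hf : MemLp f 2 P) (hg : MemLp g 2 P) (h : ∀ ω, c * g ω ^ 2 ≤ G * (1 + f ω ^ 2)) :
    c * ∫ ω, g ω ^ 2 ∂P ≤ G * (1 + ∫ ω, f ω ^ 2 ∂P) := by
  have e : 1 + ∫ ω, f ω ^ 2 ∂P = ∫ ω, (1 + f ω ^ 2) ∂P := by
    rw [integral_add (integrable_const _) hf.integrable_sq]; simp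
  rw [e, ← integral_const_mul, ← integral_const_mul]
  exact integral_mono (hg.integrable_sq.const_mul c)
    (((integrable_const _).add hf.integrable_sq).const_mul G) h

/-- A discrete Gronwall argument. The new increment of `B` is orthogonal to the past, so one step
multiplies `1 + E|X|²` by at most `1 + (1 + 3G) δ`, which is at most an exponential. The bound
involves `hi` but not the prior, which makes all later estimates uniform over priors. -/
theorem integral_euler_sq_le (hP : P ∈ priors lo hi) (hS : ∀ y z, |S y - S z| ≤ L * |y - z|)
    (hδ : δ ≤ 1) (k : ℕ) :
    1 + ∫ ω, euler a b S x δ k ω ^ 2 ∂P ≤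
      (1 + x ^ 2) * Real.exp ((1 + 3 * growth hi a b S L) * (k * δ)) := by
  have := hP.1
  set G := growth hi a b S L with hG
  have hG0 : 0 ≤ G := growth_nonneg
  have hδ' : (δ : ℝ) ≤ 1 := by exact_mod_cast hδ
  have hδ0 : (0 : ℝ) ≤ δ := δ.coe_nonneg
  induction k with
  | zero => simp [euler]
  | succ k ih =>
    set E := euler a b S x δ k with hE
    have hEm : Measurable[Filt (k * δ)] E := measurable_euler (continuous_of_lip hS).measurable k
    have hE2 : MemLp E 2 P := memLp_euler hP hS k
    have hSE := memLp_comp_lip hS hE2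
    have hSm : Measurable[Filt (k * δ)] fun ω => S (E ω) :=
      (continuous_of_lip hS).measurable.comp hEm
    have hD2 : MemLp (fun ω => a * E ω + b) 2 P := (hE2.const_mul a).add (memLp_const b)
    have hU : MemLp (fun ω => E ω + (a * E ω + b) * δ) 2 P := hE2.add (hD2.mul_const (δ : ℝ))
    have hst := monotone_grid δ (Nat.le_succ k)
    have hV := memLp_mul_incr hP hst hSm hSE
    set V : Path → ℝ := fun ω => S (E ω) * (B ((k + 1 : ℕ) * δ) ω - B (k * δ) ω) with hVdef
    have hUV : ∫ ω, (E ω + (a * E ω + b) * δ) * V ω ∂P = 0 := by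
      have i := hU.integrable_mul hV
      have := integral_mul_incr hP hst (Z := fun ω => (E ω + (a * E ω + b) * δ) * S (E ω))
        ((hEm.add (((hEm.const_mul a).add_const b).mul_const _)).mul hSm)
        (i.congr (ae_of_all _ fun ω => by simp [hVdef, mul_assoc]))
      rw [← this]
      exact integral_congr_ae (ae_of_all _ fun ω => by simp [hVdef, mul_assoc])
    have e : ∫ ω, euler a b S x δ (k + 1) ω ^ 2 ∂P =
        ∫ ω, (E ω + (a * E ω + b) * δ) ^ 2 ∂P + ∫ ω, V ω ^ 2 ∂P := by
      have e1 : ∀ ω, euler a b S x δ (k + 1) ω ^ 2 = (E ω + (a * E ω + b) * δ) ^ 2 +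
          2 * ((E ω + (a * E ω + b) * δ) * V ω) + V ω ^ 2 := fun ω => by
        simp only [euler, hVdef, ← hE]; ring
      have i12 : Integrable (fun ω => (E ω + (a * E ω + b) * δ) ^ 2 +
          2 * ((E ω + (a * E ω + b) * δ) * V ω)) P :=
        hU.integrable_sq.add ((hU.integrable_mul hV).const_mul 2)
      have i2 : Integrable (fun ω => 2 * ((E ω + (a * E ω + b) * δ) * V ω)) P :=
        (hU.integrable_mul hV).const_mul 2
      simp_rw [e1]
      rw [integral_add i12 hV.integrable_sq, integral_add hU.integrable_sq i2,
        integral_const_mul, hUV]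
      ring
    have b2 : ∫ ω, V ω ^ 2 ∂P ≤ δ * (G * (1 + ∫ ω, E ω ^ 2 ∂P)) := by
      refine (integral_mul_incr_sq_le hP hst hSm hSE).trans ?_
      have := integral_sq_le_growth hE2 hSE (fun ω => vol_sq_le (a := a) (b := b) (hi := hi) hS (E ω))
      have c : ((((k + 1 : ℕ) : ℝ≥0) * δ : ℝ≥0) : ℝ) - ((k : ℝ≥0) * δ : ℝ≥0) = δ := by
        push_cast; ring
      rw [c]
      have := mul_le_mul_of_nonneg_left this hδ0
      linarith
    have b1 : ∫ ω, (E ω + (a * E ω + b) * δ) ^ 2 ∂P ≤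
        ∫ ω, E ω ^ 2 ∂P + δ * ((1 + 2 * G) * (1 + ∫ ω, E ω ^ 2 ∂P)) := by
      have e1 : 1 + ∫ ω, E ω ^ 2 ∂P = ∫ ω, (1 + E ω ^ 2) ∂P := by
        rw [integral_add (integrable_const _) hE2.integrable_sq]; simp
      have i1 : Integrable (fun ω => 1 + E ω ^ 2) P := (integrable_const _).add hE2.integrable_sq
      rw [e1, ← integral_const_mul, ← integral_const_mul,
        ← integral_add hE2.integrable_sq ((i1.const_mul _).const_mul _)]
      refine integral_mono hU.integrable_sq
        (hE2.integrable_sq.add ((i1.const_mul _).const_mul _)) fun ω => ?_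
      have h1 : (a * E ω + b) ^ 2 ≤ G * (1 + E ω ^ 2) := drift_sq_le _
      -- Here the step size is at most `1`, so `δ²` may be replaced by `δ`.
      have h2 : (a * E ω + b) ^ 2 * δ ^ 2 ≤ (a * E ω + b) ^ 2 * δ :=
        mul_le_mul_of_nonneg_left (by nlinarith) (sq_nonneg _)
      have h3 := mul_le_mul_of_nonneg_left h1 hδ0
      have h4 : 0 ≤ δ * (E ω - (a * E ω + b)) ^ 2 := mul_nonneg hδ0 (sq_nonneg _)
      dsimp only
      nlinarith
    set M := ∫ ω, E ω ^ 2 ∂P with hM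
    have hM0 : 0 ≤ M := integral_nonneg fun _ => sq_nonneg _
    rw [e]
    calc _ ≤ (1 + M) * ((1 + 3 * G) * δ + 1) := by linarith
      _ ≤ (1 + M) * Real.exp ((1 + 3 * G) * δ) :=
        mul_le_mul_of_nonneg_left (Real.add_one_le_exp _) (by linarith)
      _ ≤ (1 + x ^ 2) * Real.exp ((1 + 3 * G) * (k * δ)) * Real.exp ((1 + 3 * G) * δ) :=
        mul_le_mul_of_nonneg_right ih (Real.exp_pos _).le
      _ = _ := by
        rw [mul_assoc, ← Real.exp_add]; congr 2; push_cast; ring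

/-- The state frozen at the last grid point. -/
noncomputable abbrev frozen (a b : ℝ) (S : ℝ → ℝ) (x : ℝ) (δ : ℝ≥0) (n : ℕ) :
    ℝ≥0 → Path → ℝ := stepVal n (fun i => i * δ) (euler a b S x δ)

theorem integral_frozen_sq_le (hP : P ∈ priors lo hi) (hS : ∀ y z, |S y - S z| ≤ L * |y - z|)
    (hδ : δ ≤ 1) {s : ℝ≥0} (h0 : 0 < s) (hs : s ≤ n * δ) :
    ∫ ω, frozen a b S x δ n s ω ^ 2 ∂P ≤
      (1 + x ^ 2) * Real.exp ((1 + 3 * growth hi a b S L) * s) := by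
  obtain ⟨k, hk, hk'⟩ := exists_mem_grid h0 hs
  simp_rw [frozen, stepVal_of_mem (monotone_grid δ) hk hk']
  have h := integral_euler_sq_le (a := a) (b := b) (x := x) hP hS hδ k
  have hG : 0 ≤ growth hi a b S L := growth_nonneg
  have h1 : ((k : ℝ) * δ) ≤ s := by exact_mod_cast hk'.1.le
  have h2 : Real.exp ((1 + 3 * growth hi a b S L) * (k * δ)) ≤
    Real.exp ((1 + 3 * growth hi a b S L) * s) := by gcongr
  have h3 := mul_le_mul_of_nonneg_left h2 (by positivity : 0 ≤ 1 + x ^ 2)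
  linarith

/-- Within one cell the drift moves the state by order `δ` and the noise by order `√δ` in `L²`,
hence the squared displacement is of order `δ`. -/
theorem integral_sub_frozen_sq_le (hP : P ∈ priors lo hi)
    (hS : ∀ y z, |S y - S z| ≤ L * |y - z|) (hδ : δ ≤ 1) {s : ℝ≥0} (h0 : 0 < s) (hs : s ≤ n * δ) :
    ∫ ω, (eulerProc a b S x δ n s ω - frozen a b S x δ n s ω) ^ 2 ∂P ≤
      4 * growth hi a b S L * δ * ((1 + x ^ 2) * Real.exp ((1 + 3 * growth hi a b S L) * s)) := by
  have := hP.1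
  obtain ⟨k, hk, hk'⟩ := exists_mem_grid h0 hs
  simp_rw [frozen, stepVal_of_mem (monotone_grid δ) hk hk', eulerProc_of_mem hk ⟨hk'.1.le, hk'.2⟩]
  set G := growth hi a b S L with hG
  have hG0 : 0 ≤ G := growth_nonneg
  set E := euler a b S x δ k with hE
  have hEm : Measurable[Filt (k * δ)] E := measurable_euler (continuous_of_lip hS).measurable k
  have hE2 : MemLp E 2 P := memLp_euler hP hS k
  have hSE := memLp_comp_lip hS hE2
  have hSm : Measurable[Filt (k * δ)] fun ω => S (E ω) :=
    (continuous_of_lip hS).measurable.comp hEm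
  have hD2 : MemLp (fun ω => a * E ω + b) 2 P := (hE2.const_mul a).add (memLp_const b)
  have hV := memLp_mul_incr hP hk'.1.le hSm hSE
  have hr0 : (0 : ℝ) ≤ s - k * δ := sub_nonneg.2 (by exact_mod_cast hk'.1.le)
  have hr1 : (s : ℝ) - k * δ ≤ δ := by
    have : (s : ℝ) ≤ (k + 1 : ℕ) * δ := by exact_mod_cast hk'.2
    push_cast at this; linarith
  have hδ' : (δ : ℝ) ≤ 1 := by exact_mod_cast hδ
  set r : ℝ := s - k * δ with hr
  have b1 := integral_sq_le_growth (c := 1) (G := G) hE2 hD2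
    (fun ω => by rw [one_mul]; exact drift_sq_le (E ω))
  have b2 := (integral_mul_incr_sq_le hP hk'.1.le hSm hSE)
  have b3 := integral_sq_le_growth hE2 hSE
    (fun ω => vol_sq_le (a := a) (b := b) (hi := hi) hS (E ω))
  have c : (s : ℝ) - ((k : ℝ≥0) * δ : ℝ≥0) = r := by rw [hr]; push_cast; ring
  rw [c] at b2
  have hI : ∫ ω, (E ω + (a * E ω + b) * r + S (E ω) * (B s ω - B (k * δ) ω) - E ω) ^ 2 ∂P ≤
      2 * r ^ 2 * ∫ ω, (a * E ω + b) ^ 2 ∂P +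
        2 * ∫ ω, (S (E ω) * (B s ω - B (k * δ) ω)) ^ 2 ∂P := by
    rw [← integral_const_mul, ← integral_const_mul,
      ← integral_add (hD2.integrable_sq.const_mul _) (hV.integrable_sq.const_mul _)]
    refine integral_mono_of_nonneg (ae_of_all _ fun _ => sq_nonneg _)
      ((hD2.integrable_sq.const_mul _).add (hV.integrable_sq.const_mul _))
      (ae_of_all _ fun ω => ?_)
    have := sq_nonneg ((a * E ω + b) * r - S (E ω) * (B s ω - B (k * δ) ω))
    dsimp only
    nlinarith
  refine hI.trans ?_
  set M := ∫ ω, E ω ^ 2 ∂P with hM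
  have hM0 : 0 ≤ M := integral_nonneg fun _ => sq_nonneg _
  have hm := integral_euler_sq_le (a := a) (b := b) (x := x) hP hS hδ k
  rw [← hE, ← hM, ← hG] at hm
  have hexp : (1 + x ^ 2) * Real.exp ((1 + 3 * G) * (k * δ)) ≤
      (1 + x ^ 2) * Real.exp ((1 + 3 * G) * s) := by
    have : ((k : ℝ) * δ) ≤ s := by linarith
    gcongr
  set W := (1 + x ^ 2) * Real.exp ((1 + 3 * G) * s) with hW
  have hMW : 1 + M ≤ W := hm.trans hexp
  have hA : r ^ 2 * ∫ ω, (a * E ω + b) ^ 2 ∂P ≤ δ * (G * W) := by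
    have h1 : r ^ 2 ≤ δ := by nlinarith
    refine mul_le_mul h1 ?_ (integral_nonneg fun _ => sq_nonneg _) δ.coe_nonneg
    rw [one_mul] at b1
    exact b1.trans (mul_le_mul_of_nonneg_left hMW hG0)
  have hB : ∫ ω, (S (E ω) * (B s ω - B (k * δ) ω)) ^ 2 ∂P ≤ δ * (G * W) := by
    refine b2.trans ?_
    calc hi ^ 2 * r * ∫ ω, S (E ω) ^ 2 ∂P = r * (hi ^ 2 * ∫ ω, S (E ω) ^ 2 ∂P) := by ring
      _ ≤ δ * (G * W) := mul_le_mul hr1 (b3.trans (mul_le_mul_of_nonneg_left hMW hG0))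
        (mul_nonneg (sq_nonneg _) (integral_nonneg fun _ => sq_nonneg _)) δ.coe_nonneg
  linarith

theorem itoProc_eulerProc (hP : P ∈ priors lo hi) (h0 : 0 ≤ hi)
    (hS : ∀ y z, |S y - S z| ≤ L * |y - z|) :
    ItoProc P x (eulerProc a b S x δ n)
      (stepVal n (fun i => i * δ) fun i ω => a * euler a b S x δ i ω + b)
      (stepVal n (fun i => i * δ) fun i ω => S (euler a b S x δ i ω)) := by
  have := hP.1
  have hm := measurable_euler (a := a) (b := b) (x := x) (δ := δ) (continuous_of_lip hS).measurable
  have h2 := memLp_euler (a := a) (b := b) (x := x) (δ := δ) hP hS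
  exact itoProc_step hP h0 (monotone_grid δ)
    (fun i => (continuous_of_lip hS).measurable.comp (hm i)) (fun i => memLp_comp_lip hS (h2 i))
    (fun i => ((hm i).const_mul a).add_const b)
    (fun i => ((h2 i).const_mul a).add (memLp_const b)) x

theorem drift_eulerProc {s : ℝ≥0} (h0 : 0 < s) (hs : s ≤ n * δ) (φ : ℝ → ℝ) (ω : Path) :
    stepVal n (fun i => i * δ) (fun i ω => φ (euler a b S x δ i ω)) s ω =
      φ (frozen a b S x δ n s ω) := by
  obtain ⟨k, hk, hk'⟩ := exists_mem_grid h0 hs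
  rw [frozen, stepVal_of_mem (monotone_grid δ) hk hk', stepVal_of_mem (monotone_grid δ) hk hk']

theorem memLp_frozen (hP : P ∈ priors lo hi) (hS : ∀ y z, |S y - S z| ≤ L * |y - z|) (T : ℝ≥0) :
    MemLp (joint (frozen a b S x δ n)) 2 (prodT P T) := by
  have := hP.1
  exact memLp_joint_stepVal (monotone_grid δ)
    (fun i => (measurable_euler (continuous_of_lip hS).measurable i).mono (Filt.le _) le_rfl)
    (memLp_euler hP hS) T

theorem ae_pos_time (P : Measure Path) [SFinite P] (T : ℝ≥0) :
    ∀ᵐ p ∂prodT P T, 0 < p.2 ∧ p.2 ≤ T := by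
  have h1 : ∀ᵐ s ∂dt.restrict (Set.Iic T), 0 < s ∧ s ≤ T := by
    have : ∀ᵐ s ∂dt.restrict (Set.Iic T), s ≠ 0 := Measure.ae_ne _ 0
    filter_upwards [ae_restrict_mem measurableSet_Iic, this] with s hs hs'
    exact ⟨pos_iff_ne_zero.2 hs', hs⟩
  exact Measure.quasiMeasurePreserving_snd.ae h1

theorem integral_joint_sub_frozen_sq_le (hP : P ∈ priors lo hi) (hi0 : 0 ≤ hi)
    (hS : ∀ y z, |S y - S z| ≤ L * |y - z|) (hδ : δ ≤ 1) {T : ℝ≥0} (hT : T ≤ n * δ) :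
    ∫ p, (joint (eulerProc a b S x δ n) p - joint (frozen a b S x δ n) p) ^ 2 ∂prodT P T ≤
      T * (4 * growth hi a b S L * δ *
        ((1 + x ^ 2) * Real.exp ((1 + 3 * growth hi a b S L) * T))) := by
  have := hP.1
  have hX := (itoProc_eulerProc (a := a) (b := b) (x := x) (δ := δ) (n := n) hP hi0 hS).sqX T
  have hF := memLp_frozen (a := a) (b := b) (x := x) (δ := δ) (n := n) hP hS T
  have hi2 := (hX.sub hF).integrable_sq
  simp only [Pi.sub_apply] at hi2
  have hG : 0 ≤ growth hi a b S L := growth_nonneg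
  set Z : ℝ := 4 * growth hi a b S L * δ *
        ((1 + x ^ 2) * Real.exp ((1 + 3 * growth hi a b S L) * T)) with hZ
  have e : (T : ℝ) * Z = ∫ _ in Set.Iic T, Z ∂dt := by
    rw [setIntegral_const, measureReal_def, dt_Iic, ENNReal.toReal_ofReal T.coe_nonneg, smul_eq_mul]
  rw [e, integral_prodT hi2]
  refine integral_mono_ae hi2.integral_prod_right (integrable_const _) ?_
  have : ∀ᵐ s ∂dt.restrict (Set.Iic T), s ≠ 0 := Measure.ae_ne _ 0
  filter_upwards [ae_restrict_mem measurableSet_Iic, this] with s hs hs'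
  have hs2 : s ≤ T := hs
  refine (integral_sub_frozen_sq_le hP hS hδ (pos_iff_ne_zero.2 hs') (hs2.trans hT)).trans ?_
  have : (s : ℝ) ≤ T := by exact_mod_cast hs2
  rw [hZ]
  gcongr

/-- Two Euler schemes are close to each other. -/
theorem integral_eulerProc_sub_sq_le (hP : P ∈ priors lo hi) (hi0 : 0 ≤ hi)
    (hS : ∀ y z, |S y - S z| ≤ L * |y - z|) {δ' : ℝ≥0} {n' : ℕ} (hδ : δ ≤ 1) (hδ' : δ' ≤ 1)
    {T : ℝ≥0} (hT : T ≤ n * δ) (hT' : T ≤ n' * δ') :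
    ∫ ω, (eulerProc a b S x δ n T ω - eulerProc a b S x δ' n' T ω) ^ 2 ∂P ≤
      3 * (a ^ 2 + hi ^ 2 * L ^ 2) * (T * (4 * growth hi a b S L *
        ((1 + x ^ 2) * Real.exp ((1 + 3 * growth hi a b S L) * T)))) *
        (1 + Real.exp (2 * (1 + 3 * (a ^ 2 + hi ^ 2 * L ^ 2)) * T)) * (δ + δ') := by
  have := hP.1
  have h1 := itoProc_eulerProc (a := a) (b := b) (x := x) (δ := δ) (n := n) hP hi0 hS
  have h2 := itoProc_eulerProc (a := a) (b := b) (x := x) (δ := δ') (n := n') hP hi0 hS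
  have hD := h1.sub h2 hP
  set D : ℝ≥0 → Path → ℝ := fun s ω => eulerProc a b S x δ n s ω - eulerProc a b S x δ' n' s ω
    with hDdef
  have hG : 0 ≤ growth hi a b S L := growth_nonneg
  set Q : ℝ := a ^ 2 + hi ^ 2 * L ^ 2 with hQ
  have hQ0 : 0 ≤ Q := by positivity
  set Z : ℝ := 4 * growth hi a b S L *
        ((1 + x ^ 2) * Real.exp ((1 + 3 * growth hi a b S L) * T)) with hZ
  have hZ0 : 0 ≤ Z := by positivity
  have hloc : IntegrableOn (fun s => ∫ ω, D s ω ^ 2 ∂P) (Set.Iic T) dt :=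
    (hD.sqX T).integrable_sq.integral_prod_right
  -- The difference of two schemes has coefficients evaluated at frozen states. Up to freezing
  -- errors of order `δ + δ'`, these are Lipschitz in the difference itself.
  have hg := gronwall (K := 3 * Q * (T * Z * (δ + δ'))) (C := 1 + 3 * Q) (by positivity)
    (by positivity) hloc (fun s => integral_nonneg fun _ => sq_nonneg _) fun s hs => by
      refine (hD.integral_X_sq_le hP hi0 s).trans ?_
      rw [sub_self, zero_pow two_ne_zero, zero_add]
      have hF := memLp_frozen (a := a) (b := b) (x := x) (δ := δ) (n := n) hP hS s
      have hF' := memLp_frozen (a := a) (b := b) (x := x) (δ := δ') (n := n') hP hS s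
      have iD := (hD.sqX s).integrable_sq
      have ie := ((h1.sqX s).sub hF).integrable_sq
      have ie' := ((h2.sqX s).sub hF').integrable_sq
      simp only [Pi.sub_apply] at ie ie'
      have bE := integral_joint_sub_frozen_sq_le (a := a) (b := b) (x := x) hP hi0 hS hδ
        (hs.trans hT)
      have bE' := integral_joint_sub_frozen_sq_le (a := a) (b := b) (x := x) hP hi0 hS hδ'
        (hs.trans hT')
      have hsT : (s : ℝ) ≤ T := by exact_mod_cast hs
      have c1 : (s : ℝ) * (4 * growth hi a b S L * δ *
          ((1 + x ^ 2) * Real.exp ((1 + 3 * growth hi a b S L) * s))) ≤ T * Z * δ := by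
        have : (s : ℝ) * (4 * growth hi a b S L * δ *
          ((1 + x ^ 2) * Real.exp ((1 + 3 * growth hi a b S L) * s))) ≤
          T * (4 * growth hi a b S L * δ *
          ((1 + x ^ 2) * Real.exp ((1 + 3 * growth hi a b S L) * T))) := by gcongr
        rw [hZ]; linarith
      have c2 : (s : ℝ) * (4 * growth hi a b S L * δ' *
          ((1 + x ^ 2) * Real.exp ((1 + 3 * growth hi a b S L) * s))) ≤ T * Z * δ' := by
        have : (s : ℝ) * (4 * growth hi a b S L * δ' *
          ((1 + x ^ 2) * Real.exp ((1 + 3 * growth hi a b S L) * s))) ≤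
          T * (4 * growth hi a b S L * δ' *
          ((1 + x ^ 2) * Real.exp ((1 + 3 * growth hi a b S L) * T))) := by gcongr
        rw [hZ]; linarith
      have e : ∫ r in Set.Iic s, ∫ ω, D r ω ^ 2 ∂P ∂dt = ∫ p, joint D p ^ 2 ∂prodT P s := by
        rw [integral_prodT iD]; rfl
      rw [e]
      have hmono : ∫ p, (joint D p ^ 2 +
          joint (fun s ω => stepVal n (fun i => i * δ) (fun i ω => a * euler a b S x δ i ω + b) s ω -
            stepVal n' (fun i => i * δ') (fun i ω => a * euler a b S x δ' i ω + b) s ω) p ^ 2 +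
          hi ^ 2 * joint (fun s ω => stepVal n (fun i => i * δ) (fun i ω => S (euler a b S x δ i ω)) s ω -
            stepVal n' (fun i => i * δ') (fun i ω => S (euler a b S x δ' i ω)) s ω) p ^ 2)
          ∂prodT P s ≤ ∫ p, ((1 + 3 * Q) * joint D p ^ 2 + (3 * Q *
            (joint (eulerProc a b S x δ n) p - joint (frozen a b S x δ n) p) ^ 2 + 3 * Q *
            (joint (eulerProc a b S x δ' n') p - joint (frozen a b S x δ' n') p) ^ 2))
            ∂prodT P s := by
        refine integral_mono_ae ((iD.add (hD.sqβ s).integrable_sq).add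
          ((hD.sqH hP s).integrable_sq.const_mul _))
          ((iD.const_mul _).add ((ie.const_mul _).add (ie'.const_mul _))) ?_
        filter_upwards [ae_pos_time P s] with p hp
        simp only [joint, hDdef]
        rw [drift_eulerProc hp.1 (hp.2.trans (hs.trans hT)) (fun y => a * y + b),
          drift_eulerProc hp.1 (hp.2.trans (hs.trans hT')) (fun y => a * y + b),
          drift_eulerProc hp.1 (hp.2.trans (hs.trans hT)) S,
          drift_eulerProc hp.1 (hp.2.trans (hs.trans hT')) S]
        set u := eulerProc a b S x δ n p.2 p.1
        set u' := eulerProc a b S x δ' n' p.2 p.1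
        set f := frozen a b S x δ n p.2 p.1
        set f' := frozen a b S x δ' n' p.2 p.1
        have q1 : hi ^ 2 * (S f - S f') ^ 2 ≤ hi ^ 2 * (L ^ 2 * (f - f') ^ 2) := by
          refine mul_le_mul_of_nonneg_left ?_ (sq_nonneg _)
          rw [← sq_abs, ← sq_abs (f - f'), ← mul_pow]
          exact pow_le_pow_left₀ (abs_nonneg _) (hS f f') 2
        -- The factor `3` comes from splitting `f - f'` into `f - u`, `u - u'` and `u' - f'`.
        have q2 : (f - f') ^ 2 ≤ 3 * ((u - u') ^ 2 + (u - f) ^ 2 + (u' - f') ^ 2) := by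
          nlinarith [sq_nonneg ((u - u') + (u - f)), sq_nonneg ((u - u') - (u' - f')),
            sq_nonneg ((u - f) + (u' - f'))]
        have q3 := mul_le_mul_of_nonneg_left q2 hQ0
        have q4 : (a * f + b - (a * f' + b)) ^ 2 = a ^ 2 * (f - f') ^ 2 := by ring
        rw [q4]
        have q5 : a ^ 2 * (f - f') ^ 2 + hi ^ 2 * (L ^ 2 * (f - f') ^ 2) = Q * (f - f') ^ 2 := by
          rw [hQ]; ring
        linarith
      refine hmono.trans ?_
      have iee : Integrable (fun p => 3 * Q *
          (joint (eulerProc a b S x δ n) p - joint (frozen a b S x δ n) p) ^ 2 + 3 * Q *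
          (joint (eulerProc a b S x δ' n') p - joint (frozen a b S x δ' n') p) ^ 2) (prodT P s) :=
        (ie.const_mul _).add (ie'.const_mul _)
      rw [integral_add (iD.const_mul _) iee, integral_add (ie.const_mul _) (ie'.const_mul _),
        integral_const_mul, integral_const_mul, integral_const_mul]
      have d1 := mul_le_mul_of_nonneg_left (bE.trans c1) (by positivity : 0 ≤ 3 * Q)
      have d2 := mul_le_mul_of_nonneg_left (bE'.trans c2) (by positivity : 0 ≤ 3 * Q)
      linarith
  refine hg.trans (le_of_eq ?_)
  ring

end Euler

/-! ### Existence of solutions -/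

theorem measurable_limUnder_seq {α : Type*} {mα : MeasurableSpace α} {f : ℕ → α → ℝ}
    (h : ∀ n, Measurable (f n)) : Measurable fun p => limUnder atTop fun n => f n p :=
  (StronglyMeasurable.limUnder (l := atTop) fun n => (h n).stronglyMeasurable).measurable

/-- The Euler schemes with step `4⁻ⁿ` on `[0, n]`. -/
noncomputable def eulerSeq (a b : ℝ) (S : ℝ → ℝ) (x : ℝ) (n : ℕ) : ℝ≥0 → Path → ℝ :=
  eulerProc a b S x ((1 / 4) ^ n) (n * 4 ^ n)

/-- The limit of the Euler schemes. -/
noncomputable def eulerLim (a b : ℝ) (S : ℝ → ℝ) (x : ℝ) (t : ℝ≥0) (ω : Path) : ℝ :=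
  limUnder atTop fun n => eulerSeq a b S x n t ω

/-- The constant in the error estimate of the Euler scheme. -/
noncomputable def eulerConst (hi a b : ℝ) (S : ℝ → ℝ) (L x T : ℝ) : ℝ :=
  3 * (a ^ 2 + hi ^ 2 * L ^ 2) * (T * (4 * growth hi a b S L *
    ((1 + x ^ 2) * Real.exp ((1 + 3 * growth hi a b S L) * T)))) *
    (1 + Real.exp (2 * (1 + 3 * (a ^ 2 + hi ^ 2 * L ^ 2)) * T))

theorem tsum_ofReal_geometric (C : ℝ) (hC : 0 ≤ C) :
    ∑' N : ℕ, ENNReal.ofReal (C * (1 / 2) ^ N) ≠ ∞ := by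
  rw [← ENNReal.ofReal_tsum_of_nonneg (fun N => by positivity)
    ((summable_geometric_of_lt_one (by norm_num) (by norm_num)).mul_left C)]
  exact ENNReal.ofReal_ne_top

theorem eLpNorm_le_of_integral_sq_le {α : Type*} {mα : MeasurableSpace α} {μ : Measure α}
    {f : α → ℝ} (hf : MemLp f 2 μ) {c : ℝ} (h : ∫ ω, f ω ^ 2 ∂μ ≤ c ^ 2) (hc : 0 ≤ c) :
    eLpNorm f 2 μ ≤ ENNReal.ofReal c := by
  rw [← ENNReal.pow_le_pow_left_iff two_ne_zero, eLpNorm_two_sq_eq_ofReal hf,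
    ← ENNReal.ofReal_pow hc]
  exact ENNReal.ofReal_le_ofReal h

section

variable {lo hi a b x L : ℝ} {S : ℝ → ℝ} {P : Measure Path}

theorem eulerConst_nonneg {T : ℝ} (hT : 0 ≤ T) : 0 ≤ eulerConst hi a b S L x T := by
  have : 0 ≤ growth hi a b S L := growth_nonneg
  unfold eulerConst; positivity

theorem eulerConst_mono {s T : ℝ} (hs : 0 ≤ s) (h : s ≤ T) :
    eulerConst hi a b S L x s ≤ eulerConst hi a b S L x T := by
  have : 0 ≤ growth hi a b S L := growth_nonneg
  have hT := hs.trans h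
  unfold eulerConst; gcongr

theorem quarter_pow_le_one (n : ℕ) : ((1 / 4 : ℝ≥0)) ^ n ≤ 1 :=
  pow_le_one₀ zero_le (by rw [div_le_one (by norm_num)]; norm_num)

/-- Exactly `n * 4 ^ n` steps of length `4⁻ⁿ` reach time `n`. -/
theorem le_horizon {T : ℝ≥0} {n : ℕ} (h : T ≤ n) :
    T ≤ ((n * 4 ^ n : ℕ) : ℝ≥0) * (1 / 4) ^ n := by
  push_cast
  rw [mul_assoc, ← mul_pow]
  simpa using h

theorem eLpNorm_eulerSeq_sub_le (hP : P ∈ priors lo hi) (hi0 : 0 ≤ hi)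
    (hS : ∀ y z, |S y - S z| ≤ L * |y - z|) {T : ℝ≥0} {N n m : ℕ} (hn : T ≤ n) (hm : T ≤ m)
    (hNn : N ≤ n) (hNm : N ≤ m) :
    eLpNorm (eulerSeq a b S x n T - eulerSeq a b S x m T) 2 P ≤
      ENNReal.ofReal (√(2 * eulerConst hi a b S L x T) * (1 / 2) ^ N) := by
  have hK : 0 ≤ eulerConst hi a b S L x T := eulerConst_nonneg T.coe_nonneg
  refine eLpNorm_le_of_integral_sq_le
    (((itoProc_eulerProc hP hi0 hS).memLp_X hP T).sub
      ((itoProc_eulerProc hP hi0 hS).memLp_X hP T)) ?_ (by positivity)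
  refine (integral_eulerProc_sub_sq_le hP hi0 hS (quarter_pow_le_one n) (quarter_pow_le_one m)
    (le_horizon hn) (le_horizon hm)).trans ?_
  change eulerConst hi a b S L x T * _ ≤ _
  rw [mul_pow, Real.sq_sqrt (by positivity), ← pow_mul, mul_comm N 2, pow_mul]
  push_cast
  have h1 : ((1 : ℝ) / 4) ^ n ≤ (1 / 4) ^ N := pow_le_pow_of_le_one (by norm_num) (by norm_num) hNn
  have h2 : ((1 : ℝ) / 4) ^ m ≤ (1 / 4) ^ N := pow_le_pow_of_le_one (by norm_num) (by norm_num) hNm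
  have h3 : ((1 : ℝ) / 2) ^ 2 = 1 / 4 := by norm_num
  rw [h3]
  have := mul_le_mul_of_nonneg_left (add_le_add h1 h2) hK
  linarith

/-- Steps of length `4⁻ⁿ` make the successive `L²` errors of order `2⁻ⁿ`, hence summable, and
convergence is almost sure under each prior. The limit `eulerLim` is taken path by path without
reference to a prior, so a single process serves all the mutually singular priors. -/
theorem ae_tendsto_eulerSeq (hP : P ∈ priors lo hi) (hi0 : 0 ≤ hi)
    (hS : ∀ y z, |S y - S z| ≤ L * |y - z|) (T : ℝ≥0) :
    ∀ᵐ ω ∂P, Tendsto (fun n => eulerSeq a b S x n T ω) atTop (𝓝 (eulerLim a b S x T ω)) := by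
  obtain ⟨n₀, hn₀⟩ := exists_nat_ge T
  have hK : 0 ≤ eulerConst hi a b S L x T := eulerConst_nonneg T.coe_nonneg
  have h := Lp.ae_tendsto_of_cauchy_eLpNorm (μ := P) (p := 2)
    (f := fun n => eulerSeq a b S x (n + n₀) T)
    (fun n => ((itoProc_eulerProc hP hi0 hS).memLp_X hP T).1) one_le_two
    (tsum_ofReal_geometric (√(2 * eulerConst hi a b S L x T) + 1) (by positivity))
    fun N n m hn hm => by
      refine (eLpNorm_eulerSeq_sub_le (N := N) hP hi0 hS
        (hn₀.trans (by exact_mod_cast Nat.le_add_left _ _))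
        (hn₀.trans (by exact_mod_cast Nat.le_add_left _ _)) (by lia) (by lia)).trans_lt ?_
      rw [ENNReal.ofReal_lt_ofReal_iff (by positivity)]
      have : (0 : ℝ) < (1 / 2) ^ N := by positivity
      nlinarith
  filter_upwards [h] with ω ⟨l, hl⟩
  exact tendsto_nhds_limUnder ⟨l, (tendsto_add_atTop_iff_nat n₀).1 hl⟩

/-- Fatou's lemma turns the Cauchy estimate into an estimate against the limit. -/
theorem eLpNorm_eulerSeq_sub_lim_le (hP : P ∈ priors lo hi) (hi0 : 0 ≤ hi)
    (hS : ∀ y z, |S y - S z| ≤ L * |y - z|) {T : ℝ≥0} {n : ℕ} (hn : T ≤ n) :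
    eLpNorm (eulerSeq a b S x n T - eulerLim a b S x T) 2 P ≤
      ENNReal.ofReal (√(2 * eulerConst hi a b S L x T) * (1 / 2) ^ n) := by
  have h2 : ∀ m, AEStronglyMeasurable (eulerSeq a b S x m T) P := fun m =>
    ((itoProc_eulerProc hP hi0 hS).memLp_X hP T).1
  refine (Lp.eLpNorm_lim_le_liminf_eLpNorm (fun m => (h2 n).sub (h2 m)) _ ?_).trans ?_
  · filter_upwards [ae_tendsto_eulerSeq (a := a) (b := b) (x := x) hP hi0 hS T] with ω hω
    exact tendsto_const_nhds.sub hω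
  · refine liminf_le_of_frequently_le' (Eventually.frequently ?_)
    filter_upwards [eventually_ge_atTop n] with m hm
    exact eLpNorm_eulerSeq_sub_le hP hi0 hS hn (hn.trans (by exact_mod_cast hm)) le_rfl hm

theorem isProgressive_eulerSeq (hS : ∀ y z, |S y - S z| ≤ L * |y - z|) (n : ℕ) :
    IsProgressive Filt (eulerSeq a b S x n) := by
  have hm := measurable_euler (a := a) (b := b) (x := x) (δ := (1 / 4) ^ n)
    (continuous_of_lip hS).measurable
  refine IsProgressive.add (IsProgressive.add (fun _ => measurable_const) ?_)
    (isProgressive_stepInt (monotone_grid _)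
      (fun i => (continuous_of_lip hS).measurable.comp (hm i)))
  have e := fun s ω => primitive_stepVal (n := n * 4 ^ n)
    (ξ := fun i ω => a * euler a b S x ((1 / 4) ^ n) i ω + b) (monotone_grid ((1 / 4) ^ n)) s ω
  refine isProgressive_of_continuous (fun t => ?_) fun ω => by fun_prop
  have hz : ∀ i : ℕ, (fun ω => (a * euler a b S x ((1 / 4) ^ n) i ω + b) *
      ((min ((i + 1 : ℕ) * (1 / 4) ^ n) t : ℝ≥0) - (min (i * (1 / 4) ^ n) t : ℝ≥0) : ℝ)) =
      fun ω => (if i * (1 / 4) ^ n ≤ t then a * euler a b S x ((1 / 4) ^ n) i ω + b else 0) *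
      ((min ((i + 1 : ℕ) * (1 / 4) ^ n) t : ℝ≥0) - (min (i * (1 / 4) ^ n) t : ℝ≥0) : ℝ) := by
    intro i
    ext ω
    split_ifs with h
    · rfl
    · rw [min_eq_right (not_le.1 h).le, min_eq_right ((not_le.1 h).le.trans
        (monotone_grid _ (Nat.le_succ i)))]
      simp
  refine Finset.measurable_sum _ fun i _ => ?_
  rw [hz]
  refine Measurable.mul_const ?_ _
  split_ifs with h
  · exact (((hm i).mono (Filt.mono h) le_rfl).const_mul a).add_const b
  · exact measurable_const

/-- A pathwise limit of progressive processes is progressive for the raw filtration: no completion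
by null sets enters, because `limUnder` is measurable even where the limit does not exist. -/
theorem isProgressive_eulerLim (hS : ∀ y z, |S y - S z| ≤ L * |y - z|) :
    IsProgressive Filt (eulerLim a b S x) := fun i => by
  exact measurable_limUnder_seq fun n => isProgressive_eulerSeq (a := a) (b := b) (x := x) hS n i

theorem eLpNorm_joint_le {X : ℝ≥0 → Path → ℝ} [SFinite P] (hX : Measurable (joint X)) {T : ℝ≥0}
    {c : ℝ≥0∞} (h : ∀ s ≤ T, eLpNorm (X s) 2 P ≤ c) :
    eLpNorm (joint X) 2 (prodT P T) ^ 2 ≤ ENNReal.ofReal T * c ^ 2 := by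
  rw [eLpNorm_two_sq, lintegral_prod_symm _ (measurable_sq_joint hX).aemeasurable]
  calc _ ≤ ∫⁻ _ in Set.Iic T, c ^ 2 ∂dt := by
        refine setLIntegral_mono measurable_const fun s hs => ?_
        change ∫⁻ ω, ENNReal.ofReal (X s ω ^ 2) ∂P ≤ _
        rw [← eLpNorm_two_sq]
        exact pow_le_pow_left₀ zero_le (h s hs) 2
    _ = _ := by rw [setLIntegral_const, dt_Iic, mul_comm]

/-- The bound for the error of the frozen Euler scheme in `L²(P ⊗ dt)`. -/
noncomputable def eulerErr (hi a b : ℝ) (S : ℝ → ℝ) (L x T : ℝ) (n : ℕ) : ℝ :=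
  √(T * (4 * growth hi a b S L *
    ((1 + x ^ 2) * Real.exp ((1 + 3 * growth hi a b S L) * T)))) * (1 / 2) ^ n +
  √(T * (2 * eulerConst hi a b S L x T)) * (1 / 2) ^ n

theorem eLpNorm_frozen_sub_lim_le (hP : P ∈ priors lo hi) (hi0 : 0 ≤ hi)
    (hS : ∀ y z, |S y - S z| ≤ L * |y - z|) {T : ℝ≥0} {n : ℕ} (hn : T ≤ n) :
    eLpNorm (joint (frozen a b S x ((1 / 4) ^ n) (n * 4 ^ n)) - joint (eulerLim a b S x)) 2
      (prodT P T) ≤ ENNReal.ofReal (eulerErr hi a b S L x T n) := by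
  have := hP.1
  have hG : 0 ≤ growth hi a b S L := growth_nonneg
  have hK : 0 ≤ eulerConst hi a b S L x T := eulerConst_nonneg T.coe_nonneg
  have hX := (itoProc_eulerProc (a := a) (b := b) (x := x) (δ := (1 / 4) ^ n) (n := n * 4 ^ n)
    hP hi0 hS).sqX T
  have hF := memLp_frozen (a := a) (b := b) (x := x) (δ := (1 / 4) ^ n) (n := n * 4 ^ n) hP hS T
  have mS := measurable_joint (isProgressive_eulerSeq (a := a) (b := b) (x := x) hS n)
  have mL := measurable_joint (isProgressive_eulerLim (a := a) (b := b) (x := x) hS)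
  have h1 : eLpNorm (joint (frozen a b S x ((1 / 4) ^ n) (n * 4 ^ n)) -
      joint (eulerSeq a b S x n)) 2 (prodT P T) ≤ ENNReal.ofReal (√(T * (4 * growth hi a b S L *
    ((1 + x ^ 2) * Real.exp ((1 + 3 * growth hi a b S L) * T)))) * (1 / 2) ^ n) := by
    rw [eLpNorm_sub_comm]
    refine eLpNorm_le_of_integral_sq_le (hX.sub hF) ?_ (by positivity)
    refine (integral_joint_sub_frozen_sq_le hP hi0 hS (quarter_pow_le_one n)
      (le_horizon hn)).trans (le_of_eq ?_)
    rw [mul_pow, Real.sq_sqrt (by positivity), ← pow_mul, mul_comm n 2, pow_mul]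
    push_cast
    rw [show ((1 : ℝ) / 2) ^ 2 = 1 / 4 by norm_num]
    ring
  have h2 : eLpNorm (joint (eulerSeq a b S x n) - joint (eulerLim a b S x)) 2 (prodT P T) ≤
      ENNReal.ofReal (√(T * (2 * eulerConst hi a b S L x T)) * (1 / 2) ^ n) := by
    rw [← ENNReal.pow_le_pow_left_iff two_ne_zero]
    refine (eLpNorm_joint_le (X := fun s ω => eulerSeq a b S x n s ω - eulerLim a b S x s ω)
      (mS.sub mL) (c := ENNReal.ofReal (√(2 * eulerConst hi a b S L x T) * (1 / 2) ^ n))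
      fun s hs => (eLpNorm_eulerSeq_sub_lim_le hP hi0 hS (hs.trans hn)).trans ?_).trans ?_
    · have := eulerConst_mono (hi := hi) (a := a) (b := b) (S := S) (L := L) (x := x)
        s.coe_nonneg (show (s : ℝ) ≤ T by exact_mod_cast hs)
      gcongr
    · rw [← ENNReal.ofReal_pow (by positivity), ← ENNReal.ofReal_pow (by positivity),
        ← ENNReal.ofReal_mul T.coe_nonneg, mul_pow, mul_pow, Real.sq_sqrt (by positivity),
        Real.sq_sqrt (by positivity)]
      exact le_of_eq (by ring_nf)
  rw [eulerErr, ENNReal.ofReal_add (by positivity) (by positivity)]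
  refine le_trans (le_of_eq ?_) ((eLpNorm_add_le ((hF.1).sub mS.aestronglyMeasurable)
    (mS.sub mL).aestronglyMeasurable one_le_two).trans (add_le_add h1 h2))
  rw [sub_add_sub_cancel]

theorem tendsto_eulerErr (hi a b : ℝ) (S : ℝ → ℝ) (L x T : ℝ) :
    Tendsto (fun n => ENNReal.ofReal (eulerErr hi a b S L x T n)) atTop (𝓝 0) := by
  have h := tendsto_pow_atTop_nhds_zero_of_lt_one (r := (1 / 2 : ℝ)) (by norm_num) (by norm_num)
  have := ENNReal.tendsto_ofReal ((h.const_mul (√(T * (4 * growth hi a b S L *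
    ((1 + x ^ 2) * Real.exp ((1 + 3 * growth hi a b S L) * T)))))).add
    (h.const_mul (√(T * (2 * eulerConst hi a b S L x T)))))
  simpa [eulerErr] using this

/-- The frozen volatilities and the martingale parts of the Euler schemes both converge in `L²`, and
the Itô integral is closed under such limits. The uniform moment bound is read off from one scheme
with a sufficiently long horizon. -/
theorem exists_isSol (lo : ℝ) {hi : ℝ} (hi0 : 0 ≤ hi) (a b : ℝ)
    (hS : ∀ y z, |S y - S z| ≤ L * |y - z|) (x : ℝ) : ∃ X, IsSol lo hi a b S x X := by
  have hL : 0 ≤ L := by simpa using (abs_nonneg _).trans (hS 1 0)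
  have hSc := continuous_of_lip hS
  have pX := isProgressive_eulerLim (a := a) (b := b) (x := x) hS
  have mX := measurable_joint pX
  have hG : 0 ≤ growth hi a b S L := growth_nonneg
  have hF : ∀ P ∈ priors lo hi, ∀ n T, MemLp (joint (frozen a b S x ((1 / 4) ^ n) (n * 4 ^ n))) 2
      (prodT P T) := fun P hP n T => memLp_frozen hP hS T
  -- a bound for the second moment which is uniform in the prior
  have hbd : ∀ T : ℝ≥0, ∃ C : ℝ≥0∞, C < ∞ ∧ ∀ P ∈ priors lo hi,
      eLpNorm (joint (eulerLim a b S x)) 2 (prodT P T) ≤ C := fun T => by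
    obtain ⟨n, hn⟩ := exists_nat_ge T
    refine ⟨ENNReal.ofReal (eulerErr hi a b S L x T n) + ENNReal.ofReal
      (√(T * ((1 + x ^ 2) * Real.exp ((1 + 3 * growth hi a b S L) * T)))), by finiteness,
      fun P hP => ?_⟩
    have := hP.1
    have e : joint (eulerLim a b S x) = -(joint (frozen a b S x ((1 / 4) ^ n) (n * 4 ^ n)) -
      joint (eulerLim a b S x)) + joint (frozen a b S x ((1 / 4) ^ n) (n * 4 ^ n)) := by abel
    rw [e]
    refine (eLpNorm_add_le ((hF P hP n T).1.sub mX.aestronglyMeasurable).neg (hF P hP n T).1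
      one_le_two).trans (add_le_add ?_ ?_)
    · rw [eLpNorm_neg]; exact eLpNorm_frozen_sub_lim_le hP hi0 hS hn
    · refine eLpNorm_le_of_integral_sq_le (hF P hP n T) ?_ (by positivity)
      rw [Real.sq_sqrt (by positivity), integral_prodT (hF P hP n T).integrable_sq]
      set Z : ℝ := (1 + x ^ 2) * Real.exp ((1 + 3 * growth hi a b S L) * T) with hZ
      have e : (T : ℝ) * Z = ∫ _ in Set.Iic T, Z ∂dt := by
        rw [setIntegral_const, measureReal_def, dt_Iic, ENNReal.toReal_ofReal T.coe_nonneg,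
          smul_eq_mul]
      rw [e]
      refine integral_mono_ae (hF P hP n T).integrable_sq.integral_prod_right
        (integrable_const _) ?_
      have : ∀ᵐ s ∂dt.restrict (Set.Iic T), s ≠ 0 := Measure.ae_ne _ 0
      filter_upwards [ae_restrict_mem measurableSet_Iic, this] with s hs hs'
      have hs2 : s ≤ T := hs
      refine (integral_frozen_sq_le hP hS (quarter_pow_le_one n) (pos_iff_ne_zero.2 hs')
        (hs2.trans (le_horizon hn))).trans ?_
      have : (s : ℝ) ≤ T := by exact_mod_cast hs2
      rw [hZ]; gcongr
  refine ⟨eulerLim a b S x, pX, fun T => ?_, fun P hP T => ?_⟩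
  · obtain ⟨C, hC, h⟩ := hbd T
    refine (iSup₂_le fun P hP => ?_ : upperE (priors lo hi) _ ≤ C ^ 2).trans_lt
      (ENNReal.pow_lt_top hC)
    have := hP.1
    rw [show ∫⁻ ω, ∫⁻ s in Set.Iic T, ENNReal.ofReal (eulerLim a b S x s ω ^ 2) ∂dt ∂P =
      eLpNorm (joint (eulerLim a b S x)) 2 (prodT P T) ^ 2 by
        rw [eLpNorm_two_sq, lintegral_prodT (measurable_sq_joint mX)]; rfl]
    exact pow_le_pow_left₀ zero_le (h P hP) 2
  · have := hP.1
    obtain ⟨n₀, hn₀⟩ := exists_nat_ge T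
    have hX2 : MemLp (joint (eulerLim a b S x)) 2 (prodT P T) := by
      obtain ⟨C, hC, h⟩ := hbd T
      exact ⟨mX.aestronglyMeasurable, (h P hP).trans_lt hC⟩
    have hI := fun n => itoProc_eulerProc (a := a) (b := b) (x := x) (δ := (1 / 4) ^ n)
      (n := n * 4 ^ n) hP hi0 hS
    -- convergence of the Lipschitz functions of the frozen scheme
    have hconv : ∀ (φ : ℝ → ℝ) (M : ℝ), (∀ y z, |φ y - φ z| ≤ M * |y - z|) →
        Tendsto (fun n => eLpNorm (joint (stepVal (n * 4 ^ n) (fun i => i * (1 / 4) ^ n)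
          fun i ω => φ (euler a b S x ((1 / 4) ^ n) i ω)) -
          joint fun s ω => φ (eulerLim a b S x s ω)) 2 (prodT P T)) atTop (𝓝 0) := by
      intro φ M hφ
      have hb := ENNReal.Tendsto.const_mul (a := ENNReal.ofReal M)
        (tendsto_eulerErr hi a b S L x T) (.inr ENNReal.ofReal_ne_top)
      rw [mul_zero] at hb
      refine tendsto_of_tendsto_of_tendsto_of_le_of_le' tendsto_const_nhds hb
        (Eventually.of_forall fun _ => zero_le) ?_
      filter_upwards [eventually_ge_atTop n₀] with n hn
      have hTn : T ≤ n := hn₀.trans (by exact_mod_cast hn)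
      refine (eLpNorm_le_mul_eLpNorm_of_ae_le_mul (g := joint (frozen a b S x ((1 / 4) ^ n)
        (n * 4 ^ n)) - joint (eulerLim a b S x)) (c := M) ?_ 2).trans
        (mul_le_mul' le_rfl (eLpNorm_frozen_sub_lim_le hP hi0 hS hTn))
      filter_upwards [ae_pos_time P T] with p hp
      simp only [joint, Pi.sub_apply, Real.norm_eq_abs]
      rw [drift_eulerProc hp.1 (hp.2.trans (le_horizon hTn)) φ]
      exact hφ _ _
    have hdrift := hconv (fun y => a * y + b) |a| fun y z => by
      rw [← abs_mul]; exact le_of_eq (by congr 1; ring)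
    have hXT : Tendsto (fun n => eLpNorm (eulerSeq a b S x n T - eulerLim a b S x T) 2 P) atTop
        (𝓝 0) := by
      have h := tendsto_pow_atTop_nhds_zero_of_lt_one (r := (1 / 2 : ℝ)) (by norm_num)
        (by norm_num)
      have hb := ENNReal.tendsto_ofReal (h.const_mul (√(2 * eulerConst hi a b S L x T)))
      rw [mul_zero, ENNReal.ofReal_zero] at hb
      refine tendsto_of_tendsto_of_tendsto_of_le_of_le' tendsto_const_nhds hb
        (Eventually.of_forall fun _ => zero_le) ?_
      filter_upwards [eventually_ge_atTop n₀] with n hn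
      exact eLpNorm_eulerSeq_sub_lim_le hP hi0 hS (hn₀.trans (by exact_mod_cast hn))
    have pβ : IsProgressive Filt fun s ω => a * eulerLim a b S x s ω + b :=
      pX.comp_measurable (g := fun y => a * y + b) (by fun_prop)
    have mβ := measurable_joint pβ
    have hβ2 : MemLp (joint fun s ω => a * eulerLim a b S x s ω + b) 2 (prodT P T) :=
      (hX2.const_mul a).add (memLp_const b)
    have mprim := (measurable_slice (measurable_joint_primitive mβ) T).aestronglyMeasurable (μ := P)
    refine hasItoIntegral_of_tendsto hP
      (fun n => (hI n).measH.aemeasurable) (fun n => (hI n).aesm_mart T)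
      (measurable_joint (pX.comp_measurable hSc.measurable)).aemeasurable
      (((measurable_slice mX T).aestronglyMeasurable.sub aestronglyMeasurable_const).sub mprim)
      (Eventually.of_forall fun n => (hI n).ito T) (hconv S L hS) ?_
    set β : ℕ → ℝ≥0 → Path → ℝ := fun n => stepVal (n * 4 ^ n) (fun i => i * (1 / 4) ^ n)
      fun i ω => a * euler a b S x ((1 / 4) ^ n) i ω + b with hβ
    have hprim : Tendsto (fun n => eLpNorm (primitive (β n) T -
        primitive (fun s ω => a * eulerLim a b S x s ω + b) T) 2 P) atTop (𝓝 0) := by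
      refine tendsto_zero_of_sq ?_
      have hb := ENNReal.Tendsto.const_mul (a := ENNReal.ofReal T) (tendsto_sq_zero hdrift)
        (.inr ENNReal.ofReal_ne_top)
      rw [mul_zero] at hb
      refine tendsto_of_tendsto_of_tendsto_of_le_of_le tendsto_const_nhds hb
        (fun _ => zero_le) fun n => ?_
      have hd : primitive (β n) T - primitive (fun s ω => a * eulerLim a b S x s ω + b) T =ᵐ[P]
          primitive (fun s ω => β n s ω - (a * eulerLim a b S x s ω + b)) T := by
        filter_upwards [(((hI n).sqβ T).integrable one_le_two).prod_right_ae,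
          (hβ2.integrable one_le_two).prod_right_ae] with ω h1 h2
        simp only [joint] at h1 h2
        simp only [primitive, Pi.sub_apply]
        rw [integral_sub h1 h2]
      rw [eLpNorm_congr_ae hd, eLpNorm_two_sq]
      refine (lintegral_sq_primitive_le
        (β := fun s ω => β n s ω - (a * eulerLim a b S x s ω + b)) ((hI n).measβ.sub mβ) T).trans (le_of_eq ?_)
      rw [← eLpNorm_two_sq]
      rfl
    have hsum := hXT.add hprim
    rw [add_zero] at hsum
    refine tendsto_of_tendsto_of_tendsto_of_le_of_le tendsto_const_nhds hsum
      (fun _ => zero_le) fun n => ?_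
    have mn := (measurable_slice (measurable_joint_primitive (hI n).measβ) T).aestronglyMeasurable
      (μ := P)
    refine le_trans (le_of_eq ?_) (eLpNorm_sub_le
      (((hI n).memLp_X hP T).1.sub (measurable_slice mX T).aestronglyMeasurable)
      (mn.sub mprim) one_le_two)
    congr 1
    ext ω
    simp only [ItoProc.mart, primitive, Pi.sub_apply, eulerSeq]
    ring

end

/-! ### Lower expectations and discounted moments -/

section LowerE

variable {Ps : Set (Measure Path)} {ξ : Path → ℝ}

theorem lowerE_le {P : Measure Path} (hP : P ∈ Ps) : lowerE Ps ξ ≤ ((∫ ω, ξ ω ∂P : ℝ) : EReal) := by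
  have h : ((∫ ω, -ξ ω ∂P : ℝ) : EReal) ≤ sublinE Ps fun ω => -ξ ω :=
    le_iSup₂ (f := fun P (_ : P ∈ Ps) => ((∫ ω, -ξ ω ∂P : ℝ) : EReal)) P hP
  rw [integral_neg, EReal.coe_neg] at h
  exact EReal.neg_le.1 h

theorem le_lowerE {v : ℝ} (h : ∀ P ∈ Ps, v ≤ ∫ ω, ξ ω ∂P) : (v : EReal) ≤ lowerE Ps ξ := by
  refine EReal.le_neg_of_le_neg (iSup₂_le fun P hP => ?_)
  rw [integral_neg, EReal.coe_neg]
  exact EReal.neg_le_neg_iff.2 (EReal.coe_le_coe_iff.2 (h P hP))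

theorem lowerE_eq {v : ℝ} {P : Measure Path} (hP : P ∈ Ps) (h : ∀ P ∈ Ps, v ≤ ∫ ω, ξ ω ∂P)
    (h' : ∫ ω, ξ ω ∂P ≤ v) : lowerE Ps ξ = v :=
  le_antisymm ((lowerE_le hP).trans (EReal.coe_le_coe_iff.2 h')) (le_lowerE h)

theorem lowerE_const {c : ℝ} {P : Measure Path} (hP : P ∈ Ps) (h : ∀ P ∈ Ps, ∫ ω, ξ ω ∂P = c) :
    lowerE Ps ξ = c := lowerE_eq hP (fun P hP => (h P hP).ge) (h P hP).le

end LowerE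

theorem transversal_of_liminf {Ps : Set (Measure Path)} {ρ : ℝ} {X : ℝ≥0 → Path → ℝ}
    (h : liminf (fun T : ℝ≥0 => ENNReal.ofReal (Real.exp (-ρ * T)) *
      upperE Ps (fun ω => ENNReal.ofReal (X T ω ^ 2))) atTop = 0)
    {P : Measure Path} (hP : P ∈ Ps) : Transversal P ρ X := by
  intro ε hε
  have h1 := frequently_lt_of_liminf_lt (h := h.trans_lt (ENNReal.ofReal_pos.2 hε))
  refine h1.mono fun T hT => ?_
  by_cases hi : Integrable (fun ω => X T ω ^ 2) P
  · have h2 : ENNReal.ofReal (∫ ω, X T ω ^ 2 ∂P) ≤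
        upperE Ps (fun ω => ENNReal.ofReal (X T ω ^ 2)) := by
      rw [ofReal_integral_eq_lintegral_ofReal hi (ae_of_all _ fun _ => sq_nonneg _)]
      exact le_iSup₂ (f := fun P (_ : P ∈ Ps) => ∫⁻ ω, ENNReal.ofReal (X T ω ^ 2) ∂P) P hP
    have h3 := (mul_le_mul' le_rfl h2).trans_lt hT
    rw [← ENNReal.ofReal_mul (Real.exp_pos _).le] at h3
    exact (ENNReal.ofReal_lt_ofReal_iff hε).1 h3
  -- If the square is not integrable, its Bochner integral is `0` by convention and the inequality
  -- is trivial.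
  · rw [integral_undef hi, mul_zero]; exact hε

/-- Integrability of discounted processes. -/
theorem integrable_of_upperE {Ps : Set (Measure Path)} {ρ : ℝ} {R : ℝ≥0 → Path → ℝ}
    (h : upperE Ps (fun ω => ∫⁻ t, ENNReal.ofReal (Real.exp (-ρ * t) * |R t ω|) ∂dt) < ∞)
    {P : Measure Path} (hP : P ∈ Ps) (hm : AEMeasurable (joint R) (P.prod dt)) :
    Integrable (fun p : Path × ℝ≥0 => Real.exp (-ρ * p.2) * joint R p) (P.prod dt) := by
  have hm2 : AEMeasurable (fun p : Path × ℝ≥0 => Real.exp (-ρ * p.2) * joint R p) (P.prod dt) :=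
    (by fun_prop : Measurable fun p : Path × ℝ≥0 => Real.exp (-ρ * p.2)).aemeasurable.mul hm
  refine ⟨hm2.aestronglyMeasurable, ?_⟩
  rw [hasFiniteIntegral_iff_norm, lintegral_prod _ hm2.norm.ennreal_ofReal]
  refine lt_of_le_of_lt (le_of_eq ?_) (lintegral_lt_top_of_upperE h hP)
  refine lintegral_congr fun ω => lintegral_congr fun t => ?_
  rw [norm_mul, Real.norm_eq_abs, Real.norm_eq_abs, Real.abs_exp]
  rfl

theorem integrableOn_exp_dt {ρ : ℝ} (hρ : 0 < ρ) :
    Integrable (fun s : ℝ≥0 => Real.exp (-ρ * s)) dt := by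
  have h : Integrable (fun s : ℝ => Real.exp (-ρ * s)) (dt.map ((↑) : ℝ≥0 → ℝ)) := by
    rw [map_dt]
    exact (integrableOn_Ici_iff_integrableOn_Ioi).2 (integrableOn_exp_mul_Ioi (by linarith) 0)
  exact (measurableEmbedding_coe_nnreal.integrable_map_iff).1 h

theorem integral_exp_dt {ρ : ℝ} (hρ : 0 < ρ) :
    ∫ s : ℝ≥0, Real.exp (-ρ * s) ∂dt = 1 / ρ := by
  have h := measurableEmbedding_coe_nnreal.integral_map (μ := dt) fun s : ℝ => Real.exp (-ρ * s)
  rw [← h, map_dt, integral_Ici_eq_integral_Ioi, integral_exp_mul_Ioi (by linarith) 0]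
  simp [neg_div_neg_eq]

theorem integrable_exp_prod {P : Measure Path} [IsProbabilityMeasure P] {ρ : ℝ} (hρ : 0 < ρ) :
    Integrable (fun p : Path × ℝ≥0 => Real.exp (-ρ * p.2)) (P.prod dt) :=
  (integrableOn_exp_dt hρ).comp_snd P

theorem integral_exp_prod {P : Measure Path} [IsProbabilityMeasure P] {ρ : ℝ} (hρ : 0 < ρ) :
    ∫ p : Path × ℝ≥0, Real.exp (-ρ * p.2) ∂P.prod dt = 1 / ρ := by
  rw [integral_prod _ (integrable_exp_prod hρ)]
  simp only [integral_exp_dt hρ, integral_const, probReal_univ, one_smul]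

section Moments

variable {lo hi a b c d w x ρ : ℝ} {S : ℝ → ℝ} {X : ℝ≥0 → Path → ℝ}

/-- An exponential bound for the second moment, uniform in the prior. -/
theorem IsSol.exists_moment_bound (hX : IsSol lo hi a b S x X) (hSc : Continuous S)
    (hS : ∀ y, S y ^ 2 = (c * y + d) ^ 2 + w) (h0 : 0 ≤ hi) (hρ : 0 < ρ)
    (hκ : 2 * a + c ^ 2 * hi ^ 2 < ρ) :
    ∃ K, 0 ≤ K ∧ ∀ P ∈ priors lo hi, ∀ T : ℝ≥0, ∫ ω, X T ω ^ 2 ∂P ≤ K * Real.exp (ρ * T) := by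
  set q := 2 * a + c ^ 2 * hi ^ 2 with hq
  set p := 2 * b + 2 * c * d * hi ^ 2 with hp
  -- The first summand is the maximum over `y` of `p y - (ρ - q) y²`, the price of absorbing the
  -- linear term into the gap between `q` and `ρ`.
  set C := p ^ 2 / (4 * (ρ - q)) + |hi ^ 2 * (d ^ 2 + w)| with hC
  have hd : 0 < ρ - q := by linarith
  have hC0 : 0 ≤ C := by positivity
  have hpt : ∀ y, 2 * (a * y + b) * y + hi ^ 2 * S y ^ 2 ≤ ρ * y ^ 2 + C := by
    intro y
    rw [hS]
    have h1 : p * y ≤ (ρ - q) * y ^ 2 + p ^ 2 / (4 * (ρ - q)) := by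
      have : (ρ - q) * y ^ 2 + p ^ 2 / (4 * (ρ - q)) - p * y =
          (ρ - q) * (y - p / (2 * (ρ - q))) ^ 2 := by field_simp; ring
      have h2 : 0 ≤ (ρ - q) * (y - p / (2 * (ρ - q))) ^ 2 := by positivity
      linarith
    have h2 := le_abs_self (hi ^ 2 * (d ^ 2 + w))
    have h3 : 2 * (a * y + b) * y + hi ^ 2 * ((c * y + d) ^ 2 + w) =
      q * y ^ 2 + p * y + hi ^ 2 * (d ^ 2 + w) := by rw [hq, hp]; ring
    rw [h3, hC]; linarith
  refine ⟨x ^ 2 + C / ρ, by positivity, fun P hP T => ?_⟩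
  have := hP.1
  have hI := hX.itoProc hSc hP
  have hy : IntegrableOn (fun s => ∫ ω, X s ω ^ 2 ∂P) (Set.Iic T) dt :=
    (hI.sqX T).integrable_sq.integral_prod_right
  have hk : IntegrableOn (fun s => ρ * ∫ ω, X s ω ^ 2 ∂P + C) (Set.Iic T) dt :=
    (hy.const_mul ρ).add (integrable_const C)
  -- The second moment `y` satisfies `y(s) ≤ x² + ∫ (ρ y + C)`. Discounting at the same rate `ρ`
  -- cancels the two integrals of `y` and leaves an explicit bound.
  have h := discount_le (c := x ^ 2) hρ.le hy hk fun s hs => by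
    rw [hI.integral_X_sq hP h0 s]
    have h1 := hI.integral_mart_sq_le hP h0 s
    have i1 := (hI.sqX s).integrable_sq
    have i2 := ((hI.sqβ s).integrable_mul (hI.sqX s)).const_mul 2
    have i3 := (hI.sqH hP s).integrable_sq.const_mul (hi ^ 2)
    simp only [Pi.mul_apply] at i2
    have e : ∫ r in Set.Iic s, (ρ * ∫ ω, X r ω ^ 2 ∂P + C) ∂dt =
        ∫ p, (ρ * joint X p ^ 2 + C) ∂prodT P s := by
      have i4 : Integrable (fun p => ρ * joint X p ^ 2 + C) (prodT P s) :=
        (i1.const_mul ρ).add (integrable_const C)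
      rw [integral_prodT i4]
      refine setIntegral_congr_ae measurableSet_Iic ?_
      have h2 := ae_memLp_slice hI.measX (hI.sqX s)
      filter_upwards [(ae_restrict_iff' measurableSet_Iic).1 h2] with r hr hrs
      simp only [joint]
      rw [integral_add ((hr hrs).integrable_sq.const_mul ρ) (integrable_const C),
        integral_const_mul]
      simp
    have hmono : ∫ p, (2 * (joint (fun s ω => a * X s ω + b) p * joint X p) +
        hi ^ 2 * joint (fun s ω => S (X s ω)) p ^ 2) ∂prodT P s ≤
        ∫ p, (ρ * joint X p ^ 2 + C) ∂prodT P s := by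
      refine integral_mono (i2.add i3) ((i1.const_mul ρ).add (integrable_const C)) fun p => ?_
      have := hpt (joint X p)
      simp only [joint] at this ⊢
      linarith
    rw [integral_add i2 i3, integral_const_mul, integral_const_mul] at hmono
    rw [e]
    linarith
  have hexp : IntegrableOn (fun s : ℝ≥0 => ρ * Real.exp (-ρ * s)) (Set.Iic T) dt :=
    integrableOn_of_continuous (by fun_prop) T
  have e2 : ∫ s in Set.Iic T, Real.exp (-ρ * s) * (ρ * ∫ ω, X s ω ^ 2 ∂P + C) ∂dt =
      ∫ s in Set.Iic T, ρ * (Real.exp (-ρ * s) * ∫ ω, X s ω ^ 2 ∂P) ∂dt +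
      C / ρ * (1 - Real.exp (-ρ * T)) := by
    rw [← integral_exp_Iic, ← integral_const_mul,
      ← integral_add ((integrableOn_exp_mul ρ hy).const_mul ρ) (hexp.const_mul _)]
    refine integral_congr_ae (ae_of_all _ fun s => ?_)
    field_simp
  rw [e2] at h
  have h3 : Real.exp (-ρ * T) * ∫ ω, X T ω ^ 2 ∂P ≤ x ^ 2 + C / ρ := by
    have h4 : 0 ≤ C / ρ * Real.exp (-ρ * T) := by positivity
    linarith
  have h5 := mul_le_mul_of_nonneg_right h3 (Real.exp_pos (ρ * T)).le
  rw [mul_right_comm, ← Real.exp_add] at h5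
  simpa using h5

theorem IsSol.lintegral_sq_le (hX : IsSol lo hi a b S x X) (hSc : Continuous S) {K : ℝ}
    (hK : ∀ P ∈ priors lo hi, ∀ T : ℝ≥0, ∫ ω, X T ω ^ 2 ∂P ≤ K * Real.exp (ρ * T))
    {P : Measure Path} (hP : P ∈ priors lo hi) (T : ℝ≥0) :
    ∫⁻ ω, ENNReal.ofReal (X T ω ^ 2) ∂P ≤ ENNReal.ofReal (K * Real.exp (ρ * T)) := by
  rw [← ofReal_integral_eq_lintegral_ofReal ((hX.itoProc hSc hP).memLp_X hP T).integrable_sq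
    (ae_of_all _ fun _ => sq_nonneg _)]
  exact ENNReal.ofReal_le_ofReal (hK P hP T)

/-- A rate `ρ'` strictly between the growth exponent and `ρ` still bounds the moments, and the spare
factor `e^{-(ρ - ρ') T}` vanishes. The maximum with `0` keeps `ρ'` positive. -/
theorem IsSol.liminf_eq_zero (hX : IsSol lo hi a b S x X) (hSc : Continuous S)
    (hS : ∀ y, S y ^ 2 = (c * y + d) ^ 2 + w) (h0 : 0 ≤ hi) (hρ : 0 < ρ)
    (hκ : 2 * a + c ^ 2 * hi ^ 2 < ρ) :
    liminf (fun T : ℝ≥0 => ENNReal.ofReal (Real.exp (-ρ * T)) *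
      upperE (priors lo hi) (fun ω => ENNReal.ofReal (X T ω ^ 2))) atTop = 0 := by
  obtain ⟨ρ', h1, h2⟩ := exists_between (max_lt hκ hρ)
  obtain ⟨K, hK0, hK⟩ := hX.exists_moment_bound hSc hS h0 ((le_max_right _ _).trans_lt h1)
    ((le_max_left _ _).trans_lt h1)
  have hT : Tendsto (fun T : ℝ≥0 => ENNReal.ofReal (K * Real.exp (-(ρ - ρ') * T))) atTop (𝓝 0) := by
    have := ENNReal.tendsto_ofReal ((tendsto_exp_neg_mul (sub_pos.2 h2)).const_mul K)
    rwa [mul_zero, ENNReal.ofReal_zero] at this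
  refine (tendsto_of_tendsto_of_tendsto_of_le_of_le tendsto_const_nhds hT (fun _ => zero_le)
    fun T => ?_).liminf_eq
  have hb : upperE (priors lo hi) (fun ω => ENNReal.ofReal (X T ω ^ 2)) ≤
      ENNReal.ofReal (K * Real.exp (ρ' * T)) :=
    iSup₂_le fun P hP => hX.lintegral_sq_le hSc hK hP T
  refine (mul_le_mul' le_rfl hb).trans (le_of_eq ?_)
  rw [← ENNReal.ofReal_mul (Real.exp_pos _).le, mul_left_comm, ← Real.exp_add]
  congr 3; ring

/-- The same intermediate rate `ρ'` makes the discounted second moment integrable over the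
half-line, with a bound common to all priors. -/
theorem IsSol.upperE_lt_top (hX : IsSol lo hi a b S x X) (hSc : Continuous S)
    (hS : ∀ y, S y ^ 2 = (c * y + d) ^ 2 + w) (h0 : 0 ≤ hi) (hρ : 0 < ρ)
    (hκ : 2 * a + c ^ 2 * hi ^ 2 < ρ) {G : ℝ → ℝ} {C : ℝ} (hC : 0 ≤ C)
    (hG : ∀ y, |G y| ≤ C * (1 + y ^ 2)) :
    upperE (priors lo hi) (fun ω => ∫⁻ t, ENNReal.ofReal (Real.exp (-ρ * t) * |G (X t ω)|) ∂dt)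
      < ∞ := by
  obtain ⟨ρ', h1, h2⟩ := exists_between (max_lt hκ hρ)
  obtain ⟨K, hK0, hK⟩ := hX.exists_moment_bound hSc hS h0 ((le_max_right _ _).trans_lt h1)
    ((le_max_left _ _).trans_lt h1)
  have hfin : ∫⁻ t : ℝ≥0, (ENNReal.ofReal (C * Real.exp (-ρ * t)) +
      ENNReal.ofReal (C * K * Real.exp (-(ρ - ρ') * t))) ∂dt < ∞ := by
    rw [lintegral_add_left (by fun_prop)]
    refine ENNReal.add_lt_top.2 ⟨?_, ?_⟩
    · exact ((integrableOn_exp_dt hρ).const_mul C).lintegral_lt_top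
    · exact ((integrableOn_exp_dt (sub_pos.2 h2)).const_mul (C * K)).lintegral_lt_top
  refine (iSup₂_le fun P hP => ?_ : upperE (priors lo hi) _ ≤ _).trans_lt hfin
  have := hP.1
  have mX := measurable_joint hX.1
  calc _ ≤ ∫⁻ ω, ∫⁻ t, ENNReal.ofReal (Real.exp (-ρ * t) * (C * (1 + X t ω ^ 2))) ∂dt ∂P := by
        gcongr with ω t
        exact hG _
    _ = ∫⁻ t, ∫⁻ ω, ENNReal.ofReal (Real.exp (-ρ * t) * (C * (1 + X t ω ^ 2))) ∂P ∂dt := by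
        have hm : Measurable fun p : Path × ℝ≥0 =>
            ENNReal.ofReal (Real.exp (-ρ * p.2) * (C * (1 + X p.2 p.1 ^ 2))) := by
          have h3 : Measurable fun p : Path × ℝ≥0 => X p.2 p.1 := mX
          exact ((by fun_prop : Measurable fun p : Path × ℝ≥0 => Real.exp (-ρ * p.2)).mul
            (((h3.pow_const 2).const_add 1).const_mul C)).ennreal_ofReal
        exact lintegral_lintegral_swap hm.aemeasurable
    _ ≤ _ := by
        refine lintegral_mono fun t => ?_
        have e : ∀ ω, ENNReal.ofReal (Real.exp (-ρ * t) * (C * (1 + X t ω ^ 2))) =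
            ENNReal.ofReal (C * Real.exp (-ρ * t)) +
            ENNReal.ofReal (C * Real.exp (-ρ * t)) * ENNReal.ofReal (X t ω ^ 2) := fun ω => by
          rw [← ENNReal.ofReal_mul (by positivity), ← ENNReal.ofReal_add (by positivity)
            (by positivity)]
          congr 1; ring
        simp_rw [e]
        rw [lintegral_add_left measurable_const, lintegral_const, measure_univ, mul_one,
          lintegral_const_mul' _ _ ENNReal.ofReal_ne_top]
        refine add_le_add le_rfl ((mul_le_mul' le_rfl (hX.lintegral_sq_le hSc hK hP t)).trans
          (le_of_eq ?_))
        rw [← ENNReal.ofReal_mul (by positivity), mul_assoc, mul_left_comm _ K, ← Real.exp_add,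
          mul_assoc]
        congr 5; ring

end Moments

/-! ### Closed-loop rewards of linear feedbacks -/

theorem quad_ne_bounded_below {p₂ p₁ p₀ : ℝ} (hp : p₂ < 0) (C : ℝ) : ∃ x, quad p₂ p₁ p₀ x < C := by
  set N := |p₁| + |p₀| + |C| with hN
  have hN0 : 0 ≤ N := by positivity
  have hq : 0 < -p₂ := by linarith
  -- At this point the quadratic term contributes less than `-(N + 1)(1 + z)`, which outweighs the
  -- linear term, the constant and `C`.
  refine ⟨1 + 2 * (N + 1) / (-p₂), ?_⟩
  set z := 2 * (N + 1) / (-p₂) with hz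
  have hz0 : 0 < z := by positivity
  have hzp : -p₂ * z = 2 * (N + 1) := by
    rw [hz]; exact mul_div_cancel₀ _ hq.ne'
  have h1 : p₁ * (1 + z) ≤ |p₁| * (1 + z) :=
    mul_le_mul_of_nonneg_right (le_abs_self _) (by linarith)
  have h2 := le_abs_self p₀
  have h3 := neg_abs_le C
  have h4 : |p₁| ≤ N := by rw [hN]; linarith [abs_nonneg p₀, abs_nonneg C]
  have h5 : 1 / 2 * p₂ * (1 + z) ^ 2 = 1 / 2 * p₂ * (1 + z) - (N + 1) * (1 + z) := by
    linear_combination (-(1 + z) / 2) * hzp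
  have h6 : p₂ * (1 + z) < 0 := mul_neg_of_neg_of_pos hp (by linarith)
  have h7 : |p₁| * z ≤ N * z := mul_le_mul_of_nonneg_right h4 hz0.le
  unfold quad
  rw [h5]
  nlinarith [abs_nonneg p₁]

theorem eq_zero_of_forall_quad {k₂ k₁ k₀ : ℝ} (h : ∀ x, k₂ * x ^ 2 + k₁ * x + k₀ = 0) :
    k₂ = 0 ∧ k₁ = 0 ∧ k₀ = 0 := by
  have h0 := h 0
  have h1 := h 1
  have h2 := h (-1)
  refine ⟨?_, ?_, ?_⟩ <;> linarith

section

variable {lo hi a b c d w ρ x : ℝ} {S : ℝ → ℝ} {X : ℝ≥0 → Path → ℝ} {P : Measure Path}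

theorem joint_quad_measurable (hX : IsSol lo hi a b S x X) (g₂ g₁ g₀ : ℝ) :
    Measurable (joint fun t ω => quad g₂ g₁ g₀ (X t ω)) := by
  have := measurable_joint hX.1
  have hq : Measurable (quad g₂ g₁ g₀) := by unfold quad; fun_prop
  exact hq.comp this

theorem integral_reward {G : Path × ℝ≥0 → ℝ} [SFinite P]
    (h : Integrable (fun p : Path × ℝ≥0 => Real.exp (-ρ * p.2) * G p) (P.prod dt)) :
    ∫ ω, ∫ t : ℝ≥0, Real.exp (-ρ * t) * G (ω, t) ∂dt ∂P =
      ∫ p : Path × ℝ≥0, Real.exp (-ρ * p.2) * G p ∂P.prod dt :=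
  (integral_prod _ h).symm

theorem integral_exp_quad [IsProbabilityMeasure P] (hρ : 0 < ρ) {Y : Path × ℝ≥0 → ℝ}
    (i2 : Integrable (fun p : Path × ℝ≥0 => Real.exp (-ρ * p.2) * Y p ^ 2) (P.prod dt))
    (i1 : Integrable (fun p : Path × ℝ≥0 => Real.exp (-ρ * p.2) * Y p) (P.prod dt))
    (k₂ k₁ k₀ : ℝ) :
    Integrable (fun p : Path × ℝ≥0 => Real.exp (-ρ * p.2) * (k₂ * Y p ^ 2 + k₁ * Y p + k₀))
      (P.prod dt) ∧
    ∫ p : Path × ℝ≥0, Real.exp (-ρ * p.2) * (k₂ * Y p ^ 2 + k₁ * Y p + k₀) ∂P.prod dt =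
      k₂ * ∫ p : Path × ℝ≥0, Real.exp (-ρ * p.2) * Y p ^ 2 ∂P.prod dt +
      k₁ * ∫ p : Path × ℝ≥0, Real.exp (-ρ * p.2) * Y p ∂P.prod dt + k₀ / ρ := by
  have i0 := integrable_exp_prod (P := P) hρ
  have e : ∀ p : Path × ℝ≥0, Real.exp (-ρ * p.2) * (k₂ * Y p ^ 2 + k₁ * Y p + k₀) =
      k₂ * (Real.exp (-ρ * p.2) * Y p ^ 2) + k₁ * (Real.exp (-ρ * p.2) * Y p) +
      k₀ * Real.exp (-ρ * p.2) := fun p => by ring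
  have i21 : Integrable (fun p : Path × ℝ≥0 => k₂ * (Real.exp (-ρ * p.2) * Y p ^ 2) +
      k₁ * (Real.exp (-ρ * p.2) * Y p)) (P.prod dt) := (i2.const_mul k₂).add (i1.const_mul k₁)
  simp_rw [e]
  refine ⟨i21.add (i0.const_mul k₀), ?_⟩
  rw [integral_add i21 (i0.const_mul k₀), integral_add (i2.const_mul k₂) (i1.const_mul k₁),
    integral_const_mul, integral_const_mul, integral_const_mul, integral_exp_prod hρ]
  ring

/-- If a quadratic functional with concave leading part is discounted integrable, so are the first
two powers of the state. -/
theorem integrable_powers [IsProbabilityMeasure P] (hρ : 0 < ρ) {Y : Path × ℝ≥0 → ℝ}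
    (hY : Measurable Y) {g₂ g₁ g₀ : ℝ} (hg : g₂ ≠ 0)
    (h : Integrable (fun p : Path × ℝ≥0 => Real.exp (-ρ * p.2) * quad g₂ g₁ g₀ (Y p)) (P.prod dt)) :
    Integrable (fun p : Path × ℝ≥0 => Real.exp (-ρ * p.2) * Y p ^ 2) (P.prod dt) ∧
    Integrable (fun p : Path × ℝ≥0 => Real.exp (-ρ * p.2) * Y p) (P.prod dt) := by
  have i0 := integrable_exp_prod (P := P) hρ
  have me : Measurable fun p : Path × ℝ≥0 => Real.exp (-ρ * p.2) := by fun_prop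
  have hg' : 0 < |g₂| := abs_pos.2 hg
  set C := g₁ ^ 2 / g₂ ^ 2 * 4 + 4 * |g₀| / |g₂| with hC
  have i2 : Integrable (fun p : Path × ℝ≥0 => Real.exp (-ρ * p.2) * Y p ^ 2) (P.prod dt) := by
    refine Integrable.mono' ((h.abs.const_mul (4 / |g₂|)).add (i0.const_mul C))
      (me.mul (hY.pow_const 2)).aestronglyMeasurable (ae_of_all _ fun p => ?_)
    have he := Real.exp_pos (-ρ * p.2)
    simp only [Pi.add_apply, Real.norm_eq_abs, abs_mul, Real.abs_exp, abs_pow, sq_abs]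
    have hk : Y p ^ 2 ≤ 4 / |g₂| * |quad g₂ g₁ g₀ (Y p)| + C := by
      set y := Y p
      set q := quad g₂ g₁ g₀ y with hq
      -- The polynomial is solved for `y²`; half of `y²` then absorbs the linear term.
      have e1 : y ^ 2 = 2 * (q / g₂) - 2 * (g₁ / g₂) * y - 2 * (g₀ / g₂) := by
        rw [hq, quad]; field_simp; ring
      have e2 : -2 * (g₁ / g₂) * y ≤ y ^ 2 / 2 + 2 * (g₁ / g₂) ^ 2 := by
        nlinarith [sq_nonneg (y + 2 * (g₁ / g₂))]
      have e3 := le_abs_self (q / g₂)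
      have e4 := neg_abs_le (g₀ / g₂)
      rw [abs_div] at e3 e4
      have e5 : 4 / |g₂| * |q| = 4 * (|q| / |g₂|) := by ring
      have e6 : C = 4 * (g₁ / g₂) ^ 2 + 4 * (|g₀| / |g₂|) := by rw [hC]; ring
      rw [e5, e6]; linarith
    have := mul_le_mul_of_nonneg_left hk he.le
    linarith
  refine ⟨i2, Integrable.mono' (i2.add i0) (me.mul hY).aestronglyMeasurable
    (ae_of_all _ fun p => ?_)⟩
  have he := Real.exp_pos (-ρ * p.2)
  simp only [Pi.add_apply, Real.norm_eq_abs, abs_mul, Real.abs_exp]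
  have hk : |Y p| ≤ Y p ^ 2 + 1 := by
    rw [abs_le]; constructor <;> nlinarith [sq_nonneg (Y p - 1), sq_nonneg (Y p + 1)]
  have := mul_le_mul_of_nonneg_left hk he.le
  linarith

/-- The discounted first moment of a solution. -/
theorem IsSol.first_moment (hX : IsSol lo hi a b S x X) (hSc : Continuous S)
    (hP : P ∈ priors lo hi) (h0 : 0 ≤ hi) (hρ : 0 < ρ) (htv : Transversal P ρ X)
    (i1 : Integrable (fun p : Path × ℝ≥0 => Real.exp (-ρ * p.2) * joint X p) (P.prod dt)) :
    (ρ - a) * ∫ p : Path × ℝ≥0, Real.exp (-ρ * p.2) * joint X p ∂P.prod dt = x + b / ρ := by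
  have := hP.1
  have i0 := integrable_exp_prod (P := P) hρ
  have e : ∀ p : Path × ℝ≥0, Real.exp (-ρ * p.2) *
      (ρ * joint X p - joint (fun s ω => a * X s ω + b) p) =
      (ρ - a) * (Real.exp (-ρ * p.2) * joint X p) - b * Real.exp (-ρ * p.2) := fun p => by
    simp only [joint]; ring
  have h := (hX.itoProc hSc hP).verification_linear hP h0 hρ htv (by
    simp_rw [e]; exact (i1.const_mul _).sub (i0.const_mul b))
  simp_rw [e] at h
  rw [integral_sub (i1.const_mul _) (i0.const_mul b), integral_const_mul, integral_const_mul,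
    integral_exp_prod hρ] at h
  linear_combination h

/-- The test function is `-y²`. Under a general prior the volatility may stay below `hi`, so only
one inequality survives. -/
theorem IsSol.second_moment_le (hX : IsSol lo hi a b S x X) (hSc : Continuous S)
    (hS : ∀ y, S y ^ 2 = (c * y + d) ^ 2 + w)
    (hP : P ∈ priors lo hi) (h0 : 0 ≤ hi) (hρ : 0 < ρ) (htv : Transversal P ρ X)
    (i2 : Integrable (fun p : Path × ℝ≥0 => Real.exp (-ρ * p.2) * joint X p ^ 2) (P.prod dt))
    (i1 : Integrable (fun p : Path × ℝ≥0 => Real.exp (-ρ * p.2) * joint X p) (P.prod dt)) :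
    (ρ - (2 * a + c ^ 2 * hi ^ 2)) *
        ∫ p : Path × ℝ≥0, Real.exp (-ρ * p.2) * joint X p ^ 2 ∂P.prod dt ≤
      x ^ 2 + (2 * b + 2 * c * d * hi ^ 2) *
        ∫ p : Path × ℝ≥0, Real.exp (-ρ * p.2) * joint X p ∂P.prod dt +
      hi ^ 2 * (d ^ 2 + w) / ρ := by
  have := hP.1
  have hq := integral_exp_quad hρ i2 i1 (-(ρ - (2 * a + c ^ 2 * hi ^ 2)))
    (2 * b + 2 * c * d * hi ^ 2) (hi ^ 2 * (d ^ 2 + w))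
  have h := (hX.itoProc hSc hP).verification_ge (p₂ := -2) (p₁ := 0) (p₀ := 0) hP h0 hρ
    (by norm_num) htv hq.1 (ae_of_all _ fun p => le_of_eq (by
      simp only [residual, quad, joint, hS]; ring))
  rw [hq.2] at h
  simp only [quad] at h
  linarith

/-- Under constant volatility `hi` the test function `y²` gives equality; this prior therefore has
the largest discounted second moment once the coefficient on the left is positive. -/
theorem IsSol.second_moment_eq (hX : IsSol lo hi a b S x X) (hSc : Continuous S)
    (hS : ∀ y, S y ^ 2 = (c * y + d) ^ 2 + w) (hP' : P ∈ priors lo hi)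
    (hP : P ∈ priors hi hi) (h0 : 0 ≤ hi) (hρ : 0 < ρ) (htv : Transversal P ρ X)
    (i2 : Integrable (fun p : Path × ℝ≥0 => Real.exp (-ρ * p.2) * joint X p ^ 2) (P.prod dt))
    (i1 : Integrable (fun p : Path × ℝ≥0 => Real.exp (-ρ * p.2) * joint X p) (P.prod dt)) :
    (ρ - (2 * a + c ^ 2 * hi ^ 2)) *
        ∫ p : Path × ℝ≥0, Real.exp (-ρ * p.2) * joint X p ^ 2 ∂P.prod dt =
      x ^ 2 + (2 * b + 2 * c * d * hi ^ 2) *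
        ∫ p : Path × ℝ≥0, Real.exp (-ρ * p.2) * joint X p ∂P.prod dt +
      hi ^ 2 * (d ^ 2 + w) / ρ := by
  have := hP.1
  have hq := integral_exp_quad hρ i2 i1 (ρ - (2 * a + c ^ 2 * hi ^ 2))
    (-(2 * b + 2 * c * d * hi ^ 2)) (-(hi ^ 2 * (d ^ 2 + w)))
  have e : ∀ p, residual ρ (hi ^ 2) 2 0 0 (joint X p) (joint (fun s ω => a * X s ω + b) p)
      (joint (fun s ω => S (X s ω)) p) = (ρ - (2 * a + c ^ 2 * hi ^ 2)) * joint X p ^ 2 +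
      -(2 * b + 2 * c * d * hi ^ 2) * joint X p + -(hi ^ 2 * (d ^ 2 + w)) := fun p => by
    simp only [residual, quad, joint, hS]; ring
  have h := (hX.itoProc hSc hP').verification_eq (p₂ := 2) (p₁ := 0) (p₀ := 0) hP h0 hρ htv
    (by simp_rw [e]; exact hq.1)
  simp_rw [e] at h
  rw [hq.2] at h
  simp only [quad] at h
  linear_combination h

end

/-- The reward of a closed-loop system under a feedback for which the reward rate is quadratic. -/
noncomputable def loopReward (lo hi ρ : ℝ) (G : ℝ → ℝ) (X : ℝ≥0 → Path → ℝ) : EReal :=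
  lowerE (priors lo hi) fun ω => ∫ t, Real.exp (-ρ * t) * G (X t ω) ∂dt

/-- `X` is a transversal solution with integrable reward. -/
structure IsLoop (lo hi a b ρ : ℝ) (S G : ℝ → ℝ) (x : ℝ) (X : ℝ≥0 → Path → ℝ) : Prop where
  sol : IsSol lo hi a b S x X
  transversality : liminf (fun T : ℝ≥0 => ENNReal.ofReal (Real.exp (-ρ * T)) *
    upperE (priors lo hi) (fun ω => ENNReal.ofReal (X T ω ^ 2))) atTop = 0
  reward : upperE (priors lo hi) (fun ω => ∫⁻ t,
    ENNReal.ofReal (Real.exp (-ρ * t) * |G (X t ω)|) ∂dt) < ∞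

theorem IsLoop.integrable {lo hi a b ρ x g₂ g₁ g₀ : ℝ} {S : ℝ → ℝ} {X : ℝ≥0 → Path → ℝ}
    (h : IsLoop lo hi a b ρ S (quad g₂ g₁ g₀) x X) {P : Measure Path} (hP : P ∈ priors lo hi) :
    Integrable (fun p : Path × ℝ≥0 => Real.exp (-ρ * p.2) * quad g₂ g₁ g₀ (joint X p))
      (P.prod dt) :=
  integrable_of_upperE (R := fun t ω => quad g₂ g₁ g₀ (X t ω)) h.reward hP
    (joint_quad_measurable h.sol g₂ g₁ g₀).aemeasurable

theorem IsLoop.integral_eq {lo hi a b ρ x g₂ g₁ g₀ : ℝ} {S : ℝ → ℝ} {X : ℝ≥0 → Path → ℝ}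
    (h : IsLoop lo hi a b ρ S (quad g₂ g₁ g₀) x X) {P : Measure Path} (hP : P ∈ priors lo hi) :
    ∫ ω, ∫ t : ℝ≥0, Real.exp (-ρ * t) * quad g₂ g₁ g₀ (X t ω) ∂dt ∂P =
      ∫ p : Path × ℝ≥0, Real.exp (-ρ * p.2) * quad g₂ g₁ g₀ (joint X p) ∂P.prod dt := by
  have := hP.1
  exact integral_reward (G := fun p => quad g₂ g₁ g₀ (joint X p)) (h.integrable hP)

section

variable {lo hi a b c d w ρ g₂ g₁ g₀ p₂ p₁ p₀ : ℝ} {S : ℝ → ℝ} {P : Measure Path}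

/-- If the closed-loop reward is a strictly concave quadratic function of the initial state, then
the system is stable and the Hamilton-Jacobi-Bellman equation holds along the feedback. -/
theorem hjb_of_loopReward (hSc : Continuous S) (hS : ∀ y, S y ^ 2 = (c * y + d) ^ 2 + w)
    (h0 : 0 ≤ hi) (hρ : 0 < ρ) (hP' : P ∈ priors lo hi) (hP : P ∈ priors hi hi) (hp₂ : p₂ < 0)
    (h : ∀ x, ∃ X, IsLoop lo hi a b ρ S (quad g₂ g₁ g₀) x X ∧
      loopReward lo hi ρ (quad g₂ g₁ g₀) X = (quad p₂ p₁ p₀ x : ℝ)) :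
    2 * a + c ^ 2 * hi ^ 2 < ρ ∧
      ∀ y, quad g₂ g₁ g₀ y = residual ρ (hi ^ 2) p₂ p₁ p₀ y (a * y + b) (S y) := by
  have hPr := hP.1
  choose X hX hJ using h
  have htv : ∀ x, ∀ P ∈ priors lo hi, Transversal P ρ (X x) := fun x P hP =>
    transversal_of_liminf (hX x).transversality hP
  rcases lt_trichotomy g₂ 0 with hg | hg | hg
  · -- the concave case
    have hpow := fun x P (hP : P ∈ priors lo hi) =>
      have := hP.1
      integrable_powers hρ (measurable_joint (hX x).sol.1) hg.ne ((hX x).integrable hP)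
    have hm := fun x P (hP : P ∈ priors lo hi) =>
      (hX x).sol.first_moment hSc hP h0 hρ (htv x P hP) (hpow x P hP).2
    have hW := fun x => (hX x).sol.second_moment_eq hSc hS hP' hP h0 hρ (htv x P hP')
      (hpow x P hP').1 (hpow x P hP').2
    -- Otherwise the first-moment identity would read `0 = x + b / ρ` for every `x`.
    have hra : ρ - a ≠ 0 := fun he => by
      have h1 := hm 0 P hP'
      have h2 := hm 1 P hP'
      rw [he] at h1 h2
      linarith
    set m : ℝ → ℝ := fun x => (x + b / ρ) / (ρ - a) with hmdef
    have hm' : ∀ x, ∀ P ∈ priors lo hi,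
        ∫ p : Path × ℝ≥0, Real.exp (-ρ * p.2) * joint (X x) p ∂P.prod dt = m x := fun x P hP => by
      rw [hmdef, eq_div_iff hra, mul_comm]; exact hm x P hP
    set W : ℝ → ℝ := fun x => ∫ p : Path × ℝ≥0, Real.exp (-ρ * p.2) * joint (X x) p ^ 2 ∂P.prod dt
      with hWdef
    set κ := 2 * a + c ^ 2 * hi ^ 2 with hκ
    set q := 2 * b + 2 * c * d * hi ^ 2 with hq
    set z := hi ^ 2 * (d ^ 2 + w) / ρ with hz
    have hW' : ∀ x, (ρ - κ) * W x = x ^ 2 + q * m x + z := fun x => by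
      rw [← hm' x P hP']; exact hW x
    have hmexp : ∀ x, q * m x = q / (ρ - a) * x + q * (b / ρ) / (ρ - a) := fun x => by
      rw [hmdef]; ring
    -- Otherwise a polynomial with leading term `x²` would vanish identically.
    have hrk : ρ - κ ≠ 0 := fun he => by
      have := eq_zero_of_forall_quad (k₂ := 1) (k₁ := q / (ρ - a))
        (k₀ := q * (b / ρ) / (ρ - a) + z) fun x => by
          have := hW' x
          rw [he, zero_mul, hmexp] at this
          linarith
      exact one_ne_zero this.1
    have hW0 : ∀ x, 0 ≤ W x := fun x => integral_nonneg fun p => by positivity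
    -- This is where stability comes from: `W` is nonnegative, while the right-hand side of `hW'` is
    -- positive for suitable `x`, so the factor `ρ - κ` cannot be negative.
    have hκρ : 0 < ρ - κ := by
      rcases lt_or_gt_of_ne hrk with h | h
      · exfalso
        obtain ⟨x, hx⟩ := quad_ne_bounded_below (p₂ := -2) (p₁ := -(q / (ρ - a)))
          (p₀ := -(q * (b / ρ) / (ρ - a) + z)) (by norm_num) 0
        have h1 := hW' x
        rw [hmexp] at h1
        have h3 : (ρ - κ) * W x ≤ 0 := mul_nonpos_of_nonpos_of_nonneg h.le (hW0 x)
        unfold quad at hx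
        linarith
      · exact h
    -- The means agree under all priors and `ρ - κ > 0`, so the second moment is largest under
    -- constant volatility `hi`. As `g₂ < 0`, that prior attains the lower expectation.
    have hWle : ∀ x, ∀ P' ∈ priors lo hi,
        ∫ p : Path × ℝ≥0, Real.exp (-ρ * p.2) * joint (X x) p ^ 2 ∂P'.prod dt ≤ W x :=
      fun x P' hP'' => by
        have := (hX x).sol.second_moment_le hSc hS hP'' h0 hρ (htv x P' hP'')
          (hpow x P' hP'').1 (hpow x P' hP'').2
        rw [hm' x P' hP''] at this
        refine le_of_mul_le_mul_left (this.trans ?_) hκρ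
        rw [hW']
    have hJP : ∀ x, ∀ P' ∈ priors lo hi,
        ∫ ω, ∫ t : ℝ≥0, Real.exp (-ρ * t) * quad g₂ g₁ g₀ (X x t ω) ∂dt ∂P' =
        1 / 2 * g₂ * ∫ p : Path × ℝ≥0, Real.exp (-ρ * p.2) * joint (X x) p ^ 2 ∂P'.prod dt +
          g₁ * m x + g₀ / ρ := fun x P' hP'' => by
      have := hP''.1
      rw [(hX x).integral_eq hP'', ← hm' x P' hP'']
      exact (integral_exp_quad hρ (hpow x P' hP'').1 (hpow x P' hP'').2 (1 / 2 * g₂) g₁ g₀).2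
    have hval : ∀ x, quad p₂ p₁ p₀ x = 1 / 2 * g₂ * W x + g₁ * m x + g₀ / ρ := fun x => by
      have h1 := hJ x
      rw [loopReward, lowerE_eq (v := 1 / 2 * g₂ * W x + g₁ * m x + g₀ / ρ) hP'
        (fun P' hP'' => ?_) (hJP x P hP').le] at h1
      · exact (EReal.coe_eq_coe_iff.1 h1).symm
      · rw [hJP x P' hP'']
        have := mul_le_mul_of_nonpos_left (hWle x P' hP'') (by linarith : 1 / 2 * g₂ ≤ 0)
        linarith
    have hWx : ∀ x, W x = (x ^ 2 + q * m x + z) / (ρ - κ) := fun x => by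
      rw [eq_div_iff hrk, mul_comm]; exact hW' x
    -- Both expressions for the reward are polynomials in the initial state. Their three coefficient
    -- identities, solved for `g₂`, `g₁`, `g₀`, are the Hamilton–Jacobi–Bellman equation.
    obtain ⟨e2, e1, e0⟩ := eq_zero_of_forall_quad
      (k₂ := 1 / 2 * (g₂ / (ρ - κ) - p₂))
      (k₁ := (1 / 2 * g₂ * q / (ρ - κ) + g₁) / (ρ - a) - p₁)
      (k₀ := 1 / 2 * g₂ * (q * (b / ρ) / (ρ - a) + z) / (ρ - κ) + g₁ * (b / ρ) / (ρ - a) +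
        g₀ / ρ - p₀) fun x => by
        have h1 := hval x
        rw [hWx] at h1
        simp only [quad, hmdef] at h1
        have e : (x ^ 2 + q * ((x + b / ρ) / (ρ - a)) + z) / (ρ - κ) =
          x ^ 2 / (ρ - κ) + q * x / (ρ - a) / (ρ - κ) +
            (q * (b / ρ) / (ρ - a) + z) / (ρ - κ) := by ring
        rw [e] at h1
        linear_combination -h1
    have hg₂ : g₂ = p₂ * (ρ - κ) := by
      have : g₂ / (ρ - κ) = p₂ := by linarith
      rw [← this]; field_simp
    have hg₁ : g₁ = p₁ * (ρ - a) - 1 / 2 * p₂ * q := by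
      have e3 : (1 / 2 * g₂ * q / (ρ - κ) + g₁) / (ρ - a) = p₁ := by linarith
      rw [div_eq_iff hra, hg₂] at e3
      have e4 : 1 / 2 * (p₂ * (ρ - κ)) * q / (ρ - κ) = 1 / 2 * p₂ * q := by field_simp
      linarith
    have hg₀ : g₀ = ρ * p₀ - b * p₁ - 1 / 2 * p₂ * z * ρ := by
      have e3 : 1 / 2 * g₂ * (q * (b / ρ) / (ρ - a) + z) / (ρ - κ) =
          1 / 2 * p₂ * (q * (b / ρ) / (ρ - a) + z) := by rw [hg₂]; field_simp
      rw [e3, hg₁] at e0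
      have e5 : (p₁ * (ρ - a) - 1 / 2 * p₂ * q) * (b / ρ) / (ρ - a) =
        p₁ * (b / ρ) - 1 / 2 * p₂ * (q * (b / ρ) / (ρ - a)) := by field_simp
      rw [e5] at e0
      have e6 : g₀ / ρ = p₀ - p₁ * (b / ρ) - 1 / 2 * p₂ * z := by linarith
      rw [div_eq_iff hρ.ne'] at e6
      rw [e6]; field_simp
    refine ⟨by linarith, fun y => ?_⟩
    simp only [quad, residual, hS]
    rw [hg₂, hg₁, hg₀, hκ, hq, hz]
    field_simp
    ring
  · -- the affine case
    exfalso
    -- The discounted mean is affine in the initial state and independent of the prior. An affine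
    -- reward rate would thus give an affine value, contradicting `p₂ < 0`.
    have hpt : ∀ y, quad g₂ g₁ g₀ y = g₁ * y + g₀ := fun y => by rw [quad, hg]; ring
    by_cases hg1 : g₁ = 0
    · have hc : ∀ x, quad p₂ p₁ p₀ x = g₀ / ρ := fun x => by
        have h1 := hJ x
        rw [loopReward, lowerE_const (c := g₀ / ρ) hP' fun P' hP'' => ?_] at h1
        · exact (EReal.coe_eq_coe_iff.1 h1).symm
        · have := hP''.1
          simp_rw [hpt, hg1, zero_mul, zero_add, integral_mul_const, integral_exp_dt hρ]
          simp; ring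
      obtain ⟨x, hx⟩ := quad_ne_bounded_below (p₁ := p₁) (p₀ := p₀) hp₂ (g₀ / ρ)
      exact hx.ne (hc x)
    · have i1 : ∀ x, ∀ P ∈ priors lo hi, Integrable
          (fun p : Path × ℝ≥0 => Real.exp (-ρ * p.2) * joint (X x) p) (P.prod dt) := fun x P hP => by
        have := hP.1
        refine (((hX x).integrable hP).sub
          ((integrable_exp_prod (P := P) hρ).const_mul g₀)).const_mul (1 / g₁) |>.congr
          (ae_of_all _ fun p => ?_)
        simp only [Pi.sub_apply, hpt]
        field_simp
        ring
      have hm := fun x P (hP : P ∈ priors lo hi) =>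
        (hX x).sol.first_moment hSc hP h0 hρ (htv x P hP) (i1 x P hP)
      have hra : ρ - a ≠ 0 := fun he => by
        have h1 := hm 0 P hP'
        have h2 := hm 1 P hP'
        rw [he] at h1 h2
        linarith
      have hval : ∀ x, quad p₂ p₁ p₀ x = g₁ * ((x + b / ρ) / (ρ - a)) + g₀ / ρ := fun x => by
        have h1 := hJ x
        rw [loopReward, lowerE_const (c := g₁ * ((x + b / ρ) / (ρ - a)) + g₀ / ρ) hP'
          fun P' hP'' => ?_] at h1
        · exact (EReal.coe_eq_coe_iff.1 h1).symm
        · have := hP''.1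
          rw [(hX x).integral_eq hP'']
          have e : ∀ p : Path × ℝ≥0, Real.exp (-ρ * p.2) * quad g₂ g₁ g₀ (joint (X x) p) =
            g₁ * (Real.exp (-ρ * p.2) * joint (X x) p) + g₀ * Real.exp (-ρ * p.2) := fun p => by
              rw [hpt]; ring
          simp_rw [e]
          rw [integral_add ((i1 x P' hP'').const_mul g₁)
            ((integrable_exp_prod (P := P') hρ).const_mul g₀), integral_const_mul,
            integral_const_mul, integral_exp_prod hρ, ← hm x P' hP'']
          field_simp
      have := (eq_zero_of_forall_quad (k₂ := 1 / 2 * p₂) (k₁ := p₁ - g₁ / (ρ - a))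
        (k₀ := p₀ - g₁ * (b / ρ) / (ρ - a) - g₀ / ρ) fun x => by
          have h1 := hval x
          rw [quad] at h1
          linear_combination h1).1
      linarith
  · -- the convex case
    exfalso
    -- Completing the square bounds a convex reward rate below by a constant, hence also the value.
    -- A strictly concave quadratic is not bounded below.
    obtain ⟨x, hx⟩ := quad_ne_bounded_below (p₁ := p₁) (p₀ := p₀) hp₂
      ((g₀ - g₁ ^ 2 / (2 * g₂)) / ρ)
    have h1 : (((g₀ - g₁ ^ 2 / (2 * g₂)) / ρ : ℝ) : EReal) ≤
        loopReward lo hi ρ (quad g₂ g₁ g₀) (X x) := by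
      refine le_lowerE fun P' hP'' => ?_
      have := hP''.1
      rw [(hX x).integral_eq hP'']
      have e : (g₀ - g₁ ^ 2 / (2 * g₂)) / ρ = ∫ p : Path × ℝ≥0,
          Real.exp (-ρ * p.2) * (g₀ - g₁ ^ 2 / (2 * g₂)) ∂P'.prod dt := by
        rw [integral_mul_const, integral_exp_prod hρ]; ring
      rw [e]
      refine integral_mono ((integrable_exp_prod hρ).mul_const _) ((hX x).integrable hP'')
        fun p => mul_le_mul_of_nonneg_left ?_ (Real.exp_pos _).le
      have : quad g₂ g₁ g₀ (joint (X x) p) - (g₀ - g₁ ^ 2 / (2 * g₂)) =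
          1 / 2 * g₂ * (joint (X x) p + g₁ / g₂) ^ 2 := by
        rw [quad]; field_simp; ring
      have h2 : 0 ≤ 1 / 2 * g₂ * (joint (X x) p + g₁ / g₂) ^ 2 := by positivity
      linarith
    rw [hJ x, EReal.coe_le_coe_iff] at h1
    linarith

/-- Conversely, the reward of a stable feedback that satisfies the Hamilton-Jacobi-Bellman
equation. -/
theorem loopReward_eq {x : ℝ} {X : ℝ≥0 → Path → ℝ} (hSc : Continuous S)
    (h0 : 0 ≤ hi) (hρ : 0 < ρ) (hP' : P ∈ priors lo hi) (hP : P ∈ priors hi hi) (hp₂ : p₂ ≤ 0)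
    (hX : IsLoop lo hi a b ρ S (quad g₂ g₁ g₀) x X)
    (hG : ∀ y, quad g₂ g₁ g₀ y = residual ρ (hi ^ 2) p₂ p₁ p₀ y (a * y + b) (S y)) :
    loopReward lo hi ρ (quad g₂ g₁ g₀) X = (quad p₂ p₁ p₀ x : ℝ) := by
  refine lowerE_eq hP' (fun P' hP'' => ?_) ?_
  · rw [hX.integral_eq hP'']
    exact (hX.sol.itoProc hSc hP'').verification_ge hP'' h0 hρ hp₂
      (transversal_of_liminf hX.transversality hP'') (hX.integrable hP'')
      (ae_of_all _ fun p => (hG _).ge)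
  · rw [hX.integral_eq hP']
    exact (hX.sol.itoProc hSc hP').verification_le hP h0 hρ
      (transversal_of_liminf hX.transversality hP') (hX.integrable hP')
      (ae_of_all _ fun p => (hG _).le)

theorem exists_isLoop {L : ℝ} (hSL : ∀ y z, |S y - S z| ≤ L * |y - z|)
    (hS : ∀ y, S y ^ 2 = (c * y + d) ^ 2 + w) (h0 : 0 ≤ hi) (hρ : 0 < ρ)
    (hκ : 2 * a + c ^ 2 * hi ^ 2 < ρ) (g₂ g₁ g₀ x : ℝ) :
    ∃ X, IsLoop lo hi a b ρ S (quad g₂ g₁ g₀) x X := by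
  obtain ⟨X, hX⟩ := exists_isSol lo h0 a b hSL x
  have hSc := continuous_of_lip hSL
  refine ⟨X, hX, hX.liminf_eq_zero hSc hS h0 hρ hκ, hX.upperE_lt_top hSc hS h0 hρ hκ
    (C := |g₂| + |g₁| + |g₀|) (by positivity) fun y => ?_⟩
  have h1 : |y| ≤ 1 + y ^ 2 := by
    rw [abs_le]; constructor <;> nlinarith [sq_nonneg (y - 1), sq_nonneg (y + 1)]
  unfold quad
  refine (abs_add_three _ _ _).trans ?_
  rw [abs_mul, abs_mul, abs_mul, abs_of_nonneg (sq_nonneg y), abs_of_pos (one_half_pos (α := ℝ))]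
  have h2 := mul_le_mul_of_nonneg_left h1 (abs_nonneg g₁)
  nlinarith [mul_nonneg (abs_nonneg g₂) (sq_nonneg y), mul_nonneg (abs_nonneg g₀) (sq_nonneg y),
    abs_nonneg g₂]

end

/-! ### Isonormal Gaussian families on Hilbert spaces -/

section Isonormal

variable {Ω : Type*} [MeasurableSpace Ω] {P : Measure Ω} [IsProbabilityMeasure P]

lemma integral_abs_le_norm (ξ : Lp ℝ 2 P) : ∫ ω, |ξ ω| ∂P ≤ ‖ξ‖ := by
  have h1 : ∫ ω, |ξ ω| ∂P = (eLpNorm ξ 1 P).toReal := by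
    rw [eLpNorm_one_eq_lintegral_enorm, ← integral_norm_eq_lintegral_enorm
      (Lp.aestronglyMeasurable ξ)]
    simp
  rw [h1, Lp.norm_def]
  exact ENNReal.toReal_mono (Lp.eLpNorm_ne_top ξ)
    (eLpNorm_le_eLpNorm_of_exponent_le (by norm_num) (Lp.aestronglyMeasurable ξ))

lemma integrable_exp_I (ξ : Lp ℝ 2 P) :
    Integrable (fun ω => Complex.exp (Complex.I * (ξ ω : ℝ))) P := by
  refine Integrable.of_bound (C := 1) ?_ (ae_of_all _ fun ω => ?_)
  · exact (Complex.measurable_exp.comp (measurable_const.mul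
      (Complex.measurable_ofReal))).comp_aemeasurable
      (Lp.aestronglyMeasurable ξ).aemeasurable |>.aestronglyMeasurable
  · rw [mul_comm, Complex.norm_exp_ofReal_mul_I]

/-- The map `ξ ↦ e^{iξ}` is 1-Lipschitz into `L¹`, and the `L¹` norm is dominated by the `L²` norm.
-/
lemma continuous_integral_exp_I :
    Continuous fun ξ : Lp ℝ 2 P => ∫ ω, Complex.exp (Complex.I * (ξ ω : ℝ)) ∂P := by
  refine (LipschitzWith.of_dist_le_mul (K := 1) fun ξ η => ?_).continuous
  rw [dist_eq_norm, dist_eq_norm, ← integral_sub (integrable_exp_I ξ) (integrable_exp_I η)]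
  refine (norm_integral_le_integral_norm _).trans ?_
  refine le_trans ?_ ((integral_abs_le_norm (ξ - η)).trans (by simp))
  refine integral_mono_ae ((integrable_exp_I ξ).sub (integrable_exp_I η)).norm
    ((Lp.memLp (ξ - η)).integrable (by norm_num)).norm ?_
  filter_upwards [Lp.coeFn_sub ξ η] with ω hω
  simp only [hω, Pi.sub_apply]
  have : Complex.exp (Complex.I * (ξ ω : ℝ)) - Complex.exp (Complex.I * (η ω : ℝ))
      = Complex.exp ((η ω : ℝ) * Complex.I) *
        (Complex.exp (Complex.I * ((ξ ω - η ω : ℝ) : ℂ)) - 1) := by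
    rw [mul_sub, ← Complex.exp_add]; push_cast; ring_nf
  rw [this, norm_mul, Complex.norm_exp_ofReal_mul_I, one_mul]
  exact Real.norm_exp_I_mul_ofReal_sub_one_le

/-- A linear isometry into `L²` whose values on a Hilbert basis are independent standard Gaussian
variables takes centred Gaussian values. -/
lemma map_eq_gaussianReal_of_hilbertBasis {H ι : Type*} [NormedAddCommGroup H]
    [InnerProductSpace ℝ H] (b : HilbertBasis ι ℝ H) (W : H →ₗᵢ[ℝ] Lp ℝ 2 P) (Z : ι → Ω → ℝ)
    (hZ : ∀ i, HasLaw (Z i) (gaussianReal 0 1) P) (hind : iIndepFun Z P)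
    (hW : ∀ i, W (b i) =ᵐ[P] Z i) (f : H) :
    P.map (W f) = gaussianReal 0 (‖f‖₊ ^ 2) := by
  have key : ∀ f : H, ∫ ω, Complex.exp (Complex.I * (W f ω : ℝ)) ∂P
      = Complex.exp (-((‖f‖ : ℂ) ^ 2) / 2) := by
    -- Both sides are continuous in `f`, so the identity need only be checked on the dense span of
    -- the basis, where independence factorizes the characteristic function.
    have hcl : IsClosed {f : H | ∫ ω, Complex.exp (Complex.I * (W f ω : ℝ)) ∂P
        = Complex.exp (-((‖f‖ : ℂ) ^ 2) / 2)} :=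
      isClosed_eq (continuous_integral_exp_I.comp W.continuous) (by fun_prop)
    have hsub : ((Submodule.span ℝ (Set.range b) : Submodule ℝ H) : Set H) ⊆
        {f : H | ∫ ω, Complex.exp (Complex.I * (W f ω : ℝ)) ∂P
        = Complex.exp (-((‖f‖ : ℂ) ^ 2) / 2)} := by
      intro f hf
      obtain ⟨c, rfl⟩ := Finsupp.mem_span_range_iff_exists_finsupp.1 hf
      simp only [Set.mem_ofPred_eq, Finsupp.sum]
      have h1 : W (∑ i ∈ c.support, c i • b i) =ᵐ[P] fun ω => ∑ i ∈ c.support, c i * Z i ω := by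
        rw [map_sum]
        refine (Lp.coeFn_finsetSum _ _).trans ?_
        have : ∀ᵐ ω ∂P, ∀ i ∈ c.support, (W (c i • b i)) ω = c i * Z i ω := by
          refine (ae_ball_iff c.support.countable_toSet).2 fun i _ => ?_
          rw [map_smul]
          filter_upwards [Lp.coeFn_smul (c i) (W (b i)), hW i] with ω h1 h2
          rw [h1, Pi.smul_apply, h2, smul_eq_mul]
        filter_upwards [this] with ω hω
        rw [Finset.sum_apply]
        exact Finset.sum_congr rfl hω
      have h2 : ∫ ω, Complex.exp (Complex.I * (W (∑ i ∈ c.support, c i • b i) ω : ℝ)) ∂P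
          = charFun (P.map fun ω => ∑ i ∈ c.support, c i * Z i ω) 1 := by
        rw [charFun_apply_real, integral_map]
        · refine integral_congr_ae ?_
          filter_upwards [h1] with ω hω
          rw [hω]; push_cast; ring_nf
        · exact Finset.aemeasurable_fun_sum _ fun i _ => (hZ i).aemeasurable.const_mul _
        · fun_prop
      have h3 : iIndepFun (c.support.restrict fun i ω => c i * Z i ω) P := by
        have := (hind.comp (fun i x => c i * x) (fun i => by fun_prop)).precomp
          (g := ((↑) : c.support → ι)) Subtype.val_injective
        exact this
      have h4 : ‖∑ i ∈ c.support, c i • b i‖ ^ 2 = ∑ i ∈ c.support, c i ^ 2 := by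
        rw [← real_inner_self_eq_norm_sq, b.orthonormal.inner_sum]
        simp [pow_two]
      rw [h2, iIndepFun.charFun_map_fun_finsetSum_eq_prod
        (fun i _ => (hZ i).aemeasurable.const_mul _) h3, Finset.prod_apply]
      simp_rw [fun i => (gaussianReal_const_mul (hZ i) (c i)).map_eq, charFun_gaussianReal]
      rw [← Complex.exp_sum]
      congr 1
      have h5 : ((‖∑ i ∈ c.support, c i • b i‖ : ℂ)) ^ 2 = ∑ i ∈ c.support, (c i : ℂ) ^ 2 := by
        exact_mod_cast congrArg ((↑) : ℝ → ℂ) h4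
      rw [h5, ← Finset.sum_neg_distrib, Finset.sum_div]
      refine Finset.sum_congr rfl fun i _ => ?_
      simp
      ring
    intro f
    have : f ∈ closure ((Submodule.span ℝ (Set.range b) : Submodule ℝ H) : Set H) := by
      rw [← Submodule.topologicalClosure_coe, b.dense_span]; trivial
    exact closure_minimal hsub hcl this
  have hm : AEMeasurable (W f) P := (Lp.aestronglyMeasurable _).aemeasurable
  have : IsProbabilityMeasure (P.map (W f)) := Measure.isProbabilityMeasure_map hm
  refine Measure.ext_of_charFun ?_
  ext t
  rw [charFun_gaussianReal, charFun_apply_real, integral_map hm (by fun_prop)]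
  -- By linearity the characteristic function of `W f` at `t` is that of `W (t • f)` at `1`.
  have h := key (t • f)
  rw [map_smul] at h
  have h' : ∫ ω, Complex.exp (Complex.I * ((t • W f : Lp ℝ 2 P) ω : ℝ)) ∂P
      = ∫ ω, Complex.exp (t * (W f ω : ℝ) * Complex.I) ∂P := by
    refine integral_congr_ae ?_
    filter_upwards [Lp.coeFn_smul t (W f)] with ω hω
    rw [hω, Pi.smul_apply, smul_eq_mul]; push_cast; ring_nf
  rw [← h', h]
  congr 1
  have : ((‖t • f‖ : ℝ) : ℂ) ^ 2 = (t : ℂ) ^ 2 * (‖f‖ : ℂ) ^ 2 := by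
    rw [norm_smul, Real.norm_eq_abs]
    have : (|t| * ‖f‖) ^ 2 = t ^ 2 * ‖f‖ ^ 2 := by rw [mul_pow, sq_abs]
    exact_mod_cast congrArg ((↑) : ℝ → ℂ) this
  rw [this]
  simp
  ring

/-- Every real Hilbert space carries an isonormal Gaussian family. -/
lemma exists_isonormal (H : Type) [NormedAddCommGroup H] [InnerProductSpace ℝ H]
    [CompleteSpace H] : ∃ (Ω : Type) (_ : MeasurableSpace Ω) (P : Measure Ω)
      (_ : IsProbabilityMeasure P) (W : H →ₗᵢ[ℝ] Lp ℝ 2 P),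
      ∀ f, P.map (W f) = gaussianReal 0 (‖f‖₊ ^ 2) := by
  classical
  obtain ⟨w, b, -⟩ := exists_hilbertBasis ℝ H
  obtain ⟨Ω, mΩ, P, Z, hZm, hZ, hind, hP⟩ := exists_iid w (gaussianReal 0 1)
  have hZ2 : ∀ i, MemLp (Z i) 2 P := fun i => (hZ i).hasGaussianLaw.memLp_two
  have hon : Orthonormal ℝ fun i => (hZ2 i).toLp (Z i) := by
    have hin : ∀ i j, inner ℝ ((hZ2 i).toLp (Z i)) ((hZ2 j).toLp (Z j))
        = ∫ ω, Z i ω * Z j ω ∂P := by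
      intro i j
      rw [L2.inner_def]
      refine integral_congr_ae ?_
      filter_upwards [(hZ2 i).coeFn_toLp, (hZ2 j).coeFn_toLp] with ω h1 h2
      simp [h1, h2, mul_comm]
    have hmean : ∀ i, ∫ ω, Z i ω ∂P = 0 := fun i => by
      rw [(hZ i).integral_eq, integral_id_gaussianReal]
    rw [orthonormal_iff_ite]
    intro i j
    rw [hin]
    split_ifs with hij
    · subst hij
      have := (hZ i).variance_eq
      rw [variance_id_gaussianReal, variance_eq_integral (hZ i).aemeasurable, hmean] at this
      simpa [pow_two] using this
    · have := (hind.indepFun hij).integral_mul_eq_mul_integral (hZm i).aestronglyMeasurable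
        (hZm j).aestronglyMeasurable
      simpa [hmean] using this
  refine ⟨Ω, mΩ, P, hP, hon.orthogonalFamily.linearIsometry.comp b.repr.toLinearIsometry,
    map_eq_gaussianReal_of_hilbertBasis b _ Z hZ hind fun i => ?_⟩
  have : (hon.orthogonalFamily.linearIsometry.comp b.repr.toLinearIsometry) (b i)
      = (hZ2 i).toLp (Z i) := by
    simp [b.repr_self, hon.orthogonalFamily.linearIsometry_apply_single]
  rw [this]
  exact (hZ2 i).coeFn_toLp

end Isonormal

/-- There is a pre-Brownian motion. -/
lemma exists_isPreBrownianReal : ∃ (Ω : Type) (_ : MeasurableSpace Ω) (P : Measure Ω)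
    (_ : IsProbabilityMeasure P) (X : ℝ≥0 → Ω → ℝ),
    (∀ t, Measurable (X t)) ∧ IsPreBrownianReal X P := by
  obtain ⟨Ω, mΩ, P, hP, W, hW⟩ := exists_isonormal (Lp ℝ 2 dt)
  have hfin : ∀ t : ℝ≥0, dt (Set.Iic t) ≠ ∞ := fun t => by rw [dt_Iic]; exact ENNReal.coe_ne_top
  -- The process is the image of the indicator of `[0, t]`. The inner product of two such indicators
  -- is the smaller time, which is the Brownian covariance.
  let e : ℝ≥0 → Lp ℝ 2 dt := fun t => indicatorConstLp 2 measurableSet_Iic (hfin t) 1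
  have hin : ∀ s t, s ≤ t → inner ℝ (e s) (e t) = (s : ℝ) := by
    intro s t hst
    rw [L2.inner_indicatorConstLp_indicatorConstLp measurableSet_Iic measurableSet_Iic (hfin s) (hfin t), Set.Iic_inter_Iic, min_eq_left hst,
      Measure.real, dt_Iic]
    simp
  have hmean : ∀ f, ∫ ω, W f ω ∂P = 0 := fun f => by
    have := integral_map (Lp.aestronglyMeasurable (W f)).aemeasurable
      (aestronglyMeasurable_id (α := ℝ) (μ := P.map (W f)))
    simp only [id] at this
    rw [← this, hW]
    exact integral_id_gaussianReal
  refine ⟨Ω, mΩ, P, hP, fun t => W (e t), fun t => (Lp.stronglyMeasurable _).measurable, ?_⟩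
  refine IsGaussianProcess.isPreBrownianReal_of_covariance ⟨fun I => ⟨?_⟩⟩ (fun t => hmean _)
    fun s t hst => ?_
  -- Every linear functional of the marginals is the image under `W` of a single vector, hence
  -- Gaussian.
  · refine isGaussian_of_map_eq_gaussianReal fun L => ?_
    refine ⟨0, ‖∑ s : I, L (Pi.single s 1) • e s‖₊ ^ 2, ?_⟩
    have hm : AEMeasurable (fun ω => I.restrict fun x => W (e x) ω) P :=
      aemeasurable_pi_lambda _ fun _ => (Lp.aestronglyMeasurable _).aemeasurable
    rw [← hW, AEMeasurable.map_map_of_aemeasurable (by fun_prop) hm]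
    refine Measure.map_congr ?_
    rw [map_sum]
    have h1 : ∀ᵐ ω ∂P, ∀ s : I, (W (L (Pi.single s 1) • e s)) ω
        = L (Pi.single s 1) * W (e s) ω := by
      refine ae_all_iff.2 fun s => ?_
      rw [map_smul]
      filter_upwards [Lp.coeFn_smul (L (Pi.single s 1)) (W (e s))] with ω h
      rw [h, Pi.smul_apply, smul_eq_mul]
    filter_upwards [h1, Lp.coeFn_finsetSum Finset.univ
      fun s : I => W (L (Pi.single s 1) • e s)] with ω h2 h3
    rw [h3, Finset.sum_apply]
    simp_rw [h2]
    have h4 : (I.restrict fun x => W (e x) ω)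
        = ∑ s : I, W (e s) ω • (Pi.single s 1 : I → ℝ) := by
      ext s
      simp [Finset.sum_apply, Pi.single_apply]
    simp only [Function.comp]
    rw [h4, map_sum]
    simp [mul_comm]
  · rw [covariance, hmean, hmean, ← hin s t hst, ← W.inner_map_map, L2.inner_def]
    simp [mul_comm]

/-! ### Dyadic interpolation of paths -/

section Interpolation

/-- The projection of the real line to the unit interval. -/
noncomputable def clamp (y : ℝ) : ℝ := max 0 (min y 1)

lemma continuous_clamp : Continuous clamp := by unfold clamp; fun_prop

lemma clamp_of_nonpos {y : ℝ} (h : y ≤ 0) : clamp y = 0 := by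
  unfold clamp; exact max_eq_left ((min_le_left _ _).trans h)

lemma clamp_of_one_le {y : ℝ} (h : 1 ≤ y) : clamp y = 1 := by
  unfold clamp; rw [min_eq_right h]; norm_num

lemma clamp_mem (y : ℝ) : 0 ≤ clamp y ∧ clamp y ≤ 1 := by
  unfold clamp; exact ⟨le_max_left _ _, max_le zero_le_one (min_le_right _ _)⟩

lemma abs_clamp_sub_le (x y : ℝ) : |clamp x - clamp y| ≤ 1 := by
  have := clamp_mem x; have := clamp_mem y
  rw [abs_le]; constructor <;> linarith

/-- The increment of `x` over the `k`-th dyadic interval of level `n`. -/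
noncomputable def dyadIncr (x : ℝ≥0 → ℝ) (n k : ℕ) : ℝ :=
  x ((k + 1 : ℕ) / 2 ^ n) - x ((k : ℕ) / 2 ^ n)

/-- The piecewise linear interpolation of `x - x 0` on the dyadic grid of level `n` of `[0, n]`. -/
noncomputable def dyadInterp (x : ℝ≥0 → ℝ) (n : ℕ) (t : ℝ≥0) : ℝ :=
  ∑ k ∈ Finset.range (n * 2 ^ n), dyadIncr x n k * clamp (2 ^ n * (t : ℝ) - k)

lemma continuous_dyadInterp (x : ℝ≥0 → ℝ) (n : ℕ) : Continuous (dyadInterp x n) := by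
  unfold dyadInterp
  exact continuous_finsetSum _ fun k _ => continuous_const.mul
    (continuous_clamp.comp (by fun_prop))

lemma dyadInterp_zero (x : ℝ≥0 → ℝ) (n : ℕ) : dyadInterp x n 0 = 0 := by
  unfold dyadInterp
  refine Finset.sum_eq_zero fun k _ => ?_
  rw [clamp_of_nonpos (by simp), mul_zero]

lemma dyadIncr_eq_add (x : ℝ≥0 → ℝ) (n k : ℕ) :
    dyadIncr x n k = dyadIncr x (n + 1) (2 * k) + dyadIncr x (n + 1) (2 * k + 1) := by
  unfold dyadIncr
  have h1 : (((2 * k + 1 + 1 : ℕ) : ℝ≥0)) / 2 ^ (n + 1) = ((k + 1 : ℕ) : ℝ≥0) / 2 ^ n := by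
    push_cast; rw [pow_succ, div_eq_div_iff (by positivity) (by positivity)]; ring
  have h2 : (((2 * k : ℕ) : ℝ≥0)) / 2 ^ (n + 1) = ((k : ℕ) : ℝ≥0) / 2 ^ n := by
    push_cast; rw [pow_succ, div_eq_div_iff (by positivity) (by positivity)]; ring
  rw [h1, h2]; ring

lemma sum_range_two_mul (f : ℕ → ℝ) (N : ℕ) :
    ∑ j ∈ Finset.range (2 * N), f j = ∑ k ∈ Finset.range N, (f (2 * k) + f (2 * k + 1)) := by
  induction N with
  | zero => simp
  | succ N ih =>
    rw [Finset.sum_range_succ, ← ih, show 2 * (N + 1) = 2 * N + 1 + 1 by ring,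
      Finset.sum_range_succ, Finset.sum_range_succ]
    ring

/-- Cells completed before `t` contribute the same at both levels, and later cells contribute
nothing. In the cell containing `t` the two half-increments enter with weights of modulus at most
`1`, which gives the factor `2`. -/
lemma abs_dyadInterp_succ_sub_le (x : ℝ≥0 → ℝ) (n : ℕ) {t : ℝ≥0} (ht : t ≤ n) {ε : ℝ}
    (hε : 0 ≤ ε) (h : ∀ j < 2 * (n * 2 ^ n), |dyadIncr x (n + 1) j| ≤ ε) :
    |dyadInterp x (n + 1) t - dyadInterp x n t| ≤ 2 * ε := by
  have ht' : (t : ℝ) ≤ n := by exact_mod_cast ht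
  set s : ℝ := 2 ^ n * (t : ℝ) with hs
  have h1 : dyadInterp x (n + 1) t = ∑ j ∈ Finset.range (2 * (n * 2 ^ n)),
      dyadIncr x (n + 1) j * clamp (2 * s - j) := by
    unfold dyadInterp
    rw [show 2 ^ (n + 1) * (t : ℝ) = 2 * s by rw [hs]; ring]
    symm
    refine Finset.sum_subset (Finset.range_mono ?_) fun j _ hj => ?_
    · rw [pow_succ]; nlinarith [Nat.zero_le (2 ^ n)]
    · rw [Finset.mem_range, not_lt] at hj
      rw [clamp_of_nonpos, mul_zero]
      have : ((2 * (n * 2 ^ n) : ℕ) : ℝ) ≤ j := by exact_mod_cast hj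
      push_cast at this
      have h2 : s ≤ 2 ^ n * n := by rw [hs]; gcongr
      linarith
  have h2 : dyadInterp x (n + 1) t - dyadInterp x n t = ∑ k ∈ Finset.range (n * 2 ^ n),
      (dyadIncr x (n + 1) (2 * k) * (clamp (2 * (s - k)) - clamp (s - k)) +
        dyadIncr x (n + 1) (2 * k + 1) * (clamp (2 * (s - k) - 1) - clamp (s - k))) := by
    rw [h1, sum_range_two_mul, dyadInterp, ← Finset.sum_sub_distrib]
    refine Finset.sum_congr rfl fun k _ => ?_
    rw [dyadIncr_eq_add x n k]
    push_cast
    rw [show 2 * s - 2 * (k : ℝ) = 2 * (s - k) by ring,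
      show 2 * s - (2 * (k : ℝ) + 1) = 2 * (s - k) - 1 by ring]
    ring
  have hs0 : 0 ≤ s := by positivity
  have hterm : ∀ k ∈ Finset.range (n * 2 ^ n), k ≠ ⌊s⌋₊ →
      (dyadIncr x (n + 1) (2 * k) * (clamp (2 * (s - k)) - clamp (s - k)) +
        dyadIncr x (n + 1) (2 * k + 1) * (clamp (2 * (s - k) - 1) - clamp (s - k))) = 0 := by
    intro k _ hk
    rcases lt_or_gt_of_ne hk with hk | hk
    · have : (k : ℝ) + 1 ≤ s := by
        have := Nat.floor_le hs0
        have h' : ((k + 1 : ℕ) : ℝ) ≤ ⌊s⌋₊ := by exact_mod_cast hk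
        push_cast at h'; linarith
      rw [clamp_of_one_le (by linarith), clamp_of_one_le (by linarith),
        clamp_of_one_le (by linarith)]
      ring
    · have : s ≤ k := ((Nat.floor_lt hs0).1 hk).le
      rw [clamp_of_nonpos (by linarith), clamp_of_nonpos (by linarith),
        clamp_of_nonpos (by linarith)]
      ring
  rw [h2]
  by_cases hmem : ⌊s⌋₊ ∈ Finset.range (n * 2 ^ n)
  · rw [Finset.sum_eq_single_of_mem _ hmem hterm]
    have hlt := Finset.mem_range.1 hmem
    have e1 := h (2 * ⌊s⌋₊) (by omega)
    have e2 := h (2 * ⌊s⌋₊ + 1) (by omega)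
    refine (abs_add_le _ _).trans ?_
    rw [abs_mul, abs_mul]
    have f1 := mul_le_mul e1 (abs_clamp_sub_le (2 * (s - ⌊s⌋₊)) (s - ⌊s⌋₊)) (abs_nonneg _) hε
    have f2 := mul_le_mul e2 (abs_clamp_sub_le (2 * (s - ⌊s⌋₊) - 1) (s - ⌊s⌋₊)) (abs_nonneg _) hε
    linarith
  · rw [Finset.sum_eq_zero fun k hk => hterm k hk fun h => hmem (h ▸ hk), abs_zero]
    positivity

/-- The completed increments telescope to the value at the last grid point before `t`. This form is
used to compare the interpolation with the process at time `t`. -/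
lemma dyadInterp_eq (x : ℝ≥0 → ℝ) {n : ℕ} {t : ℝ≥0} (ht : t < n) :
    dyadInterp x n t = x (⌊2 ^ n * (t : ℝ)⌋₊ / 2 ^ n) - x 0 +
      dyadIncr x n ⌊2 ^ n * (t : ℝ)⌋₊ * clamp (2 ^ n * (t : ℝ) - ⌊2 ^ n * (t : ℝ)⌋₊) := by
  have ht' : (t : ℝ) < n := by exact_mod_cast ht
  set s : ℝ := 2 ^ n * (t : ℝ) with hs
  have hs0 : 0 ≤ s := by positivity
  have hlt : ⌊s⌋₊ < n * 2 ^ n := by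
    rw [Nat.floor_lt hs0]; push_cast; rw [hs, mul_comm]; gcongr
  have h1 : dyadInterp x n t = ∑ k ∈ Finset.range (⌊s⌋₊ + 1), dyadIncr x n k * clamp (s - k) := by
    unfold dyadInterp
    symm
    refine Finset.sum_subset (Finset.range_mono hlt) fun k _ hk => ?_
    rw [Finset.mem_range, not_lt] at hk
    rw [clamp_of_nonpos, mul_zero]
    have := (Nat.floor_lt hs0).1 hk
    linarith
  rw [h1, Finset.sum_range_succ]
  congr 1
  have h2 : ∀ k ∈ Finset.range ⌊s⌋₊, dyadIncr x n k * clamp (s - k)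
      = x ((k + 1 : ℕ) / 2 ^ n) - x ((k : ℕ) / 2 ^ n) := by
    intro k hk
    have hk := Finset.mem_range.1 hk
    rw [clamp_of_one_le, mul_one, dyadIncr]
    have := Nat.floor_le hs0
    have h' : ((k + 1 : ℕ) : ℝ) ≤ ⌊s⌋₊ := by exact_mod_cast hk
    push_cast at h'; linarith
  rw [Finset.sum_congr rfl h2, Finset.sum_range_sub fun k : ℕ => x ((k : ℕ) / 2 ^ n)]
  simp

end Interpolation

/-- Paths whose dyadic increments decay geometrically have a continuous limit interpolation. -/
lemma exists_continuous_limit (x : ℝ≥0 → ℝ) {r : ℝ} (hr0 : 0 ≤ r) (hr1 : r < 1) (N : ℕ)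
    (h : ∀ n ≥ N, ∀ j < 2 * (n * 2 ^ n), |dyadIncr x (n + 1) j| ≤ r ^ n) :
    ∃ y : ℝ≥0 → ℝ, Continuous y ∧ y 0 = 0 ∧
      ∀ t, Tendsto (fun n => dyadInterp x n t) atTop (𝓝 (y t)) := by
  have hstep : ∀ n ≥ N, ∀ t : ℝ≥0, t ≤ n →
      dist (dyadInterp x n t) (dyadInterp x (n + 1) t) ≤ 2 * r ^ n := by
    intro n hn t ht
    rw [dist_comm, Real.dist_eq]
    exact abs_dyadInterp_succ_sub_le x n ht (by positivity) (h n hn)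
  have hlim : ∀ t, ∃ l, Tendsto (fun n => dyadInterp x n t) atTop (𝓝 l) := by
    intro t
    obtain ⟨m, hm⟩ := exists_nat_ge t
    have hc : CauchySeq fun n => dyadInterp x (n + (N + m)) t := by
      refine cauchySeq_of_le_geometric r 2 hr1 fun n => ?_
      refine (show _ ≤ 2 * r ^ (n + (N + m)) from ?_).trans ?_
      · have := hstep (n + (N + m)) (by omega) t (hm.trans (by exact_mod_cast (by omega)))
        rwa [show n + 1 + (N + m) = n + (N + m) + 1 by ring]
      · exact mul_le_mul_of_nonneg_left (pow_le_pow_of_le_one hr0 hr1.le (by omega)) (by norm_num)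
    obtain ⟨l, hl⟩ := cauchySeq_tendsto_of_complete hc
    exact ⟨l, (tendsto_add_atTop_iff_nat (N + m)).1 hl⟩
  choose y hy using hlim
  refine ⟨y, ?_, ?_, hy⟩
  -- Near `t` all points lie below a common integer, so the geometric tail bounds are uniform there;
  -- continuity passes to the limit.
  · have hloc : TendstoLocallyUniformly (fun n t => dyadInterp x n t) y atTop := by
      rw [Metric.tendstoLocallyUniformly_iff]
      intro ε hε t
      obtain ⟨m, hm⟩ := exists_nat_ge (t + 1)
      have hnhd : Set.Iic (m : ℝ≥0) ∈ 𝓝 t :=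
        Iic_mem_nhds ((lt_add_of_pos_right t one_pos).trans_le hm)
      refine ⟨_, hnhd, ?_⟩
      have hz : Tendsto (fun n : ℕ => 2 * r ^ n / (1 - r)) atTop (𝓝 0) := by
        have := ((tendsto_pow_atTop_nhds_zero_of_lt_one hr0 hr1).const_mul 2).div_const (1 - r)
        simpa using this
      filter_upwards [hz.eventually_lt_const hε, eventually_ge_atTop (N + m)] with n hn hnm u hu
      refine lt_of_le_of_lt ?_ hn
      rw [dist_comm]
      have hstep' : ∀ i, dist (dyadInterp x (n + i) u) (dyadInterp x (n + (i + 1)) u)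
          ≤ 2 * r ^ n * r ^ i := by
        intro i
        have := hstep (n + i) (by omega) u ((Set.mem_Iic.1 hu).trans
          (by exact_mod_cast (by omega)))
        rw [pow_add, ← mul_assoc] at this
        exact this
      have := dist_le_of_le_geometric_of_tendsto r (2 * r ^ n) hr1 (f := fun i =>
        dyadInterp x (n + i) u) hstep' (a := y u) (by
          have := (tendsto_add_atTop_iff_nat n).2 (hy u)
          simpa [add_comm] using this) 0
      simpa using this
    exact hloc.continuous (Frequently.of_forall fun n => continuous_dyadInterp x n)
  · refine tendsto_nhds_unique (hy 0) ?_
    simp only [dyadInterp_zero]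
    exact tendsto_const_nhds

/-- By scaling, the fourth moment of a centred Gaussian is a multiple of the squared variance. The
value of the multiple is irrelevant. -/
lemma exists_fourth_moment : ∃ c : ℝ, 0 ≤ c ∧ ∀ v : ℝ≥0,
    ∫⁻ x, ENNReal.ofReal (x ^ 4) ∂gaussianReal 0 v = ENNReal.ofReal (c * (v : ℝ) ^ 2) := by
  have hfin : ∫⁻ x, ENNReal.ofReal (x ^ 4) ∂gaussianReal 0 1 ≠ ∞ := by
    have h := (memLp_id_gaussianReal (μ := 0) (v := 1) 4).integrable_norm_pow (by norm_num)
    have h' := h.lintegral_lt_top.ne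
    convert h' using 4
    simp only [id, Real.norm_eq_abs]
    exact (Even.pow_abs (by decide) _).symm
  refine ⟨(∫⁻ x, ENNReal.ofReal (x ^ 4) ∂gaussianReal 0 1).toReal, ENNReal.toReal_nonneg,
    fun v => ?_⟩
  have h1 : gaussianReal 0 v = (gaussianReal 0 1).map (fun x => √(v : ℝ) * x) := by
    rw [gaussianReal_map_const_mul, mul_zero, mul_one]
    congr 1
    ext
    simp
  rw [h1, lintegral_map (by fun_prop) (by fun_prop), ENNReal.ofReal_mul ENNReal.toReal_nonneg,
    ENNReal.ofReal_toReal hfin, mul_comm, ← lintegral_const_mul _ (by fun_prop)]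
  refine lintegral_congr fun x => ?_
  rw [← ENNReal.ofReal_mul (by positivity)]
  congr 1
  rw [mul_pow, show (√(v : ℝ)) ^ 4 = ((√(v : ℝ)) ^ 2) ^ 2 by ring, Real.sq_sqrt (by positivity)]

/-! ### Continuous modification of a pre-Brownian motion -/

variable {Ω : Type} [MeasurableSpace Ω] {P : Measure Ω} {X : ℝ≥0 → Ω → ℝ}

lemma measurable_dyadIncr (hm : ∀ t, Measurable (X t)) (n k : ℕ) :
    Measurable fun ω => dyadIncr (fun t => X t ω) n k := (hm _).sub (hm _)

lemma measurable_dyadInterp (hm : ∀ t, Measurable (X t)) (n : ℕ) (t : ℝ≥0) :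
    Measurable fun ω => dyadInterp (fun t => X t ω) n t :=
  Finset.measurable_fun_sum _ fun k _ => (measurable_dyadIncr hm n k).mul_const _

lemma hasLaw_dyadIncr (hX : IsPreBrownianReal X P) (n k : ℕ) :
    HasLaw (fun ω => dyadIncr (fun t => X t ω) n k) (gaussianReal 0 (1 / 2 ^ n)) P := by
  have := hX.hasLaw_sub ((k + 1 : ℕ) / 2 ^ n) ((k : ℕ) / 2 ^ n)
  have h : nndist (((k + 1 : ℕ) / 2 ^ n : ℝ≥0) : ℝ) (((k : ℕ) / 2 ^ n : ℝ≥0) : ℝ)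
      = 1 / 2 ^ n := by
    ext
    rw [coe_nndist, Real.dist_eq]
    push_cast
    rw [← sub_div, add_sub_cancel_left, abs_of_nonneg (by positivity)]
  rw [← h]
  exact this

/-- Markov's inequality for the fourth power; second moments would not beat the number of dyadic
cells. -/
lemma meas_dyadIncr_gt_le {c : ℝ}
    (hc : ∀ v : ℝ≥0, ∫⁻ x, ENNReal.ofReal (x ^ 4) ∂gaussianReal 0 v
      = ENNReal.ofReal (c * (v : ℝ) ^ 2)) (hX : IsPreBrownianReal X P) (n k : ℕ) {ε : ℝ}
    (hε : 0 < ε) : P {ω | ε < |dyadIncr (fun t => X t ω) n k|} ≤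
      ENNReal.ofReal (c * (1 / 2 ^ n) ^ 2 / ε ^ 4) := by
  have hl := hasLaw_dyadIncr hX n k
  have h1 : ∫⁻ ω, ENNReal.ofReal (dyadIncr (fun t => X t ω) n k ^ 4) ∂P
      = ENNReal.ofReal (c * (1 / 2 ^ n) ^ 2) := by
    have := hc (1 / 2 ^ n)
    rw [← hl.map_eq, lintegral_map' (by fun_prop) hl.aemeasurable] at this
    rw [this]; simp
  rw [ENNReal.ofReal_div_of_pos (by positivity), ← h1]
  refine le_trans (measure_mono ?_) (meas_ge_le_lintegral_div
    (f := fun ω => ENNReal.ofReal (dyadIncr (fun t => X t ω) n k ^ 4))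
    ((hl.aemeasurable.pow_const 4).ennreal_ofReal) (by simpa using pow_pos hε 4) (by simp))
  intro ω hω
  have hω : ε < |dyadIncr (fun t => X t ω) n k| := hω
  show ENNReal.ofReal (ε ^ 4) ≤ _
  refine ENNReal.ofReal_le_ofReal ?_
  rw [← Even.pow_abs (n := 4) (by decide) (dyadIncr _ n k)]
  exact pow_le_pow_left₀ hε.le hω.le 4

/-- Borel–Cantelli. There are about `n 2ⁿ` increments, each large with probability of order `4⁻ⁿ /
(9/10)⁴ⁿ`. The threshold `9/10` works because its fourth power exceeds `1/2`: the resulting ratio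
`5000/6561` is less than `1`. -/
lemma ae_eventually_dyadIncr_le [IsProbabilityMeasure P] (hX : IsPreBrownianReal X P) :
    ∀ᵐ ω ∂P, ∃ N : ℕ, ∀ n ≥ N, ∀ j < 2 * (n * 2 ^ n),
      |dyadIncr (fun t => X t ω) (n + 1) j| ≤ (9 / 10 : ℝ) ^ n := by
  obtain ⟨c, hc0, hc⟩ := exists_fourth_moment
  set bad : ℕ → Set Ω := fun n => ⋃ j ∈ Finset.range (2 * (n * 2 ^ n)),
    {ω | (9 / 10 : ℝ) ^ n < |dyadIncr (fun t => X t ω) (n + 1) j|} with hbad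
  have hle : ∀ n, P (bad n) ≤ ENNReal.ofReal (c * (n * (5000 / 6561 : ℝ) ^ n)) := by
    intro n
    refine (measure_biUnion_finset_le _ _).trans ?_
    refine (Finset.sum_le_sum fun j _ => meas_dyadIncr_gt_le hc hX (n + 1) j
      (by positivity : (0 : ℝ) < (9 / 10) ^ n)).trans ?_
    rw [Finset.sum_const, Finset.card_range, nsmul_eq_mul, ← ENNReal.ofReal_natCast,
      ← ENNReal.ofReal_mul (by positivity)]
    refine ENNReal.ofReal_le_ofReal ?_
    push_cast
    have h1 : (5000 / 6561 : ℝ) ^ n = 2 ^ n * ((1 / 2 ^ n) ^ 2) / ((9 / 10) ^ n) ^ 4 := by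
      rw [← pow_mul, mul_comm n 4, pow_mul, ← one_div_pow, ← pow_mul, mul_comm n 2, pow_mul,
        ← mul_pow, ← div_pow]
      norm_num
    have h2 : (1 / 2 ^ (n + 1) : ℝ) ^ 2 = (1 / 2 ^ n) ^ 2 / 4 := by
      rw [pow_succ]; field_simp; ring
    rw [h1, h2]
    have : 2 * ((n : ℝ) * 2 ^ n) * (c * ((1 / 2 ^ n) ^ 2 / 4) / ((9 / 10) ^ n) ^ 4)
        = 1 / 2 * (c * (n * (2 ^ n * (1 / 2 ^ n) ^ 2 / ((9 / 10) ^ n) ^ 4))) := by ring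
    rw [this]
    have : 0 ≤ c * (n * (2 ^ n * (1 / 2 ^ n) ^ 2 / ((9 / 10 : ℝ) ^ n) ^ 4)) := by positivity
    linarith
  have hsum : ∑' n, P (bad n) ≠ ∞ := by
    have h1 : Summable fun n : ℕ => c * (n * (5000 / 6561 : ℝ) ^ n) := by
      have := summable_pow_mul_geometric_of_norm_lt_one (R := ℝ) 1
        (r := 5000 / 6561) (by rw [Real.norm_eq_abs, abs_of_pos] <;> norm_num)
      simpa using this.mul_left c
    exact ne_top_of_le_ne_top h1.tsum_ofReal_ne_top (ENNReal.tsum_le_tsum hle)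
  filter_upwards [ae_eventually_notMem hsum] with ω hω
  obtain ⟨N, hN⟩ := eventually_atTop.1 hω
  refine ⟨N, fun n hn j hj => ?_⟩
  have := hN n hn
  simp only [hbad, Set.mem_iUnion, not_exists] at this
  exact not_lt.1 (this j (Finset.mem_range.2 hj))

lemma memLp_two_sub (hX : IsPreBrownianReal X P) (s t : ℝ≥0) :
    eLpNorm (X s - X t) 2 P = ENNReal.ofReal (√(nndist (s : ℝ) t)) := by
  have hl := hX.hasLaw_sub s t
  have h2 : MemLp (X s - X t) 2 P := hl.hasGaussianLaw.memLp_two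
  rw [h2.eLpNorm_eq_integral_rpow_norm (by norm_num) (by norm_num)]
  congr 1
  have hv := hl.variance_eq
  rw [variance_id_gaussianReal, variance_eq_integral hl.aemeasurable, hl.integral_eq,
    integral_id_gaussianReal] at hv
  simp only [sub_zero] at hv
  have hv' : (nndist (s : ℝ) t : ℝ) = _ := hv.symm
  rw [Real.sqrt_eq_rpow, hv']
  norm_num

/-- This identifies the limit of the interpolations at a fixed time. The interpolation differs from
`X t - X 0` by at most two increments over intervals of length `2⁻ⁿ`, each of `L²` norm at most
`2^{-n/2}`. -/
lemma tendsto_eLpNorm_dyadInterp [IsProbabilityMeasure P] (hX : IsPreBrownianReal X P) (hm : ∀ t, Measurable (X t))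
    (t : ℝ≥0) : Tendsto (fun n => eLpNorm ((fun ω => dyadInterp (fun t => X t ω) n t)
      - (X t - X 0)) 2 P) atTop (𝓝 0) := by
  have hz : Tendsto (fun n : ℕ => 2 * ENNReal.ofReal (√((1 / 2 : ℝ) ^ n))) atTop (𝓝 0) := by
    have h1 : Tendsto (fun n : ℕ => √((1 / 2 : ℝ) ^ n)) atTop (𝓝 0) := by
      have := (tendsto_pow_atTop_nhds_zero_of_lt_one (r := (1 / 2 : ℝ))
        (by norm_num) (by norm_num)).sqrt
      simpa using this
    have := ENNReal.Tendsto.const_mul (a := 2) (ENNReal.tendsto_ofReal h1) (by simp)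
    simpa using this
  refine tendsto_of_tendsto_of_tendsto_of_le_of_le' tendsto_const_nhds hz
    (Eventually.of_forall fun _ => zero_le) ?_
  obtain ⟨m, hmt⟩ := exists_nat_gt t
  filter_upwards [eventually_ge_atTop m] with n hn
  have htn : t < n := hmt.trans_le (by exact_mod_cast hn)
  set k := ⌊2 ^ n * (t : ℝ)⌋₊ with hk
  have heq : (fun ω => dyadInterp (fun t => X t ω) n t) - (X t - X 0)
      = (X (k / 2 ^ n) - X t) + fun ω => dyadIncr (fun t => X t ω) n k *
        clamp (2 ^ n * (t : ℝ) - k) := by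
    ext ω
    simp only [Pi.sub_apply, Pi.add_apply]
    rw [dyadInterp_eq _ htn]; ring
  rw [heq, two_mul]
  refine (eLpNorm_add_le ((hm _).sub (hm _)).aestronglyMeasurable
    ((measurable_dyadIncr hm n k).mul_const _).aestronglyMeasurable (by norm_num)).trans ?_
  have h2 : (0 : ℝ) < 2 ^ n := by positivity
  have hfl := Nat.floor_le (show 0 ≤ 2 ^ n * (t : ℝ) by positivity)
  have hfl' := Nat.lt_floor_add_one (2 ^ n * (t : ℝ))
  rw [← hk] at hfl hfl'
  refine add_le_add ?_ ?_
  · rw [memLp_two_sub hX]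
    refine ENNReal.ofReal_le_ofReal (Real.sqrt_le_sqrt ?_)
    rw [coe_nndist, Real.dist_eq, abs_sub_comm, one_div_pow]
    push_cast
    rw [abs_of_nonneg (by rw [sub_nonneg, div_le_iff₀ h2]; linarith), sub_le_iff_le_add, ← add_div,
      le_div_iff₀ h2]
    linarith
  · refine (eLpNorm_mono_real (g := fun ω => |dyadIncr (fun t => X t ω) n k|) fun ω => ?_).trans ?_
    · rw [norm_mul, Real.norm_eq_abs, Real.norm_eq_abs, abs_of_nonneg (clamp_mem _).1]
      exact mul_le_of_le_one_right (abs_nonneg _) (clamp_mem _).2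
    · have : eLpNorm (fun ω => |dyadIncr (fun t => X t ω) n k|) 2 P
          = eLpNorm (X ((k + 1 : ℕ) / 2 ^ n) - X ((k : ℕ) / 2 ^ n)) 2 P :=
        eLpNorm_norm (fun ω => dyadIncr (fun t => X t ω) n k)
      rw [this, memLp_two_sub hX]
      refine ENNReal.ofReal_le_ofReal (Real.sqrt_le_sqrt ?_)
      rw [coe_nndist, Real.dist_eq, one_div_pow]
      push_cast
      rw [← sub_div, add_sub_cancel_left, abs_of_nonneg (by positivity)]

/-- A pre-Brownian motion has a modification with continuous paths. -/
lemma exists_continuous_modification [IsProbabilityMeasure P] (hX : IsPreBrownianReal X P) (hm : ∀ t, Measurable (X t)) :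
    ∃ Y : Ω → Path, Measurable Y ∧ ∀ t, X t =ᵐ[P] fun ω => B t (Y ω) := by
  classical
  -- The set of good sample points is measurable; off it the modification is the zero path, so that
  -- a path is assigned to every point.
  set G : Set Ω := {ω | ∃ N : ℕ, ∀ n ≥ N, ∀ j < 2 * (n * 2 ^ n),
      |dyadIncr (fun t => X t ω) (n + 1) j| ≤ (9 / 10 : ℝ) ^ n} with hG
  have hGm : MeasurableSet G := by
    have : G = ⋃ N : ℕ, ⋂ n : ℕ, ⋂ (_ : N ≤ n), ⋂ j : ℕ, ⋂ (_ : j < 2 * (n * 2 ^ n)),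
      {ω | |dyadIncr (fun t => X t ω) (n + 1) j| ≤ (9 / 10 : ℝ) ^ n} := by
      ext ω; simp [hG]
    rw [this]
    exact MeasurableSet.iUnion fun N => MeasurableSet.iInter fun n => MeasurableSet.iInter fun _ =>
      MeasurableSet.iInter fun j => MeasurableSet.iInter fun _ =>
      measurableSet_le (measurable_dyadIncr hm _ _).abs measurable_const
  have hex : ∀ ω, ∃ y : Path, ∀ t, Tendsto (fun n => G.indicator
      (fun ω => dyadInterp (fun t => X t ω) n t) ω) atTop (𝓝 (B t y)) := by
    intro ω
    by_cases hω : ω ∈ G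
    · obtain ⟨N, hN⟩ := hω
      obtain ⟨y, hy, hy0, hl⟩ := exists_continuous_limit (fun t => X t ω) (by norm_num)
        (by norm_num) N hN
      refine ⟨⟨y, hy, hy0⟩, fun t => ?_⟩
      simp only [Set.indicator_of_mem (show ω ∈ G from ⟨N, hN⟩)]
      exact hl t
    · refine ⟨⟨0, continuous_const, rfl⟩, fun t => ?_⟩
      simp only [Set.indicator_of_notMem hω]
      exact tendsto_const_nhds
  choose Y hY using hex
  have hYm : ∀ t, Measurable fun ω => B t (Y ω) := fun t =>
    measurable_of_tendsto_metrizable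
      (fun n => (measurable_dyadInterp hm n t).indicator hGm) (tendsto_pi_nhds.2 fun ω => hY ω t)
  refine ⟨Y, ?_, fun t => ?_⟩
  · exact Measurable.subtype_mk (measurable_pi_iff.2 hYm)
  -- The same interpolations converge in `L²` to `X t - X 0` and almost surely to the new path.
  -- Limits in measure are unique.
  · have h1 : TendstoInMeasure P (fun n ω => dyadInterp (fun t => X t ω) n t) atTop (X t - X 0) :=
      tendstoInMeasure_of_tendsto_eLpNorm (p := 2) (by norm_num)
        (fun n => (measurable_dyadInterp hm n t).aestronglyMeasurable)
        ((hm _).sub (hm _)).aestronglyMeasurable (tendsto_eLpNorm_dyadInterp hX hm t)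
    have h2 : TendstoInMeasure P (fun n ω => dyadInterp (fun t => X t ω) n t) atTop
        (fun ω => B t (Y ω)) := by
      refine tendstoInMeasure_of_tendsto_ae
        (fun n => (measurable_dyadInterp hm n t).aestronglyMeasurable) ?_
      filter_upwards [ae_eventually_dyadIncr_le hX] with ω hω
      have := hY ω t
      simpa only [Set.indicator_of_mem (show ω ∈ G from hω)] using this
    filter_upwards [tendstoInMeasure_ae_unique h1 h2, hX.eval_zero_ae_eq_zero] with ω h h0
    rw [← h, Pi.sub_apply, h0, sub_zero]

/-! ### Scaled Wiener measure as a prior -/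

section

variable {P : Measure Path} {σ : ℝ}

/-- The raw filtration at time `s` is generated by the rescaled process up to `s`, and the increment
is a function of the rescaled process shifted to start at `s`; these are independent. -/
lemma indep_incr_filt (hσ : 0 < σ) (hX : IsPreBrownianReal (fun t ω => σ⁻¹ * B t ω) P)
    (s t : ℝ≥0) (hst : s ≤ t) :
    Indep (MeasurableSpace.comap (fun ω => B t ω - B s ω) inferInstance) (Filt s) P := by
  have hind := hX.indepFun_shift s
  have h1 : MeasurableSpace.comap (fun ω => B t ω - B s ω) inferInstance ≤
      MeasurableSpace.comap (fun ω (u : ℝ≥0) => σ⁻¹ * B (s + u) ω - σ⁻¹ * B s ω)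
        inferInstance := by
    have : (fun ω => B t ω - B s ω) = (fun f : ℝ≥0 → ℝ => σ * f (t - s)) ∘
        (fun ω (u : ℝ≥0) => σ⁻¹ * B (s + u) ω - σ⁻¹ * B s ω) := by
      ext ω
      simp only [Function.comp, add_tsub_cancel_of_le hst]
      field_simp
    rw [this, ← MeasurableSpace.comap_comp]
    exact MeasurableSpace.comap_mono (Measurable.comap_le (by fun_prop))
  have h2 : (Filt s : MeasurableSpace Path) ≤ MeasurableSpace.comap
      (fun ω (u : Set.Iic s) => σ⁻¹ * B u ω) inferInstance := by
    refine iSup₂_le fun u hu => ?_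
    have : B u = (fun f : Set.Iic s → ℝ => σ * f ⟨u, hu⟩) ∘
        (fun ω (u : Set.Iic s) => σ⁻¹ * B u ω) := by
      ext ω
      simp only [Function.comp]
      field_simp
    show MeasurableSpace.comap (B u) inferInstance ≤ _
    rw [this, ← MeasurableSpace.comap_comp]
    exact MeasurableSpace.comap_mono (Measurable.comap_le (by fun_prop))
  exact indep_of_indep_of_le_left (indep_of_indep_of_le_right hind h2) h1

/-- Increments independent of the past, centred and of variance `σ² (t - s)`, make both `B` and `B²
- σ² t` martingales. The latter is then a super- and a submartingale, as membership with equal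
bounds requires. -/
lemma mem_priors_of_isPreBrownianReal [IsProbabilityMeasure P] (hσ : 0 < σ)
    (hX : IsPreBrownianReal (fun t ω => σ⁻¹ * B t ω) P) : P ∈ priors σ σ := by
  have hL2 : ∀ t, MemLp (B t) 2 P := fun t => by
    have := (hX.hasLaw_eval t).hasGaussianLaw.memLp_two.const_mul σ
    convert this using 2
    field_simp
  have hincr1 : ∀ s t, ∫ ω, (B t ω - B s ω) ∂P = 0 := by
    have h0 : ∀ t, ∫ ω, B t ω ∂P = 0 := fun t => by
      have := hX.integral_eval t
      rw [integral_const_mul] at this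
      simpa [hσ.ne'] using this
    intro s t
    rw [integral_sub ((hL2 t).integrable (by norm_num)) ((hL2 s).integrable (by norm_num)), h0, h0,
      sub_zero]
  have hincr2 : ∀ s t, s ≤ t → ∫ ω, (B t ω - B s ω) ^ 2 ∂P = σ ^ 2 * ((t : ℝ) - s) := by
    intro s t hst
    have hl := hX.hasLaw_sub t s
    have hv := hl.variance_eq
    rw [variance_id_gaussianReal, variance_eq_integral hl.aemeasurable, hl.integral_eq,
      integral_id_gaussianReal, coe_nndist, Real.dist_eq] at hv
    have hst' : (s : ℝ) ≤ t := by exact_mod_cast hst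
    have h1 : ((t : ℝ) - s) = |t.1 - s.1| := by
      rw [abs_of_nonneg]
      · rfl
      · exact sub_nonneg.2 hst'
    rw [h1, ← hv, ← integral_const_mul]
    refine integral_congr_ae (ae_of_all _ fun ω => ?_)
    simp only [Pi.sub_apply, sub_zero, ← mul_sub]
    field_simp
  have hBF : ∀ t, StronglyMeasurable[Filt t] (B t) := fun t =>
    (Filtration.stronglyAdapted_natural _) t
  have hc : ∀ s t, s ≤ t → P[fun ω => B t ω - B s ω | Filt s] =ᵐ[P] 0 := by
    intro s t hst
    have := condExp_indep_eq (μ := P) (f := fun ω => B t ω - B s ω)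
      (((measurable_B t).sub (measurable_B s)).comap_le) (Filt.le s)
      (Measurable.stronglyMeasurable (comap_measurable _)) (indep_incr_filt hσ hX s t hst)
    rw [hincr1] at this
    exact this
  have hc2 : ∀ s t, s ≤ t → P[fun ω => (B t ω - B s ω) ^ 2 | Filt s]
      =ᵐ[P] fun _ => σ ^ 2 * ((t : ℝ) - s) := by
    intro s t hst
    have := condExp_indep_eq (μ := P) (f := fun ω => (B t ω - B s ω) ^ 2)
      (((measurable_B t).sub (measurable_B s)).comap_le) (Filt.le s)
      (Measurable.stronglyMeasurable ((comap_measurable _).pow_const 2))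
      (indep_incr_filt hσ hX s t hst)
    rw [hincr2 s t hst] at this
    exact this
  have hmart : Martingale B Filt P := by
    refine ⟨hBF, fun s t hst => ?_⟩
    have h2 := condExp_add (μ := P) (((hL2 t).sub (hL2 s)).integrable (by norm_num))
      ((hL2 s).integrable (by norm_num)) (Filt s)
    have h3 : P[B s | Filt s] = B s := condExp_of_stronglyMeasurable (Filt.le s) (hBF s)
      ((hL2 s).integrable (by norm_num))
    have h4 : P[B t | Filt s] = P[B t - B s + B s | Filt s] := by rw [sub_add_cancel]
    rw [h4]
    filter_upwards [h2, hc s t hst] with ω h2 h5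
    rw [h2, Pi.add_apply, h3]
    have : P[B t - B s | Filt s] ω = 0 := h5
    rw [this, zero_add]
  have hmart2 : Martingale (fun (t : ℝ≥0) ω => B t ω ^ 2 - σ ^ 2 * (t : ℝ)) Filt P := by
    refine ⟨fun t => ((hBF t).pow 2).sub stronglyMeasurable_const, fun s t hst => ?_⟩
    have i1 : Integrable (fun ω => (B t ω - B s ω) ^ 2) P := ((hL2 t).sub (hL2 s)).integrable_sq
    have i2 : Integrable (fun ω => B s ω * (B t ω - B s ω)) P :=
      (hL2 s).integrable_mul ((hL2 t).sub (hL2 s))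
    have i2' : Integrable ((2 : ℝ) • fun ω => B s ω * (B t ω - B s ω)) P := i2.smul 2
    have i3 : Integrable (fun ω => B s ω ^ 2 - σ ^ 2 * (t : ℝ)) P :=
      (hL2 s).integrable_sq.sub (integrable_const _)
    have h1 : (fun ω => B t ω ^ 2 - σ ^ 2 * (t : ℝ)) = ((fun ω => (B t ω - B s ω) ^ 2)
        + (2 : ℝ) • fun ω => B s ω * (B t ω - B s ω)) + fun ω => B s ω ^ 2 - σ ^ 2 * (t : ℝ) := by
      ext ω
      simp only [Pi.add_apply, Pi.smul_apply, smul_eq_mul]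
      ring
    have h2 := condExp_add (μ := P) (i1.add i2') i3 (Filt s)
    have h3 := condExp_add (μ := P) i1 i2' (Filt s)
    have h4 := condExp_smul (μ := P) (2 : ℝ) (fun ω => B s ω * (B t ω - B s ω)) (Filt s)
    have h5 : P[fun ω => B s ω * (B t ω - B s ω) | Filt s]
        =ᵐ[P] (B s) * P[fun ω => B t ω - B s ω | Filt s] :=
      condExp_mul_of_stronglyMeasurable_left (hBF s) i2
        (((hL2 t).sub (hL2 s)).integrable (by norm_num))
    have h6 : P[fun ω => B s ω ^ 2 - σ ^ 2 * (t : ℝ) | Filt s]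
        = fun ω => B s ω ^ 2 - σ ^ 2 * (t : ℝ) :=
      condExp_of_stronglyMeasurable (Filt.le s) (((hBF s).pow 2).sub stronglyMeasurable_const) i3
    show P[fun ω => B t ω ^ 2 - σ ^ 2 * (t : ℝ) | Filt s] =ᵐ[P] _
    rw [h1]
    filter_upwards [h2, h3, h4, h5, hc s t hst, hc2 s t hst] with ω h2 h3 h4 h5 h7 h8
    rw [h2, Pi.add_apply, h3, Pi.add_apply, h4, Pi.smul_apply, h5, Pi.mul_apply, h6, h7, h8]
    simp only [Pi.zero_apply, smul_eq_mul]
    ring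
  exact ⟨inferInstance, hmart, hmart2.supermartingale, hmart2.submartingale⟩

end

/-- Wiener measure with volatility `σ` is a prior. -/
lemma exists_mem_priors {σ : ℝ} (hσ : 0 < σ) : ∃ P, P ∈ priors σ σ := by
  obtain ⟨Ω, mΩ, P, hP, X, hm, hX⟩ := exists_isPreBrownianReal
  obtain ⟨Y, hY, hXY⟩ := exists_continuous_modification hX hm
  let Φ : Path → Path := fun ω => ⟨fun t => σ * ω.1 t, continuous_const.mul ω.2.1, by
    show σ * ω.1 0 = 0
    exact mul_eq_zero_of_right _ ω.2.2⟩
  have hΦ : Measurable Φ := Measurable.subtype_mk (measurable_pi_iff.2 fun t =>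
    (measurable_B t).const_mul σ)
  have : IsProbabilityMeasure (P.map (Φ ∘ Y)) :=
    Measure.isProbabilityMeasure_map (hΦ.comp hY).aemeasurable
  refine ⟨P.map (Φ ∘ Y), mem_priors_of_isPreBrownianReal hσ ⟨fun I => ?_⟩⟩
  have hl := (hX.congr hXY).hasLaw I
  have hmI : Measurable fun ω : Path => I.restrict fun t => σ⁻¹ * B t ω :=
    measurable_pi_iff.2 fun t => (measurable_B t).const_mul _
  refine ⟨hmI.aemeasurable, ?_⟩
  rw [Measure.map_map hmI (hΦ.comp hY), ← hl.map_eq]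
  congr 1
  ext ω t
  show σ⁻¹ * (σ * (Y ω).1 t) = (Y ω).1 t
  field_simp

/-- Lowering the lower bound adds the deterministic nondecreasing term `(σhi² - σlo²) t` to a
submartingale. -/
lemma priors_mono {σlo σhi : ℝ} (h0 : 0 ≤ σlo) (h : σlo ≤ σhi) :
    priors σhi σhi ⊆ priors σlo σhi := by
  rintro P ⟨hP, h1, h2, h3⟩
  refine ⟨hP, h1, h2, ?_⟩
  have h4 : Submartingale (fun (t : ℝ≥0) (_ : Path) => (σhi ^ 2 - σlo ^ 2) * (t : ℝ)) Filt P := by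
    refine ⟨fun t => stronglyMeasurable_const, fun s t hst => ?_, fun t => integrable_const _⟩
    rw [condExp_const (Filt.le s)]
    refine ae_of_all _ fun ω => ?_
    have : (s : ℝ) ≤ t := by exact_mod_cast hst
    have : 0 ≤ σhi ^ 2 - σlo ^ 2 := by nlinarith
    show (σhi ^ 2 - σlo ^ 2) * (s : ℝ) ≤ (σhi ^ 2 - σlo ^ 2) * (t : ℝ)
    gcongr
  have h5 : (fun (t : ℝ≥0) ω => B t ω ^ 2 - σlo ^ 2 * (t : ℝ))
      = (fun (t : ℝ≥0) ω => B t ω ^ 2 - σhi ^ 2 * (t : ℝ))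
        + fun (t : ℝ≥0) _ => (σhi ^ 2 - σlo ^ 2) * (t : ℝ) := by
    funext t ω
    show B t ω ^ 2 - σlo ^ 2 * (t : ℝ)
      = (B t ω ^ 2 - σhi ^ 2 * (t : ℝ)) + (σhi ^ 2 - σlo ^ 2) * (t : ℝ)
    ring
  rw [h5]
  exact h3.add h4

/-! ### Jointly measurable versions of density-valued processes -/

section DensityVersion

/-- The dyadic interval `[k / 2ⁿ, (k + 1) / 2ⁿ]`. -/
def dyadCell (n : ℕ) (k : ℤ) : Set ℝ :=
  Metric.closedBall (((k : ℝ) + 1 / 2) / 2 ^ n) ((1 / 2) ^ (n + 1))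

lemma measurableSet_dyadCell (n : ℕ) (k : ℤ) : MeasurableSet (dyadCell n k) :=
  Metric.isClosed_closedBall.measurableSet

/-- The average of `f` over a dyadic interval. -/
noncomputable def dyadAverage (n : ℕ) (f : ℝ → ℝ) (k : ℤ) : ℝ :=
  (volume.real (dyadCell n k))⁻¹ * ∫ y in dyadCell n k, f y

/-- The limit of the averages of `f` over dyadic intervals. -/
noncomputable def densVersion (f : ℝ → ℝ) (u : ℝ) : ℝ :=
  limUnder atTop fun n : ℕ => dyadAverage n f ⌊2 ^ n * u⌋

/-- Lebesgue's differentiation theorem along dyadic cells, which are closed balls shrinking to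
points they contain. A randomized control is only known through its integrals over Borel sets; this
version depends on nothing else and is therefore jointly measurable. -/
lemma densVersion_ae_eq {f : ℝ → ℝ} (hf : Integrable f) : densVersion f =ᵐ[volume] f := by
  filter_upwards [IsUnifLocDoublingMeasure.ae_tendsto_average volume hf.locallyIntegrable 1]
    with u hu
  refine Tendsto.limUnder_eq ?_
  simp only [dyadAverage, ← smul_eq_mul, ← setAverage_eq]
  refine hu (fun n : ℕ => ((⌊2 ^ n * u⌋ : ℝ) + 1 / 2) / 2 ^ n) (fun n => (1 / 2) ^ (n + 1))
    ?_ (Eventually.of_forall fun n => ?_)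
  · refine tendsto_nhdsWithin_iff.2 ⟨?_, Eventually.of_forall fun n => ?_⟩
    · exact (tendsto_add_atTop_iff_nat 1).2
        (tendsto_pow_atTop_nhds_zero_of_lt_one (r := (1 / 2 : ℝ)) (by norm_num) (by norm_num))
    · exact pow_pos (by norm_num : (0 : ℝ) < 1 / 2) _
  · have h2 : (0 : ℝ) < 2 ^ n := by positivity
    have h1 := Int.floor_le (2 ^ n * u)
    have h3 := Int.lt_floor_add_one (2 ^ n * u)
    rw [Metric.mem_closedBall, Real.dist_eq, one_mul, one_div_pow, pow_succ, abs_le]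
    have e : u - ((⌊2 ^ n * u⌋ : ℝ) + 1 / 2) / 2 ^ n
        = (2 ^ n * u - ⌊2 ^ n * u⌋ - 1 / 2) / 2 ^ n := by field_simp; ring
    have e' : (1 : ℝ) / (2 ^ n * 2) = (1 / 2) / 2 ^ n := by field_simp
    rw [e, e', ← neg_div]
    constructor
    · exact div_le_div_of_nonneg_right (by linarith) h2.le
    · exact div_le_div_of_nonneg_right (by linarith) h2.le

lemma measurable_dyadAverage {α : Type*} {mα : MeasurableSpace α} {f : α → ℝ → ℝ}
    (h : ∀ S : Set ℝ, MeasurableSet S → Measurable fun a => ∫ u in S, f a u) (n : ℕ) :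
    Measurable fun p : α × ℤ => dyadAverage n (f p.1) p.2 := by
  refine measurable_from_prod_countable_left fun k => ?_
  unfold dyadAverage
  exact (h _ (measurableSet_dyadCell n k)).const_mul (volume.real (dyadCell n k))⁻¹

lemma measurable_dyadAverage_floor {α : Type*} {mα : MeasurableSpace α} {f : α → ℝ → ℝ}
    (h : ∀ S : Set ℝ, MeasurableSet S → Measurable fun a => ∫ u in S, f a u) (n : ℕ) :
    Measurable fun p : α × ℝ => dyadAverage n (f p.1) ⌊2 ^ n * p.2⌋ := by
  have h1 : Measurable fun p : α × ℝ => (2 : ℝ) ^ n * p.2 := measurable_snd.const_mul _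
  have h2 := (measurable_dyadAverage h n).comp (measurable_fst.prodMk h1.floor)
  simp only [Function.comp_def] at h2
  exact h2

lemma measurable_densVersion {α : Type*} {mα : MeasurableSpace α} {f : α → ℝ → ℝ}
    (h : ∀ S : Set ℝ, MeasurableSet S → Measurable fun a => ∫ u in S, f a u) :
    Measurable fun p : α × ℝ => densVersion (f p.1) p.2 :=
  measurable_limUnder_seq fun n => measurable_dyadAverage_floor h n

lemma IsDensity.densVersion {f : ℝ → ℝ} (hf : IsDensity f) : densVersion f =ᵐ[volume] f :=
  densVersion_ae_eq hf.1

/-- The property is rephrased through integrals and the jointly measurable version so that it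
defines a measurable set of parameters. Integrability need not be listed: a non-integrable function
has Bochner integral `0`, not `1`. -/
lemma isDensity_iff {f : ℝ → ℝ} :
    IsDensity f ↔ ∫ u, f u = 1 ∧ ∫⁻ u, ENNReal.ofReal (-GLQ.densVersion f u) = 0 ∧
      AEMeasurable (GLQ.densVersion f) := by
  constructor
  · intro hf
    refine ⟨hf.2.2, ?_, hf.1.aestronglyMeasurable.aemeasurable.congr hf.densVersion.symm⟩
    rw [lintegral_congr_ae (g := fun _ => 0), lintegral_zero]
    filter_upwards [hf.densVersion, hf.2.1] with u h1 h2
    rw [h1]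
    exact ENNReal.ofReal_of_nonpos (by linarith)
  · rintro ⟨h1, h2, h3⟩
    have hi : Integrable f := by
      by_contra h
      rw [integral_undef h] at h1
      exact zero_ne_one h1
    refine ⟨hi, ?_, h1⟩
    rw [lintegral_eq_zero_iff' (f := fun u => ENNReal.ofReal (-GLQ.densVersion f u))
      h3.neg.ennreal_ofReal] at h2
    filter_upwards [densVersion_ae_eq hi, h2] with u e h
    have := ENNReal.ofReal_eq_zero.1 h
    rw [e] at this
    linarith

lemma measurableSet_isDensity {α : Type*} {mα : MeasurableSpace α} {f : α → ℝ → ℝ}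
    (h : ∀ S : Set ℝ, MeasurableSet S → Measurable fun a => ∫ u in S, f a u) :
    MeasurableSet {a | IsDensity (f a)} := by
  have hm := measurable_densVersion h
  have e : {a | IsDensity (f a)} = {a | ∫ u in Set.univ, f a u = 1} ∩
      {a | ∫⁻ u, ENNReal.ofReal (-densVersion (f a) u) = 0} := by
    ext a
    have hs : AEMeasurable (densVersion (f a)) volume :=
      (hm.comp measurable_prodMk_left).aemeasurable
    show IsDensity (f a) ↔ (∫ u in Set.univ, f a u) = 1 ∧ _
    rw [isDensity_iff, setIntegral_univ]
    exact ⟨fun h => ⟨h.1, h.2.1⟩, fun h => ⟨h.1, h.2, hs⟩⟩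
  rw [e]
  exact (h _ MeasurableSet.univ (measurableSet_singleton 1)).inter
    ((Measurable.lintegral_prod_right (f := fun a u => ENNReal.ofReal (-densVersion (f a) u))
      hm.neg.ennreal_ofReal) (measurableSet_singleton 0))

lemma measurable_integral_densVersion {α : Type*} {mα : MeasurableSpace α} {f : α → ℝ → ℝ}
    (h : ∀ S : Set ℝ, MeasurableSet S → Measurable fun a => ∫ u in S, f a u)
    {X : α → ℝ} (hX : Measurable X) {φ : ℝ × ℝ × ℝ → ℝ} (hφ : Measurable φ) :
    Measurable fun a => ∫ u, φ (X a, u, densVersion (f a) u) := by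
  refine (StronglyMeasurable.integral_prod_right
    (f := fun a u => φ (X a, u, densVersion (f a) u)) ?_).measurable
  exact (hφ.comp ((hX.comp measurable_fst).prodMk
    (measurable_snd.prodMk (measurable_densVersion h)))).stronglyMeasurable

lemma isProgressive_integral_densVersion {θ : RandControl} {X : ℝ≥0 → Path → ℝ}
    (h : ∀ S : Set ℝ, MeasurableSet S → IsProgressive Filt fun t ω => ∫ u in S, θ t ω u)
    (hX : IsProgressive Filt X) {φ : ℝ × ℝ × ℝ → ℝ} (hφ : Measurable φ) :
    IsProgressive Filt fun t ω => ∫ u, φ (X t ω, u, densVersion (θ t ω) u) := fun i =>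
  measurable_integral_densVersion (mα := Subtype.instMeasurableSpace.prod (Filt i))
    (f := fun p : Set.Iic i × Path => θ p.1 p.2) (fun S hS => h S hS i) (hX i) hφ

end DensityVersion

/-! ### Almost-everywhere properties of admissible randomized controls -/

section Admissible

variable {m : Model} {lam x : ℝ} {θ : RandControl} {X : ℝ≥0 → Path → ℝ} {P : Measure Path}

namespace Model

lemma bTilde_congr {y : ℝ} {f f' : ℝ → ℝ} (h : f =ᵐ[volume] f') :
    m.bTilde y f = m.bTilde y f' :=
  integral_congr_ae (h.mono fun u hu => by simp only [hu])

lemma volTilde_congr {y : ℝ} {f f' : ℝ → ℝ} (h : f =ᵐ[volume] f') :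
    m.volTilde y f = m.volTilde y f' := by
  unfold volTilde
  congr 1
  exact integral_congr_ae (h.mono fun u hu => by simp only [hu])

lemma g_congr {y : ℝ} {f f' : ℝ → ℝ} (h : f =ᵐ[volume] f') :
    m.g lam y f = m.g lam y f' := by
  unfold g
  congr 1
  · exact integral_congr_ae (h.mono fun u hu => by simp only [hu])
  · congr 1
    exact integral_congr_ae (h.mono fun u hu => by simp only [hu])

namespace Admissible

lemma measurable_setIntegral (h : m.Admissible lam x θ X) (S : Set ℝ) (hS : MeasurableSet S) :
    Measurable fun p : Path × ℝ≥0 => ∫ u in S, θ p.2 p.1 u :=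
  measurable_joint (h.progressive S hS)

/-- The density property is assumed for each time outside a null set depending on that time.
Measurability of the exceptional set allows Fubini to exchange the quantifiers. -/
lemma ae_isDensity (h : m.Admissible lam x θ X) (hP : P ∈ m.scen) :
    ∀ᵐ p ∂P.prod dt, IsDensity (θ p.2 p.1) := by
  have := hP.1
  have hm := measurableSet_isDensity h.measurable_setIntegral
  rw [Measure.ae_prod_iff_ae_ae hm, Measure.ae_ae_comm hm]
  exact ae_of_all _ fun t => h.density t P hP

/-- The second moment is integrable over each `[0, n]`, hence finite almost everywhere there. The
measurable version is used to state this for a measurable function. -/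
lemma ae_integrable_sq (h : m.Admissible lam x θ X) (hP : P ∈ m.scen) :
    ∀ᵐ p ∂P.prod dt, Integrable fun u => u ^ 2 * θ p.2 p.1 u := by
  have := hP.1
  have hv := measurable_densVersion h.measurable_setIntegral
  set J : Path × ℝ≥0 → ℝ≥0∞ := fun p => ∫⁻ u, ENNReal.ofReal (u ^ 2 * densVersion (θ p.2 p.1) u)
    with hJ
  have hJm : Measurable J := Measurable.lintegral_prod_right
    (f := fun (p : Path × ℝ≥0) u => ENNReal.ofReal (u ^ 2 * densVersion (θ p.2 p.1) u))
    (((measurable_snd.pow_const 2).mul hv).ennreal_ofReal)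
  have hJe : ∀ p : Path × ℝ≥0, IsDensity (θ p.2 p.1) →
      J p = ∫⁻ u, ENNReal.ofReal (u ^ 2 * θ p.2 p.1 u) := fun p hp =>
    lintegral_congr_ae (hp.densVersion.mono fun u hu => by simp only [hu])
  have hd := h.ae_isDensity hP
  have hfin : ∀ᵐ p ∂P.prod dt, J p < ∞ := by
    have key : ∀ n : ℕ, ∀ᵐ p ∂P.prod dt, p.2 ∈ Set.Iic (n : ℝ≥0) → J p < ∞ := by
      intro n
      have h1 : ∫⁻ p, J p ∂prodT P n < ∞ := by
        rw [lintegral_prod _ hJm.aemeasurable]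
        refine lt_of_le_of_lt (le_of_eq ?_) (lintegral_lt_top_of_upperE (h.moment n) hP)
        refine lintegral_congr_ae ?_
        filter_upwards [Measure.ae_ae_of_ae_prod hd] with ω hω
        refine lintegral_congr_ae ?_
        filter_upwards [ae_restrict_of_ae hω] with t ht using hJe (ω, t) ht
      have h2 := ae_lt_top hJm h1.ne
      rw [prodT_eq_restrict, ae_restrict_iff' (measurable_snd measurableSet_Iic)] at h2
      exact h2
    filter_upwards [ae_all_iff.2 key] with p hp
    obtain ⟨n, hn⟩ := exists_nat_ge p.2
    exact hp n hn
  filter_upwards [hd, hfin] with p hp hf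
  rw [hJe p hp] at hf
  have hmm : AEStronglyMeasurable (fun u => u ^ 2 * θ p.2 p.1 u) volume :=
    (by fun_prop : AEStronglyMeasurable (fun u : ℝ => u ^ 2) volume).mul hp.1.aestronglyMeasurable
  refine ⟨hmm, (hasFiniteIntegral_iff_ofReal ?_).2 hf⟩
  filter_upwards [hp.2.1] with u hu using mul_nonneg (sq_nonneg u) hu

lemma ae_integrable_log (h : m.Admissible lam x θ X) (hP : P ∈ m.scen) :
    ∀ᵐ p ∂P.prod dt, Integrable fun u => θ p.2 p.1 u * Real.log (θ p.2 p.1 u) := by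
  have := hP.1
  have hv := measurable_densVersion h.measurable_setIntegral
  set J : Path × ℝ≥0 → ℝ≥0∞ := fun p => ∫⁻ u, ENNReal.ofReal
    |densVersion (θ p.2 p.1) u * Real.log (densVersion (θ p.2 p.1) u)| with hJ
  have hJm : Measurable J := Measurable.lintegral_prod_right
    (f := fun (p : Path × ℝ≥0) u => ENNReal.ofReal
      |densVersion (θ p.2 p.1) u * Real.log (densVersion (θ p.2 p.1) u)|)
    ((hv.mul (Real.measurable_log.comp hv)).abs.ennreal_ofReal)
  have hJe : ∀ p : Path × ℝ≥0, IsDensity (θ p.2 p.1) →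
      J p = ∫⁻ u, ENNReal.ofReal |θ p.2 p.1 u * Real.log (θ p.2 p.1 u)| := fun p hp =>
    lintegral_congr_ae (hp.densVersion.mono fun u hu => by simp only [hu])
  have hd := h.ae_isDensity hP
  have hfin : ∀ᵐ p ∂P.prod dt, J p < ∞ := by
    rw [Measure.ae_prod_iff_ae_ae (p := fun p => J p < ∞) (hJm measurableSet_Iio)]
    filter_upwards [Measure.ae_ae_of_ae_prod hd, h.entropy P hP] with ω h1 h2
    filter_upwards [h1, h2] with t h1 h2
    rw [hJe (ω, t) h1]
    have := h2.2
    rwa [hasFiniteIntegral_iff_norm] at this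
  filter_upwards [hd, hfin] with p hp hf
  rw [hJe p hp] at hf
  refine ⟨hp.1.aestronglyMeasurable.mul
    (Real.measurable_log.comp_aemeasurable hp.1.aestronglyMeasurable.aemeasurable).aestronglyMeasurable,
    ?_⟩
  rw [hasFiniteIntegral_iff_norm]
  exact hf

end Admissible

end Model

end Admissible

/-! ### Moments and entropy of probability densities -/

section Density

variable {f : ℝ → ℝ}

lemma integrable_mul_of_sq (hf : IsDensity f) (h2 : Integrable fun u => u ^ 2 * f u) :
    Integrable fun u => u * f u := by
  have hm : AEStronglyMeasurable (fun u => u * f u) volume :=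
    aestronglyMeasurable_id.mul hf.1.aestronglyMeasurable
  refine (hf.1.add h2).mono' hm ?_
  filter_upwards [hf.2.1] with u hu
  rw [norm_mul, Real.norm_eq_abs, Real.norm_eq_abs, abs_of_nonneg hu]
  have : |u| ≤ 1 + u ^ 2 := by
    rcases abs_cases u with ⟨h, _⟩ | ⟨h, _⟩ <;> rw [h] <;> nlinarith [sq_nonneg (u - 1), sq_nonneg (u + 1)]
  calc |u| * f u ≤ (1 + u ^ 2) * f u := by gcongr
    _ = _ := by simp only [Pi.add_apply]; ring

lemma integral_quadratic_mul (hf : IsDensity f) (h2 : Integrable fun u => u ^ 2 * f u)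
    (q₂ q₁ q₀ : ℝ) : Integrable (fun u => (q₂ * u ^ 2 + q₁ * u + q₀) * f u) ∧
    ∫ u, (q₂ * u ^ 2 + q₁ * u + q₀) * f u = q₂ * (∫ u, u ^ 2 * f u) + q₁ * (∫ u, u * f u) + q₀ := by
  have h1 := integrable_mul_of_sq hf h2
  have e : (fun u => (q₂ * u ^ 2 + q₁ * u + q₀) * f u)
      = fun u => (q₂ * (u ^ 2 * f u) + q₁ * (u * f u)) + q₀ * f u := by
    ext u; ring
  rw [e]
  have i21 : Integrable fun u => q₂ * (u ^ 2 * f u) + q₁ * (u * f u) :=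
    (h2.const_mul _).add (h1.const_mul _)
  refine ⟨i21.add (hf.1.const_mul _), ?_⟩
  rw [integral_add i21 (hf.1.const_mul _), integral_add (h2.const_mul _) (h1.const_mul _), integral_const_mul, integral_const_mul,
    integral_const_mul, hf.2.2, mul_one]

lemma sq_integral_mul_le (hf : IsDensity f) (h2 : Integrable fun u => u ^ 2 * f u) :
    (∫ u, u * f u) ^ 2 ≤ ∫ u, u ^ 2 * f u := by
  set c := ∫ u, u * f u with hc
  have h := (integral_quadratic_mul hf h2 1 (-2 * c) (c ^ 2)).2
  have h0 : 0 ≤ ∫ u, (1 * u ^ 2 + -2 * c * u + c ^ 2) * f u := by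
    refine integral_nonneg_of_ae ?_
    filter_upwards [hf.2.1] with u hu
    exact mul_nonneg (by nlinarith [sq_nonneg (u - c)]) hu
  rw [h, ← hc] at h0
  nlinarith

/-- The Gaussian density maximizes entropy for a given second moment. -/
lemma neg_integral_mul_log_le (hf : IsDensity f) (h2 : Integrable fun u => u ^ 2 * f u)
    (hl : Integrable fun u => f u * Real.log (f u)) (c : ℝ) {v : ℝ≥0} (hv : 0 < v) :
    -∫ u, f u * Real.log (f u) ≤ 1 / 2 * Real.log (2 * Real.pi * v)
      + 1 / (2 * v) * ∫ u, (u - c) ^ 2 * f u := by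
  have hv' : (0 : ℝ) < v := hv
  have hq := integral_quadratic_mul hf h2 (1 / (2 * v)) (1 / (2 * v) * (-2 * c))
    (1 / (2 * v) * c ^ 2 + 1 / 2 * Real.log (2 * Real.pi * v))
  have hq' := integral_quadratic_mul hf h2 1 (-2 * c) (c ^ 2)
  have e1 : ∫ u, (u - c) ^ 2 * f u = ∫ u, (1 * u ^ 2 + -2 * c * u + c ^ 2) * f u :=
    integral_congr_ae (ae_of_all _ fun u => by ring)
  have i1 : Integrable fun u => f u * Real.log (f u) + (1 / (2 * v) * u ^ 2 +
      1 / (2 * v) * (-2 * c) * u + (1 / (2 * v) * c ^ 2 + 1 / 2 * Real.log (2 * Real.pi * v))) * f u :=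
    hl.add hq.1
  have i2 : Integrable fun u => f u - gaussianPDFReal c v u :=
    hf.1.sub (integrable_gaussianPDFReal c v)
  have h0 : 0 ≤ ∫ u, ((f u * Real.log (f u) + (1 / (2 * v) * u ^ 2 + 1 / (2 * v) * (-2 * c) * u +
      (1 / (2 * v) * c ^ 2 + 1 / 2 * Real.log (2 * Real.pi * v))) * f u)
      - (f u - gaussianPDFReal c v u)) := by
    refine integral_nonneg_of_ae ?_
    filter_upwards [hf.2.1] with u hu
    have hφ := gaussianPDFReal_pos c v u hv.ne'
    have hlog : Real.log (gaussianPDFReal c v u)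
        = -(1 / 2 * Real.log (2 * Real.pi * v)) - 1 / (2 * v) * (u - c) ^ 2 := by
      rw [gaussianPDFReal, Real.log_mul (by positivity) (by positivity), Real.log_exp, Real.log_inv,
        Real.log_sqrt (by positivity)]
      ring
    -- Gibbs' inequality pointwise: `log z ≤ z - 1` at the ratio `z` of the Gaussian density to `f`.
    -- Where `f` vanishes, positivity of the Gaussian density is enough.
    have key : f u - gaussianPDFReal c v u
        ≤ f u * Real.log (f u) - f u * Real.log (gaussianPDFReal c v u) := by
      rcases hu.eq_or_lt with h | h
      · rw [← h]; simp [hφ.le]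
      · have := Real.log_le_sub_one_of_pos (div_pos hφ h)
        rw [Real.log_div hφ.ne' h.ne'] at this
        have h3 := mul_le_mul_of_nonneg_left this h.le
        have h4 : f u * (gaussianPDFReal c v u / f u - 1) = gaussianPDFReal c v u - f u := by
          field_simp
        rw [h4] at h3
        linarith
    rw [hlog] at key
    simp only [Pi.zero_apply]
    nlinarith [key]
  rw [integral_sub i1 i2,
    integral_add hl hq.1, hq.2, integral_sub hf.1 (integrable_gaussianPDFReal c v), hf.2.2,
    integral_gaussianPDFReal_eq_one c hv.ne'] at h0
  rw [e1, hq'.2]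
  linarith

end Density

/-! ### The Hamilton–Jacobi–Bellman equation and its defect -/

namespace Model

variable {m : Model} {α₂ α₁ α₀ lam : ℝ} {f : ℝ → ℝ}

/-- The Hamilton–Jacobi–Bellman equation at the candidate feedback. -/
def SolvesHJB (m : Model) (α₂ α₁ α₀ : ℝ) : Prop :=
  ∀ y, m.r y (m.uStar α₂ α₁ y) = residual m.ρ (m.σhi ^ 2) α₂ α₁ α₀ y
    (m.b y (m.uStar α₂ α₁ y)) (m.vol y (m.uStar α₂ α₁ y))

/-- The value of entropy `λ / (2ρ) ln (2πλ / (K - α₂ D² σhi²))`. -/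
noncomputable def entropyValue (m : Model) (lam α₂ : ℝ) : ℝ :=
  lam / (2 * m.ρ) * Real.log (2 * Real.pi * (lam / m.denom α₂))

lemma σhi_pos (m : Model) : 0 < m.σhi := m.σlo_pos.trans_le m.σlo_le

lemma denom_pos (hα₂ : α₂ < 0) : 0 < m.denom α₂ := by
  have := m.K_pos
  have : 0 ≤ -α₂ * (m.D ^ 2 * m.σhi ^ 2) := mul_nonneg (by linarith) (by positivity)
  unfold denom
  nlinarith

lemma denom_mul_uStar (hα₂ : α₂ < 0) (y : ℝ) : m.denom α₂ * m.uStar α₂ α₁ y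
    = (α₂ * (m.F + m.C * m.D * m.σhi ^ 2) - m.I) * y + α₁ * m.F - m.Q := by
  have := (denom_pos (m := m) hα₂).ne'
  unfold uStar
  field_simp

/-- The defect in the Hamilton–Jacobi–Bellman equation at an arbitrary control. -/
lemma SolvesHJB.r_eq (h : m.SolvesHJB α₂ α₁ α₀) (hα₂ : α₂ < 0) (y u : ℝ) :
    m.r y u = residual m.ρ (m.σhi ^ 2) α₂ α₁ α₀ y (m.b y u) (m.vol y u)
      - m.denom α₂ / 2 * (u - m.uStar α₂ α₁ y) ^ 2 := by
  have h1 := h y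
  have h2 := denom_mul_uStar (m := m) (α₁ := α₁) hα₂ y
  generalize m.uStar α₂ α₁ y = w at h1 h2
  simp only [r, residual, b, vol, denom] at h1 h2 ⊢
  -- Both sides are quadratic in `u` with the same leading coefficient. The relation `h2` defining
  -- `u*` matches the slopes at `u*`, and the equation `h1` matches the values there.
  linear_combination h1 - (u - w) * h2

lemma volTilde_sq (hf : IsDensity f) (y : ℝ) :
    m.volTilde y f ^ 2 = ∫ u, m.vol y u ^ 2 * f u := by
  unfold volTilde
  refine Real.sq_sqrt (integral_nonneg_of_ae ?_)
  filter_upwards [hf.2.1] with u hu using mul_nonneg (sq_nonneg _) hu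

lemma bTilde_eq (hf : IsDensity f) (h2 : Integrable fun u => u ^ 2 * f u) (y : ℝ) :
    m.bTilde y f = m.A * y + m.F * ∫ u, u * f u := by
  have := (integral_quadratic_mul hf h2 0 m.F (m.A * y)).2
  rw [bTilde, ← add_comm (m.F * _), ← zero_add (m.F * _), ← zero_mul (∫ u, u ^ 2 * f u), ← this]
  exact integral_congr_ae (ae_of_all _ fun u => by simp only [b]; ring)

lemma volTilde_sq_eq (hf : IsDensity f) (h2 : Integrable fun u => u ^ 2 * f u) (y : ℝ) :
    m.volTilde y f ^ 2 = m.D ^ 2 * (∫ u, u ^ 2 * f u) + 2 * m.C * m.D * y * (∫ u, u * f u)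
      + m.C ^ 2 * y ^ 2 := by
  rw [volTilde_sq hf, ← (integral_quadratic_mul hf h2 _ _ _).2]
  exact integral_congr_ae (ae_of_all _ fun u => by simp only [vol]; ring)

lemma integral_r_eq (hf : IsDensity f) (h2 : Integrable fun u => u ^ 2 * f u) (y : ℝ) :
    ∫ u, m.r y u * f u = -(m.K / 2) * (∫ u, u ^ 2 * f u) + -(m.I * y + m.Q) * (∫ u, u * f u)
      + -(m.M / 2 * y ^ 2 + m.P * y) := by
  rw [← (integral_quadratic_mul hf h2 _ _ _).2]
  exact integral_congr_ae (ae_of_all _ fun u => by simp only [r]; ring)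

lemma integral_sub_sq_eq (hf : IsDensity f) (h2 : Integrable fun u => u ^ 2 * f u) (c : ℝ) :
    ∫ u, (u - c) ^ 2 * f u = (∫ u, u ^ 2 * f u) - 2 * c * (∫ u, u * f u) + c ^ 2 := by
  have := (integral_quadratic_mul hf h2 1 (-2 * c) (c ^ 2)).2
  rw [show ∫ u, (u - c) ^ 2 * f u = ∫ u, (1 * u ^ 2 + -2 * c * u + c ^ 2) * f u from
    integral_congr_ae (ae_of_all _ fun u => by ring), this]
  ring

/-- The integrated defect in the Hamilton–Jacobi–Bellman equation. -/
lemma SolvesHJB.integral_r (h : m.SolvesHJB α₂ α₁ α₀) (hα₂ : α₂ < 0) (hf : IsDensity f)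
    (h2 : Integrable fun u => u ^ 2 * f u) (y : ℝ) :
    ∫ u, m.r y u * f u
      = residual m.ρ (m.σhi ^ 2) α₂ α₁ α₀ y (m.bTilde y f) (m.volTilde y f)
        - m.denom α₂ / 2 * ∫ u, (u - m.uStar α₂ α₁ y) ^ 2 * f u := by
  have h1 := h.r_eq hα₂ y 0
  have hp := h.r_eq hα₂ y 1
  have hm := h.r_eq hα₂ y (-1)
  rw [integral_r_eq hf h2, integral_sub_sq_eq hf h2, residual, bTilde_eq hf h2,
    volTilde_sq_eq hf h2]
  generalize m.uStar α₂ α₁ y = w at *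
  generalize (∫ u, u * f u) = m1 at *
  generalize (∫ u, u ^ 2 * f u) = m2 at *
  simp only [r, residual, b, vol] at h1 hp hm ⊢
  -- Only the first two moments of `f` enter, and they enter affinely. The weights on the controls
  -- `0`, `1`, `-1` have total mass `1`, mean `m1` and second moment `m2`, so the identity follows
  -- from the pointwise one at three controls.
  linear_combination h1 * (1 - m2) + hp * ((m2 + m1) / 2) + hm * ((m2 - m1) / 2)

lemma residual_add_const (ρ v p₂ p₁ p₀ c y β H : ℝ) :
    residual ρ v p₂ p₁ (p₀ + c) y β H = residual ρ v p₂ p₁ p₀ y β H + ρ * c := by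
  simp only [residual, quad]; ring

lemma rho_mul_entropyValue (lam α₂ : ℝ) : m.ρ * m.entropyValue lam α₂
    = lam * (1 / 2 * Real.log (2 * Real.pi * (lam / m.denom α₂))) := by
  have := m.ρ_pos.ne'
  unfold entropyValue
  field_simp

lemma coe_varStar (hlam : 0 < lam) (hα₂ : α₂ < 0) :
    (m.varStar lam α₂ : ℝ) = lam / m.denom α₂ :=
  Real.coe_toNNReal _ (div_pos hlam (denom_pos hα₂)).le

lemma varStar_pos (hlam : 0 < lam) (hα₂ : α₂ < 0) : 0 < m.varStar lam α₂ :=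
  Real.toNNReal_pos.2 (div_pos hlam (denom_pos hα₂))

/-- The exploratory running reward is dominated by the generator of the candidate value. -/
lemma SolvesHJB.g_le (h : m.SolvesHJB α₂ α₁ α₀) (hα₂ : α₂ < 0) (hlam : 0 < lam) (hf : IsDensity f)
    (h2 : Integrable fun u => u ^ 2 * f u) (hl : Integrable fun u => f u * Real.log (f u)) (y : ℝ) :
    m.g lam y f ≤ residual m.ρ (m.σhi ^ 2) α₂ α₁ (α₀ + m.entropyValue lam α₂) y
      (m.bTilde y f) (m.volTilde y f) := by
  have h1 := neg_integral_mul_log_le hf h2 hl (m.uStar α₂ α₁ y) (varStar_pos (m := m) hlam hα₂)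
  have h3 := mul_le_mul_of_nonneg_left h1 hlam.le
  rw [coe_varStar hlam hα₂] at h3
  have hd := denom_pos (m := m) hα₂
  -- The variance `λ / denom` is the one for which `λ` times the Gaussian penalty in the entropy
  -- bound is exactly the quadratic defect of the equation.
  have e : lam * (1 / (2 * (lam / m.denom α₂))) = m.denom α₂ / 2 := by field_simp
  rw [residual_add_const, rho_mul_entropyValue, g, h.integral_r hα₂ hf h2]
  rw [mul_add, ← mul_assoc lam (1 / (2 * (lam / m.denom α₂))), e] at h3
  linarith

end Model

/-! ### Upper bounds for the two value functions -/

namespace Model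

variable {m : Model} {lam x α₂ α₁ α₀ : ℝ} {θ : RandControl} {X u : ℝ≥0 → Path → ℝ}
  {P : Measure Path}

lemma priors_subset_scen (m : Model) : priors m.σhi m.σhi ⊆ m.scen :=
  priors_mono m.σlo_pos.le m.σlo_le

lemma exists_mem_priors_σhi (m : Model) : ∃ P ∈ m.scen, P ∈ priors m.σhi m.σhi :=
  let ⟨P, hP⟩ := exists_mem_priors m.σhi_pos
  ⟨P, m.priors_subset_scen hP, hP⟩

namespace Admissible

/-- The exploratory drift as a progressive process. -/
noncomputable def drift (m : Model) (θ : RandControl) (X : ℝ≥0 → Path → ℝ) (t : ℝ≥0) (ω : Path) :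
    ℝ := m.bTilde (X t ω) (densVersion (θ t ω))

/-- The exploratory volatility as a progressive process. -/
noncomputable def diffusion (m : Model) (θ : RandControl) (X : ℝ≥0 → Path → ℝ) (t : ℝ≥0)
    (ω : Path) : ℝ := m.volTilde (X t ω) (densVersion (θ t ω))

lemma isProgressive_drift (h : m.Admissible lam x θ X) : IsProgressive Filt (drift m θ X) :=
  isProgressive_integral_densVersion h.progressive h.state.1
    (φ := fun q => m.b q.1 q.2.1 * q.2.2) (by unfold b; fun_prop)

lemma isProgressive_diffusion (h : m.Admissible lam x θ X) :
    IsProgressive Filt (diffusion m θ X) :=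
  (isProgressive_integral_densVersion h.progressive h.state.1
    (φ := fun q => m.vol q.1 q.2.1 ^ 2 * q.2.2) (by unfold vol; fun_prop)).comp_measurable
    (g := fun y => √y) (by fun_prop)

lemma ae_drift_eq (h : m.Admissible lam x θ X) (hP : P ∈ m.scen) : ∀ᵐ p ∂P.prod dt,
    joint (drift m θ X) p = m.bTilde (joint X p) (θ p.2 p.1) := by
  filter_upwards [h.ae_isDensity hP] with p hp using bTilde_congr hp.densVersion

lemma ae_diffusion_eq (h : m.Admissible lam x θ X) (hP : P ∈ m.scen) : ∀ᵐ p ∂P.prod dt,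
    joint (diffusion m θ X) p = m.volTilde (joint X p) (θ p.2 p.1) := by
  filter_upwards [h.ae_isDensity hP] with p hp using volTilde_congr hp.densVersion

lemma memLp_joint_X (h : m.Admissible lam x θ X) (hP : P ∈ m.scen) (T : ℝ≥0) :
    MemLp (joint X) 2 (prodT P T) :=
  memLp_joint_of_lintegral (measurable_joint h.state.1)
    (lintegral_lt_top_of_upperE (h.state.2.1 T) hP)

/-- The drift is affine in the state and in the mean of the control density. The squared mean is at
most the second moment, which the moment condition makes integrable. -/
lemma memLp_joint_drift (h : m.Admissible lam x θ X) (hP : P ∈ m.scen) (T : ℝ≥0) :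
    MemLp (joint (drift m θ X)) 2 (prodT P T) := by
  have := hP.1
  have hv := measurable_densVersion h.measurable_setIntegral
  set J : Path × ℝ≥0 → ℝ≥0∞ := fun p => ∫⁻ u, ENNReal.ofReal (u ^ 2 * densVersion (θ p.2 p.1) u)
    with hJ
  have hJm : Measurable J := Measurable.lintegral_prod_right
    (f := fun (p : Path × ℝ≥0) u => ENNReal.ofReal (u ^ 2 * densVersion (θ p.2 p.1) u))
    (((measurable_snd.pow_const 2).mul hv).ennreal_ofReal)
  have hac : ∀ {p : Path × ℝ≥0 → Prop}, (∀ᵐ q ∂P.prod dt, p q) → ∀ᵐ q ∂prodT P T, p q :=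
    fun hp => by rw [prodT_eq_restrict]; exact ae_restrict_of_ae hp
  have hd := hac (h.ae_isDensity hP)
  have h2 := hac (h.ae_integrable_sq hP)
  have hJe : ∀ᵐ p ∂prodT P T, J p = ∫⁻ u, ENNReal.ofReal (u ^ 2 * θ p.2 p.1 u) := by
    filter_upwards [hd] with p hp
    exact lintegral_congr_ae (hp.densVersion.mono fun u hu => by simp only [hu])
  have hfin : ∫⁻ p, J p ∂prodT P T < ∞ := by
    rw [lintegral_prod _ hJm.aemeasurable]
    refine lt_of_le_of_lt (le_of_eq ?_) (lintegral_lt_top_of_upperE (h.moment T) hP)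
    refine lintegral_congr_ae ?_
    filter_upwards [Measure.ae_ae_of_ae_prod hJe] with ω hω
    exact lintegral_congr_ae hω
  have hN := integrable_toReal_of_lintegral_ne_top hJm.aemeasurable hfin.ne
  have hmd := measurable_joint h.isProgressive_drift
  rw [memLp_two_iff_integrable_sq hmd.aestronglyMeasurable]
  refine (((h.memLp_joint_X hP T).integrable_sq.const_mul (2 * m.A ^ 2)).add
    (hN.const_mul (2 * m.F ^ 2))).mono' (hmd.pow_const 2).aestronglyMeasurable ?_
  filter_upwards [hd, h2, hJe, hac (h.ae_drift_eq hP)] with p hp hp2 hJp hdp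
  have e : (J p).toReal = ∫ u, u ^ 2 * θ p.2 p.1 u := by
    rw [hJp, integral_eq_lintegral_of_nonneg_ae]
    · filter_upwards [hp.2.1] with u hu using mul_nonneg (sq_nonneg u) hu
    · exact hp2.aestronglyMeasurable
  have h3 := sq_integral_mul_le hp hp2
  rw [Real.norm_eq_abs, abs_of_nonneg (sq_nonneg _), hdp, bTilde_eq hp hp2]
  simp only [Pi.add_apply]
  rw [e]
  have h4 := mul_le_mul_of_nonneg_left h3 (show 0 ≤ 2 * m.F ^ 2 by positivity)
  nlinarith [sq_nonneg (m.A * joint X p - m.F * ∫ u, u * θ p.2 p.1 u)]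

/-- The coefficients built from the control itself are not known to be progressive. They agree
almost everywhere with those built from `densVersion`, and the Itô integral does not see the
difference. -/
lemma itoProc (h : m.Admissible lam x θ X) (hP : P ∈ m.scen) :
    ItoProc P x X (drift m θ X) (diffusion m θ X) := by
  have := hP.1
  refine ⟨h.state.1, h.isProgressive_drift, h.isProgressive_diffusion, h.memLp_joint_X hP,
    h.memLp_joint_drift hP, fun T => (h.state.2.2 P hP T).congr ?_ ?_⟩
  · rw [prodT_eq_restrict]
    refine ae_restrict_of_ae ?_
    filter_upwards [h.ae_diffusion_eq hP] with p hp using hp.symm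
  · filter_upwards [Measure.ae_ae_of_ae_prod (h.ae_drift_eq hP)] with ω hω
    congr 1
    refine integral_congr_ae (ae_restrict_of_ae ?_)
    filter_upwards [hω] with t ht using ht.symm

lemma integrable_g (h : m.Admissible lam x θ X) (hP : P ∈ m.scen) :
    Integrable (fun p : Path × ℝ≥0 => Real.exp (-m.ρ * p.2) *
      joint (fun t ω => m.g lam (X t ω) (θ t ω)) p) (P.prod dt) := by
  refine integrable_of_upperE h.reward hP ?_
  have hX : Measurable fun p : Path × ℝ≥0 => X p.2 p.1 := measurable_joint h.state.1
  have h1 : Measurable fun p : Path × ℝ≥0 => m.g lam (X p.2 p.1) (densVersion (θ p.2 p.1)) := by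
    refine Measurable.sub ?_ (Measurable.const_mul ?_ lam)
    · exact measurable_integral_densVersion h.measurable_setIntegral hX
        (φ := fun q => m.r q.1 q.2.1 * q.2.2) (by unfold r; fun_prop)
    · exact measurable_integral_densVersion h.measurable_setIntegral hX
        (φ := fun q => q.2.2 * Real.log q.2.2) (by fun_prop)
  refine h1.aemeasurable.congr ?_
  filter_upwards [h.ae_isDensity hP] with p hp using g_congr hp.densVersion

/-- No admissible randomized control does better than the candidate value. -/
lemma explReward_le (h : m.Admissible lam x θ X) (hα₂ : α₂ < 0) (hlam : 0 < lam)
    (hH : m.SolvesHJB α₂ α₁ α₀) :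
    m.explReward lam θ X ≤ (quad α₂ α₁ (α₀ + m.entropyValue lam α₂) x : ℝ) := by
  obtain ⟨P, hP, hP'⟩ := m.exists_mem_priors_σhi
  have := hP.1
  -- A lower expectation is at most the expectation under any one prior; constant volatility `σhi`
  -- is the prior under which the Dynkin formula is exact.
  refine (lowerE_le hP).trans (EReal.coe_le_coe_iff.2 ?_)
  have hi := h.integrable_g hP
  have e := integral_reward (G := joint fun t ω => m.g lam (X t ω) (θ t ω)) hi
  simp only [joint] at e
  rw [e]
  refine (h.itoProc hP).verification_le hP' m.σhi_pos.le m.ρ_pos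
    (transversal_of_liminf h.transversality hP) hi ?_
  filter_upwards [h.ae_isDensity hP, h.ae_integrable_sq hP, h.ae_integrable_log hP,
    h.ae_drift_eq hP, h.ae_diffusion_eq hP] with p h1 h2 h3 h4 h5
  rw [h4, h5]
  exact hH.g_le hα₂ hlam h1 h2 h3 _

end Admissible

namespace AdmissibleNe

lemma isProgressive_b (h : m.AdmissibleNe x u X) :
    IsProgressive Filt fun t ω => m.b (X t ω) (u t ω) := fun i =>
  ((h.state.1 i).const_mul m.A).add ((h.progressive i).const_mul m.F)

lemma isProgressive_vol (h : m.AdmissibleNe x u X) :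
    IsProgressive Filt fun t ω => m.vol (X t ω) (u t ω) := fun i =>
  ((h.state.1 i).const_mul m.C).add ((h.progressive i).const_mul m.D)

lemma itoProc (h : m.AdmissibleNe x u X) (hP : P ∈ m.scen) :
    ItoProc P x X (fun t ω => m.b (X t ω) (u t ω)) fun t ω => m.vol (X t ω) (u t ω) := by
  have h1 : ∀ T, MemLp (joint X) 2 (prodT P T) := fun T =>
    memLp_joint_of_lintegral (measurable_joint h.state.1)
      (lintegral_lt_top_of_upperE (h.state.2.1 T) hP)
  have h2 : ∀ T, MemLp (joint u) 2 (prodT P T) := fun T =>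
    memLp_joint_of_lintegral (measurable_joint h.progressive)
      (lintegral_lt_top_of_upperE (h.moment T) hP)
  exact ⟨h.state.1, h.isProgressive_b, h.isProgressive_vol, h1,
    fun T => ((h1 T).const_mul m.A).add ((h2 T).const_mul m.F), fun T => h.state.2.2 P hP T⟩

/-- No admissible control does better than the candidate value. -/
lemma reward_le (h : m.AdmissibleNe x u X) (hα₂ : α₂ < 0) (hH : m.SolvesHJB α₂ α₁ α₀) :
    m.reward u X ≤ (quad α₂ α₁ α₀ x : ℝ) := by
  obtain ⟨P, hP, hP'⟩ := m.exists_mem_priors_σhi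
  have := hP.1
  refine (lowerE_le hP).trans (EReal.coe_le_coe_iff.2 ?_)
  have hm : Measurable (joint fun t ω => m.r (X t ω) (u t ω)) := by
    have hX : Measurable fun p : Path × ℝ≥0 => X p.2 p.1 := measurable_joint h.state.1
    have hu : Measurable fun p : Path × ℝ≥0 => u p.2 p.1 := measurable_joint h.progressive
    exact (((((hX.pow_const 2).const_mul _).add ((hX.const_mul _).mul hu)).add
      ((hu.pow_const 2).const_mul _)).add (hX.const_mul _)).add (hu.const_mul _) |>.neg
  have hi := integrable_of_upperE h.reward hP hm.aemeasurable
  have e := integral_reward (G := joint fun t ω => m.r (X t ω) (u t ω)) hi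
  simp only [joint] at e
  rw [e]
  refine (h.itoProc hP).verification_le hP' m.σhi_pos.le m.ρ_pos
    (transversal_of_liminf h.transversality hP) hi (ae_of_all _ fun p => ?_)
  have h1 := hH.r_eq hα₂ (X p.2 p.1) (u p.2 p.1)
  have := mul_nonneg (denom_pos (m := m) hα₂).le
    (sq_nonneg (u p.2 p.1 - m.uStar α₂ α₁ (X p.2 p.1)))
  simp only [joint]
  linarith

end AdmissibleNe

end Model

/-! ### Moments and entropy of the Gaussian density -/

section GaussianDensity

variable {c : ℝ} {v : ℝ≥0}

lemma isDensity_gaussianPDFReal (hv : 0 < v) : IsDensity (gaussianPDFReal c v) :=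
  ⟨integrable_gaussianPDFReal c v, ae_of_all _ fun u => gaussianPDFReal_nonneg c v u,
    integral_gaussianPDFReal_eq_one c hv.ne'⟩

lemma integrable_sq_mul_gaussianPDFReal (hv : 0 < v) :
    Integrable fun u => u ^ 2 * gaussianPDFReal c v u := by
  have h := (memLp_id_gaussianReal (μ := c) (v := v) 2).integrable_sq
  rw [gaussianReal_of_var_ne_zero _ hv.ne', integrable_withDensity_iff_integrable_smul'
    (measurable_gaussianPDF c v) (ae_of_all _ fun _ => gaussianPDF_lt_top)] at h
  refine h.congr (ae_of_all _ fun u => ?_)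
  simp only [toReal_gaussianPDF, smul_eq_mul, id]
  ring

lemma integral_mul_gaussianPDFReal (hv : 0 < v) : ∫ u, u * gaussianPDFReal c v u = c := by
  have h := integral_id_gaussianReal (μ := c) (v := v)
  rw [integral_gaussianReal_eq_integral_smul hv.ne'] at h
  refine Eq.trans ?_ h
  exact integral_congr_ae (ae_of_all _ fun u => by simp only [smul_eq_mul]; ring)

lemma integral_sq_mul_gaussianPDFReal (hv : 0 < v) :
    ∫ u, u ^ 2 * gaussianPDFReal c v u = c ^ 2 + v := by
  have h := variance_id_gaussianReal (μ := c) (v := v)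
  rw [variance_eq_sub (memLp_id_gaussianReal (μ := c) (v := v) 2)] at h
  simp only [id, Pi.pow_apply] at h
  rw [integral_id_gaussianReal, integral_gaussianReal_eq_integral_smul hv.ne'] at h
  rw [← h]
  have : ∫ u, gaussianPDFReal c v u • u ^ 2 = ∫ u, u ^ 2 * gaussianPDFReal c v u :=
    integral_congr_ae (ae_of_all _ fun u => by simp only [smul_eq_mul]; ring)
  rw [this]; ring

lemma gaussianPDFReal_mul_log (hv : 0 < v) (u : ℝ) :
    gaussianPDFReal c v u * Real.log (gaussianPDFReal c v u)
      = (-(1 / (2 * v)) * u ^ 2 + c / v * u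
        + (-(1 / 2 * Real.log (2 * Real.pi * v)) - c ^ 2 / (2 * v))) * gaussianPDFReal c v u := by
  have hv' : (0 : ℝ) < v := hv
  have hlog : Real.log (gaussianPDFReal c v u)
      = -(1 / 2 * Real.log (2 * Real.pi * v)) - 1 / (2 * v) * (u - c) ^ 2 := by
    rw [gaussianPDFReal, Real.log_mul (by positivity) (by positivity), Real.log_exp, Real.log_inv,
      Real.log_sqrt (by positivity)]
    ring
  rw [hlog]
  field_simp
  ring

lemma integrable_gaussianPDFReal_mul_log (hv : 0 < v) :
    Integrable fun u => gaussianPDFReal c v u * Real.log (gaussianPDFReal c v u) := by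
  simp_rw [gaussianPDFReal_mul_log hv]
  exact (integral_quadratic_mul (isDensity_gaussianPDFReal hv)
    (integrable_sq_mul_gaussianPDFReal hv) _ _ _).1

lemma integral_gaussianPDFReal_mul_log (hv : 0 < v) :
    ∫ u, gaussianPDFReal c v u * Real.log (gaussianPDFReal c v u)
      = -(1 / 2 * Real.log (2 * Real.pi * v)) - 1 / 2 := by
  have hv' : (0 : ℝ) < v := hv
  simp_rw [gaussianPDFReal_mul_log hv]
  rw [(integral_quadratic_mul (isDensity_gaussianPDFReal hv)
    (integrable_sq_mul_gaussianPDFReal hv) _ _ _).2, integral_mul_gaussianPDFReal hv,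
    integral_sq_mul_gaussianPDFReal hv]
  field_simp
  ring

end GaussianDensity

/-- The function `p ↦ √(p² + w)` is the Euclidean norm of `(p, √w)`, hence 1-Lipschitz. It makes the
exploratory closed-loop volatility Lipschitz although it is not affine. -/
lemma abs_sqrt_sub_sqrt_le {p q w : ℝ} (hw : 0 ≤ w) :
    |√(p ^ 2 + w) - √(q ^ 2 + w)| ≤ |p - q| := by
  have key : ∀ p q : ℝ, √(p ^ 2 + w) ≤ √(q ^ 2 + w) + |p - q| := by
    intro p q
    refine Real.sqrt_le_iff.2 ⟨by positivity, ?_⟩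
    have h1 : |q| ≤ √(q ^ 2 + w) := by
      rw [← Real.sqrt_sq_eq_abs]; exact Real.sqrt_le_sqrt (by linarith)
    have h2 := Real.sq_sqrt (show 0 ≤ q ^ 2 + w by positivity)
    have h3 : q * (p - q) ≤ |q| * |p - q| := by rw [← abs_mul]; exact le_abs_self _
    have h4 := mul_le_mul_of_nonneg_right h1 (abs_nonneg (p - q))
    nlinarith [sq_abs (p - q)]
  rw [abs_sub_le_iff]
  refine ⟨by linarith [key p q], ?_⟩
  have := key q p
  rw [abs_sub_comm q p] at this
  linarith

/-! ### Closed-loop coefficients and equivalence of the two equations -/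

namespace Model

variable {m : Model} {α₂ α₁ α₀ lam x : ℝ}

/-- The slope of the linear feedback. -/
noncomputable def slope (m : Model) (α₂ : ℝ) : ℝ :=
  (α₂ * (m.F + m.C * m.D * m.σhi ^ 2) - m.I) / m.denom α₂

/-- The intercept of the linear feedback. -/
noncomputable def intercept (m : Model) (α₂ α₁ : ℝ) : ℝ := (α₁ * m.F - m.Q) / m.denom α₂

lemma uStar_eq (y : ℝ) : m.uStar α₂ α₁ y = m.slope α₂ * y + m.intercept α₂ α₁ := by
  unfold uStar slope intercept
  ring

lemma continuous_uStar : Continuous (m.uStar α₂ α₁) := by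
  unfold uStar; fun_prop

lemma b_uStar (y : ℝ) : m.b y (m.uStar α₂ α₁ y)
    = (m.A + m.F * m.slope α₂) * y + m.F * m.intercept α₂ α₁ := by
  rw [uStar_eq, b]; ring

lemma vol_uStar (y : ℝ) : m.vol y (m.uStar α₂ α₁ y)
    = (m.C + m.D * m.slope α₂) * y + m.D * m.intercept α₂ α₁ := by
  rw [uStar_eq, vol]; ring

/-- The coefficients of the quadratic function `y ↦ r y (u* y)`. -/
noncomputable def loopCoeff (m : Model) (α₂ α₁ : ℝ) : Fin 3 → ℝ :=
  ![-(m.K / 2 * m.intercept α₂ α₁ ^ 2 + m.Q * m.intercept α₂ α₁),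
    -(m.I * m.intercept α₂ α₁ + m.K * m.slope α₂ * m.intercept α₂ α₁ + m.P + m.Q * m.slope α₂),
    -(m.M + 2 * m.I * m.slope α₂ + m.K * m.slope α₂ ^ 2)]

lemma r_uStar (y : ℝ) : m.r y (m.uStar α₂ α₁ y)
    = quad (m.loopCoeff α₂ α₁ 2) (m.loopCoeff α₂ α₁ 1) (m.loopCoeff α₂ α₁ 0) y := by
  simp only [uStar_eq, r, quad, loopCoeff, Matrix.cons_val]
  ring


lemma isDensity_thetaStar (hα₂ : α₂ < 0) (hlam : 0 < lam) (y : ℝ) :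
    IsDensity (m.thetaStar lam α₂ α₁ y) :=
  isDensity_gaussianPDFReal (varStar_pos hlam hα₂)

lemma bTilde_thetaStar (hα₂ : α₂ < 0) (hlam : 0 < lam) (y : ℝ) :
    m.bTilde y (m.thetaStar lam α₂ α₁ y)
      = (m.A + m.F * m.slope α₂) * y + m.F * m.intercept α₂ α₁ := by
  rw [bTilde_eq (isDensity_thetaStar hα₂ hlam y)
    (integrable_sq_mul_gaussianPDFReal (varStar_pos hlam hα₂)), ← b_uStar, b, thetaStar,
    integral_mul_gaussianPDFReal (varStar_pos hlam hα₂)]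

/-- The closed-loop volatility of the Gaussian feedback. -/
noncomputable def loopVol (m : Model) (lam α₂ α₁ y : ℝ) : ℝ :=
  √(((m.C + m.D * m.slope α₂) * y + m.D * m.intercept α₂ α₁) ^ 2 + m.D ^ 2 * m.varStar lam α₂)

lemma loopVol_sq (y : ℝ) : m.loopVol lam α₂ α₁ y ^ 2
    = ((m.C + m.D * m.slope α₂) * y + m.D * m.intercept α₂ α₁) ^ 2 + m.D ^ 2 * m.varStar lam α₂ :=
  Real.sq_sqrt (by positivity)

lemma abs_loopVol_sub_le (y z : ℝ) : |m.loopVol lam α₂ α₁ y - m.loopVol lam α₂ α₁ z|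
    ≤ |m.C + m.D * m.slope α₂| * |y - z| := by
  unfold loopVol
  refine (abs_sqrt_sub_sqrt_le (by positivity)).trans ?_
  rw [← abs_mul]
  exact le_of_eq (congrArg _ (by ring))

lemma volTilde_thetaStar (hα₂ : α₂ < 0) (hlam : 0 < lam) (y : ℝ) :
    m.volTilde y (m.thetaStar lam α₂ α₁ y) = m.loopVol lam α₂ α₁ y := by
  have h0 : 0 ≤ m.volTilde y (m.thetaStar lam α₂ α₁ y) := Real.sqrt_nonneg _
  have h := volTilde_sq_eq (m := m) (isDensity_thetaStar (m := m) (α₁ := α₁) hα₂ hlam y)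
    (integrable_sq_mul_gaussianPDFReal (varStar_pos hlam hα₂)) y
  rw [← Real.sqrt_sq h0, h, loopVol, ← vol_uStar, thetaStar,
    integral_mul_gaussianPDFReal (varStar_pos hlam hα₂),
    integral_sq_mul_gaussianPDFReal (varStar_pos hlam hα₂)]
  congr 1
  simp only [vol]
  ring

/-- The constant part of the running reward due to exploration. -/
noncomputable def exploreConst (m : Model) (lam α₂ : ℝ) : ℝ :=
  -(m.K / 2 * (lam / m.denom α₂))
    + lam * (1 / 2 * Real.log (2 * Real.pi * (lam / m.denom α₂)) + 1 / 2)

lemma g_thetaStar (hα₂ : α₂ < 0) (hlam : 0 < lam) (y : ℝ) :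
    m.g lam y (m.thetaStar lam α₂ α₁ y) = quad (m.loopCoeff α₂ α₁ 2) (m.loopCoeff α₂ α₁ 1)
      (m.loopCoeff α₂ α₁ 0 + m.exploreConst lam α₂) y := by
  have hv := varStar_pos (m := m) hlam hα₂
  have h : ∀ p₂ p₁ p₀ c : ℝ, quad p₂ p₁ (p₀ + c) y = quad p₂ p₁ p₀ y + c := by
    intros; simp only [quad]; ring
  rw [h, ← r_uStar, g, integral_r_eq (isDensity_thetaStar hα₂ hlam y)
    (integrable_sq_mul_gaussianPDFReal hv), thetaStar, integral_mul_gaussianPDFReal hv,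
    integral_sq_mul_gaussianPDFReal hv, integral_gaussianPDFReal_mul_log hv, coe_varStar hlam hα₂]
  simp only [r, exploreConst]
  ring

/-- The Hamilton–Jacobi–Bellman equations of the two problems are equivalent. -/
lemma solvesHJB_iff (hα₂ : α₂ < 0) (hlam : 0 < lam) : m.SolvesHJB α₂ α₁ α₀ ↔
    ∀ y, quad (m.loopCoeff α₂ α₁ 2) (m.loopCoeff α₂ α₁ 1)
      (m.loopCoeff α₂ α₁ 0 + m.exploreConst lam α₂) y
      = residual m.ρ (m.σhi ^ 2) α₂ α₁ (α₀ + m.entropyValue lam α₂) y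
        ((m.A + m.F * m.slope α₂) * y + m.F * m.intercept α₂ α₁) (m.loopVol lam α₂ α₁ y) := by
  have hd := denom_pos (m := m) hα₂
  have hq : ∀ p₂ p₁ p₀ c y : ℝ, quad p₂ p₁ (p₀ + c) y = quad p₂ p₁ p₀ y + c := by
    intros; simp only [quad]; ring
  refine forall_congr' fun y => ?_
  rw [residual_add_const, rho_mul_entropyValue, hq, ← r_uStar, residual, residual, loopVol_sq,
    vol_uStar, b_uStar, coe_varStar hlam hα₂, exploreConst]
  -- Exploration with variance `v = λ / denom` costs `K v / 2` in the reward and adds `½ α₂ σhi² D²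
  -- v` through the volatility. By the definition of `denom` the two differ by `λ / 2`, the constant
  -- in the Gaussian entropy, so the `λ`-dependence cancels.
  have hK : m.K / 2 * (lam / m.denom α₂)
      = lam / 2 + 1 / 2 * α₂ * m.σhi ^ 2 * (m.D ^ 2 * (lam / m.denom α₂)) := by
    have : m.K = m.denom α₂ + α₂ * m.D ^ 2 * m.σhi ^ 2 := by unfold denom; ring
    rw [this]
    field_simp
  constructor <;> intro h
  · linear_combination h - hK
  · linear_combination h + hK

lemma solvesHJB_iff_quad : m.SolvesHJB α₂ α₁ α₀ ↔
    ∀ y, quad (m.loopCoeff α₂ α₁ 2) (m.loopCoeff α₂ α₁ 1) (m.loopCoeff α₂ α₁ 0) y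
      = residual m.ρ (m.σhi ^ 2) α₂ α₁ α₀ y
        ((m.A + m.F * m.slope α₂) * y + m.F * m.intercept α₂ α₁)
        ((m.C + m.D * m.slope α₂) * y + m.D * m.intercept α₂ α₁) := by
  refine forall_congr' fun y => ?_
  rw [r_uStar, b_uStar, vol_uStar]

end Model

/-- Functions of quadratic growth of a square-integrable process have finite upper expectation. -/
lemma upperE_lintegral_lt_top {lo hi : ℝ} {X : ℝ≥0 → Path → ℝ} {T : ℝ≥0}
    (hX : upperE (priors lo hi) (fun ω => ∫⁻ s in Set.Iic T, ENNReal.ofReal (X s ω ^ 2) ∂dt) < ∞)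
    {G : ℝ → ℝ} {c₁ c₀ : ℝ} (h1 : 0 ≤ c₁) (h0 : 0 ≤ c₀) (hG : ∀ y, G y ≤ c₁ * y ^ 2 + c₀) :
    upperE (priors lo hi) (fun ω => ∫⁻ s in Set.Iic T, ENNReal.ofReal (G (X s ω)) ∂dt) < ∞ := by
  have hle : upperE (priors lo hi) (fun ω => ∫⁻ s in Set.Iic T, ENNReal.ofReal (G (X s ω)) ∂dt)
      ≤ ENNReal.ofReal c₁ * upperE (priors lo hi)
        (fun ω => ∫⁻ s in Set.Iic T, ENNReal.ofReal (X s ω ^ 2) ∂dt)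
        + ENNReal.ofReal c₀ * ENNReal.ofReal T := by
    refine iSup₂_le fun P hP => ?_
    have := hP.1
    calc ∫⁻ ω, ∫⁻ s in Set.Iic T, ENNReal.ofReal (G (X s ω)) ∂dt ∂P
        ≤ ∫⁻ ω, (ENNReal.ofReal c₁ * (∫⁻ s in Set.Iic T, ENNReal.ofReal (X s ω ^ 2) ∂dt)
          + ENNReal.ofReal c₀ * ENNReal.ofReal T) ∂P := by
          refine lintegral_mono fun ω => ?_
          rw [← lintegral_const_mul' _ _ ENNReal.ofReal_ne_top, ← dt_Iic, ← setLIntegral_const,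
            ← lintegral_add_right _ measurable_const]
          refine lintegral_mono fun s => ?_
          rw [← ENNReal.ofReal_mul h1, ← ENNReal.ofReal_add (by positivity) h0]
          exact ENNReal.ofReal_le_ofReal (hG _)
      _ = ENNReal.ofReal c₁ * (∫⁻ ω, ∫⁻ s in Set.Iic T, ENNReal.ofReal (X s ω ^ 2) ∂dt ∂P)
          + ENNReal.ofReal c₀ * ENNReal.ofReal T := by
          rw [lintegral_add_right _ measurable_const, lintegral_const_mul' _ _ ENNReal.ofReal_ne_top,
            lintegral_const, measure_univ, mul_one]
      _ ≤ _ := by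
          gcongr
          exact le_iSup₂ (f := fun P (_ : P ∈ priors lo hi) =>
            ∫⁻ ω, ∫⁻ s in Set.Iic T, ENNReal.ofReal (X s ω ^ 2) ∂dt ∂P) P hP
  refine hle.trans_lt (ENNReal.add_lt_top.2 ⟨ENNReal.mul_lt_top ENNReal.ofReal_lt_top hX,
    ENNReal.mul_lt_top ENNReal.ofReal_lt_top ENNReal.ofReal_lt_top⟩)

namespace Model

variable {m : Model} {α₂ α₁ α₀ lam x : ℝ} {X : ℝ≥0 → Path → ℝ}

/-- The drift coefficients of the closed loop. -/
noncomputable def loopSlope (m : Model) (α₂ : ℝ) : ℝ := m.A + m.F * m.slope α₂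

/-- The inhomogeneity of the closed-loop drift. -/
noncomputable def loopShift (m : Model) (α₂ α₁ : ℝ) : ℝ := m.F * m.intercept α₂ α₁

/-- The volatility of the closed loop without exploration. -/
noncomputable def loopVolNe (m : Model) (α₂ α₁ y : ℝ) : ℝ :=
  (m.C + m.D * m.slope α₂) * y + m.D * m.intercept α₂ α₁

lemma continuous_loopVol : Continuous (m.loopVol lam α₂ α₁) := by unfold loopVol; fun_prop

lemma continuous_loopVolNe : Continuous (m.loopVolNe α₂ α₁) := by unfold loopVolNe; fun_prop

lemma abs_loopVolNe_sub_le (y z : ℝ) : |m.loopVolNe α₂ α₁ y - m.loopVolNe α₂ α₁ z|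
    ≤ |m.C + m.D * m.slope α₂| * |y - z| := by
  unfold loopVolNe
  rw [← abs_mul]
  exact le_of_eq (congrArg _ (by ring))

lemma uStar_sq_le (y : ℝ) : m.uStar α₂ α₁ y ^ 2
    ≤ 2 * m.slope α₂ ^ 2 * y ^ 2 + 2 * m.intercept α₂ α₁ ^ 2 := by
  rw [uStar_eq]
  nlinarith [sq_nonneg (m.slope α₂ * y - m.intercept α₂ α₁)]

/-! ### The non-exploratory closed loop -/

lemma isState_uStar_iff : m.IsState x (fun t ω => m.uStar α₂ α₁ (X t ω)) X ↔
    IsSol m.σlo m.σhi (m.loopSlope α₂) (m.loopShift α₂ α₁) (m.loopVolNe α₂ α₁) x X := by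
  unfold IsState IsSol
  simp only [b_uStar, vol_uStar]
  rfl

/-- This reduces admissibility to the scalar closed-loop equation. The moment condition on the
control is automatic, since `u*` is affine in a square-integrable state. -/
lemma admissibleNe_uStar_iff : m.AdmissibleNe x (fun t ω => m.uStar α₂ α₁ (X t ω)) X ↔
    IsLoop m.σlo m.σhi (m.loopSlope α₂) (m.loopShift α₂ α₁) m.ρ (m.loopVolNe α₂ α₁)
      (quad (m.loopCoeff α₂ α₁ 2) (m.loopCoeff α₂ α₁ 1) (m.loopCoeff α₂ α₁ 0)) x X := by
  constructor
  · intro h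
    refine ⟨isState_uStar_iff.1 h.state, h.transversality, ?_⟩
    have := h.reward
    simp only [r_uStar] at this
    exact this
  · intro h
    have hs := h.sol
    refine ⟨hs.1.comp_measurable continuous_uStar.measurable, fun t => ?_,
      isState_uStar_iff.2 hs, h.transversality, ?_⟩
    · exact upperE_lintegral_lt_top (G := fun y => m.uStar α₂ α₁ y ^ 2) (hs.2.1 t)
        (by positivity) (by positivity) uStar_sq_le
    · simp only [r_uStar]
      exact h.reward

lemma reward_uStar : m.reward (fun t ω => m.uStar α₂ α₁ (X t ω)) X = loopReward m.σlo m.σhi m.ρ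
    (quad (m.loopCoeff α₂ α₁ 2) (m.loopCoeff α₂ α₁ 1) (m.loopCoeff α₂ α₁ 0)) X := by
  unfold reward loopReward
  simp only [r_uStar]
  rfl

/-! ### The exploratory closed loop -/

lemma isExplState_thetaStar_iff (hα₂ : α₂ < 0) (hlam : 0 < lam) :
    m.IsExplState x (fun t ω => m.thetaStar lam α₂ α₁ (X t ω)) X ↔
    IsSol m.σlo m.σhi (m.loopSlope α₂) (m.loopShift α₂ α₁) (m.loopVol lam α₂ α₁) x X := by
  unfold IsExplState IsSol
  simp only [bTilde_thetaStar hα₂ hlam, volTilde_thetaStar hα₂ hlam]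
  rfl

lemma measurable_setIntegral_thetaStar (S : Set ℝ) :
    Measurable fun y => ∫ u in S, m.thetaStar lam α₂ α₁ y u := by
  refine (StronglyMeasurable.integral_prod_right
    (f := fun y u => gaussianPDFReal (m.uStar α₂ α₁ y) (m.varStar lam α₂) u) ?_).measurable
  refine Measurable.stronglyMeasurable ?_
  exact measurable_uncurry_gaussianPDFReal.comp
    ((continuous_uStar.measurable.comp measurable_fst).prodMk
      (measurable_const.prodMk measurable_snd))

lemma lintegral_sq_mul_thetaStar (hα₂ : α₂ < 0) (hlam : 0 < lam) (y : ℝ) :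
    ∫⁻ u, ENNReal.ofReal (u ^ 2 * m.thetaStar lam α₂ α₁ y u)
      = ENNReal.ofReal (m.uStar α₂ α₁ y ^ 2 + m.varStar lam α₂) := by
  have hv := varStar_pos (m := m) hlam hα₂
  rw [← integral_sq_mul_gaussianPDFReal hv]
  exact (ofReal_integral_eq_lintegral_ofReal (integrable_sq_mul_gaussianPDFReal hv)
    (ae_of_all _ fun u => mul_nonneg (sq_nonneg u) (gaussianPDFReal_nonneg _ _ u))).symm

/-- With Gaussian densities, the density, measurability, moment and entropy conditions hold
automatically; what remains is the same kind of scalar closed loop. -/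
lemma admissible_thetaStar_iff (hα₂ : α₂ < 0) (hlam : 0 < lam) :
    m.Admissible lam x (fun t ω => m.thetaStar lam α₂ α₁ (X t ω)) X ↔
    IsLoop m.σlo m.σhi (m.loopSlope α₂) (m.loopShift α₂ α₁) m.ρ (m.loopVol lam α₂ α₁)
      (quad (m.loopCoeff α₂ α₁ 2) (m.loopCoeff α₂ α₁ 1)
        (m.loopCoeff α₂ α₁ 0 + m.exploreConst lam α₂)) x X := by
  constructor
  · intro h
    refine ⟨(isExplState_thetaStar_iff hα₂ hlam).1 h.state, h.transversality, ?_⟩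
    have := h.reward
    simp only [g_thetaStar hα₂ hlam] at this
    exact this
  · intro h
    have hs := h.sol
    refine ⟨fun t P hP => ae_of_all _ fun ω => isDensity_thetaStar hα₂ hlam _,
      fun S _ => hs.1.comp_measurable (measurable_setIntegral_thetaStar S), fun t => ?_,
      (isExplState_thetaStar_iff hα₂ hlam).2 hs, h.transversality,
      fun P hP => ae_of_all _ fun ω => ae_of_all _ fun t =>
        integrable_gaussianPDFReal_mul_log (varStar_pos hlam hα₂), ?_⟩
    · simp only [lintegral_sq_mul_thetaStar hα₂ hlam]
      refine upperE_lintegral_lt_top (G := fun y => m.uStar α₂ α₁ y ^ 2 + m.varStar lam α₂)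
        (c₁ := 2 * m.slope α₂ ^ 2) (c₀ := 2 * m.intercept α₂ α₁ ^ 2 + m.varStar lam α₂) (hs.2.1 t)
        (by positivity) (by positivity) fun y => ?_
      linarith [uStar_sq_le (m := m) (α₂ := α₂) (α₁ := α₁) y]
    · simp only [g_thetaStar hα₂ hlam]
      exact h.reward

lemma explReward_thetaStar (hα₂ : α₂ < 0) (hlam : 0 < lam) :
    m.explReward lam (fun t ω => m.thetaStar lam α₂ α₁ (X t ω)) X = loopReward m.σlo m.σhi m.ρ
    (quad (m.loopCoeff α₂ α₁ 2) (m.loopCoeff α₂ α₁ 1)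
      (m.loopCoeff α₂ α₁ 0 + m.exploreConst lam α₂)) X := by
  unfold explReward loopReward
  simp only [g_thetaStar hα₂ hlam]
  rfl

/-! ### The stability condition and the Hamilton–Jacobi–Bellman equation -/

/-- The second moment of the closed loop grows more slowly than the discount factor decays. -/
def Stable (m : Model) (α₂ : ℝ) : Prop :=
  2 * m.loopSlope α₂ + (m.C + m.D * m.slope α₂) ^ 2 * m.σhi ^ 2 < m.ρ

/-- Optimality enters only through the value it assigns to the reward of the feedback; that reward
being a strictly concave quadratic is all that is used. -/
lemma SolvedNe.stable_and_hjb (h : m.SolvedNe α₂ α₁ α₀) (hα₂ : α₂ < 0) :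
    m.Stable α₂ ∧ m.SolvesHJB α₂ α₁ α₀ := by
  obtain ⟨P, hP, hP'⟩ := m.exists_mem_priors_σhi
  rw [solvesHJB_iff_quad]
  refine hjb_of_loopReward (S := m.loopVolNe α₂ α₁) (w := 0) continuous_loopVolNe
    (fun y => by rw [loopVolNe, add_zero]) m.σhi_pos.le m.ρ_pos hP hP' hα₂ fun x => ?_
  obtain ⟨X, hX, -, hr⟩ := h.2 x
  exact ⟨X, admissibleNe_uStar_iff.1 hX, by rw [← reward_uStar, hr, h.1]; rfl⟩

lemma SolvedExpl.stable_and_hjb (h : m.SolvedExpl lam α₂ α₁ α₀) (hα₂ : α₂ < 0) (hlam : 0 < lam) :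
    m.Stable α₂ ∧ m.SolvesHJB α₂ α₁ α₀ := by
  obtain ⟨P, hP, hP'⟩ := m.exists_mem_priors_σhi
  rw [solvesHJB_iff hα₂ hlam]
  refine hjb_of_loopReward (S := m.loopVol lam α₂ α₁) continuous_loopVol
    loopVol_sq m.σhi_pos.le m.ρ_pos hP hP' hα₂ fun x => ?_
  obtain ⟨X, hX, -, hr⟩ := h.2.2 x
  refine ⟨X, (admissible_thetaStar_iff hα₂ hlam).1 hX, ?_⟩
  rw [← explReward_thetaStar hα₂ hlam, hr, h.1]
  congr 1
  have hd := denom_pos (m := m) hα₂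
  -- The factor `e` inside the logarithm cancels the `-1` in the stated value, leaving `α₀ +
  -- entropyValue`.
  have h1 : Real.log (2 * Real.pi * Real.exp 1 * lam / m.denom α₂)
      = Real.log (2 * Real.pi * (lam / m.denom α₂)) + 1 := by
    rw [show 2 * Real.pi * Real.exp 1 * lam / m.denom α₂
      = 2 * Real.pi * (lam / m.denom α₂) * Real.exp 1 by ring,
      Real.log_mul (by positivity) (by positivity), Real.log_exp]
  rw [h1, quad, entropyValue]
  ring

/-! ### Optimality -/

/-- Stability makes the closed loop admissible, the equation gives its reward, and verification
shows that no admissible control earns more. -/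
lemma optimal_uStar (hα₂ : α₂ < 0) (hs : m.Stable α₂) (hH : m.SolvesHJB α₂ α₁ α₀) :
    m.IsOptimalFeedback (m.uStar α₂ α₁) ∧ ∀ x, m.Vne x = (quad α₂ α₁ α₀ x : ℝ) := by
  obtain ⟨P, hP, hP'⟩ := m.exists_mem_priors_σhi
  have key : ∀ x, ∃ X, m.AdmissibleNe x (fun t ω => m.uStar α₂ α₁ (X t ω)) X ∧
      (∀ Y, m.IsState x (fun t ω => m.uStar α₂ α₁ (Y t ω)) Y →
        ∀ t, QS m.scen fun ω => Y t ω = X t ω) ∧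
      m.reward (fun t ω => m.uStar α₂ α₁ (X t ω)) X = (quad α₂ α₁ α₀ x : ℝ) := by
    intro x
    obtain ⟨X, hX⟩ := exists_isLoop (lo := m.σlo) (b := m.loopShift α₂ α₁)
      (abs_loopVolNe_sub_le (m := m) (α₂ := α₂) (α₁ := α₁))
      (d := m.D * m.intercept α₂ α₁) (w := 0)
      (fun y => by rw [loopVolNe, add_zero]) m.σhi_pos.le m.ρ_pos hs (m.loopCoeff α₂ α₁ 2)
      (m.loopCoeff α₂ α₁ 1) (m.loopCoeff α₂ α₁ 0) x
    refine ⟨X, admissibleNe_uStar_iff.2 hX, fun Y hY t P hP => ?_, ?_⟩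
    · exact hX.sol.unique (isState_uStar_iff.1 hY) m.σhi_pos.le abs_loopVolNe_sub_le
        continuous_loopVolNe hP t
    · rw [reward_uStar]
      exact loopReward_eq continuous_loopVolNe m.σhi_pos.le m.ρ_pos hP hP' hα₂.le hX
        (solvesHJB_iff_quad.1 hH)
  have hV : ∀ x, m.Vne x = (quad α₂ α₁ α₀ x : ℝ) := by
    intro x
    refine le_antisymm (iSup_le fun u => iSup_le fun X => iSup_le fun h => h.reward_le hα₂ hH) ?_
    obtain ⟨X, hX, -, hr⟩ := key x
    rw [← hr]
    exact le_iSup_of_le (fun t ω => m.uStar α₂ α₁ (X t ω)) (le_iSup_of_le X (le_iSup_of_le hX le_rfl))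
  refine ⟨fun x => ?_, hV⟩
  obtain ⟨X, hX, hu, hr⟩ := key x
  exact ⟨X, hX, hu, by rw [hr, hV]⟩

/-- The same argument with the Gaussian feedback. The weight affects only the constants and the
bounded-below part of the volatility, so the stability condition is that of the non-exploratory
loop. -/
lemma optimal_thetaStar (hα₂ : α₂ < 0) (hlam : 0 < lam) (hs : m.Stable α₂)
    (hH : m.SolvesHJB α₂ α₁ α₀) : m.IsOptimalRandFeedback lam (m.thetaStar lam α₂ α₁) ∧
      ∀ x, m.V lam x = (quad α₂ α₁ (α₀ + m.entropyValue lam α₂) x : ℝ) := by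
  obtain ⟨P, hP, hP'⟩ := m.exists_mem_priors_σhi
  have key : ∀ x, ∃ X, m.Admissible lam x (fun t ω => m.thetaStar lam α₂ α₁ (X t ω)) X ∧
      (∀ Y, m.IsExplState x (fun t ω => m.thetaStar lam α₂ α₁ (Y t ω)) Y →
        ∀ t, QS m.scen fun ω => Y t ω = X t ω) ∧
      m.explReward lam (fun t ω => m.thetaStar lam α₂ α₁ (X t ω)) X
        = (quad α₂ α₁ (α₀ + m.entropyValue lam α₂) x : ℝ) := by
    intro x
    obtain ⟨X, hX⟩ := exists_isLoop (lo := m.σlo) (b := m.loopShift α₂ α₁)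
      (abs_loopVol_sub_le (m := m) (α₂ := α₂) (α₁ := α₁) (lam := lam))
      loopVol_sq m.σhi_pos.le m.ρ_pos hs (m.loopCoeff α₂ α₁ 2)
      (m.loopCoeff α₂ α₁ 1) (m.loopCoeff α₂ α₁ 0 + m.exploreConst lam α₂) x
    refine ⟨X, (admissible_thetaStar_iff hα₂ hlam).2 hX, fun Y hY t P hP => ?_, ?_⟩
    · exact hX.sol.unique ((isExplState_thetaStar_iff hα₂ hlam).1 hY) m.σhi_pos.le
        abs_loopVol_sub_le continuous_loopVol hP t
    · rw [explReward_thetaStar hα₂ hlam]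
      exact loopReward_eq continuous_loopVol m.σhi_pos.le m.ρ_pos hP hP' hα₂.le hX
        ((solvesHJB_iff hα₂ hlam).1 hH)
  have hV : ∀ x, m.V lam x = (quad α₂ α₁ (α₀ + m.entropyValue lam α₂) x : ℝ) := by
    intro x
    refine le_antisymm
      (iSup_le fun θ => iSup_le fun X => iSup_le fun h => h.explReward_le hα₂ hlam hH) ?_
    obtain ⟨X, hX, -, hr⟩ := key x
    rw [← hr]
    exact le_iSup_of_le (fun t ω => m.thetaStar lam α₂ α₁ (X t ω))
      (le_iSup_of_le X (le_iSup_of_le hX le_rfl))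
  refine ⟨⟨isDensity_thetaStar hα₂ hlam, fun x => ?_⟩, hV⟩
  obtain ⟨X, hX, hu, hr⟩ := key x
  exact ⟨X, hX, hu, by rw [hr, hV]⟩

/-! ### Vanishing exploration -/

lemma tendsto_entropyValue (hα₂ : α₂ < 0) :
    Tendsto (fun lam : ℝ => m.entropyValue lam α₂) (𝓝[>] 0) (𝓝 0) := by
  have hd := denom_pos (m := m) hα₂
  have hc : (0 : ℝ) < 2 * Real.pi / m.denom α₂ := by positivity
  have h1 : Tendsto (fun lam : ℝ => lam * 2 * Real.pi / m.denom α₂) (𝓝[>] 0) (𝓝 0) := by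
    have : Tendsto (fun lam : ℝ => lam * 2 * Real.pi / m.denom α₂) (𝓝 0)
        (𝓝 (0 * 2 * Real.pi / m.denom α₂)) := Continuous.tendsto (by fun_prop) 0
    simp only [zero_mul, zero_div] at this
    exact this.mono_left nhdsWithin_le_nhds
  -- The function `z ↦ z log z` is continuous at `0`, and `entropyValue` is a constant multiple of
  -- it at `z = 2πλ / denom`.
  have h2 := (Real.continuous_mul_log.tendsto 0).comp h1
  have h3 := h2.const_mul (m.denom α₂ / (4 * Real.pi * m.ρ))
  simp only [zero_mul, mul_zero] at h3
  refine h3.congr fun lam => ?_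
  have := m.ρ_pos.ne'
  simp only [Function.comp, entropyValue]
  rw [show 2 * Real.pi * (lam / m.denom α₂) = lam * 2 * Real.pi / m.denom α₂ by ring]
  field_simp
  ring

/-- Lévy's continuity theorem: the mean is fixed and the variance tends to zero, so the
characteristic functions converge to that of the degenerate Gaussian, a point mass. -/
lemma tendsto_thetaStarMeasure (α₂ α₁ x : ℝ) :
    Tendsto (fun lam : ℝ => m.thetaStarMeasure lam α₂ α₁ x) (𝓝[>] 0)
      (𝓝 (diracProba (m.uStar α₂ α₁ x))) := by
  refine tendsto_of_seq_tendsto fun l hl => ?_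
  refine ProbabilityMeasure.tendsto_iff_tendsto_charFun.2 fun t => ?_
  have e : charFun (diracProba (m.uStar α₂ α₁ x) : Measure ℝ) t
      = Complex.exp (t * (m.uStar α₂ α₁ x : ℝ) * Complex.I - ((0 : ℝ≥0) : ℝ) * t ^ 2 / 2) := by
    rw [← charFun_gaussianReal, gaussianReal_zero_var]
    rfl
  have e' : ∀ n, charFun (m.thetaStarMeasure (l n) α₂ α₁ x : Measure ℝ) t
      = Complex.exp (t * (m.uStar α₂ α₁ x : ℝ) * Complex.I
        - (m.varStar (l n) α₂ : ℝ) * t ^ 2 / 2) := fun n => charFun_gaussianReal t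
  have hv : Tendsto (fun n => (m.varStar (l n) α₂ : ℝ≥0)) atTop (𝓝 0) := by
    have h1 : Tendsto (fun n => l n / m.denom α₂) atTop (𝓝 0) := by
      have := (hl.mono_right nhdsWithin_le_nhds).div_const (m.denom α₂)
      simpa using this
    have := (continuous_real_toNNReal.tendsto 0).comp h1
    rw [Real.toNNReal_zero] at this
    exact this
  rw [e]
  refine Tendsto.congr (fun n => (e' n).symm) ?_
  have hc : Continuous fun v : ℝ≥0 => Complex.exp (t * (m.uStar α₂ α₁ x : ℝ) * Complex.I
        - ((v : ℝ) : ℂ) * t ^ 2 / 2) := by fun_prop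
  exact (hc.tendsto 0).comp hv

end Model

end GLQ

/-! ### Solvability equivalence and vanishing exploration -/

theorem proposition4 (m : GLQ.Model) (α₂ α₁ α₀ : ℝ) (hα₂ : α₂ < 0)
    (h : (∃ lam : ℝ, 0 < lam ∧ m.SolvedExpl lam α₂ α₁ α₀) ∨ m.SolvedNe α₂ α₁ α₀) :
    (∀ lam : ℝ, 0 < lam → m.IsOptimalRandFeedback lam (m.thetaStar lam α₂ α₁)) ∧
    m.IsOptimalFeedback (m.uStar α₂ α₁) ∧
    (∀ x : ℝ, Tendsto (fun lam : ℝ => m.thetaStarMeasure lam α₂ α₁ x) (𝓝[>] 0)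
      (𝓝 (diracProba (m.uStar α₂ α₁ x)))) ∧
    (∀ x : ℝ, (∀ lam : ℝ, 0 < lam → m.V lam x ≠ ⊥ ∧ m.V lam x ≠ ⊤) ∧
      m.Vne x ≠ ⊥ ∧ m.Vne x ≠ ⊤ ∧
      Tendsto (fun lam : ℝ => |(m.V lam x).toReal - (m.Vne x).toReal|) (𝓝[>] 0) (𝓝 0)) := by
  -- Either hypothesis is used only through these two conditions, which do not mention `λ`;
  -- everything else is rebuilt from them.
  obtain ⟨hs, hH⟩ : m.Stable α₂ ∧ m.SolvesHJB α₂ α₁ α₀ := by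
    rcases h with ⟨lam, hlam, h⟩ | h
    · exact h.stable_and_hjb hα₂ hlam
    · exact h.stable_and_hjb hα₂
  obtain ⟨hne, hVne⟩ := GLQ.Model.optimal_uStar hα₂ hs hH
  have hex := fun lam (hlam : 0 < lam) => GLQ.Model.optimal_thetaStar hα₂ hlam hs hH
  refine ⟨fun lam hlam => (hex lam hlam).1, hne, GLQ.Model.tendsto_thetaStarMeasure α₂ α₁, fun x =>
    ⟨fun lam hlam => ?_, ?_, ?_, ?_⟩⟩
  · rw [(hex lam hlam).2 x]
    exact ⟨EReal.coe_ne_bot _, EReal.coe_ne_top _⟩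
  · rw [hVne]; exact EReal.coe_ne_bot _
  · rw [hVne]; exact EReal.coe_ne_top _
  -- The two values differ by exactly `entropyValue`, whatever the state.
  · have h1 := (GLQ.Model.tendsto_entropyValue (m := m) hα₂).abs
    rw [abs_zero] at h1
    refine h1.congr' ?_
    filter_upwards [self_mem_nhdsWithin] with lam hlam
    rw [(hex lam hlam).2 x, hVne, EReal.toReal_coe, EReal.toReal_coe]
    congr 1
    simp only [GLQ.quad]
    ring
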